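/- **Setting.** Let $G=(V,E)$ be a connected graph with $n$ vertices and diameter $D$ that has no cut vertex (i.e. $G\setminus\{v\}$ is connected for every $v$). The vertices have distinct identifiers of at most $\kappa\log n$ bits, $\kappa$ a constant (throughout, $\log n$ denotes the bit length $\lfloor\log_2 n\rfloor+1$). Let $T$ be a BFS tree of $G$ rooted at $s$, and let $T_v$ be the subtree of $T$ hanging at $v$. Each non-leaf $v$ has a heavy child, a child $v'$ with $|V(T_{v'})|$ maximal (ties broken arbitrarily); vertices that are not heavy children are light. The ancestry label $\mathrm{anc}_T(v)$ is the list of the light vertices on the path of $T$ from $s$ to $v$, each with the number of heavy vertices of the path that follow it before the next light one (or up to and including $v$). A pair of distinct vertices $x,y$ is a *cut pair* if $G\setminus\{x,y\}$ is not connected. **Sketches.** A seed $\mathcal S_{\mathrm{id}}$ determines identifiers $\mathrm{uid}(e)$ of $O(\log n)$ bits for all pairs $e$ of vertices, such that for a random seed the XOR of the identifiers of a nonempty set of pairs, other than a single pair, is the identifier of a pair with probability at most $n^{-10}$; for an edge $e=(u,v)$ put $\mathrm{eid}_T(e)=[\mathrm{uid}(e),\mathrm{id}(u),\mathrm{id}(v),\mathrm{anc}_T(u),\mathrm{anc}_T(v)]$.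 Let $\log M=\lceil\log_2\binom n2\rceil$. A seed $\mathcal S_h$ determines $L=\lambda\log n$ hash functions $h_1,\dots,h_L$ from a pairwise independent family with values in $\{0,\dots,2^{\log M}-1\}$, where $\lambda$ is a constant. The sketch $\mathrm{sketch}_G(v)$ has for $1\le i\le L$, $0\le j\le\log M$ the entry $\bigoplus \mathrm{eid}_T(e)$ over the edges $e$ at $v$ with $h_i(e)<2^{\log M-j}$, and $\mathrm{sketch}_G(U)=\bigoplus_{v\in U}\mathrm{sketch}_G(v)$ for $U\subseteq V$. **Preprocessing information.** Each vertex $v$ knows $n$, its identifier and those of its neighbours, and: $\mathcal S_{\mathrm{id}}$ and $\mathcal S_h$; $\mathrm{eid}_T(e)$ for every edge $e$ at $v$; $|V(T_v)|$ and $|V(T_{v'})|$ for every child $v'$ of $v$ in $T$; $\mathrm{sketch}_G(v)$, $\mathrm{sketch}_G(V)$, $\mathrm{sketch}_G(V(T_v))$, and $\mathrm{sketch}_G(V(T_{v'}))$ for every child $v'$ of $v$; and $\mathrm{eid}_T(e)$ for all $e$ in a set $\widetilde E(v)\subseteq E\setminus E(T)$ such that $(T\setminus\{v\})\cup\widetilde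 E(v)$ is a spanning tree of $G\setminus\{v\}$. **Model.** Algorithms are randomized algorithms in the CONGEST model: in each synchronous round, each vertex may send a message of $O(\log n)$ bits to each neighbour; local computation is free, and each vertex has private random bits. Outputs are irrevocable. An execution takes at most $R$ rounds if no message is sent and no output changes after the first $R$ rounds. The congestion is the maximum over the edges of the total number of messages exchanged through the edge. Below, $\widetilde O(f)$ means at most $C\,f\,(\log n)^k$. **Statement.** For all $\kappa,\lambda,c$ there are constants $C$, $k$ and a constant for the message length, algorithms $\mathcal A_y$ (one algorithm, with the identifier of $y$ as a parameter), and an algorithm $\mathcal B$, such that for every $G$, identifiers, $T$, heavy children and preprocessing information (for every value of the seeds and every admissible choice of the sets $\widetilde E(v)$) as above: 1. For every $y\in V$ and all values of the random bits, $\mathcal A_y$ takes $\widetilde O(D)$ rounds, has congestion $\widetilde O(1)$, and sends messages only on edges incident to $V(T_y)$. With probability at least $1-n^{-c}$, every $x\in V(T_y)\setminus\{y\}$ outputs whether $x,y$ is a cut pair. 2. If every $\mathcal A_y$, with independent random bits, is started after a delay $\delta_y$, where the $\delta_y$ are independent and uniform in $\{0,\dots,R\}$ for a certain $R=\widetilde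 O(D)$ that also bounds the number of rounds in 1 and 3, then with probability at least $1-n^{-c}$, in each time slot and for each edge, in each direction, only $\widetilde O(1)$ of the algorithms send a message through it. 3. $\mathcal B$ executes all $\mathcal A_y$, $y\in V$, simultaneously: with probability at least $1-n^{-c}$, $\mathcal B$ takes $\widetilde O(D)$ rounds, every vertex learns its output in every $\mathcal A_y$ (run on random bits that are part of those of $\mathcal B$, independent for different $y$), and for all $y\in V$ and $x\in V(T_y)\setminus\{y\}$, $x$ learns whether $x,y$ is a cut pair. Thus all dependent cut pairs are detected. -/

import Mathlib

open scoped BigOperators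

/-- The bit length of `n`; this is the `log n` of all the bounds below. -/
def lg (n : ℕ) : ℕ := Nat.log 2 n + 1

section Bits

/-- Bit strings of length `w`; the group operation `+` is the bitwise XOR. -/
abbrev Bits (w : ℕ) : Type := Fin w → ZMod 2

/-- The `w`-bit binary representation of `m`. -/
def natBits (w m : ℕ) : Bits w := fun i => if m.testBit i then 1 else 0

/-- `r` random bits. -/
abbrev Coins (r : ℕ) : Type := Fin r → Bool

/-- Probability of an event under the uniform distribution on a finite type.  A uniform point of a
product (or of a finite function space) has independent uniform coordinates. -/
noncomputable def prob {Ω : Type} (P : Ω → Prop) : ℝ :=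
  (Nat.card {ω : Ω // P ω} : ℝ) / (Nat.card Ω : ℝ)

end Bits

section RootedTrees

variable {V : Type}

/-- The vertices of the path from `s` to `v` in the tree `T`, in order
(`[]` if there is none, which does not happen in a tree). -/
noncomputable def rootPath (T : SimpleGraph V) (s v : V) : List V :=
  open Classical in
  if h : ∃ p : T.Walk s v, p.IsPath then h.choose.support else []

/-- `x ∈ V(T_y)`: the vertex `x` lies in the subtree of `T` (rooted at `s`) hanging at `y`. -/
def InSubtree (T : SimpleGraph V) (s y x : V) : Prop := y ∈ rootPath T s x

/-- `w` is a child of `v` in `T` rooted at `s`. -/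
def IsChild (T : SimpleGraph V) (s v w : V) : Prop := T.Adj v w ∧ InSubtree T s v w

/-- `|V(T_v)|`. -/
noncomputable def subtreeSize (T : SimpleGraph V) (s v : V) : ℕ :=
  Nat.card {x : V // InSubtree T s v x}

end RootedTrees

/-- The network: a connected `n`-vertex graph `G` without cut vertices, a BFS tree `T` of `G` rooted at `s`,
unique identifiers of `O(log n)` bits, and a heavy child for each non-leaf of `T`
(ties broken arbitrarily). -/
structure Setting (κ n : ℕ) (V : Type) [Fintype V] where
  card_eq : Fintype.card V = n
  G : SimpleGraph V
  T : SimpleGraph V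
  s : V
  id : V → ℕ
  heavy : V → Option V
  connected : G.Connected
  no_cut_vertex : ∀ v, (G.induce ({v}ᶜ : Set V)).Preconnected
  tree_le : T ≤ G
  isTree : T.IsTree
  bfs : ∀ v, T.dist s v = G.dist s v
  id_inj : Function.Injective id
  id_lt : ∀ v, id v < 2 ^ (κ * lg n)
  heavy_some : ∀ u v, heavy u = some v →
    IsChild T s u v ∧ ∀ w, IsChild T s u w → subtreeSize T s w ≤ subtreeSize T s v
  heavy_none : ∀ u, heavy u = none → ∀ w, ¬ IsChild T s u w

section SketchParameters

/-- Bit length of the unique edge identifiers, and of the field used for hashing. -/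
def fieldLen (n κ : ℕ) : ℕ := (2 * κ + 13) * lg n

/-- The finite field with `2 ^ fieldLen n κ` elements. -/
abbrev GF (n κ : ℕ) : Type := GaloisField 2 (fieldLen n κ)

theorem fieldLen_ne_zero (n κ : ℕ) : fieldLen n κ ≠ 0 := by
  simp [fieldLen, lg]

/-- The bits of a field element, with respect to a fixed basis over the two-element field. -/
noncomputable def gfBits (n κ : ℕ) : GF n κ ≃ₗ[ZMod 2] Bits (fieldLen n κ) :=
  (Module.finBasisOfFinrankEq (ZMod 2) (GF n κ)
    (GaloisField.finrank 2 (fieldLen_ne_zero n κ))).equivFun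

/-- `log M` for `M = binom n 2`, rounded up. -/
def logM (n : ℕ) : ℕ := Nat.clog 2 (n.choose 2)

/-- The number `L` of basic sketch units. -/
def numUnits (n lam : ℕ) : ℕ := lam * lg n

/-- The number with the binary digits given by the first `logM n` bits of a field element. -/
noncomputable def truncVal (n κ : ℕ) (z : GF n κ) : ℕ :=
  ∑ t ∈ Finset.range (logM n),
    if h : t < fieldLen n κ then (gfBits n κ z ⟨t, h⟩).val * 2 ^ t else 0

/-- The pairwise independent hash function `x ↦ a x + b` (truncated) with seed `(a, b)`,
on bit strings given as numbers below `2 ^ fieldLen n κ`, with values below `2 ^ logM n`. -/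
noncomputable def hashVal (n κ : ℕ) (seed : Bits (fieldLen n κ) × Bits (fieldLen n κ)) (x : ℕ) : ℕ :=
  truncVal n κ ((gfBits n κ).symm seed.1 * (gfBits n κ).symm (natBits (fieldLen n κ) x) +
    (gfBits n κ).symm seed.2)

/-- The pair of identifiers `i`, `j`, as one number of `2 κ log n` bits. -/
def pairCode (n κ i j : ℕ) : ℕ := i * 2 ^ (κ * lg n) + j

/-- The unique identifier of the pair `(i, j)` under the seed `ξ`: the field element
`ξ ^ pairCode i j`.
The XOR of the identifiers of a nonempty set of pairs is the value at `ξ` of a nonzero polynomial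
of degree below `2 ^ (2 κ log n)`, hence vanishes with probability at most `2 ^ (-13 log n)` over
`ξ`; so the XOR of the identifiers of at least two distinct pairs is the identifier of a pair with
probability at most `n ^ (-10)`. -/
noncomputable def uidOf (n κ : ℕ) (ξ : Bits (fieldLen n κ)) (i j : ℕ) : Bits (fieldLen n κ) :=
  gfBits n κ ((gfBits n κ).symm ξ ^ pairCode n κ i j)

/-- Ancestry labels: compressed paths, i.e. the list of the identifiers of the light vertices on
the root path, each with the number of heavy vertices up to the next light one. -/
abbrev AncLabel : Type := List (ℕ × ℕ)

/-- Extended edge identifiers `[uid(e), id(u), id(v), anc(u), anc(v)]`. -/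
structure ExtId (n κ : ℕ) where
  uid : Bits (fieldLen n κ)
  id₁ : ℕ
  id₂ : ℕ
  anc₁ : AncLabel
  anc₂ : AncLabel

/-- Fixed-length bit strings for ancestry labels: one slot for each of the at most `lg n` light
vertices of a root path, with a bit telling that the slot is in use. -/
abbrev AncBits (n κ : ℕ) : Type := Fin (lg n) → ZMod 2 × Bits (κ * lg n) × Bits (lg n)

def ancBits (n κ : ℕ) (a : AncLabel) : AncBits n κ := fun i =>
  match a[(i : ℕ)]? with
  | none => 0
  | some q => (1, natBits (κ * lg n) q.1, natBits (lg n) q.2)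

/-- Fixed-length bit strings for extended edge identifiers. -/
abbrev EidBits (n κ : ℕ) : Type :=
  Bits (fieldLen n κ) × Bits (κ * lg n) × Bits (κ * lg n) × AncBits n κ × AncBits n κ

def ExtId.toBits {n κ : ℕ} (e : ExtId n κ) : EidBits n κ :=
  (e.uid, natBits _ e.id₁, natBits _ e.id₂, ancBits n κ e.anc₁, ancBits n κ e.anc₂)

/-- Sketches: `L` basic units, each with `logM n + 1` entries. -/
abbrev Sketch (n κ lam : ℕ) : Type := Fin (numUnits n lam) → Fin (logM n + 1) → EidBits n κ

/-- What a single vertex knows when the algorithms start: its identifier, the identifiers of its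
neighbours, and its preprocessing information.  A table indexed by neighbours (or children) is
indexed by their identifiers, and is `none` elsewhere. -/
structure LocalInput (n κ lam : ℕ) where
  id : ℕ
  nbrs : Set ℕ
  seedId : Bits (fieldLen n κ)
  seedHash : Fin (numUnits n lam) → Bits (fieldLen n κ) × Bits (fieldLen n κ)
  eid : ℕ → Option (ExtId n κ)
  size : ℕ
  childSize : ℕ → Option ℕ
  sketchSelf : Sketch n κ lam
  sketchAll : Sketch n κ lam
  sketchSubtree : Sketch n κ lam
  childSketch : ℕ → Option (Sketch n κ lam)
  extraEdges : Set (ExtId n κ)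

end SketchParameters

section Network

variable {V : Type}

/-- The table with value `f u` at the identifier of `u`, for those `u` that satisfy `P`. -/
noncomputable def byId {X : Type} (id : V → ℕ) (P : V → Prop) (f : V → X) : ℕ → Option X :=
  open Classical in
  fun i => if h : ∃ u, P u ∧ id u = i then some (f h.choose) else none

namespace Setting

variable {κ n : ℕ} [Fintype V] (S : Setting κ n V)

/-- `x ∈ V(T_y)`. -/
def InSub (y x : V) : Prop := InSubtree S.T S.s y x

/-- `{x, y}` is a cut pair. -/
def IsCutPair (x y : V) : Prop :=
  x ≠ y ∧ ¬ (S.G.induce ({x, y}ᶜ : Set V)).Preconnected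

/-- A vertex is light if it is not the heavy child of a vertex. -/
def IsLight (v : V) : Prop := ∀ u, S.heavy u ≠ some v

/-- The ancestry label of `v`: its compressed path.  The path is scanned from `v` upwards; the
counter holds the number of heavy vertices met since the last light one. -/
noncomputable def anc (v : V) : AncLabel :=
  open Classical in
  ((rootPath S.T S.s v).foldr
    (fun u (q : ℕ × AncLabel) => if S.IsLight u then (0, (S.id u, q.1) :: q.2) else (q.1 + 1, q.2))
    (0, [])).2

/-- The code of the edge `uv`, the endpoint with the smaller identifier first. -/
def edgeCode (u v : V) : ℕ :=
  pairCode n κ (min (S.id u) (S.id v)) (max (S.id u) (S.id v))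

/-- The extended identifier of the edge `uv`, the endpoint with the smaller identifier first. -/
noncomputable def eid (ξ : Bits (fieldLen n κ)) (u v : V) : ExtId n κ :=
  if S.id u < S.id v then
    ⟨uidOf n κ ξ (S.id u) (S.id v), S.id u, S.id v, S.anc u, S.anc v⟩
  else
    ⟨uidOf n κ ξ (S.id v) (S.id u), S.id v, S.id u, S.anc v, S.anc u⟩

end Setting

/-- Preprocessing information: the seeds, and for every `v` a set `E v` of non-tree edges of
`G \ {v}` for which `(T \ {v}) ∪ E v` is a spanning tree of `G \ {v}`. -/
structure Prep {κ n : ℕ} [Fintype V] (S : Setting κ n V) (lam : ℕ) where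
  seedId : Bits (fieldLen n κ)
  seedHash : Fin (numUnits n lam) → Bits (fieldLen n κ) × Bits (fieldLen n κ)
  E : V → Set (Sym2 V)
  E_subset : ∀ v, E v ⊆ S.G.edgeSet \ S.T.edgeSet
  E_avoids : ∀ v, ∀ e ∈ E v, v ∉ e
  E_preconnected : ∀ v,
    ((S.T ⊔ SimpleGraph.fromEdgeSet (E v)).induce ({v}ᶜ : Set V)).Preconnected
  E_acyclic : ∀ v, ((S.T ⊔ SimpleGraph.fromEdgeSet (E v)).induce ({v}ᶜ : Set V)).IsAcyclic

namespace Prep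

variable {κ n lam : ℕ} [Fintype V] {S : Setting κ n V} (P : Prep S lam)

/-- The sketch of the vertex `v`: entry `(i, j)` is the XOR of the extended identifiers of the
edges at `v` whose `i`-th hash value is below `2 ^ (log M - j)`. -/
noncomputable def sketch (v : V) : Sketch n κ lam := fun i j =>
  open Classical in
  ∑ u ∈ Finset.univ.filter (fun u => S.G.Adj v u ∧
      hashVal n κ (P.seedHash i) (S.edgeCode v u)
        < 2 ^ (logM n - (j : ℕ))),
    (S.eid P.seedId v u).toBits

/-- The sketch of a set of vertices. -/
noncomputable def sketchSet (U : Set V) : Sketch n κ lam :=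
  open Classical in
  ∑ v ∈ Finset.univ.filter (fun v => v ∈ U), P.sketch v

/-- What the vertex `v` knows at the start. -/
noncomputable def localInput (v : V) : LocalInput n κ lam where
  id := S.id v
  nbrs := {i | ∃ u, S.G.Adj v u ∧ S.id u = i}
  seedId := P.seedId
  seedHash := P.seedHash
  eid := byId S.id (S.G.Adj v) (fun u => S.eid P.seedId v u)
  size := subtreeSize S.T S.s v
  childSize := byId S.id (IsChild S.T S.s v) (fun w => subtreeSize S.T S.s w)
  sketchSelf := P.sketch v
  sketchAll := P.sketchSet Set.univ
  sketchSubtree := P.sketchSet {x | S.InSub v x}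
  childSketch := byId S.id (IsChild S.T S.s v) (fun w => P.sketchSet {x | S.InSub w x})
  extraEdges := {e | ∃ a b, s(a, b) ∈ P.E v ∧ e = S.eid P.seedId a b}

end Prep

/-- A randomized algorithm of the CONGEST model with messages of at most `bw` bits.  A vertex
starts from its input and its private coins.  In each round it may send one message to each
neighbour (addressed by identifier), and updates its state from the messages received. -/
structure CongestAlg (In Coin Out : Type) (bw : ℕ) where
  State : Type
  init : In → Coin → State
  send : State → ℕ → Option (List Bool)
  send_length : ∀ σ i m, send σ i = some m → m.length ≤ bw
  recv : State → (ℕ → Option (List Bool)) → State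
  out : State → Out

namespace CongestAlg

variable {In Coin Out : Type} {bw : ℕ} (A : CongestAlg In Coin Out bw)
  (G : SimpleGraph V) (id : V → ℕ) (inp : V → In) (ω : V → Coin)

/-- The states after `t` rounds. -/
noncomputable def run : ℕ → V → A.State
  | 0, v => A.init (inp v) (ω v)
  | t + 1, v => A.recv (run t v)
      (fun i => (byId id (G.Adj v) (fun u => A.send (run t u) (id v)) i).join)

/-- In round `t` (counted from `0`) a message goes from `u` to `v`. -/
def Sends (t : ℕ) (u v : V) : Prop :=
  G.Adj u v ∧ A.send (A.run G id inp ω t u) (id v) ≠ none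

/-- The output of `v` after `t` rounds. -/
noncomputable def outAt (t : ℕ) (v : V) : Out := A.out (A.run G id inp ω t v)

/-- The execution takes at most `R` rounds: later no message is sent and no output changes. -/
def FinishesBy (R : ℕ) : Prop :=
  ∀ t, R ≤ t → (∀ u v, ¬ A.Sends G id inp ω t u v) ∧
    ∀ v, A.outAt G id inp ω t v = A.outAt G id inp ω R v

/-- The number of messages exchanged through the edge `uv`, in both directions, in the first `N`
rounds. -/
noncomputable def load (N : ℕ) (u v : V) : ℕ :=
  open Classical in
  ((Finset.range N).filter (fun t => A.Sends G id inp ω t u v)).card +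
    ((Finset.range N).filter (fun t => A.Sends G id inp ω t v u)).card

end CongestAlg

end Network

/-! Fix `y`. Without `y` the tree `T` falls into the subtrees at the children of `y` and, if `y` is
not the root, the rest. The edges of `E y` make these components connected, and `y` chooses a rooted
spanning tree of them; its root is the rest or, if `y` is the root of `T`, the component of one
child. Let `x` lie in the component of the child `k`. Every vertex `v` other than `y` hangs on this
component at a definite vertex `att y k v`: at `v` itself, at the point where the branch containing
`v` is joined, or at the end of the edge to the parent component. The position of that vertex
relative to `x` sorts the vertices of the graph without `x` and `y` into parts, each named by a
neighbour of `x` and each connected (`PartRel.joined`). Hence `x`, `y` is a cut pair exactly if the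
multigraph of parts is disconnected (`conn_iff`).

To place an endpoint of an edge, `x` uses only its label: ancestry label and component number.
Inside the component of `x`, ancestry labels expand to symbolic root paths, and subtrees are
recognized by prefixes (`path_prefix_iff`). Other components are numbered in the lexicographic order
of their positions in the tree of components. A branch then occupies an interval of numbers
(`num_mem_iff`), and the branches joined inside a subtree of `T` are separated from those joined
elsewhere (`hull`). So each subtree need report only two numbers and one bit for `x` to name the
part of any label (`part_eq`).

Connectivity of the parts is decided by Boruvka's algorithm on linear sketches. The statement is for
every value of the given seeds, so each subalgorithm draws fresh randomness: sampling bits for the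
edges, and one element `ξ` of a field of characteristic two. A sampled edge contributes the power of
`ξ` whose exponent encodes the two labels of its ends, and edges inside a set cancel. A nonempty cut
has a single sampled edge at some level with probability at least 1/8 (`single_sampled`), so each
phase reduces the expected number of surplus classes by the factor 15/16 (`sum_num_phase`), and a
sketch of no edge or of several edges rarely looks like one power (`card_badSeed_le`). Nothing is
computed outside `T_y`. This is harmless, because the edges there lie inside one part
(`partRel_congr`) and because in characteristic two a set and its complement have the same sketch
(`sum_out`).

The subalgorithm thus has six phases: downward, across edges and upward, twice. Messages are
functions of those received and are never revised, so all the subalgorithms form a monotone family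
that one scheduler can execute, sending the pending bit of highest priority on each edge. Each
message gets a deadline that respects both dependencies and priorities; the rank of `y` among the
ancestors of a vertex pipelines the many subalgorithms. The lemma `deadline` then bounds the running
time for all random bits, without any delays. When the execution is over, the messages form the
unique solution of the local equations (`IsFix.unique`), so the joint execution and the single ones
agree (`joint_eq_single`).

The claim on random delays is a separate count. Only subalgorithms of ancestors of `u` send from
`u`, each sends a bounded number of times on an edge, and the range of delays is so long that fewer
than one of them is expected in a slot (`card_due_le`); a union bound over slots and edges finishes
the argument. -/

set_option linter.unusedSectionVars false

/-! ### Root paths, subtrees and induction in the rooted tree. -/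

section TreePaths

variable {V : Type}

theorem rootPath_of_isPath {T : SimpleGraph V} (hT : T.IsAcyclic) {s v : V} (p : T.Walk s v)
    (hp : p.IsPath) : rootPath T s v = p.support := by
  have h : ∃ p : T.Walk s v, p.IsPath := ⟨p, hp⟩
  have e : (⟨h.choose, h.choose_spec⟩ : T.Path s v) = ⟨p, hp⟩ := (hT.subsingleton_path _ _).elim _ _
  rw [rootPath, dif_pos h]
  exact congrArg (fun q : T.Path s v => q.1.support) e

end TreePaths

namespace Setting

variable {κ n : ℕ} {V : Type} [Fintype V] (S : Setting κ n V)

/-- The vertices of the tree path from the root to `v`. -/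
noncomputable def rp (v : V) : List V := rootPath S.T S.s v

theorem exists_rp (v : V) : ∃ p : S.T.Walk S.s v, p.IsPath ∧ S.rp v = p.support := by
  obtain ⟨p, hp⟩ := (S.isTree.connected S.s v).exists_isPath
  exact ⟨p, hp, rootPath_of_isPath S.isTree.isAcyclic p hp⟩

theorem rp_eq {v : V} (p : S.T.Walk S.s v) (hp : p.IsPath) : S.rp v = p.support :=
  rootPath_of_isPath S.isTree.isAcyclic p hp

theorem inSub_iff {y x : V} : S.InSub y x ↔ y ∈ S.rp x := Iff.rfl

theorem rp_root : S.rp S.s = [S.s] := S.rp_eq .nil .nil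

theorem mem_rp_self (v : V) : v ∈ S.rp v := by
  obtain ⟨p, -, h⟩ := S.exists_rp v; simp [h]

theorem rp_nodup (v : V) : (S.rp v).Nodup := by
  obtain ⟨p, hp, h⟩ := S.exists_rp v; rw [h]; exact hp.support_nodup

theorem exists_rp_eq_append (v : V) : ∃ l, S.rp v = l ++ [v] := by
  obtain ⟨p, hp, h⟩ := S.exists_rp v
  refine ⟨p.support.dropLast, ?_⟩
  rw [h]
  conv_lhs => rw [← List.dropLast_append_getLast p.support_ne_nil]
  simp

theorem rp_ne_nil (v : V) : S.rp v ≠ [] := List.ne_nil_of_mem (S.mem_rp_self v)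

theorem rp_prefix {z v : V} (h : z ∈ S.rp v) : S.rp z <+: S.rp v := by
  classical
  obtain ⟨p, hp, e⟩ := S.exists_rp v
  rw [e] at h
  rw [e, S.rp_eq _ (hp.takeUntil h)]
  conv_rhs => rw [← p.take_spec h, SimpleGraph.Walk.support_append]
  exact List.prefix_append _ _

theorem mem_rp_iff_prefix {z v : V} : z ∈ S.rp v ↔ S.rp z <+: S.rp v :=
  ⟨S.rp_prefix, fun h => h.subset (S.mem_rp_self z)⟩

theorem rp_injective : Function.Injective S.rp := by
  intro u v h
  obtain ⟨l, hl⟩ := S.exists_rp_eq_append u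
  obtain ⟨m, hm⟩ := S.exists_rp_eq_append v
  rw [hl, hm] at h
  simpa using (List.append_inj' h rfl).2

theorem exists_parent {v : V} (h : v ≠ S.s) : ∃ p, S.T.Adj p v ∧ S.rp v = S.rp p ++ [v] := by
  obtain ⟨p, hp, e⟩ := S.exists_rp v
  have hn : ¬ p.Nil := fun hn => h hn.eq.symm
  refine ⟨p.penultimate, p.adj_penultimate hn, ?_⟩
  have hd : p.dropLast.IsPath := by
    have := SimpleGraph.Walk.concat_dropLast (p.adj_penultimate hn)
    rw [← this] at hp
    exact SimpleGraph.Walk.IsPath.of_append_left (by rw [← SimpleGraph.Walk.concat_eq_append]; exact hp)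
  rw [S.rp_eq _ hd, e]
  conv_lhs => rw [← SimpleGraph.Walk.concat_dropLast (p.adj_penultimate hn)]
  rw [SimpleGraph.Walk.support_concat]

/-- `w` is a child of `v`. -/
def Child (v w : V) : Prop := IsChild S.T S.s v w

theorem child_iff {v w : V} : S.Child v w ↔ S.rp w = S.rp v ++ [w] := by
  constructor
  · rintro ⟨ha, hv⟩
    have hw : w ∉ S.rp v := fun hw => ha.ne (S.rp_injective
      ((S.rp_prefix hv).eq_of_length (le_antisymm (S.rp_prefix hv).length_le (S.rp_prefix hw).length_le)))
    obtain ⟨p, hp, e⟩ := S.exists_rp v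
    rw [e] at hw
    rw [S.rp_eq (p.concat ha) (hp.concat hw ha), e, SimpleGraph.Walk.support_concat]
  · intro h
    have hw : w ≠ S.s := by
      rintro rfl
      rw [S.rp_root] at h
      have := congrArg List.length h
      simp [S.rp_ne_nil] at this
    obtain ⟨p, hp, e⟩ := S.exists_parent hw
    rw [e] at h
    have : p = v := S.rp_injective (List.append_cancel_right h)
    subst this
    exact ⟨hp, S.inSub_iff.2 (by rw [e]; simp [S.mem_rp_self])⟩

variable {S}

theorem Child.rp_eq {v w : V} (h : S.Child v w) : S.rp w = S.rp v ++ [w] := S.child_iff.1 h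
theorem Child.adj {v w : V} (h : S.Child v w) : S.G.Adj v w := S.tree_le h.1
theorem Child.mem {v w : V} (h : S.Child v w) : S.InSub v w := h.2
theorem Child.ne {v w : V} (h : S.Child v w) : v ≠ w := h.1.ne

theorem Child.unique {u v w : V} (h : S.Child u w) (h' : S.Child v w) : u = v :=
  S.rp_injective (List.append_cancel_right (h.rp_eq.symm.trans h'.rp_eq))

theorem InSub.refl (v : V) : S.InSub v v := S.mem_rp_self v

theorem InSub.trans {u v w : V} (h : S.InSub u v) (h' : S.InSub v w) : S.InSub u w :=
  (S.rp_prefix h').subset h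

theorem InSub.antisymm {u v : V} (h : S.InSub u v) (h' : S.InSub v u) : u = v :=
  S.rp_injective ((S.rp_prefix h).eq_of_length
    (le_antisymm (S.rp_prefix h).length_le (S.rp_prefix h').length_le))

theorem InSub.total {u v w : V} (h : S.InSub u w) (h' : S.InSub v w) : S.InSub u v ∨ S.InSub v u := by
  rcases List.prefix_or_prefix_of_prefix (S.rp_prefix h) (S.rp_prefix h') with h | h
  · exact Or.inl (S.mem_rp_iff_prefix.2 h)
  · exact Or.inr (S.mem_rp_iff_prefix.2 h)

theorem Child.not_inSub {v w : V} (h : S.Child v w) : ¬ S.InSub w v := fun h' =>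
  h.ne (h.mem.antisymm h')

/-- A vertex below `w` is `w` or below the parent of `w`. -/
theorem Child.inSub_iff {v w u : V} (h : S.Child v w) : S.InSub u w ↔ u = w ∨ S.InSub u v := by
  rw [S.inSub_iff, h.rp_eq]
  simp [S.inSub_iff, or_comm]

variable (S)

theorem inSub_root (v : V) : S.InSub S.s v := by
  obtain ⟨p, -, h⟩ := S.exists_rp v; rw [S.inSub_iff, h]; simp

theorem child_of_ne_root {v : V} (h : v ≠ S.s) : ∃ p, S.Child p v := by
  obtain ⟨p, -, e⟩ := S.exists_parent h
  exact ⟨p, S.child_iff.2 e⟩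

theorem not_child_root (v : V) : ¬ S.Child v S.s := fun h => h.not_inSub (S.inSub_root v)

/-- Induction from the root downwards. -/
theorem induction_down {P : V → Prop} (h₀ : P S.s) (h₁ : ∀ v w, S.Child v w → P v → P w) (v : V) :
    P v := by
  induction hl : (S.rp v).length using Nat.strong_induction_on generalizing v with
  | _ m ih =>
    by_cases h : v = S.s
    · exact h ▸ h₀
    · obtain ⟨p, hp⟩ := S.child_of_ne_root h
      exact h₁ p v hp (ih _ (by rw [← hl, hp.rp_eq]; simp) p rfl)

/-- Induction from a vertex `y` downwards. -/
theorem induction_below {P : V → Prop} {y : V} (h₀ : P y)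
    (h₁ : ∀ v w, S.InSub y v → S.Child v w → P v → P w) {v : V} (hv : S.InSub y v) : P v := by
  revert hv
  refine S.induction_down (P := fun v => S.InSub y v → P v) ?_ ?_ v
  · intro h
    have : y = S.s := h.antisymm (S.inSub_root y)
    exact this ▸ h₀
  · intro v w hc ih h
    rcases hc.inSub_iff.1 h with rfl | h
    · exact h₀
    · exact h₁ v w h hc (ih h)

theorem length_rp_le (v : V) : (S.rp v).length ≤ Fintype.card V := (S.rp_nodup v).length_le_card

/-- Induction from the leaves upwards. -/
theorem induction_up {P : V → Prop} (h : ∀ v, (∀ w, S.Child v w → P w) → P v) (v : V) : P v := by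
  induction hl : Fintype.card V - (S.rp v).length using Nat.strong_induction_on generalizing v with
  | _ m ih =>
    refine h v fun w hw => ih _ ?_ w rfl
    have := S.length_rp_le w
    have e := congrArg List.length hw.rp_eq
    simp at e
    omega

theorem exists_child_of_inSub {u v : V} (h : S.InSub u v) (hne : v ≠ u) :
    ∃ w, S.Child u w ∧ S.InSub w v := by
  refine (S.induction_below (P := fun v => v ≠ u → ∃ w, S.Child u w ∧ S.InSub w v) (by simp) ?_ h) hne
  intro v w hv hc ih hne
  by_cases h : v = u
  · exact ⟨w, h ▸ hc, InSub.refl w⟩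
  · obtain ⟨z, hz, hzv⟩ := ih h
    exact ⟨z, hz, hzv.trans hc.mem⟩

variable {S} in
theorem Child.eq_of_inSub {u w w' v : V} (h : S.Child u w) (h' : S.Child u w') (hv : S.InSub w v)
    (hv' : S.InSub w' v) : w = w' := by
  rcases hv.total hv' with h₁ | h₁
  · rcases h'.inSub_iff.1 h₁ with h₂ | h₂
    · exact h₂
    · exact absurd h₂ h.not_inSub
  · rcases h.inSub_iff.1 h₁ with h₂ | h₂
    · exact h₂.symm
    · exact absurd h₂ h'.not_inSub

theorem length_rp (v : V) : (S.rp v).length = S.T.dist S.s v + 1 := by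
  obtain ⟨p, hp, e⟩ := S.exists_rp v
  obtain ⟨q, hq, hl⟩ := (S.isTree.connected S.s v).exists_path_of_dist
  have : p = q := congrArg Subtype.val ((S.isTree.isAcyclic.subsingleton_path _ _).elim ⟨p, hp⟩ ⟨q, hq⟩)
  rw [e, SimpleGraph.Walk.length_support, this, hl]

theorem length_rp_le_diam (v : V) : (S.rp v).length ≤ S.G.diam + 1 := by
  have : Nonempty V := ⟨v⟩
  rw [S.length_rp, S.bfs]
  exact Nat.succ_le_succ (SimpleGraph.dist_le_diam
    (SimpleGraph.connected_iff_ediam_ne_top.1 S.connected))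

theorem length_rp_pos (v : V) : 0 < (S.rp v).length := List.length_pos_of_ne_nil (S.rp_ne_nil v)

open scoped Classical in
/-- The sum over a subtree, split into the sums over the subtrees of the children. -/
theorem sum_subtree {M : Type*} [AddCommMonoid M] (f : V → M) (u : V) :
    ∑ v with S.InSub u v, f v = f u + ∑ w with S.Child u w, ∑ v with S.InSub w v, f v := by
  have : (Finset.univ.filter (S.InSub u)) = insert u
      ((Finset.univ.filter (S.Child u)).biUnion fun w => Finset.univ.filter (S.InSub w)) := by
    ext v
    simp only [Finset.mem_filter, Finset.mem_univ, true_and, Finset.mem_insert, Finset.mem_biUnion]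
    constructor
    · intro h
      by_cases hv : v = u
      · exact Or.inl hv
      · exact Or.inr (S.exists_child_of_inSub h hv)
    · rintro (rfl | ⟨w, hw, h⟩)
      · exact InSub.refl v
      · exact hw.mem.trans h
  rw [this, Finset.sum_insert, Finset.sum_biUnion]
  · intro w hw w' hw' hne
    simp only [Finset.coe_filter, Finset.mem_univ, true_and, Set.mem_ofPred_eq] at hw hw'
    refine Finset.disjoint_left.2 fun v h h' => hne ?_
    simp only [Finset.mem_filter, Finset.mem_univ, true_and] at h h'
    exact hw.eq_of_inSub hw' h h'
  · simp only [Finset.mem_biUnion, Finset.mem_filter, Finset.mem_univ, true_and, not_exists, not_and]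
    exact fun w hw => hw.not_inSub

end Setting

/-! ### Ancestry labels as symbolic root paths; heavy-light bounds. -/

/-- The symbolic root path described by an ancestry label: a vertex is named by the light vertex
that starts its heavy path and by its position on that path. -/
def expandAnc (a : AncLabel) : List (ℕ × ℕ) :=
  a.flatMap fun q => (List.range (q.2 + 1)).map fun t => (q.1, t)

theorem expandAnc_append (a b : AncLabel) : expandAnc (a ++ b) = expandAnc a ++ expandAnc b := by
  simp [expandAnc]

theorem expandAnc_single (l c : ℕ) :
    expandAnc [(l, c)] = (List.range (c + 1)).map fun t => (l, t) := by simp [expandAnc]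

theorem expandAnc_single_succ (l c : ℕ) : expandAnc [(l, c + 1)] = expandAnc [(l, c)] ++ [(l, c + 1)] := by
  rw [expandAnc_single, expandAnc_single, List.range_succ (n := c + 1)]; simp

namespace Setting

variable {κ n : ℕ} {V : Type} [Fintype V] (S : Setting κ n V)

open scoped Classical in
/-- One step of the scan that produces the ancestry label. -/
noncomputable def ancStep (u : V) (q : ℕ × AncLabel) : ℕ × AncLabel :=
  if S.IsLight u then (0, (S.id u, q.1) :: q.2) else (q.1 + 1, q.2)

theorem anc_eq (v : V) : S.anc v = ((S.rp v).foldr S.ancStep (0, [])).2 := rfl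

/-- The label of a child arises by starting the scan of the parent's path from the state left by the
child. A nonzero initial state only reaches as far as the lowest light vertex: its counter grows by
`c`, and `m` is appended behind it. If there is no light vertex at all, only the running counter
changes. -/
theorem foldr_ancStep (L : List V) (c : ℕ) (m : AncLabel) :
    ((L.foldr S.ancStep (0, [])).2 = [] ∧
      L.foldr S.ancStep (c, m) = ((L.foldr S.ancStep (0, [])).1 + c, m)) ∨
    ∃ A l c₀, (L.foldr S.ancStep (0, [])).2 = A ++ [(l, c₀)] ∧
      L.foldr S.ancStep (c, m) = ((L.foldr S.ancStep (0, [])).1, A ++ (l, c₀ + c) :: m) := by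
  induction L with
  | nil => left; simp
  | cons u L ih =>
    rw [List.foldr_cons, List.foldr_cons]
    rcases ih with ⟨h₁, h₂⟩ | ⟨A, l, c₀, h₁, h₂⟩
    · by_cases hu : S.IsLight u
      · right
        refine ⟨[], S.id u, (L.foldr S.ancStep (0, [])).1, ?_, ?_⟩
        · rw [ancStep, if_pos hu, h₁]; rfl
        · rw [h₂, ancStep, ancStep, if_pos hu, if_pos hu]; simp
      · left
        rw [h₂, ancStep, ancStep, if_neg hu, if_neg hu]
        exact ⟨h₁, by simp; omega⟩
    · right
      by_cases hu : S.IsLight u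
      · refine ⟨(S.id u, (L.foldr S.ancStep (0, [])).1) :: A, l, c₀, ?_, ?_⟩
        · rw [ancStep, if_pos hu, h₁]; rfl
        · rw [h₂, ancStep, ancStep, if_pos hu, if_pos hu]; simp
      · refine ⟨A, l, c₀, ?_, ?_⟩
        · rw [ancStep, if_neg hu, h₁]
        · rw [h₂, ancStep, ancStep, if_neg hu, if_neg hu]

theorem isLight_root : S.IsLight S.s := fun u h => S.not_child_root u (S.heavy_some u S.s h).1

theorem anc_root : S.anc S.s = [(S.id S.s, 0)] := by
  rw [anc_eq, rp_root]; simp [ancStep, S.isLight_root]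

theorem anc_light {v w : V} (h : S.Child v w) (hw : S.IsLight w) :
    S.anc v = [] ∨ ∃ A l c, S.anc v = A ++ [(l, c)] ∧ S.anc w = A ++ [(l, c), (S.id w, 0)] := by
  rcases S.foldr_ancStep (S.rp v) 0 [(S.id w, 0)] with ⟨h₁, -⟩ | ⟨A, l, c, h₁, h₂⟩
  · exact Or.inl h₁
  · refine Or.inr ⟨A, l, c, h₁, ?_⟩
    have e : S.ancStep w (0, []) = (0, [(S.id w, 0)]) := if_pos hw
    rw [anc_eq, h.rp_eq, List.foldr_append, List.foldr_cons, List.foldr_nil, e, h₂]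
    rfl

theorem anc_heavy {v w : V} (h : S.Child v w) (hw : ¬ S.IsLight w) :
    S.anc v = [] ∨ ∃ A l c, S.anc v = A ++ [(l, c)] ∧ S.anc w = A ++ [(l, c + 1)] := by
  rcases S.foldr_ancStep (S.rp v) 1 [] with ⟨h₁, -⟩ | ⟨A, l, c, h₁, h₂⟩
  · exact Or.inl h₁
  · refine Or.inr ⟨A, l, c, h₁, ?_⟩
    rw [anc_eq, h.rp_eq, List.foldr_append, List.foldr_cons, List.foldr_nil]
    have e : S.ancStep w (0, []) = (1, []) := if_neg hw
    rw [e, h₂]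

/-- The ancestry label of a child. -/
theorem anc_child {v w : V} (h : S.Child v w) : ∃ A l c, S.anc v = A ++ [(l, c)] ∧
    ((S.IsLight w ∧ S.anc w = A ++ [(l, c), (S.id w, 0)]) ∨
      (¬ S.IsLight w ∧ S.anc w = A ++ [(l, c + 1)])) := by
  have hne : ∀ v, S.anc v ≠ [] := by
    refine S.induction_down (by simp [anc_root]) fun v w h hv => ?_
    by_cases hw : S.IsLight w
    · obtain h | ⟨A, l, c, -, e⟩ := S.anc_light h hw
      · exact absurd h hv
      · simp [e]
    · obtain h | ⟨A, l, c, -, e⟩ := S.anc_heavy h hw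
      · exact absurd h hv
      · simp [e]
  by_cases hw : S.IsLight w
  · obtain h | ⟨A, l, c, e₁, e⟩ := S.anc_light h hw
    · exact absurd h (hne v)
    · exact ⟨A, l, c, e₁, Or.inl ⟨hw, e⟩⟩
  · obtain h | ⟨A, l, c, e₁, e⟩ := S.anc_heavy h hw
    · exact absurd h (hne v)
    · exact ⟨A, l, c, e₁, Or.inr ⟨hw, e⟩⟩

/-- The symbolic root path of `v`, as told by its ancestry label. -/
noncomputable def path (v : V) : List (ℕ × ℕ) := expandAnc (S.anc v)

/-- The name of `v`: the light vertex above it on its heavy path, and the distance to it. -/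
noncomputable def name (v : V) : ℕ × ℕ := (S.anc v).getLastD (0, 0)

theorem name_root : S.name S.s = (S.id S.s, 0) := by simp [name, anc_root]

theorem name_light {v w : V} (h : S.Child v w) (hw : S.IsLight w) : S.name w = (S.id w, 0) := by
  obtain ⟨A, l, c, -, ⟨-, e⟩ | ⟨h, -⟩⟩ := S.anc_child h
  · simp [name, e]
  · exact absurd hw h

theorem name_heavy {v w : V} (h : S.Child v w) (hw : ¬ S.IsLight w) :
    S.name w = ((S.name v).1, (S.name v).2 + 1) := by
  obtain ⟨A, l, c, e₁, ⟨h, -⟩ | ⟨-, e⟩⟩ := S.anc_child h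
  · exact absurd h hw
  · simp [name, e, e₁]

theorem path_child {v w : V} (h : S.Child v w) : S.path w = S.path v ++ [S.name w] := by
  obtain ⟨A, l, c, e₁, ⟨-, e⟩ | ⟨-, e⟩⟩ := S.anc_child h
  · rw [path, path, name, e₁, e, show A ++ [(l, c), (S.id w, 0)] = (A ++ [(l, c)]) ++ [(S.id w, 0)] by simp,
      expandAnc_append]
    simp [expandAnc_single]
  · rw [path, path, name, e₁, e, expandAnc_append, expandAnc_append, expandAnc_single_succ]
    simp

theorem path_root : S.path S.s = [S.name S.s] := by
  rw [path, name_root, anc_root, expandAnc_single]; rfl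

theorem path_eq_map (v : V) : S.path v = (S.rp v).map S.name := by
  refine S.induction_down (P := fun v => S.path v = (S.rp v).map S.name) ?_ ?_ v
  · rw [path_root, rp_root]; rfl
  · intro v w h ih
    rw [S.path_child h, ih, h.rp_eq]; simp

/-- A light vertex is named by its identifier and the offset 0. A heavy one is the unique heavy
child of the vertex whose name has the offset smaller by one, so induction on the offset applies. -/
theorem name_injective : Function.Injective S.name := by
  have light : ∀ v, S.IsLight v → S.name v = (S.id v, 0) := fun v hv => by
    by_cases h : v = S.s
    · rw [h, name_root]
    · obtain ⟨p, hp⟩ := S.child_of_ne_root h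
      exact S.name_light hp hv
  have heavy : ∀ v, ¬ S.IsLight v → ∃ p, S.heavy p = some v ∧
      S.name v = ((S.name p).1, (S.name p).2 + 1) := fun v hv => by
    simp only [IsLight, not_forall, not_not] at hv
    obtain ⟨p, hp⟩ := hv
    exact ⟨p, hp, S.name_heavy (S.heavy_some p v hp).1 fun h => h p hp⟩
  suffices ∀ c u v, (S.name u).2 = c → S.name u = S.name v → u = v from
    fun u v h => this _ u v rfl h
  intro c
  induction c with
  | zero =>
    intro u v hc h
    by_cases hu : S.IsLight u
    · by_cases hv : S.IsLight v
      · rw [light u hu, light v hv] at h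
        exact S.id_inj (Prod.mk.inj h).1
      · obtain ⟨p, -, e⟩ := heavy v hv
        rw [h, e] at hc; simp at hc
    · obtain ⟨p, -, e⟩ := heavy u hu
      rw [e] at hc; simp at hc
  | succ c ih =>
    intro u v hc h
    have hu : ¬ S.IsLight u := fun hu => by rw [light u hu] at hc; simp at hc
    have hv : ¬ S.IsLight v := fun hv => by rw [h, light v hv] at hc; simp at hc
    obtain ⟨p, hp, e⟩ := heavy u hu
    obtain ⟨q, hq, e'⟩ := heavy v hv
    have hpq : p = q := by
      apply ih
      · rw [e] at hc; simpa using hc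
      · rw [e, e'] at h
        exact Prod.ext (Prod.mk.inj h).1 (by simpa using (Prod.mk.inj h).2)
    subst hpq
    exact Option.some_injective _ (hp.symm.trans hq)

theorem path_prefix_iff {u v : V} : S.path u <+: S.path v ↔ S.InSub u v := by
  rw [path_eq_map, path_eq_map, List.prefix_map_iff_of_injective S.name_injective,
    inSub_iff, mem_rp_iff_prefix]

theorem path_injective : Function.Injective S.path := fun u v h =>
  (S.path_prefix_iff.1 (by rw [h])).antisymm (S.path_prefix_iff.1 (by rw [h]))

theorem anc_injective : Function.Injective S.anc := fun _ _ h =>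
  S.path_injective (congrArg expandAnc h)

theorem length_path (v : V) : (S.path v).length = (S.rp v).length := by
  rw [path_eq_map, List.length_map]

/-- A neighbour whose symbolic path is the path of `v` without its last entry is the parent. -/
theorem child_iff_dropLast {u v : V} (h : u ≠ v) : S.Child u v ↔ S.path u = (S.path v).dropLast := by
  constructor
  · intro hc; rw [S.path_child hc]; simp
  · intro e
    have hv : v ≠ S.s := by
      rintro rfl
      rw [path_root] at e
      exact S.rp_ne_nil u (by simpa [path_eq_map] using e)
    obtain ⟨p, hp⟩ := S.child_of_ne_root hv
    rw [S.path_child hp, List.dropLast_concat] at e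
    rwa [S.path_injective e]

/-- Below `y`, membership in the subtree of `y` is recognized by comparing symbolic paths. -/
theorem inSub_iff_take {y u w : V} (h : S.InSub y u) :
    S.InSub y w ↔ (S.path u).take (S.path y).length <+: S.path w := by
  rw [← List.prefix_iff_eq_take.1 (S.path_prefix_iff.2 h), S.path_prefix_iff]

open scoped Classical in
theorem subtreeSize_eq (u : V) : subtreeSize S.T S.s u = ∑ v with S.InSub u v, 1 := by
  rw [subtreeSize, Nat.card_eq_fintype_card, Fintype.card_subtype]
  simp only [Finset.sum_const, smul_eq_mul, mul_one]
  rfl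

theorem subtreeSize_pos (u : V) : 0 < subtreeSize S.T S.s u := by
  classical
  rw [S.subtreeSize_eq, S.sum_subtree]; omega

/-- The heavy sibling has a subtree at least as large, and both subtrees lie in that of `v`. -/
theorem subtreeSize_light {v w : V} (h : S.Child v w) (hw : S.IsLight w) :
    2 * subtreeSize S.T S.s w ≤ subtreeSize S.T S.s v := by
  classical
  cases hv : S.heavy v with
  | none => exact absurd h (S.heavy_none v hv w)
  | some z =>
    obtain ⟨hz, hle⟩ := S.heavy_some v z hv
    have hzw : z ≠ w := fun e => hw v (e ▸ hv)
    have h₂ : ∑ i ∈ {z, w}, subtreeSize S.T S.s i ≤ ∑ i with S.Child v i, subtreeSize S.T S.s i :=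
      Finset.sum_le_sum_of_subset (by
        intro i hi
        simp only [Finset.mem_insert, Finset.mem_singleton] at hi
        rcases hi with rfl | rfl
        · exact Finset.mem_filter.2 ⟨Finset.mem_univ _, hz⟩
        · exact Finset.mem_filter.2 ⟨Finset.mem_univ _, h⟩)
    rw [Finset.sum_pair hzw] at h₂
    have h₃ := hle w h
    have h₄ := S.subtreeSize_eq v
    rw [S.sum_subtree] at h₄
    simp only [← S.subtreeSize_eq] at h₄
    omega

theorem subtreeSize_child {v w : V} (h : S.Child v w) :
    subtreeSize S.T S.s w ≤ subtreeSize S.T S.s v := by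
  classical
  rw [subtreeSize_eq, subtreeSize_eq]
  exact Finset.sum_le_sum_of_subset fun i hi => by
    simp only [Finset.mem_filter, Finset.mem_univ, true_and] at hi ⊢
    exact h.mem.trans hi

/-- Each light vertex after the root at least halves the size of the subtree. The invariant of the
downward induction is that two to the number of these halvings, times the present size, is at most
`n`. -/
theorem length_anc_le (v : V) : (S.anc v).length ≤ lg n := by
  have key : 2 ^ ((S.anc v).length - 1) * subtreeSize S.T S.s v ≤ n ∧ 1 ≤ (S.anc v).length := by
    refine S.induction_down (P := fun v => 2 ^ ((S.anc v).length - 1) * subtreeSize S.T S.s v ≤ n ∧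
      1 ≤ (S.anc v).length) ?_ ?_ v
    · classical
      rw [anc_root, subtreeSize_eq]
      refine ⟨?_, le_rfl⟩
      simp only [List.length_singleton, Nat.sub_self, pow_zero, one_mul, Finset.sum_const, smul_eq_mul,
        mul_one]
      exact (Finset.card_le_univ _).trans S.card_eq.le
    · rintro v w h ⟨ih, h1⟩
      obtain ⟨A, l, c, e₁, ⟨hw, e⟩ | ⟨-, e⟩⟩ := S.anc_child h
      · have := S.subtreeSize_light h hw
        rw [e₁] at ih
        rw [e]
        simp only [List.length_append, List.length_cons, List.length_nil] at ih ⊢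
        refine ⟨?_, by omega⟩
        calc 2 ^ (A.length + (0 + 1 + 1) - 1) * subtreeSize S.T S.s w
            = 2 ^ (A.length + (0 + 1) - 1) * (2 * subtreeSize S.T S.s w) := by
              rw [show A.length + (0 + 1 + 1) - 1 = (A.length + (0 + 1) - 1) + 1 by omega, pow_succ, mul_assoc]
          _ ≤ _ := (Nat.mul_le_mul_left _ this).trans ih
      · have := S.subtreeSize_child h
        rw [e₁] at ih
        rw [e]
        simp only [List.length_append, List.length_cons, List.length_nil] at ih ⊢
        exact ⟨(Nat.mul_le_mul_left _ this).trans ih, by omega⟩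
  have : 2 ^ ((S.anc v).length - 1) ≤ n :=
    le_trans (Nat.le_mul_of_pos_right _ (S.subtreeSize_pos v)) key.1
  have := Nat.le_log_of_pow_le (by norm_num) this
  unfold lg
  omega

theorem anc_bounds (v : V) : ∀ q ∈ S.anc v, q.1 < 2 ^ (κ * lg n) ∧ q.2 < n := by
  have h2 : ∀ q ∈ S.anc v, q.2 < (S.path v).length ∧ q.1 < 2 ^ (κ * lg n) := by
    refine S.induction_down (P := fun v => ∀ q ∈ S.anc v, q.2 < (S.path v).length ∧
      q.1 < 2 ^ (κ * lg n)) ?_ ?_ v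
    · simp [anc_root, path_root, S.id_lt]
    · intro v w h ih q hq
      have hl : (S.path w).length = (S.path v).length + 1 := by rw [S.path_child h]; simp
      rw [hl]
      obtain ⟨A, l, c, e₁, ⟨hw, e⟩ | ⟨-, e⟩⟩ := S.anc_child h
      · rw [e₁] at ih
        rw [e] at hq
        simp only [List.mem_append, List.mem_cons, List.not_mem_nil, or_false] at hq ih
        rcases hq with hq | hq | hq
        · have := ih q (Or.inl hq); exact ⟨by omega, this.2⟩
        · have := ih q (Or.inr hq); exact ⟨by omega, this.2⟩
        · subst hq; exact ⟨by simp, S.id_lt w⟩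
      · rw [e₁] at ih
        rw [e] at hq
        simp only [List.mem_append, List.mem_cons, List.not_mem_nil, or_false] at hq ih
        rcases hq with hq | hq
        · have := ih q (Or.inl hq); exact ⟨by omega, this.2⟩
        · have := ih (l, c) (Or.inr rfl); subst hq; exact ⟨by simpa using this.1, this.2⟩
  intro q hq
  have := h2 q hq
  refine ⟨this.2, this.1.trans_le ?_⟩
  rw [length_path]
  exact (S.length_rp_le v).trans S.card_eq.le

end Setting

/-! ### Message-driven families of algorithms and their bitwise scheduler. -/

/-- Partial tables of messages, indexed by the identifier of the other end and by the phase. -/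
abbrev Table (M : Type) : Type := ℕ → Fin 6 → Option M

/-- `k ≤ k'` in the order of information. -/
def Table.Le {M : Type} (k k' : Table M) : Prop := ∀ j p m, k j p = some m → k' j p = some m

/-- The single bits that are sent: phase, tag of the subalgorithm, position in the message.
The lexicographic order is the order of priority. -/
abbrev Item (N W : ℕ) : Type := Fin 6 ×ₗ (Fin N ×ₗ Fin W)

namespace Item

variable {N W : ℕ}

def mk (p : Fin 6) (i : Fin N) (b : Fin W) : Item N W := toLex (p, toLex (i, b))
def phase (q : Item N W) : Fin 6 := (ofLex q).1
def tag (q : Item N W) : Fin N := (ofLex (ofLex q).2).1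
def bit (q : Item N W) : Fin W := (ofLex (ofLex q).2).2

theorem eta (q : Item N W) : mk q.phase q.tag q.bit = q := rfl

theorem lt_cases {q q' : Item N W} (h : q < q') :
    (q.phase < q'.phase ∨ q.phase = q'.phase ∧ q.tag < q'.tag) ∨
      q.phase = q'.phase ∧ q.tag = q'.tag ∧ q.bit < q'.bit := by
  rcases Prod.Lex.lt_iff.1 h with h | ⟨h, h'⟩
  · exact Or.inl (Or.inl h)
  · rcases Prod.Lex.lt_iff.1 h' with h' | ⟨h', h''⟩
    · exact Or.inl (Or.inr ⟨h, h'⟩)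
    · exact Or.inr ⟨h, h', h''⟩

end Item

/-- Encodings of messages by bits, and of tagged bits by bit lists of bounded length. -/
structure Codec (M : Type) (N W bw : ℕ) where
  pos : 0 < W
  bits : M → Fin W → Bool
  unbits : (Fin W → Bool) → M
  unbits_bits : ∀ m, unbits (bits m) = m
  enc : Item N W × Bool → List Bool
  dec : List Bool → Item N W × Bool
  dec_enc : ∀ q, dec (enc q) = q
  length_enc : ∀ q, (enc q).length ≤ bw

/-- A family of message-driven subalgorithms, to be executed together: a vertex computes its
messages (which are never revised) from those received. -/
structure Family (In Coin M : Type) (N : ℕ) where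
  step : In → Coin → Fin N → Table M → Table M
  mono : ∀ a c i k k', Table.Le k k' → Table.Le (step a c i k) (step a c i k')

/-- States of the scheduler: the bits received and the items sent. -/
structure SchedState (In Coin : Type) (N W : ℕ) where
  inp : In
  coin : Coin
  known : ℕ → Item N W → Option Bool
  sent : ℕ → Item N W → Prop

namespace SchedState

variable {In Coin C₀ M Out : Type} {N W bw : ℕ}

open scoped Classical in
/-- The messages of the subalgorithm `i` that have been received completely. -/
noncomputable def content (cd : Codec M N W bw) (known : ℕ → Item N W → Option Bool) (i : Fin N) :
    Table M := fun j p =>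
  if ∀ b, (known j (Item.mk p i b)).isSome then
    some (cd.unbits fun b => (known j (Item.mk p i b)).getD false) else none

variable (cd : Codec M N W bw) (F : Family In C₀ M N) (act : Set (Fin N)) (cf : Coin → Fin N → C₀)

open scoped Classical in
/-- The bits that can be computed. -/
noncomputable def ready (σ : SchedState In Coin N W) (j : ℕ) (q : Item N W) : Option Bool :=
  if q.tag ∈ act then
    (F.step σ.inp (cf σ.coin q.tag) q.tag (content cd σ.known q.tag) j q.phase).map
      (fun m => cd.bits m q.bit) else none

open scoped Classical in
/-- The bits that can be computed and have not been sent. -/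
noncomputable def pending (σ : SchedState In Coin N W) (j : ℕ) : Finset (Item N W) :=
  Finset.univ.filter fun q => (ready cd F act cf σ j q).isSome ∧ ¬ σ.sent j q

open scoped Classical in
/-- The bit that is sent next to the neighbour `j`. -/
noncomputable def next (σ : SchedState In Coin N W) (j : ℕ) : Option (Item N W) :=
  if h : (pending cd F act cf σ j).Nonempty then some ((pending cd F act cf σ j).min' h) else none

open scoped Classical in
/-- The execution of the subalgorithms in `act`: in each round, every vertex sends to each
neighbour the bit of highest priority that it can compute and has not sent before. -/
noncomputable def alg (outF : In → Coin → (Fin N → Table M) → Out) : CongestAlg In Coin Out bw where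
  State := SchedState In Coin N W
  init a c := ⟨a, c, fun _ _ => none, fun _ _ => False⟩
  send σ j := (next cd F act cf σ j).bind fun q => (ready cd F act cf σ j q).map fun b => cd.enc (q, b)
  send_length σ j m h := by
    simp only [Option.bind_eq_some_iff, Option.map_eq_some_iff] at h
    obtain ⟨q, -, b, -, rfl⟩ := h
    exact cd.length_enc _
  recv σ ms :=
    { inp := σ.inp
      coin := σ.coin
      known := fun j q => ((ms j).bind fun m => if (cd.dec m).1 = q then some (cd.dec m).2 else none).or
        (σ.known j q)
      sent := fun j q => σ.sent j q ∨ next cd F act cf σ j = some q }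
  out σ := outF σ.inp σ.coin (fun i => content cd σ.known i)

variable {cd F act cf}

theorem next_eq_some {σ : SchedState In Coin N W} {j : ℕ} {q : Item N W}
    (h : next cd F act cf σ j = some q) :
    (ready cd F act cf σ j q).isSome ∧ ¬ σ.sent j q ∧
      ∀ q', (ready cd F act cf σ j q').isSome → ¬ σ.sent j q' → q ≤ q' := by
  classical
  unfold next at h
  split_ifs at h with hn
  have e := Option.some_injective _ h
  have hm := Finset.min'_mem _ hn
  rw [e] at hm
  have hm := (Finset.mem_filter.1 hm).2
  refine ⟨hm.1, hm.2, fun q' h₁ h₂ => ?_⟩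
  rw [← e]
  exact Finset.min'_le _ _ (Finset.mem_filter.2 ⟨Finset.mem_univ _, h₁, h₂⟩)

theorem exists_next {σ : SchedState In Coin N W} {j : ℕ} {q : Item N W}
    (h : (ready cd F act cf σ j q).isSome) (hs : ¬ σ.sent j q) :
    ∃ q', next cd F act cf σ j = some q' := by
  classical
  have : (pending cd F act cf σ j).Nonempty := ⟨q, Finset.mem_filter.2 ⟨Finset.mem_univ _, h, hs⟩⟩
  exact ⟨_, dif_pos this⟩

theorem content_eq_some {k : ℕ → Item N W → Option Bool} {i : Fin N} {j : ℕ} {p : Fin 6} {m : M} :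
    content cd k i j p = some m ↔ ∃ f : Fin W → Bool, (∀ b, k j (Item.mk p i b) = some (f b)) ∧
      cd.unbits f = m := by
  unfold content
  constructor
  · intro h
    split_ifs at h with hb
    refine ⟨_, fun b => ?_, Option.some_injective _ h⟩
    obtain ⟨c, hc⟩ := Option.isSome_iff_exists.1 (hb b)
    simp [hc]
  · rintro ⟨f, hf, rfl⟩
    simp [hf]

theorem content_mono {k k' : ℕ → Item N W → Option Bool}
    (h : ∀ j q b, k j q = some b → k' j q = some b) (i : Fin N) :
    (content cd k i).Le (content cd k' i) := by
  intro j p m hm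
  obtain ⟨f, hf, e⟩ := content_eq_some.1 hm
  exact content_eq_some.2 ⟨f, fun b => h _ _ _ (hf b), e⟩

theorem ready_eq_some {σ : SchedState In Coin N W} {j : ℕ} {q : Item N W} {b : Bool} :
    ready cd F act cf σ j q = some b ↔ q.tag ∈ act ∧
      ∃ m, F.step σ.inp (cf σ.coin q.tag) q.tag (content cd σ.known q.tag) j q.phase = some m ∧
        cd.bits m q.bit = b := by
  unfold ready
  split_ifs with h <;> simp [h]

end SchedState

theorem byId_id {V X : Type} {id : V → ℕ} (hid : Function.Injective id) (P : V → Prop) (f : V → X)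
    {u : V} (hu : P u) : byId id P f (id u) = some (f u) := by
  have h : ∃ w, P w ∧ id w = id u := ⟨u, hu, rfl⟩
  rw [byId, dif_pos h, hid h.choose_spec.2]

theorem byId_eq_some {V X : Type} {id : V → ℕ} {P : V → Prop} {f : V → X} {i : ℕ} {x : X}
    (h : byId id P f i = some x) : ∃ u, P u ∧ id u = i ∧ f u = x := by
  unfold byId at h
  split_ifs at h with hu
  exact ⟨_, hu.choose_spec.1, hu.choose_spec.2, Option.some_injective _ h⟩

/-! ### Executions of the scheduler: soundness, deadlines and final tables. -/

namespace SchedState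

variable {In Coin C₀ M Out V : Type} {N W bw : ℕ}

/-- What is known about the messages of a family on a network: `Good i p u v m` says that `m` is
an admissible message of phase `p` of the subalgorithm `i` from `u` to `v`, `Exp i p u v` that such
a message is due, and `dl i p u v` is the time by which it is sent. -/
structure Analysis (F : Family In C₀ M N) (act : Set (Fin N)) (G : SimpleGraph V) (id : V → ℕ)
    (inp : V → In) (coin : V → Fin N → C₀) where
  Good : Fin N → Fin 6 → V → V → M → Prop
  Exp : Fin N → Fin 6 → V → V → Prop
  dl : Fin N → Fin 6 → V → V → ℕ
  bound : ℕ
  exp_adj : ∀ {i p u v}, Exp i p u v → G.Adj u v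
  exp_of_good : ∀ {i p u v m}, Good i p u v m → Exp i p u v
  closure : ∀ {i v k}, i ∈ act →
    (∀ j p m, k j p = some m → ∃ u, id u = j ∧ Good i p u v m) →
    ∀ {w p m}, G.Adj v w → F.step (inp v) (coin v i) i k (id w) p = some m → Good i p v w m
  progress : ∀ {i v k}, i ∈ act →
    (∀ j p m, k j p = some m → ∃ u, id u = j ∧ Good i p u v m) →
    ∀ {w p}, Exp i p v w →
      (∀ u p', Exp i p' u v → dl i p' u v < dl i p v w → (k (id u) p').isSome) →
      (F.step (inp v) (coin v i) i k (id w) p).isSome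
  dl_order : ∀ {i i' p p' u v}, i ∈ act → i' ∈ act → Exp i p u v → Exp i' p' u v →
    (p < p' ∨ p = p' ∧ i < i') → dl i p u v < dl i' p' u v
  dl_lt : ∀ {i p u v}, Exp i p u v → dl i p u v < bound

/-- Consistent families of tables: every message is the one that its sender computes. -/
structure IsFix {F : Family In C₀ M N} {act : Set (Fin N)} {G : SimpleGraph V} {id : V → ℕ}
    {inp : V → In} {coin : V → Fin N → C₀} (H : Analysis F act G id inp coin) (i : Fin N)
    (k : V → Table M) : Prop where
  ok : ∀ v j p m, k v j p = some m → ∃ u, id u = j ∧ H.Good i p u v m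
  eq : ∀ u v p, G.Adj u v → k v (id u) p = F.step (inp u) (coin u i) i (k u) (id v) p

namespace IsFix

variable {F : Family In C₀ M N} {act : Set (Fin N)} {G : SimpleGraph V} {id : V → ℕ} {inp : V → In}
  {coin : V → Fin N → C₀} {H : Analysis F act G id inp coin} {i : Fin N} {k k' : V → Table M}

theorem isSome (hi : i ∈ act) (h : IsFix H i k) {p : Fin 6} {u v : V}
    (he : H.Exp i p u v) : (k v (id u) p).isSome := by
  induction hd : H.dl i p u v using Nat.strong_induction_on generalizing p u v with
  | _ d ih =>
    rw [h.eq u v p (H.exp_adj he)]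
    exact H.progress hi (h.ok u) he fun w p' hw hl => ih _ (hd ▸ hl) hw rfl

-- Induction on deadlines: two solutions agree on all messages due earlier, and by `progress` these
-- already determine the next message.
open scoped Classical in
theorem unique (hi : i ∈ act) (h : IsFix H i k) (h' : IsFix H i k') :
    k = k' := by
  have key : ∀ d, ∀ p u v, H.Exp i p u v → H.dl i p u v = d → k v (id u) p = k' v (id u) p := by
    intro d
    induction d using Nat.strong_induction_on with
    | _ d ih =>
      intro p u v he hd
      -- The common part of both tables: only messages due before `d`, where the induction
      -- hypothesis gives equality. Monotonicity carries the message computed from it to both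
      -- solutions.
      let kr : Table M := fun j p' => if ∃ w, id w = j ∧ H.Exp i p' w u ∧ H.dl i p' w u < d then k u j p'
        else none
      have h₁ : kr.Le (k u) := fun j p' m hm => by
        simp only [kr] at hm
        split_ifs at hm
        exact hm
      have h₂ : kr.Le (k' u) := fun j p' m hm => by
        simp only [kr] at hm
        split_ifs at hm with hw
        obtain ⟨w, rfl, hw, hlt⟩ := hw
        rw [← ih _ hlt p' w u hw rfl]; exact hm
      have hs : (F.step (inp u) (coin u i) i kr (id v) p).isSome := by
        refine H.progress hi (fun j p' m hm => h.ok u j p' m (h₁ _ _ _ hm)) he fun w p' hw hl => ?_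
        have hx : ∃ z, id z = id w ∧ H.Exp i p' z u ∧ H.dl i p' z u < d := ⟨w, rfl, hw, hd ▸ hl⟩
        simp only [kr, if_pos hx]
        exact h.isSome hi hw
      obtain ⟨m, hm⟩ := Option.isSome_iff_exists.1 hs
      rw [h.eq u v p (H.exp_adj he), h'.eq u v p (H.exp_adj he), F.mono _ _ _ _ _ h₁ _ _ _ hm,
        F.mono _ _ _ _ _ h₂ _ _ _ hm]
  funext v j p
  by_cases hx : ∃ u, id u = j ∧ H.Exp i p u v
  · obtain ⟨u, rfl, he⟩ := hx
    exact key _ p u v he rfl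
  · have : ∀ k : V → Table M, IsFix H i k → k v j p = none := fun k hk => by
      by_contra hc
      obtain ⟨m, hm⟩ := Option.ne_none_iff_exists'.1 hc
      obtain ⟨u, hu, hg⟩ := hk.ok v j p m hm
      exact hx ⟨u, hu, H.exp_of_good hg⟩
    rw [this k h, this k' h']

end IsFix

section Run

variable (cd : Codec M N W bw) (F : Family In C₀ M N) (act : Set (Fin N)) (cf : Coin → Fin N → C₀)
  (outF : In → Coin → (Fin N → Table M) → Out)
  (G : SimpleGraph V) (id : V → ℕ) (inp : V → In) (ω : V → Coin)

/-- The states of the execution. -/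
noncomputable def st (t : ℕ) (v : V) : SchedState In Coin N W :=
  (alg cd F act cf outF).run G id inp ω t v

theorem st_inp (t : ℕ) (v : V) : (st cd F act cf outF G id inp ω t v).inp = inp v := by
  induction t with
  | zero => rfl
  | succ t ih => exact ih

theorem st_coin (t : ℕ) (v : V) : (st cd F act cf outF G id inp ω t v).coin = ω v := by
  induction t with
  | zero => rfl
  | succ t ih => exact ih

variable {cd F act cf outF G id inp ω}

local notation "σ" => st cd F act cf outF G id inp ω
local notation "rdy" => ready cd F act cf
local notation "nxt" => next cd F act cf

theorem st_sent_succ (t : ℕ) (v : V) (j : ℕ) (q : Item N W) :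
    (σ (t + 1) v).sent j q ↔ (σ t v).sent j q ∨ nxt (σ t v) j = some q := Iff.rfl

theorem st_known_of_not_adj (t : ℕ) (v : V) (j : ℕ) (q : Item N W)
    (h : ¬ ∃ u, G.Adj v u ∧ id u = j) : (σ t v).known j q = none := by
  induction t with
  | zero => rfl
  | succ t ih =>
    have e : byId id (G.Adj v) (fun u => (alg cd F act cf outF).send (σ t u) (id v)) j = none := by
      rw [byId, dif_neg h]
    change ((Option.join (byId id (G.Adj v) (fun u => (alg cd F act cf outF).send (σ t u) (id v)) j)).bind
      _).or ((σ t v).known j q) = none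
    rw [e, ih]; rfl

theorem st_known_succ (hid : Function.Injective id) (t : ℕ) {u v : V} (h : G.Adj u v) (q : Item N W) :
    (σ (t + 1) v).known (id u) q = if nxt (σ t u) (id v) = some q then rdy (σ t u) (id v) q
      else (σ t v).known (id u) q := by
  have e := byId_id hid (G.Adj v) (fun u => (alg cd F act cf outF).send (σ t u) (id v)) h.symm
  change ((Option.join (byId id (G.Adj v) (fun u => (alg cd F act cf outF).send (σ t u) (id v))
    (id u))).bind _).or ((σ t v).known (id u) q) = _
  rw [e]
  change (((nxt (σ t u) (id v)).bind fun q => (rdy (σ t u) (id v) q).map fun b => cd.enc (q, b)).bind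
    _).or ((σ t v).known (id u) q) = _
  cases hn : nxt (σ t u) (id v) with
  | none => simp
  | some q' =>
    obtain ⟨b, hb⟩ := Option.isSome_iff_exists.1 (next_eq_some hn).1
    by_cases hq : q' = q
    · subst hq; simp [hb, cd.dec_enc]
    · simp [hb, cd.dec_enc, hq]

/-- What is known to have been sent is known at the other end, and nothing else. -/
def Inv (G : SimpleGraph V) (id : V → ℕ) (s : V → SchedState In Coin N W)
    (r : SchedState In Coin N W → ℕ → Item N W → Option Bool) : Prop :=
  ∀ u v, G.Adj u v → ∀ q, ((s u).sent (id v) q →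
    ∃ b, (s v).known (id u) q = some b ∧ r (s u) (id v) q = some b) ∧
      (¬ (s u).sent (id v) q → (s v).known (id u) q = none)

theorem known_le_succ_of_inv (hid : Function.Injective id) {t : ℕ} (hI : Inv G id (σ t) rdy) (v : V)
    (j : ℕ) (q : Item N W) (b : Bool) (h : (σ t v).known j q = some b) :
    (σ (t + 1) v).known j q = some b := by
  by_cases hu : ∃ u, G.Adj v u ∧ id u = j
  · obtain ⟨u, hu, rfl⟩ := hu
    rw [st_known_succ hid t hu.symm, if_neg, h]
    intro hn
    have := (hI u v hu.symm q).2 (next_eq_some hn).2.1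
    rw [this] at h; cases h
  · rw [st_known_of_not_adj t v j q hu] at h; cases h

theorem ready_le_succ_of_inv (hid : Function.Injective id) {t : ℕ} (hI : Inv G id (σ t) rdy) (v : V)
    (j : ℕ) (q : Item N W) (b : Bool) (h : rdy (σ t v) j q = some b) : rdy (σ (t + 1) v) j q = some b := by
  rw [ready_eq_some] at h ⊢
  obtain ⟨ha, m, hm, hb⟩ := h
  refine ⟨ha, m, ?_, hb⟩
  rw [st_inp, st_coin] at hm ⊢
  exact F.mono _ _ _ _ _ (content_mono (known_le_succ_of_inv hid hI v) _) _ _ _ hm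

/-- A bit that was ready when sent stays ready with the same value, since knowledge only grows and
steps are monotone. This keeps the transmitted bit in agreement with the sender's current table. -/
theorem inv (hid : Function.Injective id) (t : ℕ) : Inv G id (σ t) rdy := by
  induction t with
  | zero => exact fun u v _ q => ⟨fun h => h.elim, fun _ => rfl⟩
  | succ t ih =>
    intro u v huv q
    rw [st_sent_succ, st_known_succ hid t huv]
    constructor
    · rintro (h | h)
      · obtain ⟨b, h₁, h₂⟩ := (ih u v huv q).1 h
        refine ⟨b, ?_, ready_le_succ_of_inv hid ih u _ q b h₂⟩
        rw [if_neg, h₁]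
        intro hn
        exact (next_eq_some hn).2.1 h
      · obtain ⟨b, hb⟩ := Option.isSome_iff_exists.1 (next_eq_some h).1
        exact ⟨b, by rw [if_pos h, hb], ready_le_succ_of_inv hid ih u _ q b hb⟩
    · intro h
      push Not at h
      rw [if_neg h.2, (ih u v huv q).2 h.1]

theorem known_mono (hid : Function.Injective id) {t t' : ℕ} (h : t ≤ t') (v : V)
    (j : ℕ) (q : Item N W) (b : Bool) (hb : (σ t v).known j q = some b) :
    (σ t' v).known j q = some b := by
  induction t', h using Nat.le_induction with
  | base => exact hb
  | succ t' _ ih => exact known_le_succ_of_inv hid (inv hid t') v j q b ih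

/-- The messages that `v` has received completely. -/
noncomputable def tab (cd : Codec M N W bw) (F : Family In C₀ M N) (act : Set (Fin N))
    (cf : Coin → Fin N → C₀) (outF : In → Coin → (Fin N → Table M) → Out) (G : SimpleGraph V)
    (id : V → ℕ) (inp : V → In) (ω : V → Coin) (t : ℕ) (v : V) (i : Fin N) : Table M :=
  content cd (st cd F act cf outF G id inp ω t v).known i

local notation "τ" => tab cd F act cf outF G id inp ω

theorem tab_mono (hid : Function.Injective id) {t t' : ℕ} (h : t ≤ t') (v : V) (i : Fin N) :
    (τ t v i).Le (τ t' v i) := content_mono (known_mono hid h v) i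

theorem outAt_eq (t : ℕ) (v : V) : (alg cd F act cf outF).outAt G id inp ω t v =
    outF (inp v) (ω v) (τ t v) := by
  change outF (σ t v).inp (σ t v).coin _ = _
  rw [st_inp, st_coin]; rfl

theorem known_succ_ready (hid : Function.Injective id) {t : ℕ} {u v : V} (huv : G.Adj u v)
    {q : Item N W} {b : Bool} (h : (σ (t + 1) v).known (id u) q = some b) :
    rdy (σ t u) (id v) q = some b := by
  rw [st_known_succ hid t huv] at h
  split_ifs at h with hn
  · exact h
  · by_cases hs : (σ t u).sent (id v) q
    · obtain ⟨b', h₁, h₂⟩ := (inv hid t u v huv q).1 hs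
      rwa [h₂, ← h₁]
    · rw [(inv hid t u v huv q).2 hs] at h; cases h

theorem ready_eq_some' {t : ℕ} {u : V} {j : ℕ} {q : Item N W} {b : Bool} :
    rdy (σ t u) j q = some b ↔ q.tag ∈ act ∧
      ∃ m, F.step (inp u) (cf (ω u) q.tag) q.tag (τ t u q.tag) j q.phase = some m ∧
        cd.bits m q.bit = b := by
  rw [ready_eq_some, st_inp, st_coin]; rfl

/-- The bits of one message may arrive in different rounds. At time `t`, however, each of them is
still ready at the sender, so all are bits of the one message that the sender computes at that time.
-/
theorem tab_succ (hid : Function.Injective id) {t : ℕ} {v : V} {i : Fin N} {j : ℕ} {p : Fin 6} {m : M}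
    (h : τ (t + 1) v i j p = some m) : i ∈ act ∧ ∃ u, id u = j ∧ G.Adj u v ∧
      F.step (inp u) (cf (ω u) i) i (τ t u i) (id v) p = some m := by
  obtain ⟨f, hf, rfl⟩ := content_eq_some.1 h
  have hu : ∃ u, G.Adj v u ∧ id u = j := by
    by_contra hu
    have := hf ⟨0, cd.pos⟩
    rw [st_known_of_not_adj _ v j _ hu] at this; cases this
  obtain ⟨u, hu, rfl⟩ := hu
  have hr : ∀ b, i ∈ act ∧ ∃ m, F.step (inp u) (cf (ω u) i) i (τ t u i) (id v) p = some m ∧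
      cd.bits m b = f b := fun b => ready_eq_some'.1 (known_succ_ready hid hu.symm (hf b))
  obtain ⟨ha, m, hm, -⟩ := hr ⟨0, cd.pos⟩
  refine ⟨ha, u, rfl, hu.symm, ?_⟩
  rw [hm, ← cd.unbits_bits m]
  congr 2
  funext b
  obtain ⟨-, m', hm', hb⟩ := hr b
  rw [hm] at hm'
  rw [← hb, Option.some_injective _ hm']

variable (H : Analysis F act G id inp fun v => cf (ω v))
include H

theorem tab_ok (hid : Function.Injective id) (t : ℕ) (v : V) (i : Fin N) (j : ℕ) (p : Fin 6) (m : M)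
    (h : τ t v i j p = some m) : ∃ u, id u = j ∧ H.Good i p u v m := by
  induction t generalizing v j p m with
  | zero =>
    obtain ⟨f, hf, -⟩ := content_eq_some.1 h
    cases hf ⟨0, cd.pos⟩
  | succ t ih =>
    obtain ⟨ha, u, rfl, hu, e⟩ := tab_succ hid h
    exact ⟨u, rfl, H.closure ha (ih u) hu e⟩

theorem exp_of_ready (hid : Function.Injective id) {t : ℕ} {u v : V} (huv : G.Adj u v) {q : Item N W}
    (h : (rdy (σ t u) (id v) q).isSome) : q.tag ∈ act ∧ H.Exp q.tag q.phase u v := by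
  obtain ⟨b, hb⟩ := Option.isSome_iff_exists.1 h
  obtain ⟨ha, m, hm, -⟩ := ready_eq_some'.1 hb
  exact ⟨ha, H.exp_of_good (H.closure ha (tab_ok H hid t u _) huv hm)⟩

/-- Induction on time, with `W` rounds for each unit of deadline. All inputs of the message have
earlier deadlines and have arrived completely, so its bits are ready. An item that is preferred to
it also has an earlier deadline, so it has been sent before and cannot block. -/
theorem deadline (hid : Function.Injective id) (t : ℕ) {i : Fin N} {p : Fin 6} {u v : V} (b : Fin W)
    (hi : i ∈ act) (he : H.Exp i p u v) (ht : H.dl i p u v * W + b < t) :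
    (σ t u).sent (id v) (Item.mk p i b) := by
  induction t generalizing i p u v b with
  | zero => omega
  | succ t ih =>
    by_cases hlt : H.dl i p u v * W + b < t
    · exact Or.inl (ih b hi he hlt)
    rw [st_sent_succ]
    by_cases hs : (σ t u).sent (id v) (Item.mk p i b)
    · exact Or.inl hs
    right
    have huv := H.exp_adj he
    have hr : (F.step (inp u) (cf (ω u) i) i (τ t u i) (id v) p).isSome := by
      refine H.progress hi (tab_ok H hid t u i) he fun w p' hw hl => ?_
      have hk : ∀ c, ∃ x, (σ t u).known (id w) (Item.mk p' i c) = some x := fun c => by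
        have : H.dl i p' w u * W + c < t := by
          -- An earlier deadline is earlier by a whole unit, which leaves room for all `W` bits of
          -- the other message.
          have h₁ : (H.dl i p' w u + 1) * W ≤ H.dl i p u v * W := Nat.mul_le_mul_right _ hl
          have := c.2
          rw [Nat.add_mul] at h₁
          omega
        obtain ⟨x, hx, -⟩ := (inv hid t w u (H.exp_adj hw) _).1 (ih c hi hw this)
        exact ⟨x, hx⟩
      choose f hf using hk
      exact Option.isSome_iff_exists.2 ⟨_, content_eq_some.2 ⟨f, hf, rfl⟩⟩
    obtain ⟨m, hm⟩ := Option.isSome_iff_exists.1 hr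
    have hrd : rdy (σ t u) (id v) (Item.mk p i b) = some (cd.bits m b) :=
      ready_eq_some'.2 ⟨hi, m, hm, rfl⟩
    obtain ⟨q, hq⟩ := exists_next (Option.isSome_iff_exists.2 ⟨_, hrd⟩) hs
    obtain ⟨h₁, h₂, h₃⟩ := next_eq_some hq
    rcases (h₃ _ (Option.isSome_iff_exists.2 ⟨_, hrd⟩) hs).eq_or_lt with e | hqlt
    · rw [← e]; exact hq
    · exfalso
      obtain ⟨ha, hqe⟩ := exp_of_ready H hid huv h₁
      -- The competing item `q` would have been sent by its own deadline: by `dl_order` if it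
      -- belongs to another message, and by the order of bits if it belongs to the same one.
      refine h₂ (ih (p := q.phase) (i := q.tag) q.bit ha hqe ?_)
      rcases Item.lt_cases hqlt with h | ⟨hp, htag, hb⟩
      · have h₁ : (H.dl q.tag q.phase u v + 1) * W ≤ H.dl i p u v * W :=
          Nat.mul_le_mul_right _ (H.dl_order ha hi hqe he h)
        have := q.bit.2
        rw [Nat.add_mul] at h₁
        omega
      · have e₁ : q.tag = i := htag
        have e₂ : q.phase = p := hp
        have : (q.bit : ℕ) < b := hb
        rw [e₁, e₂]
        omega

theorem next_eq_none (hid : Function.Injective id) {t : ℕ} (ht : H.bound * W ≤ t) {u v : V}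
    (huv : G.Adj u v) : nxt (σ t u) (id v) = none := by
  by_contra hc
  obtain ⟨q, hq⟩ := Option.ne_none_iff_exists'.1 hc
  obtain ⟨h₁, h₂, -⟩ := next_eq_some hq
  obtain ⟨ha, he⟩ := exp_of_ready H hid huv h₁
  refine h₂ (deadline H hid t (p := q.phase) q.bit ha he ?_)
  have h₁ : (H.dl q.tag q.phase u v + 1) * W ≤ H.bound * W := Nat.mul_le_mul_right _ (H.dl_lt he)
  have := q.bit.2
  rw [Nat.add_mul, one_mul] at h₁
  calc H.dl q.tag q.phase u v * W + q.bit < H.dl q.tag q.phase u v * W + W := by omega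
    _ ≤ t := h₁.trans ht

theorem sends_imp (hid : Function.Injective id) {t : ℕ} {u v : V}
    (h : (alg cd F act cf outF).Sends G id inp ω t u v) :
    ∃ q, nxt (σ t u) (id v) = some q ∧ q.tag ∈ act ∧ H.Exp q.tag q.phase u v := by
  obtain ⟨huv, h⟩ := h
  change ((nxt (σ t u) (id v)).bind _) ≠ none at h
  cases hn : nxt (σ t u) (id v) with
  | none => rw [hn] at h; exact absurd rfl h
  | some q => exact ⟨q, rfl, exp_of_ready H hid huv (next_eq_some hn).1⟩

theorem known_stable (hid : Function.Injective id) {t : ℕ} (ht : H.bound * W ≤ t) (v : V) :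
    (σ (t + 1) v).known = (σ t v).known := by
  funext j q
  by_cases hu : ∃ u, G.Adj v u ∧ id u = j
  · obtain ⟨u, hu, rfl⟩ := hu
    rw [st_known_succ hid t hu.symm, next_eq_none H hid ht hu.symm]
    simp
  · rw [st_known_of_not_adj _ v j q hu, st_known_of_not_adj _ v j q hu]

theorem finishesBy (hid : Function.Injective id) {R : ℕ} (hR : H.bound * W ≤ R) :
    (alg cd F act cf outF).FinishesBy G id inp ω R := by
  intro t ht
  refine ⟨fun u v h => ?_, fun v => ?_⟩
  · obtain ⟨q, hq, -⟩ := sends_imp H hid h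
    rw [next_eq_none H hid (hR.trans ht) h.1] at hq
    cases hq
  · rw [outAt_eq, outAt_eq]
    suffices (σ t v).known = (σ R v).known by unfold tab; rw [this]
    induction t, ht using Nat.le_induction with
    | base => rfl
    | succ t ht ih => rw [known_stable H hid (hR.trans ht), ih]

/-- After the last deadline nothing changes any more. Every computable message has been sent
completely, and every message that was received is one computed by its sender. -/
theorem isFix (hid : Function.Injective id) {R : ℕ} (hR : H.bound * W ≤ R) {i : Fin N} (hi : i ∈ act) :
    IsFix H i fun v => τ R v i := by
  refine ⟨fun v => tab_ok H hid R v i, fun u v p huv => ?_⟩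
  have e : τ (R + 1) v i = τ R v i := by unfold tab; rw [known_stable H hid hR]
  cases h : F.step (inp u) (cf (ω u) i) i (τ R u i) (id v) p with
  | some m =>
    have he := H.exp_of_good (H.closure hi (tab_ok H hid R u i) huv h)
    change content cd (σ R v).known i (id u) p = some m
    refine content_eq_some.2 ⟨cd.bits m, fun b => ?_, cd.unbits_bits m⟩
    have hs := deadline (cd := cd) (outF := outF) H hid R (p := p) b hi he (by
      have h₁ : (H.dl i p u v + 1) * W ≤ H.bound * W := Nat.mul_le_mul_right _ (H.dl_lt he)
      have := b.2
      rw [Nat.add_mul] at h₁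
      omega)
    obtain ⟨x, hx, hx'⟩ := (inv hid R u v huv _).1 hs
    rw [hx]
    obtain ⟨-, m', hm', hb⟩ := ready_eq_some'.1 hx'
    have : m' = m := Option.some_injective _ (hm'.symm.trans h)
    rw [← hb, this]; rfl
  | none =>
    by_contra hc
    obtain ⟨m, hm⟩ := Option.ne_none_iff_exists'.1 hc
    rw [← e] at hm
    obtain ⟨-, w, hw, -, hs⟩ := tab_succ hid hm
    rw [hid hw, h] at hs
    cases hs

-- No item is sent twice over an edge in the same direction, so mapping a round to the item sent in
-- it is injective.
open scoped Classical in
theorem card_sends_le (hid : Function.Injective id) (T : ℕ) (u v : V) :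
    ((Finset.range T).filter fun t => (alg cd F act cf outF).Sends G id inp ω t u v).card ≤
      ((Finset.univ : Finset (Item N W)).filter fun q => q.tag ∈ act).card := by
  have hsent : ∀ t t' q, t ≤ t' → (σ t u).sent (id v) q → (σ t' u).sent (id v) q := by
    intro t t' q h hs
    induction t', h using Nat.le_induction with
    | base => exact hs
    | succ t' _ ih => exact Or.inl ih
  rw [← Finset.card_map (s := (Finset.univ : Finset (Item N W)).filter fun q => q.tag ∈ act)
    Function.Embedding.some]
  refine Finset.card_le_card_of_injOn (fun t => nxt (σ t u) (id v)) ?_ ?_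
  · intro t ht
    obtain ⟨q, hq, ha, -⟩ := sends_imp H hid (Finset.mem_filter.1 ht).2
    simp only [hq, Finset.coe_map, Set.mem_image, Finset.mem_coe]
    exact ⟨q, Finset.mem_filter.2 ⟨Finset.mem_univ _, ha⟩, rfl⟩
  · have key : ∀ t t', t < t' → (alg cd F act cf outF).Sends G id inp ω t u v →
        nxt (σ t u) (id v) ≠ nxt (σ t' u) (id v) := by
      intro t t' hlt hS e
      obtain ⟨q, hq, -⟩ := sends_imp H hid hS
      rw [hq] at e
      exact (next_eq_some e.symm).2.1 (hsent (t + 1) t' q hlt (Or.inr hq))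
    intro t ht t' ht' e
    rcases lt_trichotomy t t' with h | h | h
    · exact absurd e (key t t' h (Finset.mem_filter.1 ht).2)
    · exact h
    · exact absurd e.symm (key t' t h (Finset.mem_filter.1 ht').2)

end Run

end SchedState

/-! ### Uniform probability on finite types. -/

section Probability

variable {Ω Ω' : Type}

open scoped Classical in
theorem prob_eq [Fintype Ω] (P : Ω → Prop) :
    prob P = ((Finset.univ.filter P).card : ℝ) / (Fintype.card Ω : ℝ) := by
  rw [prob, Nat.card_eq_fintype_card, Nat.card_eq_fintype_card, Fintype.card_subtype]

theorem prob_mono [Finite Ω] {P Q : Ω → Prop} (h : ∀ ω, P ω → Q ω) : prob P ≤ prob Q := by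
  classical
  have := Fintype.ofFinite Ω
  rw [prob_eq, prob_eq]
  gcongr with ω
  exact h ω

theorem prob_not [Finite Ω] [Nonempty Ω] (P : Ω → Prop) : prob P = 1 - prob fun ω => ¬ P ω := by
  classical
  have := Fintype.ofFinite Ω
  have h := Finset.card_filter_add_card_filter_not (s := (Finset.univ : Finset Ω)) P
  have hc : (Fintype.card Ω : ℝ) ≠ 0 := by exact_mod_cast Fintype.card_ne_zero
  rw [prob_eq, prob_eq, eq_sub_iff_add_eq, ← add_div, div_eq_one_iff_eq hc, ← Finset.card_univ, ← h,
    Nat.cast_add]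
  congr!

theorem prob_exists_le [Finite Ω] {I : Type} (s : Finset I) (P : I → Ω → Prop) :
    prob (fun ω => ∃ i ∈ s, P i ω) ≤ ∑ i ∈ s, prob (P i) := by
  classical
  have := Fintype.ofFinite Ω
  simp only [prob_eq]
  rw [← Finset.sum_div]
  gcongr
  have : (Finset.univ.filter fun ω => ∃ i ∈ s, P i ω) = s.biUnion fun i => Finset.univ.filter (P i) := by
    ext; simp
  calc _ ≤ (((s.biUnion fun i => Finset.univ.filter (P i)).card : ℕ) : ℝ) := by
        rw [← this]; apply le_of_eq; congr!
    _ ≤ _ := by exact_mod_cast Finset.card_biUnion_le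

theorem prob_exists_le' [Finite Ω] {I : Type} (s : Finset I) (P : I → Ω → Prop) {m ε : ℝ}
    (hs : (s.card : ℝ) ≤ m) (hε : 0 ≤ ε) (h : ∀ i ∈ s, prob (P i) ≤ ε) :
    prob (fun ω => ∃ i ∈ s, P i ω) ≤ m * ε :=
  (prob_exists_le s P).trans ((Finset.sum_le_card_nsmul _ _ _ h).trans (by
    rw [nsmul_eq_mul]; gcongr))

theorem prob_or_le [Finite Ω] (P Q : Ω → Prop) : prob (fun ω => P ω ∨ Q ω) ≤ prob P + prob Q := by
  have := prob_exists_le (Finset.univ : Finset Bool) fun b ω => if b then P ω else Q ω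
  simpa [or_comm, add_comm] using this

theorem prob_equiv (e : Ω ≃ Ω') (P : Ω' → Prop) : prob (fun ω => P (e ω)) = prob P := by
  rw [prob, prob, Nat.card_congr e, Nat.card_congr (e.subtypeEquiv fun _ => Iff.rfl)]

theorem prob_prod_le [Finite Ω] [Finite Ω'] {P : Ω × Ω' → Prop} {ε : ℝ} (hε : 0 ≤ ε)
    (h : ∀ a, prob (fun b => P (a, b)) ≤ ε) : prob P ≤ ε := by
  classical
  have := Fintype.ofFinite Ω
  have := Fintype.ofFinite Ω'
  rcases isEmpty_or_nonempty (Ω × Ω') with he | he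
  · simpa [prob] using hε
  have hB : (0 : ℝ) < Fintype.card Ω' := by
    obtain ⟨a, b⟩ := he
    exact_mod_cast Fintype.card_pos_iff.2 ⟨b⟩
  have hA : (0 : ℝ) < Fintype.card Ω := by
    obtain ⟨a, b⟩ := he
    exact_mod_cast Fintype.card_pos_iff.2 ⟨a⟩
  have hsum : (Finset.univ.filter P).card = ∑ a, (Finset.univ.filter fun b => P (a, b)).card := by
    simp only [Finset.card_filter]
    exact Fintype.sum_prod_type _
  rw [prob_eq, hsum, Fintype.card_prod, div_le_iff₀ (by push_cast; positivity)]
  push_cast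
  calc ∑ a, ((Finset.univ.filter fun b => P (a, b)).card : ℝ)
      ≤ ∑ a : Ω, ε * Fintype.card Ω' := Finset.sum_le_sum fun a _ => by
        have := h a
        rwa [prob_eq, div_le_iff₀ hB] at this
    _ = ε * (Fintype.card Ω * Fintype.card Ω') := by
        rw [Finset.sum_const, Finset.card_univ, nsmul_eq_mul]; ring

theorem prob_fst [Finite Ω] [Finite Ω'] [Nonempty Ω'] (P : Ω → Prop) :
    prob (fun x : Ω × Ω' => P x.1) = prob P := by
  classical
  have := Fintype.ofFinite Ω
  have := Fintype.ofFinite Ω'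
  have hsum : (Finset.univ.filter fun x : Ω × Ω' => P x.1) = (Finset.univ.filter P) ×ˢ Finset.univ := by
    ext; simp
  rw [prob_eq, prob_eq, hsum, Finset.card_product, Fintype.card_prod, Finset.card_univ]
  push_cast
  rw [mul_div_mul_right]
  exact_mod_cast Fintype.card_ne_zero

/-- A selection of distinct coordinates of a uniform point is uniform. -/
theorem prob_comp_injective {I K : Type} [Finite I] {f : K → I} (hf : Function.Injective f)
    (P : (K → Bool) → Prop) : prob (fun ω : I → Bool => P (ω ∘ f)) = prob P := by
  classical
  have := Finite.of_injective f hf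
  let e₁ : (I → Bool) ≃ ({i // i ∈ Set.range f} → Bool) × ({i // i ∉ Set.range f} → Bool) :=
    Equiv.piEquivPiSubtypeProd _ _
  let e₂ : ({i // i ∈ Set.range f} → Bool) ≃ (K → Bool) :=
    Equiv.arrowCongr (Equiv.ofInjective f hf).symm (Equiv.refl _)
  rw [← prob_equiv e₂ P, ← prob_fst (Ω' := {i // i ∉ Set.range f} → Bool) (fun ω => P (e₂ ω)),
    ← prob_equiv e₁]
  rfl

theorem card_filter_forall_true {I : Type} [Fintype I] [DecidableEq I] (A : Finset I) :
    (Finset.univ.filter fun ω : I → Bool => ∀ i ∈ A, ω i = true).card * 2 ^ A.card =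
      2 ^ Fintype.card I := by
  have : (Finset.univ.filter fun ω : I → Bool => ∀ i ∈ A, ω i = true) =
      Fintype.piFinset fun i => if i ∈ A then {true} else Finset.univ := by
    ext ω
    simp only [Finset.mem_filter, Finset.mem_univ, true_and, Fintype.mem_piFinset]
    refine forall_congr' fun i => ?_
    split_ifs with h <;> simp [h]
  rw [this, Fintype.card_piFinset]
  have e : ∀ i, (if i ∈ A then ({true} : Finset Bool) else Finset.univ).card = if i ∈ A then 1 else 2 := by
    intro i; split_ifs <;> simp
  simp only [e]
  rw [Finset.prod_ite, Finset.prod_const_one, one_mul, Finset.prod_const, ← pow_add]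
  congr 1
  rw [add_comm, Finset.filter_not, ← Finset.compl_eq_univ_sdiff, Finset.filter_mem_eq_inter,
    Finset.univ_inter, Finset.card_add_card_compl]

/-- Resampling one coordinate. -/
theorem sum_update {T : Type} {X : Type} [DecidableEq T] [Fintype T] [Fintype X] (i : T)
    (g : (T → X) → ℝ) : ∑ h : T → X, ∑ x, g (Function.update h i x) = Fintype.card X * ∑ h, g h := by
  -- Exchanging the `i`-th coordinate with the fresh value is an involution, so resampling preserves
  -- the uniform distribution.
  let e : ((T → X) × X) ≃ ((T → X) × X) :=
    { toFun := fun a => (Function.update a.1 i a.2, a.1 i)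
      invFun := fun a => (Function.update a.1 i a.2, a.1 i)
      left_inv := fun a => by simp
      right_inv := fun a => by simp }
  rw [← Fintype.sum_prod_type' (f := fun (h : T → X) x => g (Function.update h i x)),
    ← Equiv.sum_comp e.symm]
  have : ∀ a : (T → X) × X, g (Function.update (e.symm a).1 i (e.symm a).2) = g a.1 := fun a => by
    simp [e]
  simp only [this]
  rw [Fintype.sum_prod_type]
  simp [Finset.mul_sum]

end Probability

/-! ### Boruvka's algorithm with randomly sampled cuts. -/

/-- A finite multigraph, with the edges given by their two ends. -/
structure Multi (N E : Type) [Fintype E] where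
  p₁ : E → N
  p₂ : E → N
  names : Finset N
  mem₁ : ∀ e, p₁ e ∈ names
  mem₂ : ∀ e, p₂ e ∈ names

namespace Multi

variable {N E : Type} [Fintype E] (Q : Multi N E) {J : ℕ}

/-- Membership in the same connected component. -/
def conn : Setoid N := Relation.EqvGen.setoid fun a b => ∃ e, Q.p₁ e = a ∧ Q.p₂ e = b

open scoped Classical in
/-- The edges that leave a set of vertices. -/
noncomputable def cut (A : N → Prop) : Finset E :=
  Finset.univ.filter fun e => ¬ (A (Q.p₁ e) ↔ A (Q.p₂ e))

/-- The edge `e` is sampled at level `j`: its first `j` random bits are `true`. -/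
def Sampled (h : E × Fin J → Bool) (j : Fin J) (e : E) : Prop := ∀ i, i < j → h (e, i) = true

open scoped Classical in
/-- The sampled edges that leave a set of vertices. -/
noncomputable def sampledCut (A : N → Prop) (h : E × Fin J → Bool) (j : Fin J) : Finset E :=
  (Q.cut A).filter (Sampled h j)

/-- The edges found in one phase: those that are alone in a sample of a cut of a class. -/
def Found (r : Setoid N) (h : E × Fin J → Bool) (a b : N) : Prop :=
  ∃ q ∈ Q.names, ∃ j, ∃ e, Q.sampledCut (r q) h j = {e} ∧ Q.p₁ e = a ∧ Q.p₂ e = b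

/-- One phase of Boruvka's algorithm. -/
def phase (r : Setoid N) (h : E × Fin J → Bool) : Setoid N :=
  r ⊔ Relation.EqvGen.setoid (Q.Found r h)

/-- The classes formed by the first `t` phases. -/
def classes {T : ℕ} (h : Fin T → E × Fin J → Bool) : ℕ → Setoid N
  | 0 => ⊥
  | t + 1 => if ht : t < T then Q.phase (classes h t) (h ⟨t, ht⟩) else classes h t

open scoped Classical in
/-- The number of classes. -/
noncomputable def num (r : Setoid N) : ℕ := (Q.names.image (Quotient.mk r)).card

theorem mem_cut {A : N → Prop} {e : E} : e ∈ Q.cut A ↔ ¬ (A (Q.p₁ e) ↔ A (Q.p₂ e)) := by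
  simp [cut]

theorem found_conn {r : Setoid N} {h : E × Fin J → Bool} {a b : N} (hf : Q.Found r h a b) :
    Q.conn a b := by
  obtain ⟨-, -, -, e, -, h₁, h₂⟩ := hf
  exact Relation.EqvGen.rel _ _ ⟨e, h₁, h₂⟩

theorem eqvGen_le {r : N → N → Prop} {s : Setoid N} (h : ∀ a b, r a b → s a b) :
    Relation.EqvGen.setoid r ≤ s := by
  intro a b hab
  induction hab with
  | rel _ _ hr => exact h _ _ hr
  | refl _ => exact s.refl' _
  | symm _ _ _ ih => exact s.symm' ih
  | trans _ _ _ _ _ ih₁ ih₂ => exact s.trans' ih₁ ih₂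

theorem phase_le {r : Setoid N} (hr : r ≤ Q.conn) (h : E × Fin J → Bool) : Q.phase r h ≤ Q.conn :=
  sup_le hr (eqvGen_le fun _ _ => Q.found_conn)

theorem classes_le {T : ℕ} (h : Fin T → E × Fin J → Bool) (t : ℕ) : Q.classes h t ≤ Q.conn := by
  induction t with
  | zero => exact bot_le
  | succ t ih =>
    unfold classes
    split_ifs
    · exact Q.phase_le ih _
    · exact ih

/-- The classes before phase `i` do not use the bits of that phase; this is the independence needed
to take expectations phase by phase. -/
theorem classes_update {T : ℕ} (h : Fin T → E × Fin J → Bool) (i : Fin T) (x : E × Fin J → Bool)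
    (t : ℕ) (ht : t ≤ i) : Q.classes (Function.update h i x) t = Q.classes h t := by
  induction t with
  | zero => rfl
  | succ t ih =>
    unfold classes
    rw [ih (by omega)]
    split_ifs with h'
    · rw [Function.update_of_ne]
      intro e
      rw [← e] at ht
      simp at ht
    · rfl

open scoped Classical in
/-- If the classes in `A` all grow, then their number drops by at least `|A| / 2`. -/
theorem num_coarser {r r' : Setoid N} (h : r ≤ r') (A : Finset (Quotient r))
    (hA : ∀ c ∈ A, ∃ q ∈ Q.names, ∃ q' ∈ Q.names, Quotient.mk r q = c ∧ ¬ r q q' ∧ r' q q') :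
    2 * Q.num r' + A.card ≤ 2 * Q.num r := by
  let f : Quotient r → Quotient r' := Quotient.map id h
  have hf : ∀ q, f (Quotient.mk r q) = Quotient.mk r' q := fun q => rfl
  set B := Q.names.image (Quotient.mk r) with hB
  have hAB : A ⊆ B := by
    intro c hc
    obtain ⟨q, hq, -, -, rfl, -⟩ := hA c hc
    exact Finset.mem_image_of_mem _ hq
  have himg : Q.names.image (Quotient.mk r') = B.image f := by
    rw [hB, Finset.image_image]; rfl
  have h₁ : B.card = ∑ c' ∈ B.image f, (B.filter fun c => f c = c').card :=
    Finset.card_eq_sum_card_image f B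
  have h₂ : A.card = ∑ c' ∈ B.image f, (A.filter fun c => f c = c').card :=
    Finset.card_eq_sum_card_fiberwise fun c hc => Finset.mem_image_of_mem f (hAB hc)
  rw [num, num, ← hB, himg, h₁, h₂, Finset.card_eq_sum_ones, Finset.mul_sum, Finset.mul_sum,
    ← Finset.sum_add_distrib]
  refine Finset.sum_le_sum fun c' hc' => ?_
  obtain ⟨c₀, hc₀, rfl⟩ := Finset.mem_image.1 hc'
  have hle : (A.filter fun c => f c = f c₀).card ≤ (B.filter fun c => f c = f c₀).card :=
    Finset.card_le_card (Finset.filter_subset_filter _ hAB)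
  -- Count over one class of `r'`. It always contains an old class. If it contains one from `A`, it
  -- contains at least two old classes, because such a class was merged with another.
  rcases Finset.eq_empty_or_nonempty (A.filter fun c => f c = f c₀) with he | ⟨c, hc⟩
  · have : 0 < (B.filter fun c => f c = f c₀).card :=
      Finset.card_pos.2 ⟨c₀, Finset.mem_filter.2 ⟨hc₀, rfl⟩⟩
    rw [he, Finset.card_empty]; omega
  · have : 1 < (B.filter fun c => f c = f c₀).card := by
      obtain ⟨hcA, hcf⟩ := Finset.mem_filter.1 hc
      obtain ⟨q, hq, q', hq', rfl, hn, hr⟩ := hA c hcA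
      refine Finset.one_lt_card.2 ⟨Quotient.mk r q, ?_, Quotient.mk r q', ?_, fun e => hn (Quotient.exact e)⟩
      · exact Finset.mem_filter.2 ⟨Finset.mem_image_of_mem _ hq, hcf⟩
      · refine Finset.mem_filter.2 ⟨Finset.mem_image_of_mem _ hq', ?_⟩
        rw [← hcf, hf, hf]
        exact (Quotient.sound hr).symm
    omega

theorem num_anti {r r' : Setoid N} (h : r ≤ r') : Q.num r' ≤ Q.num r := by
  have := Q.num_coarser h ∅ (by simp)
  simp at this
  omega

theorem eq_of_num_eq {r r' : Setoid N} (h : r ≤ r') (he : Q.num r ≤ Q.num r') {q q' : N}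
    (hq : q ∈ Q.names) (hq' : q' ∈ Q.names) (hr : r' q q') : r q q' := by
  classical
  by_contra hn
  have := Q.num_coarser h {Quotient.mk r q} (by
    intro c hc
    rw [Finset.mem_singleton] at hc
    exact ⟨q, hq, q', hq', hc.symm, hn, hr⟩)
  simp at this
  omega

open scoped Classical in
/-- The classes that are not yet closed. -/
noncomputable def openClasses (r : Setoid N) : Finset (Quotient r) :=
  (Q.names.filter fun q => (Q.cut (r q)).Nonempty).image (Quotient.mk r)

theorem class_eq {r : Setoid N} {q q' : N} (h : r q q') : (r q : N → Prop) = r q' := by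
  funext z
  exact propext ⟨fun hz => r.trans' (r.symm' h) hz, fun hz => r.trans' h hz⟩

/-- A class that no edge leaves is a whole component, so the closed classes number at most `Q.num
Q.conn`. -/
theorem num_le_open (r : Setoid N) : Q.num r ≤ Q.num Q.conn + (Q.openClasses r).card := by
  classical
  have h₁ : Q.names.image (Quotient.mk r) ⊆
      (Q.names.filter fun q => ¬ (Q.cut (r q)).Nonempty).image (Quotient.mk r) ∪ Q.openClasses r := by
    intro c hc
    obtain ⟨q, hq, rfl⟩ := Finset.mem_image.1 hc
    by_cases hn : (Q.cut (r q)).Nonempty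
    · exact Finset.mem_union_right _ (Finset.mem_image_of_mem _ (Finset.mem_filter.2 ⟨hq, hn⟩))
    · exact Finset.mem_union_left _ (Finset.mem_image_of_mem _ (Finset.mem_filter.2 ⟨hq, hn⟩))
  refine (Finset.card_le_card h₁).trans ((Finset.card_union_le _ _).trans (Nat.add_le_add_right ?_ _))
  rw [num]
  have key : ∀ q ∈ Q.names.filter fun q => ¬ (Q.cut (r q)).Nonempty, ∀ q', Q.conn q q' → r q q' := by
    intro q hq q' hc
    have hcl : ∀ e, (r q (Q.p₁ e) ↔ r q (Q.p₂ e)) := by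
      intro e
      by_contra hn
      exact (Finset.mem_filter.1 hq).2 ⟨e, Q.mem_cut.2 hn⟩
    have : ∀ a b, Q.conn a b → (r q a ↔ r q b) := by
      intro a b hab
      induction hab with
      | rel _ _ hr => obtain ⟨e, rfl, rfl⟩ := hr; exact hcl e
      | refl _ => rfl
      | symm _ _ _ ih => exact ih.symm
      | trans _ _ _ _ _ ih₁ ih₂ => exact ih₁.trans ih₂
    exact (this q q' hc).1 (r.refl' q)
  -- A component that contains a closed class is sent to that class; the value at any other
  -- component is arbitrary.
  refine Finset.card_le_card_of_surjOn (fun c => if h : ∃ q ∈ Q.names.filter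
    (fun q => ¬ (Q.cut (r q)).Nonempty), Quotient.mk Q.conn q = c then Quotient.mk r h.choose else
      (Quotient.mk r (Quotient.out c))) ?_
  intro c hc
  obtain ⟨q, hq, rfl⟩ := Finset.mem_image.1 hc
  refine ⟨Quotient.mk Q.conn q, ?_, ?_⟩
  · exact Finset.mem_coe.2 (Finset.mem_image_of_mem _ (Finset.mem_filter.1 hq).1)
  · have h : ∃ q' ∈ Q.names.filter (fun q => ¬ (Q.cut (r q)).Nonempty),
        Quotient.mk Q.conn q' = Quotient.mk Q.conn q := ⟨q, hq, rfl⟩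
    simp only [dif_pos h]
    exact Quotient.sound (key _ h.choose_spec.1 _ (Quotient.exact h.choose_spec.2))

open scoped Classical in
/-- A nonempty cut has a single sampled edge at some level with constant probability. -/
theorem single_sampled (C : Finset E) (hC : C.Nonempty) (hJ : 4 * C.card < 2 ^ J) :
    (1 / 8 : ℝ) * Fintype.card (E × Fin J → Bool) ≤
      ((Finset.univ.filter fun h : E × Fin J → Bool => ∃ j e, C.filter (Sampled h j) = {e}).card : ℝ) := by
  have hpos := hC.card_pos
  -- At this level the expected number of sampled edges lies between 1/4 and 1/2.
  obtain ⟨j, hj₁, hj₂⟩ : ∃ j, 2 * C.card ≤ 2 ^ j ∧ 2 ^ j ≤ 4 * C.card := by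
    refine ⟨Nat.clog 2 (2 * C.card), Nat.le_pow_clog (by norm_num) _, ?_⟩
    have h1 : 1 < 2 * C.card := by omega
    have := Nat.pow_pred_clog_lt_self (b := 2) (by norm_num) h1
    have h2 := Nat.clog_pos (b := 2) (by norm_num) (by omega : 2 ≤ 2 * C.card)
    obtain ⟨m, hm⟩ := Nat.exists_eq_succ_of_ne_zero h2.ne'
    rw [hm] at this ⊢
    simp only [Nat.pred_succ, Nat.succ_eq_add_one, pow_succ] at this ⊢
    omega
  have hjJ : j < J := (Nat.pow_lt_pow_iff_right (a := 2) (by norm_num)).1 (hj₂.trans_lt hJ)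
  let J₀ : Fin J := ⟨j, hjJ⟩
  set Ωc : ℝ := (Fintype.card (E × Fin J → Bool) : ℝ) with hΩ
  have hcard : Ωc = 2 ^ Fintype.card (E × Fin J) := by rw [hΩ, Fintype.card_fun]; simp
  set p : ℝ := 1 / 2 ^ j with hp
  have hp0 : 0 < p := by positivity
  let s : E → (E × Fin J → Bool) → ℝ := fun e h => if Sampled h J₀ e then 1 else 0
  have hcov : ∀ A : Finset E, (∑ h : E × Fin J → Bool, if ∀ e ∈ A, Sampled h J₀ e then (1 : ℝ) else 0) =
      Ωc * p ^ A.card := by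
    intro A
    have := card_filter_forall_true (A ×ˢ (Finset.univ.filter fun i : Fin J => i < J₀))
    have hc : (Finset.univ.filter fun i : Fin J => i < J₀).card = j := by
      rw [show (Finset.univ.filter fun i : Fin J => i < J₀) = Finset.Iio J₀ by ext; simp, Fin.card_Iio]
    rw [Finset.card_product, hc] at this
    rw [Finset.sum_boole]
    have e : (Finset.univ.filter fun h : E × Fin J → Bool => ∀ e ∈ A, Sampled h J₀ e) =
        Finset.univ.filter fun h : E × Fin J → Bool =>
          ∀ i ∈ A ×ˢ (Finset.univ.filter fun i : Fin J => i < J₀), h i = true := by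
      ext h
      rw [Finset.mem_filter, Finset.mem_filter]
      simp only [Finset.mem_filter, Finset.mem_univ, true_and, Finset.mem_product, Prod.forall, Sampled]
      exact ⟨fun H e i hi => H e hi.1 i hi.2, fun H e he i hi => H e i ⟨he, hi⟩⟩
    rw [e, hcard, hp, one_div, inv_pow, ← div_eq_mul_inv, eq_div_iff (by positivity), ← pow_mul,
      mul_comm j]
    exact_mod_cast this
  have hX : ∀ h, ((C.filter (Sampled h J₀)).card : ℝ) = ∑ e ∈ C, s e h := fun h => by
    simp [s, Finset.sum_boole]
  have h₁ : ∑ h, ∑ e ∈ C, s e h = Ωc * (C.card * p) := by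
    rw [Finset.sum_comm]
    have : ∀ e ∈ C, ∑ h, s e h = Ωc * p := fun e _ => by
      have := hcov {e}
      simpa [s] using this
    rw [Finset.sum_congr rfl this, Finset.sum_const, nsmul_eq_mul]; ring
  have h₂ : ∑ h, (∑ e ∈ C, s e h) ^ 2 ≤ Ωc * (C.card * p + (C.card * p) ^ 2) := by
    have : ∀ h, (∑ e ∈ C, s e h) ^ 2 = ∑ e ∈ C, ∑ e' ∈ C, s e h * s e' h := fun h => by
      rw [sq, Finset.sum_mul_sum]
    simp only [this]
    rw [Finset.sum_comm]
    have hb : ∀ e ∈ C, ∑ h, ∑ e' ∈ C, s e h * s e' h ≤ Ωc * (p + C.card * p ^ 2) := by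
      intro e he
      rw [Finset.sum_comm, ← Finset.add_sum_erase _ _ he]
      have ha : ∑ h, s e h * s e h = Ωc * p := by
        have := hcov {e}
        simp only [Finset.mem_singleton, forall_eq, Finset.card_singleton, pow_one] at this
        rw [← this]
        refine Finset.sum_congr rfl fun h _ => ?_
        simp only [s]
        split_ifs <;> simp
      have hb : ∀ e' ∈ C.erase e, ∑ h, s e h * s e' h = Ωc * p ^ 2 := by
        intro e' he'
        have := hcov {e, e'}
        rw [Finset.card_pair (Finset.ne_of_mem_erase he').symm] at this
        rw [← this]
        refine Finset.sum_congr rfl fun h _ => ?_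
        simp only [s, Finset.mem_insert, Finset.mem_singleton, forall_eq_or_imp, forall_eq]
        by_cases ha : Sampled h J₀ e <;> by_cases hb : Sampled h J₀ e' <;> simp [ha, hb]
      rw [ha, Finset.sum_congr rfl hb, Finset.sum_const, nsmul_eq_mul, mul_add]
      have : ((C.erase e).card : ℝ) ≤ C.card := by exact_mod_cast Finset.card_erase_le
      have h0 : 0 ≤ Ωc * p ^ 2 := by positivity
      nlinarith
    refine (Finset.sum_le_sum hb).trans (le_of_eq ?_)
    rw [Finset.sum_const, nsmul_eq_mul]; ring
  -- For a natural number `X`, the value `2 * X - X ^ 2` is 1 at `X = 1` and at most 0 otherwise.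
  -- Two moments, hence pairwise independence, therefore bound the probability of a single sampled
  -- edge from below.
  have h₃ : ∀ h : E × Fin J → Bool, 2 * (∑ e ∈ C, s e h) - (∑ e ∈ C, s e h) ^ 2 ≤
      if ∃ j e, C.filter (Sampled h j) = {e} then (1 : ℝ) else 0 := by
    intro h
    rw [← hX]
    set m := (C.filter (Sampled h J₀)).card with hm
    split_ifs with hs
    · nlinarith [sq_nonneg ((m : ℝ) - 1)]
    · have hm1 : m ≠ 1 := fun h1 => hs ⟨J₀, Finset.card_eq_one.1 h1⟩
      rcases Nat.lt_or_ge m 2 with h2 | h2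
      · have : m = 0 := by omega
        rw [this]; simp
      · have : (2 : ℝ) ≤ m := by exact_mod_cast h2
        nlinarith
  have h₄ := Finset.sum_le_sum fun h (_ : h ∈ (Finset.univ : Finset (E × Fin J → Bool))) => h₃ h
  rw [Finset.sum_sub_distrib, ← Finset.mul_sum, h₁, Finset.sum_boole] at h₄
  have hq₁ : (C.card : ℝ) * p ≤ 1 / 2 := by
    rw [hp, mul_one_div, div_le_iff₀ (by positivity)]
    have : (2 * C.card : ℝ) ≤ 2 ^ j := by exact_mod_cast hj₁
    linarith
  have hq₂ : 1 / 4 ≤ (C.card : ℝ) * p := by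
    rw [hp, mul_one_div, le_div_iff₀ (by positivity)]
    have : (2 ^ j : ℝ) ≤ 4 * C.card := by exact_mod_cast hj₂
    linarith
  have hΩ0 : 0 ≤ Ωc := by positivity
  -- With mean `μ` the moments give at least `2 * μ - (μ + μ ^ 2) = μ - μ ^ 2`, which exceeds 1/8
  -- for `μ` between 1/4 and 1/2.
  have : Ωc * (1 / 8) ≤ Ωc * ((C.card : ℝ) * p - ((C.card : ℝ) * p) ^ 2) := by
    apply mul_le_mul_of_nonneg_left _ hΩ0
    nlinarith
  linarith

open scoped Classical in
/-- The number of superfluous classes drops by a constant factor in expectation. -/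
theorem sum_num_phase (hJ : 4 * Fintype.card E < 2 ^ J) (r : Setoid N) :
    ∑ h : E × Fin J → Bool, ((Q.num (Q.phase r h) : ℝ) - Q.num Q.conn) ≤
      15 / 16 * Fintype.card (E × Fin J → Bool) * ((Q.num r : ℝ) - Q.num Q.conn) := by
  classical
  let A : (E × Fin J → Bool) → Finset (Quotient r) := fun h =>
    (Q.openClasses r).filter fun c => ∃ j e, (Q.cut (r c.out)).filter (Sampled h j) = {e}
  -- `A h` consists of the open classes with an isolated edge. Such an edge is found and leads out
  -- of the class, so the class grows and `num_coarser` applies.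
  have hpt : ∀ h, 2 * Q.num (Q.phase r h) + (A h).card ≤ 2 * Q.num r := by
    intro h
    refine Q.num_coarser le_sup_left _ fun c hc => ?_
    obtain ⟨hc, j, e, he⟩ := Finset.mem_filter.1 hc
    obtain ⟨q, hq, rfl⟩ := Finset.mem_image.1 hc
    have hq := (Finset.mem_filter.1 hq).1
    rw [← class_eq (Setoid.symm (Quotient.mk_out q))] at he
    have hmem : e ∈ Q.cut (r q) := by
      have : e ∈ (Q.cut (r q)).filter (Sampled h j) := by rw [he]; simp
      exact (Finset.mem_filter.1 this).1
    have hfound : (Q.phase r h) (Q.p₁ e) (Q.p₂ e) :=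
      (le_sup_right : Relation.EqvGen.setoid (Q.Found r h) ≤ Q.phase r h)
        (Relation.EqvGen.rel _ _ ⟨q, hq, j, e, he, rfl, rfl⟩)
    have hle : r ≤ Q.phase r h := le_sup_left
    rw [mem_cut] at hmem
    by_cases h₁ : r q (Q.p₁ e)
    · exact ⟨q, hq, Q.p₂ e, Q.mem₂ e, rfl, fun h₂ => hmem ⟨fun _ => h₂, fun _ => h₁⟩,
        (Q.phase r h).trans' (hle h₁) hfound⟩
    · have h₂ : r q (Q.p₂ e) := by
        by_contra h₂
        exact hmem ⟨fun h => absurd h h₁, fun h => absurd h h₂⟩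
      exact ⟨q, hq, Q.p₁ e, Q.mem₁ e, rfl, h₁,
        (Q.phase r h).trans' (hle h₂) ((Q.phase r h).symm' hfound)⟩
  have hexp : (1 / 8 : ℝ) * Fintype.card (E × Fin J → Bool) * (Q.openClasses r).card ≤
      ∑ h, ((A h).card : ℝ) := by
    have : ∑ h, ((A h).card : ℝ) = ∑ c ∈ Q.openClasses r, ((Finset.univ.filter fun h : E × Fin J → Bool =>
        ∃ j e, (Q.cut (r c.out)).filter (Sampled h j) = {e}).card : ℝ) := by
      simp only [A, Finset.card_filter, Nat.cast_sum]
      exact Finset.sum_comm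
    rw [this, mul_comm _ ((Q.openClasses r).card : ℝ), ← nsmul_eq_mul]
    refine Finset.card_nsmul_le_sum _ _ _ fun c hc => ?_
    obtain ⟨q, hq, rfl⟩ := Finset.mem_image.1 hc
    have hne := (Finset.mem_filter.1 hq).2
    rw [class_eq (Setoid.symm (Quotient.mk_out q))] at hne
    refine single_sampled _ hne (lt_of_le_of_lt ?_ hJ)
    exact Nat.mul_le_mul_left _ (Finset.card_le_univ _)
  have hopen : (Q.num r : ℝ) ≤ Q.num Q.conn + (Q.openClasses r).card := by exact_mod_cast Q.num_le_open r
  have hsum : ∑ h, (2 * (Q.num (Q.phase r h) : ℝ) + ((A h).card : ℝ)) ≤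
      ∑ h : E × Fin J → Bool, 2 * (Q.num r : ℝ) :=
    Finset.sum_le_sum fun h _ => by exact_mod_cast hpt h
  rw [Finset.sum_add_distrib, ← Finset.mul_sum, Finset.sum_const, nsmul_eq_mul, Finset.card_univ] at hsum
  rw [Finset.sum_sub_distrib, Finset.sum_const, nsmul_eq_mul, Finset.card_univ]
  have h0 : (0 : ℝ) ≤ Fintype.card (E × Fin J → Bool) := by positivity
  -- In expectation at least 1/8 of the open classes grow, and `num_coarser` turns each of them into
  -- half a class lost; this gives the factor 1 - 1/16.
  nlinarith

-- The classes after `t` phases are independent of the bits of phase `t`. Averaging over a resampled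
-- block of bits allows `sum_num_phase` to be applied for each fixed past.
open scoped Classical in
theorem sum_num_classes (hJ : 4 * Fintype.card E < 2 ^ J) {T : ℕ} (t : ℕ) (ht : t ≤ T) :
    ∑ h : Fin T → E × Fin J → Bool, ((Q.num (Q.classes h t) : ℝ) - Q.num Q.conn) ≤
      (15 / 16) ^ t * Q.names.card * Fintype.card (Fin T → E × Fin J → Bool) := by
  classical
  induction t with
  | zero =>
    refine (Finset.sum_le_card_nsmul _ _ (Q.names.card : ℝ) fun h _ => ?_).trans (by
      rw [nsmul_eq_mul, Finset.card_univ, pow_zero, one_mul, mul_comm])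
    have : Q.num (Q.classes h 0) ≤ Q.names.card := Finset.card_image_le
    have : (Q.num (Q.classes h 0) : ℝ) ≤ Q.names.card := by exact_mod_cast this
    have : (0 : ℝ) ≤ Q.num Q.conn := by positivity
    linarith
  | succ t ih =>
    have htT : t < T := ht
    obtain ⟨c, hc⟩ : ∃ c : ℝ, c = (Fintype.card (E × Fin J → Bool) : ℝ) := ⟨_, rfl⟩
    have hc0 : 0 < c := by rw [hc]; exact_mod_cast Fintype.card_pos
    have h₁ := sum_update (⟨t, htT⟩ : Fin T)
      fun h : Fin T → E × Fin J → Bool => ((Q.num (Q.classes h (t + 1)) : ℝ) - Q.num Q.conn)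
    have h₂ : ∀ h : Fin T → E × Fin J → Bool, ∑ x, ((Q.num (Q.classes (Function.update h ⟨t, htT⟩ x)
        (t + 1)) : ℝ) - Q.num Q.conn) ≤ 15 / 16 * c * ((Q.num (Q.classes h t) : ℝ) - Q.num Q.conn) := by
      intro h
      have e : ∀ x, Q.classes (Function.update h ⟨t, htT⟩ x) (t + 1) = Q.phase (Q.classes h t) x := by
        intro x
        rw [classes, dif_pos htT, Q.classes_update _ _ _ _ le_rfl, Function.update_self]
      simp only [e, hc]
      exact Q.sum_num_phase hJ _
    have h₃ := (Finset.sum_le_sum fun h (_ : h ∈ Finset.univ) => h₂ h)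
    rw [h₁, ← Finset.mul_sum, ← hc] at h₃
    have h₄ := ih htT.le
    refine le_of_mul_le_mul_left ?_ hc0
    refine h₃.trans ?_
    rw [pow_succ]
    have := mul_le_mul_of_nonneg_left h₄ (by positivity : (0 : ℝ) ≤ 15 / 16 * c)
    linarith

/-- After sufficiently many phases the classes are, with high probability, the components. -/
theorem prob_classes (hJ : 4 * Fintype.card E < 2 ^ J) {T : ℕ} :
    prob (fun h : Fin T → E × Fin J → Bool =>
      ¬ ∀ q ∈ Q.names, ∀ q' ∈ Q.names, Q.conn q q' → Q.classes h T q q') ≤ (15 / 16) ^ T * Q.names.card := by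
  classical
  have hc0 : (0 : ℝ) < Fintype.card (Fin T → E × Fin J → Bool) := by exact_mod_cast Fintype.card_pos
  rw [prob_eq, div_le_iff₀ hc0]
  refine le_trans ?_ (Q.sum_num_classes hJ T le_rfl)
  rw [Finset.card_filter, Nat.cast_sum]
  -- Markov's inequality: if a component is still divided, the surplus of classes is at least one.
  refine Finset.sum_le_sum fun h _ => ?_
  have hle : (Q.num Q.conn : ℝ) ≤ Q.num (Q.classes h T) := by
    exact_mod_cast Q.num_anti (Q.classes_le h T)
  split_ifs with hb
  · push_cast
    linarith
  · have : Q.num Q.conn < Q.num (Q.classes h T) := by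
      by_contra hn
      exact hb fun q hq q' hq' hr => Q.eq_of_num_eq (Q.classes_le h T) (not_lt.1 hn) hq hq' hr
    have : (Q.num Q.conn : ℝ) + 1 ≤ Q.num (Q.classes h T) := by exact_mod_cast this
    push_cast
    linarith

end Multi

/-! ### Decoding sketches over a finite field. -/

section Decoding

variable {N E K : Type} [Field K]

/-- The seed `ξ` makes the sketch of the edges in `X` look like the sketch of a single edge. -/
def BadSeed (code : E → ℕ) (B : ℕ) (X : Finset E) (ξ : K) : Prop :=
  ∃ m < B, ∑ e ∈ X, ξ ^ code e = ξ ^ m ∧ ¬ ∃ e, X = {e} ∧ code e = m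

/-- For each `m`, a bad seed is a root of the sum of the powers from `X` minus the `m`-th power of
the variable. Unless `X` is the single edge with code `m`, this polynomial has a nonzero
coefficient, because codes are distinct. Each of the `B` polynomials has at most `B` roots. -/
theorem card_badSeed_le [Finite K] {code : E → ℕ} (hc : Function.Injective code) {B : ℕ}
    (hB : ∀ e, code e < B) (X : Finset E) :
    prob (fun ξ : K => BadSeed code B X ξ) ≤ (B : ℝ) * B / Nat.card K := by
  classical
  have := Fintype.ofFinite K
  rw [prob_eq, Nat.card_eq_fintype_card]
  gcongr
  norm_cast
  let g : ℕ → Polynomial K := fun m => ∑ e ∈ X, Polynomial.X ^ code e - Polynomial.X ^ m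
  have hcoeff : ∀ m c, (g m).coeff c = (∑ e ∈ X, if c = code e then (1 : K) else 0) - if c = m then 1 else 0 := by
    intro m c
    simp only [g, Polynomial.coeff_sub, Polynomial.finsetSum_coeff, Polynomial.coeff_X_pow]
  have hone : ∀ e ∈ X, (∑ e' ∈ X, if code e = code e' then (1 : K) else 0) = 1 := by
    intro e he
    rw [Finset.sum_eq_single e]
    · simp
    · intro e' _ hne
      rw [if_neg fun h => hne (hc h).symm]
    · exact fun h => absurd he h
  have hg : ∀ m, (¬ ∃ e, X = {e} ∧ code e = m) → g m ≠ 0 := by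
    intro m hm h0
    by_cases h : ∃ e ∈ X, code e = m
    · obtain ⟨e, he, rfl⟩ := h
      obtain ⟨e', he', hne⟩ : ∃ e' ∈ X, e' ≠ e := by
        by_contra hcon
        push Not at hcon
        exact hm ⟨e, Finset.eq_singleton_iff_unique_mem.2 ⟨he, hcon⟩, rfl⟩
      have := hcoeff (code e) (code e')
      rw [h0, hone e' he', if_neg fun h => hne (hc h)] at this
      simp at this
    · have := hcoeff m m
      rw [h0, Finset.sum_eq_zero, if_pos rfl] at this
      · simp at this
      · intro e he
        rw [if_neg]
        intro e'
        exact h ⟨e, he, e'.symm⟩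
  have hdeg : ∀ m < B, (g m).natDegree ≤ B := by
    intro m hm
    refine (Polynomial.natDegree_sub_le _ _).trans (max_le ?_ ?_)
    · refine Polynomial.natDegree_sum_le_of_forall_le _ _ fun e _ => ?_
      rw [Polynomial.natDegree_X_pow]; exact (hB e).le
    · rw [Polynomial.natDegree_X_pow]; exact hm.le
  have hsub : (Finset.univ.filter fun ξ : K => BadSeed code B X ξ) ⊆
      (Finset.range B).biUnion fun m => (g m).roots.toFinset.filter fun _ => g m ≠ 0 := by
    intro ξ hξ
    obtain ⟨m, hm, h₁, h₂⟩ := (Finset.mem_filter.1 hξ).2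
    refine Finset.mem_biUnion.2 ⟨m, Finset.mem_range.2 hm, Finset.mem_filter.2 ⟨?_, hg m h₂⟩⟩
    rw [Multiset.mem_toFinset, Polynomial.mem_roots (hg m h₂), Polynomial.IsRoot]
    simp only [g, Polynomial.eval_sub, Polynomial.eval_finsetSum, Polynomial.eval_pow, Polynomial.eval_X]
    rw [h₁, sub_self]
  refine (Finset.card_le_card hsub).trans (Finset.card_biUnion_le.trans ?_)
  refine (Finset.sum_le_card_nsmul _ _ B fun m hm => ?_).trans (by simp)
  refine (Finset.card_filter_le _ _).trans ((Multiset.toFinset_card_le _).trans ?_)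
  exact (Polynomial.card_roots' _).trans (hdeg m (Finset.mem_range.1 hm))

open scoped Classical in
/-- Boruvka's algorithm on sketches. -/
noncomputable def decodeClasses (names : Finset N) {T J : ℕ} (Z : N → Fin T → Fin J → K) (ξ : K)
    (B : ℕ) (dec : ℕ → N → N → Prop) : ℕ → Setoid N
  | 0 => ⊥
  | t + 1 => if ht : t < T then
      decodeClasses names Z ξ B dec t ⊔ Relation.EqvGen.setoid fun a b => ∃ q ∈ names, ∃ j, ∃ m < B,
        ∑ q' ∈ names with (decodeClasses names Z ξ B dec t) q q', Z q' ⟨t, ht⟩ j = ξ ^ m ∧ dec m a b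
      else decodeClasses names Z ξ B dec t

namespace Multi

variable [Fintype E] (Q : Multi N E) {T J : ℕ}

/-- The random choices for which the sketches show the components. -/
structure GoodCoins (code : E → ℕ) (B : ℕ) (h : Fin T → E × Fin J → Bool) (ξ : K) : Prop where
  seed : ∀ (t : Fin T), ∀ q ∈ Q.names, ∀ j,
    ¬ BadSeed code B (Q.sampledCut (Q.classes h t q) (h t) j) ξ
  conn : ∀ q ∈ Q.names, ∀ q' ∈ Q.names, Q.conn q q' → Q.classes h T q q'

-- By linearity, the summed sketch of a class is the sketch of its sampled cut. For a seed that is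
-- not bad, it equals a power of `ξ` exactly when one edge was sampled, and the exponent then
-- reveals that edge. So decoding repeats the phases on the true cuts. The relation `dec` may return
-- the ends in either order, since codes are those of unordered pairs.
open scoped Classical in
theorem decode_eq {code : E → ℕ} {B : ℕ} (hB : ∀ e, code e < B) {h : Fin T → E × Fin J → Bool} {ξ : K}
    (hgood : Q.GoodCoins code B h ξ) {Z : N → Fin T → Fin J → K} {dec : ℕ → N → N → Prop}
    (hZ : ∀ (A : N → Prop) t j, ∑ q ∈ Q.names with A q, Z q t j =
      ∑ e ∈ Q.sampledCut A (h t) j, ξ ^ code e)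
    (hdec : ∀ e, dec (code e) (Q.p₁ e) (Q.p₂ e) ∨ dec (code e) (Q.p₂ e) (Q.p₁ e))
    (hdec' : ∀ e a b, dec (code e) a b → a = Q.p₁ e ∧ b = Q.p₂ e ∨ a = Q.p₂ e ∧ b = Q.p₁ e)
    (t : ℕ) : decodeClasses Q.names Z ξ B dec t = Q.classes h t := by
  induction t with
  | zero => rfl
  | succ t ih =>
    unfold decodeClasses classes
    rw [ih]
    split_ifs with ht
    · unfold phase
      congr 1
      apply le_antisymm
      · refine eqvGen_le fun a b hab => ?_
        obtain ⟨q, hq, j, m, hm, hz, hd⟩ := hab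
        rw [hZ] at hz
        have hb := hgood.seed ⟨t, ht⟩ q hq j
        have : ∃ e, Q.sampledCut (Q.classes h t q) (h ⟨t, ht⟩) j = {e} ∧ code e = m := by
          by_contra hn
          exact hb ⟨m, hm, hz, hn⟩
        obtain ⟨e, he, rfl⟩ := this
        have hf : Relation.EqvGen.setoid (Q.Found (Q.classes h t) (h ⟨t, ht⟩)) (Q.p₁ e) (Q.p₂ e) :=
          Relation.EqvGen.rel _ _ ⟨q, hq, j, e, he, rfl, rfl⟩
        rcases hdec' e a b hd with ⟨rfl, rfl⟩ | ⟨rfl, rfl⟩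
        · exact hf
        · exact Setoid.symm' _ hf
      · refine eqvGen_le fun a b hab => ?_
        obtain ⟨q, hq, j, e, he, rfl, rfl⟩ := hab
        have hz := hZ (Q.classes h t q) ⟨t, ht⟩ j
        rw [he, Finset.sum_singleton] at hz
        rcases hdec e with hd | hd
        · exact Relation.EqvGen.rel _ _ ⟨q, hq, j, _, hB e, hz, hd⟩
        · exact Setoid.symm' _ (Relation.EqvGen.rel _ _ ⟨q, hq, j, _, hB e, hz, hd⟩)
    · rfl

-- The element `ξ` is independent of the sampling. Once the sampling bits are fixed, only one sketch
-- for each phase, name and level is examined, so a union bound over these suffices.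
open scoped Classical in
theorem prob_goodCoins [Finite K] {code : E → ℕ} (hc : Function.Injective code) {B : ℕ}
    (hB : ∀ e, code e < B) (hJ : 4 * Fintype.card E < 2 ^ J) :
    prob (fun x : (Fin T → E × Fin J → Bool) × K => ¬ Q.GoodCoins code B x.1 x.2) ≤
      (15 / 16) ^ T * Q.names.card + T * Q.names.card * J * (B * B / Nat.card K) := by
  refine (prob_mono (Q := fun x : (Fin T → E × Fin J → Bool) × K =>
    (¬ ∀ q ∈ Q.names, ∀ q' ∈ Q.names, Q.conn q q' → Q.classes x.1 T q q') ∨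
    ∃ i ∈ (Finset.univ : Finset (Fin T)) ×ˢ Q.names ×ˢ (Finset.univ : Finset (Fin J)),
      BadSeed code B (Q.sampledCut (Q.classes x.1 i.1 i.2.1) (x.1 i.1) i.2.2) x.2) ?_).trans ?_
  · intro x hx
    by_contra hn
    push Not at hn
    exact hx ⟨fun t q hq j => hn.2 (t, q, j) (by simp [hq]), hn.1⟩
  · refine (prob_or_le _ _).trans (add_le_add ?_ ?_)
    · rw [prob_fst (Ω' := K) fun h : Fin T → E × Fin J → Bool =>
        ¬ ∀ q ∈ Q.names, ∀ q' ∈ Q.names, Q.conn q q' → Q.classes h T q q']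
      exact Q.prob_classes hJ
    · refine prob_prod_le (by positivity) fun h => ?_
      refine prob_exists_le' _ (fun (i : Fin T × N × Fin J) ξ => BadSeed code B (Q.sampledCut
        (Q.classes h i.1 i.2.1) (h i.1) i.2.2) ξ) ?_ (by positivity) fun i _ => card_badSeed_le hc hB _
      rw [Finset.card_product, Finset.card_product]
      simp [mul_assoc]

end Multi

end Decoding

/-! ### Parameters, message format and numbers for labelled edges. -/

section Parameters

/-- The number of phases of the decoding algorithm. -/
def numPhases (c n : ℕ) : ℕ := 16 * (c + 4) * lg n

/-- The number of sampling levels. -/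
def numLevels (n : ℕ) : ℕ := 2 * lg n + 2

/-- The bit length of vertex labels. -/
def labelBits (κ n : ℕ) : ℕ := ((κ + 1) * lg n + 1) * lg n + lg n

/-- The degree of the field in which the sketches live. -/
def skDeg (κ c n : ℕ) : ℕ := 4 * labelBits κ n + numPhases c n + numLevels n + (c + 6) * lg n

/-- Fresh sketches. -/
abbrev Sk (K : Type) (c n : ℕ) : Type := Fin (numPhases c n) → Fin (numLevels n) → K

/-- The random bits of a vertex: sampling bits for its edges, and a field element. -/
abbrev CoinIdx (κ c n : ℕ) : Type :=
  (Fin (2 ^ (κ * lg n)) × Fin (numPhases c n) × Fin (numLevels n)) ⊕ Fin (skDeg κ c n)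

theorem lg_pos (n : ℕ) : 0 < lg n := Nat.succ_pos _

theorem lt_two_pow_lg (n : ℕ) : n < 2 ^ lg n := Nat.lt_pow_succ_log_self (by norm_num) n

theorem skDeg_ne_zero (κ c n : ℕ) : skDeg κ c n ≠ 0 := by
  have := lg_pos n
  unfold skDeg numLevels
  omega

/-- Messages; each phase uses some of the fields. -/
@[ext] structure Msg (K : Type) (κ c n : ℕ) where
  dep : Fin (n + 1)
  edge : Option (Fin (2 ^ (κ * lg n)) × Fin (2 ^ (κ * lg n)))
  k : Fin (n + 1)
  lo : Fin (n + 1)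
  hi : Fin (n + 1)
  xi : K
  sk : Sk K c n
  smp : Fin (numPhases c n) → Fin (numLevels n) → Bool
  flag : Bool

/-- The message without information. -/
def Msg.blank (K : Type) [Zero K] (κ c n : ℕ) : Msg K κ c n :=
  ⟨0, none, 0, 0, 0, 0, 0, fun _ _ => false, false⟩

/-- The admissible labels of vertices: ancestry label and component number. -/
def labelSet (κ n : ℕ) : Set (AncLabel × ℕ) :=
  {l | l.1.length ≤ lg n ∧ (∀ q ∈ l.1, q.1 < 2 ^ (κ * lg n) ∧ q.2 < n) ∧ l.2 ≤ n}

/-- An admissible label has at most `lg n` entries of bounded size and one component number, so it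
embeds into a finite type whose cardinality gives the bit length. -/
theorem exists_labelCode (κ n : ℕ) : ∃ enc : AncLabel × ℕ → ℕ, Set.InjOn enc (labelSet κ n) ∧
    ∀ l, enc l < 2 ^ labelBits κ n := by
  classical
  let X := (Fin (lg n) → Option (Fin (2 ^ (κ * lg n)) × Fin (n + 1))) × Fin (n + 1)
  let g : AncLabel × ℕ → X := fun l => (fun i =>
    (l.1[(i : ℕ)]?).map fun q => (Fin.ofNat _ q.1, Fin.ofNat _ q.2), Fin.ofNat _ l.2)
  have hg : Set.InjOn g (labelSet κ n) := by
    rintro ⟨a, k⟩ ⟨ha, hb, hk⟩ ⟨a', k'⟩ ⟨ha', hb', hk'⟩ h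
    have h₁ := congrArg Prod.fst h
    have h₂ : k % (n + 1) = k' % (n + 1) := congrArg (fun x : X => x.2.val) h
    rw [Nat.mod_eq_of_lt (Nat.lt_succ_of_le hk), Nat.mod_eq_of_lt (Nat.lt_succ_of_le hk')] at h₂
    congr 1
    refine List.ext_getElem? fun i => ?_
    by_cases hi : i < lg n
    · have h₃ : (a[i]?).map (fun q => ((Fin.ofNat (2 ^ (κ * lg n)) q.1, Fin.ofNat (n + 1) q.2))) =
          (a'[i]?).map (fun q => (Fin.ofNat _ q.1, Fin.ofNat _ q.2)) := congrFun h₁ ⟨i, hi⟩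
      rcases h₅ : a[i]? with _ | q <;> rcases h₆ : a'[i]? with _ | q'
      · rfl
      · rw [h₅, h₆] at h₃; cases h₃
      · rw [h₅, h₆] at h₃; cases h₃
      · rw [h₅, h₆] at h₃
        have h₄ := Option.some_injective _ h₃
        have h₇ : q.1 % 2 ^ (κ * lg n) = q'.1 % 2 ^ (κ * lg n) := congrArg (fun x => x.1.val) h₄
        have h₈ : q.2 % (n + 1) = q'.2 % (n + 1) := congrArg (fun x => x.2.val) h₄
        obtain ⟨b₁, b₂⟩ := hb q (List.mem_of_getElem? h₅)
        obtain ⟨b₃, b₄⟩ := hb' q' (List.mem_of_getElem? h₆)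
        rw [Nat.mod_eq_of_lt b₁, Nat.mod_eq_of_lt b₃] at h₇
        rw [Nat.mod_eq_of_lt (by omega), Nat.mod_eq_of_lt (by omega)] at h₈
        rw [Prod.ext h₇ h₈]
    · rw [List.getElem?_eq_none (by simp at ha; omega), List.getElem?_eq_none (by simp at ha'; omega)]
  have hcard : Fintype.card X ≤ 2 ^ labelBits κ n := by
    simp only [X, Fintype.card_prod, Fintype.card_fun, Fintype.card_option, Fintype.card_fin]
    rw [labelBits, pow_add, pow_mul 2 ((κ + 1) * lg n + 1)]
    have h₁ := lt_two_pow_lg n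
    have h₂ : 2 ^ (κ * lg n) * (n + 1) + 1 ≤ 2 ^ ((κ + 1) * lg n + 1) := by
      rw [pow_succ, add_mul, one_mul, pow_add]
      have : 2 ^ (κ * lg n) * (n + 1) ≤ 2 ^ (κ * lg n) * 2 ^ lg n := Nat.mul_le_mul_left _ h₁
      have : 0 < 2 ^ (κ * lg n) * 2 ^ lg n := by positivity
      omega
    exact Nat.mul_le_mul (Nat.pow_le_pow_left h₂ _) h₁
  exact ⟨fun l => Fintype.equivFin X (g l), fun l hl l' hl' h =>
    hg hl hl' ((Fintype.equivFin X).injective (Fin.ext h)), fun l => (Fin.is_lt _).trans_le hcard⟩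

/-- Numbers for labels. -/
noncomputable def labelCode (κ n : ℕ) : AncLabel × ℕ → ℕ := (exists_labelCode κ n).choose

/-- Numbers for unordered pairs of labels. -/
noncomputable def edgeNum (κ n : ℕ) (l l' : AncLabel × ℕ) : ℕ :=
  min (labelCode κ n l) (labelCode κ n l') * 2 ^ labelBits κ n + max (labelCode κ n l) (labelCode κ n l')

theorem labelCode_injOn (κ n : ℕ) : Set.InjOn (labelCode κ n) (labelSet κ n) :=
  (exists_labelCode κ n).choose_spec.1

theorem labelCode_lt (κ n : ℕ) (l : AncLabel × ℕ) : labelCode κ n l < 2 ^ labelBits κ n :=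
  (exists_labelCode κ n).choose_spec.2 l

theorem edgeNum_comm (κ n : ℕ) (l l' : AncLabel × ℕ) : edgeNum κ n l l' = edgeNum κ n l' l := by
  rw [edgeNum, edgeNum, min_comm, max_comm]

theorem edgeNum_lt (κ n : ℕ) (l l' : AncLabel × ℕ) : edgeNum κ n l l' < 2 ^ (2 * labelBits κ n) := by
  have h₁ := labelCode_lt κ n l
  have h₂ := labelCode_lt κ n l'
  rw [edgeNum, two_mul, pow_add]
  have : (min (labelCode κ n l) (labelCode κ n l') + 1) * 2 ^ labelBits κ n ≤
      2 ^ labelBits κ n * 2 ^ labelBits κ n := Nat.mul_le_mul_right _ (by omega)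
  have : max (labelCode κ n l) (labelCode κ n l') < 2 ^ labelBits κ n := by omega
  rw [Nat.add_mul] at *
  omega

theorem edgeNum_eq {κ n : ℕ} {a b a' b' : AncLabel × ℕ} (ha : a ∈ labelSet κ n) (hb : b ∈ labelSet κ n)
    (ha' : a' ∈ labelSet κ n) (hb' : b' ∈ labelSet κ n) (h : edgeNum κ n a b = edgeNum κ n a' b') :
    a = a' ∧ b = b' ∨ a = b' ∧ b = a' := by
  have inj := labelCode_injOn κ n
  have hp : 0 < 2 ^ labelBits κ n := by positivity
  have hm : ∀ x y, max (labelCode κ n x) (labelCode κ n y) < 2 ^ labelBits κ n := fun x y =>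
    max_lt (labelCode_lt κ n x) (labelCode_lt κ n y)
  have h₁ := congrArg (· % 2 ^ labelBits κ n) h
  have h₂ := congrArg (· / 2 ^ labelBits κ n) h
  simp only [edgeNum] at h₁ h₂
  rw [Nat.mul_add_mod', Nat.mul_add_mod', Nat.mod_eq_of_lt (hm _ _), Nat.mod_eq_of_lt (hm _ _)] at h₁
  rw [mul_comm, Nat.mul_add_div hp, mul_comm, Nat.mul_add_div hp, Nat.div_eq_of_lt (hm _ _),
    Nat.div_eq_of_lt (hm _ _)] at h₂
  have : labelCode κ n a = labelCode κ n a' ∧ labelCode κ n b = labelCode κ n b' ∨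
      labelCode κ n a = labelCode κ n b' ∧ labelCode κ n b = labelCode κ n a' := by omega
  rcases this with ⟨e₁, e₂⟩ | ⟨e₁, e₂⟩
  · exact Or.inl ⟨inj ha ha' e₁, inj hb hb' e₂⟩
  · exact Or.inr ⟨inj ha hb' e₁, inj hb ha' e₂⟩

end Parameters

/-! ### What a vertex derives from its own input; the plan of components. -/

/-- Symbolic paths in lexicographic order. -/
abbrev LexPath : Type := List (ℕ ×ₗ ℕ)

/-- Positions of components in the tree of components, in lexicographic order. -/
abbrev CompKey : Type := List (LexPath ×ₗ ℕ)

def lexPath (p : List (ℕ × ℕ)) : LexPath := p.map toLex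

namespace LocalInput

variable {n κ lam : ℕ} (a : LocalInput n κ lam)

/-- The identifiers of the neighbours. -/
noncomputable def nb : Finset ℕ :=
  open Classical in (Finset.range (2 ^ (κ * lg n))).filter fun j => j ∈ a.nbrs

/-- The identifiers of the children. -/
noncomputable def ch : Finset ℕ := a.nb.filter fun j => (a.childSize j).isSome

/-- The ancestry label of the endpoint with identifier `j` of an edge. -/
def _root_.ExtId.ancOf (e : ExtId n κ) (j : ℕ) : AncLabel := if e.id₁ = j then e.anc₁ else e.anc₂

/-- The ancestry label of a neighbour. -/
noncomputable def ancN (j : ℕ) : AncLabel :=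
  match a.eid j with
  | some e => e.ancOf j
  | none => []

/-- The own ancestry label. -/
noncomputable def anc : AncLabel :=
  open Classical in
  if h : ∃ e, ∃ j, a.eid j = some e then h.choose.ancOf a.id else []

/-- The own symbolic path. -/
noncomputable def path : List (ℕ × ℕ) := expandAnc a.anc

/-- The symbolic path of a neighbour. -/
noncomputable def pathN (j : ℕ) : List (ℕ × ℕ) := expandAnc (a.ancN j)

/-- The identifier of the parent. -/
noncomputable def par : Option ℕ :=
  open Classical in
  if h : ∃ j, j ∈ a.nb ∧ a.pathN j = a.path.dropLast then some h.choose else none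

/-- The given edges that join the components, in both orientations: identifier and symbolic path
of both ends. -/
def joins : Set ((ℕ × List (ℕ × ℕ)) × (ℕ × List (ℕ × ℕ))) :=
  {x | ∃ e ∈ a.extraEdges, x = ((e.id₁, expandAnc e.anc₁), (e.id₂, expandAnc e.anc₂)) ∨
    x = ((e.id₂, expandAnc e.anc₂), (e.id₁, expandAnc e.anc₁))}

/-- The component of a vertex, given its symbolic path: the child above it, if there is one. -/
noncomputable def compOf (p : List (ℕ × ℕ)) : Option ℕ :=
  open Classical in
  if h : ∃ j, j ∈ a.ch ∧ a.pathN j <+: p then some h.choose else none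

/-- A rooted spanning tree of the components: the position `lp` of each component, and the edge to
its parent component. -/
structure IsPlan (lp : Option ℕ → CompKey) (ed : ℕ → Option (ℕ × ℕ)) : Prop where
  nil : lp none = []
  top : ∀ w ∈ a.ch, ed w = none →
    lp (some w) = [] ∧ a.path.length = 1 ∧ ∀ w' ∈ a.ch, ed w' = none → w' = w
  step : ∀ w ∈ a.ch, ∀ e, ed w = some e → ∃ p q, ((e.1, p), (e.2, q)) ∈ a.joins ∧
    a.compOf p = some w ∧ lp (some w) = lp (a.compOf q) ++ [toLex (lexPath q, w)]

/-- A choice of a spanning tree of the components. -/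
noncomputable def plan : (Option ℕ → CompKey) × (ℕ → Option (ℕ × ℕ)) :=
  open Classical in
  if h : ∃ x : (Option ℕ → CompKey) × (ℕ → Option (ℕ × ℕ)), a.IsPlan x.1 x.2 then h.choose
  else (fun _ => [], fun _ => none)

/-- The number of a component in the order of positions. -/
noncomputable def num (w : ℕ) : ℕ :=
  (a.ch.filter fun w' => a.plan.1 (some w') ≤ a.plan.1 (some w)).card

/-- The components in the subtree of a component. -/
noncomputable def desc (w : ℕ) : Finset ℕ :=
  open Classical in a.ch.filter fun w' => a.plan.1 (some w) <+: a.plan.1 (some w')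

/-- The last number in the subtree of a component. -/
noncomputable def last (w : ℕ) : ℕ := (a.desc w).sup a.num

end LocalInput

section Gather

variable {M : Type}

/-- The values of `f` on `A`, as soon as all of them are known. -/
noncomputable def gather (dflt : M) (A : Finset ℕ) (f : ℕ → Option M) : Option (ℕ → M) :=
  open Classical in
  if ∀ j ∈ A, (f j).isSome then some fun j => if j ∈ A then (f j).getD dflt else dflt else none

theorem gather_mono {d : M} {A : Finset ℕ} {f g : ℕ → Option M}
    (h : ∀ j m, f j = some m → g j = some m) {x : ℕ → M} (hx : gather d A f = some x) :
    gather d A g = some x := by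
  classical
  unfold gather at hx ⊢
  split_ifs at hx with hf
  have e : ∀ j ∈ A, g j = f j := fun j hj => by
    obtain ⟨m, hm⟩ := Option.isSome_iff_exists.1 (hf j hj)
    rw [hm, h j m hm]
  rw [if_pos fun j hj => by rw [e j hj]; exact hf j hj, ← Option.some_injective _ hx]
  congr 1
  funext j
  split_ifs with hj
  · rw [e j hj]
  · rfl

theorem gather_isSome {d : M} {A : Finset ℕ} {f : ℕ → Option M} (h : ∀ j ∈ A, (f j).isSome) :
    (gather d A f).isSome := by
  rw [gather, if_pos h]; rfl

end Gather

/-! ### The contents of the messages and the decision rule. -/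

namespace Protocol

variable {n κ lam c : ℕ} {K : Type} [Field K] (sd : (Fin (skDeg κ c n) → Bool) → K)
  (a : LocalInput n κ lam) (coin : CoinIdx κ c n → Bool) (i : ℕ)

/-- The message of the root `y` to a child at the start. -/
noncomputable def start (j : ℕ) : Msg K κ c n :=
  { Msg.blank K κ c n with
    dep := Fin.ofNat _ a.path.length
    edge := (a.plan.2 j).map fun e => (Fin.ofNat _ e.1, Fin.ofNat _ e.2)
    k := Fin.ofNat _ (a.num j)
    hi := Fin.ofNat _ (a.last j)
    xi := sd fun b => coin (.inr b) }

/-- The sampling bits that the vertex chooses for the edge to the neighbour `j`. -/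
def block (j : ℕ) (t : Fin (numPhases c n)) (s : Fin (numLevels n)) : Bool :=
  coin (.inl (Fin.ofNat _ j, t, s))

/-- The message of the root `y` to a child about the subtree of its component. -/
noncomputable def compSketch (u₂ : ℕ → Msg K κ c n) (j : ℕ) : Msg K κ c n :=
  { Msg.blank K κ c n with sk := ∑ w ∈ a.desc j, (u₂ w).sk }

variable (m : Msg K κ c n)

/-- The neighbours in the subtree of `y`, other than `y`. -/
noncomputable def nbU : Finset ℕ :=
  open Classical in
  a.nb.filter fun j => j ≠ i ∧ a.path.take m.dep <+: a.pathN j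

/-- The edge that joins the component of the vertex to its parent component. -/
def parentEdge : Option (ℕ × ℕ) := m.edge.map fun e => (e.1.val, e.2.val)

/-- The message to a neighbour in the subtree of `y`. -/
noncomputable def hello (j : ℕ) : Msg K κ c n :=
  { Msg.blank K κ c n with
    k := m.k
    hi := m.hi
    smp := block coin j
    flag := decide (parentEdge m = some (a.id, j)) }

variable (c₁ : ℕ → Msg K κ c n)

/-- The own label. -/
noncomputable def label : AncLabel × ℕ := (a.anc, m.k)

/-- The label of a neighbour. -/
noncomputable def labelN (j : ℕ) : AncLabel × ℕ :=
  -- The number 0 stands for the vertices outside `T_y`; the components at the children of `y` are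
  -- numbered from 1.
  (a.ancN j, if j ∈ nbU a i m then ((c₁ j).k : ℕ) else 0)

/-- The sampling bits of the edge to a neighbour. -/
noncomputable def edgeBits (j : ℕ) : Fin (numPhases c n) → Fin (numLevels n) → Bool :=
  if j ∈ nbU a i m ∧ j < a.id then (c₁ j).smp else block coin j

/-- The contribution of the edge to a neighbour. -/
noncomputable def entry (j : ℕ) : Sk K c n := fun t s =>
  if j ≠ i ∧ ∀ s' < s, edgeBits a coin i m c₁ j t s' = true then
    m.xi ^ edgeNum κ n (label a m) (labelN a i m c₁ j) else 0

/-- The own sketch. -/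
noncomputable def ownSketch : Sk K c n := ∑ j ∈ a.nb, entry a coin i m c₁ j

/-- The neighbours that are attached to the vertex in the tree of components. -/
noncomputable def attached : Finset ℕ := (nbU a i m).filter fun j => (c₁ j).flag = true

variable (u₂ : ℕ → Msg K κ c n)

/-- The first message to the parent: the sketch of the subtree, and the component numbers attached
to it. -/
noncomputable def report : Msg K κ c n :=
  { Msg.blank K κ c n with
    sk := ownSketch a coin i m c₁ + ∑ w ∈ a.ch, (u₂ w).sk
    -- Numbers are stored as differences from `n`, so that a supremum computes the smallest attached
    -- number; 0 is the neutral value.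
    lo := ((attached a i m c₁).sup fun j => Fin.ofNat _ (n - (c₁ j).k)) ⊔ a.ch.sup fun w => (u₂ w).lo
    hi := ((attached a i m c₁).sup fun j => (c₁ j).hi) ⊔ a.ch.sup fun w => (u₂ w).hi
    flag := decide ((parentEdge m).map Prod.fst = some a.id ∨ ∃ w ∈ a.ch, (u₂ w).flag = true) }

variable (i₃ : Msg K κ c n) (c₄ u₅ : ℕ → Msg K κ c n)

/-- The second message to the parent: the sketch of the subtree with all that is attached to it. -/
noncomputable def total : Msg K κ c n :=
  { Msg.blank K κ c n with
    sk := ownSketch a coin i m c₁ + ∑ j ∈ attached a i m c₁, (c₄ j).sk +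
      -- Here everything that is not below the component hangs on the vertex. In characteristic two
      -- it has the same sketch as the branch of the component itself, and this is what `i₃`
      -- carries.
      (if (parentEdge m).map Prod.fst = some a.id then i₃.sk else 0) + ∑ w ∈ a.ch, (u₅ w).sk }

/-- The parent, as a name of a part. -/
noncomputable def parName : ℕ := a.par.getD 0

open scoped Classical in
/-- The first element of `A` with the property `p`, or else the parent. -/
noncomputable def pick (A : Finset ℕ) (p : ℕ → Prop) (z : ℕ) : ℕ :=
  if h : ∃ j ∈ A, p j then h.choose else z

open scoped Classical in
/-- The part (of the graph without `x`, `y`) that contains a vertex with the given label. -/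
noncomputable def partOf (l : AncLabel × ℕ) : ℕ :=
  if l.2 = m.k then pick a.ch (fun w => a.pathN w <+: expandAnc l.1) (parName a)
  -- The numbers of the proper descendants of the component. They are attached at the vertex itself,
  -- below one of its children, or elsewhere and then on the side of the parent.
  else if m.k < l.2 ∧ l.2 ≤ m.hi then
    pick (attached a i m c₁) (fun j => (c₁ j).k ≤ l.2 ∧ l.2 ≤ (c₁ j).hi)
      -- The test compares the number with the smallest and the largest information reported by the
      -- child, the former being stored as a difference from `n`.
      (pick a.ch (fun w => n ≤ l.2 + (u₂ w).lo ∧ l.2 ≤ (u₂ w).hi) (parName a))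
  else match parentEdge m with
    | some e => if e.1 = a.id then e.2 else pick a.ch (fun w => (u₂ w).flag = true) (parName a)
    | none => parName a

open scoped Classical in
/-- The names of the parts. -/
noncomputable def names : Finset ℕ :=
  a.nb.filter fun j => j ∈ a.ch ∨ j ∈ attached a i m c₁ ∨ parentEdge m = some (a.id, j) ∨
    (a.par = some j ∧ j ≠ i)

open scoped Classical in
/-- The sketch of a part other than the one of the parent. -/
noncomputable def lowSketch (q : ℕ) : Sk K c n :=
  -- The accumulated sketch of the part still contains its edges to the deciding vertex, which are
  -- subtracted.
  (if q ∈ a.ch then (u₅ q).sk else if q ∈ attached a i m c₁ then (c₄ q).sk else i₃.sk) -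
    ∑ j ∈ a.nb with j ≠ i ∧ partOf a i m c₁ u₂ (labelN a i m c₁ j) = q, entry a coin i m c₁ j

open scoped Classical in
/-- The sketch of a part. -/
noncomputable def partSketch (q : ℕ) : Sk K c n :=
  if a.par = some q then
    -- The part of the parent cannot be summed from messages going up. The sketches of all parts add
    -- up to 0, so it is the sum of the others.
    ∑ q' ∈ (names a i m c₁).erase q, lowSketch a coin i m c₁ u₂ i₃ c₄ u₅ q'
  else lowSketch a coin i m c₁ u₂ i₃ c₄ u₅ q

open scoped Classical in
/-- The output: are the parts disconnected? -/
noncomputable def decideCut : Bool :=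
  decide (¬ ∀ q ∈ names a i m c₁, ∀ q' ∈ names a i m c₁,
    decodeClasses (names a i m c₁) (partSketch a coin i m c₁ u₂ i₃ c₄ u₅) m.xi (2 ^ (2 * labelBits κ n))
      (fun x q q' => ∃ l ∈ labelSet κ n, ∃ l' ∈ labelSet κ n, edgeNum κ n l l' = x ∧
        partOf a i m c₁ u₂ l = q ∧ partOf a i m c₁ u₂ l' = q') (numPhases c n) q q')

end Protocol

/-! ### The protocol as a monotone family. -/

namespace Protocol

variable {n κ lam c : ℕ} {K : Type} [Field K] (sd : (Fin (skDeg κ c n) → Bool) → K)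
  (a : LocalInput n κ lam) (coin : CoinIdx κ c n → Bool) (i : ℕ) (k : Table (Msg K κ c n))

/-- The message of phase `p` from the parent. -/
noncomputable def fromPar (p : Fin 6) : Option (Msg K κ c n) := a.par.bind fun z => k z p

/-- The messages of phase `p` from the neighbours below `y`. -/
noncomputable def fromNb (p : Fin 6) : Option (ℕ → Msg K κ c n) :=
  (fromPar a k 0).bind fun m => gather (Msg.blank K κ c n) (nbU a i m) fun j => k j p

/-- The messages of phase `p` from the children. -/
noncomputable def fromCh (p : Fin 6) : Option (ℕ → Msg K κ c n) :=
  gather (Msg.blank K κ c n) a.ch fun j => k j p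

/-- The messages of the algorithm `A_i` that can be computed from those received. -/
noncomputable def step : Table (Msg K κ c n) := fun j p =>
  open Classical in
  if a.id = i then
    if j ∈ a.ch then
      if p = 0 then some (start sd a coin j)
      else if p = 3 then (fromCh a k 2).map fun u₂ => compSketch a u₂ j
      else none
    else none
  else if p = 0 ∨ p = 3 then
    if j ∈ a.ch then fromPar a k p else none
  else if p = 1 then
    (fromPar a k 0).bind fun m => if j ∈ nbU a i m then some (hello a coin m j) else none
  else if p = 4 then
    (fromPar a k 0).bind fun m => if j ∈ nbU a i m then fromPar a k 3 else none
  else if a.par = some j then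
    if p = 2 then
      (fromPar a k 0).bind fun m => (fromNb a i k 1).bind fun c₁ => (fromCh a k 2).bind fun u₂ =>
        some (report a coin i m c₁ u₂)
    else
      (fromPar a k 0).bind fun m => (fromNb a i k 1).bind fun c₁ => (fromPar a k 3).bind fun i₃ =>
        (fromNb a i k 4).bind fun c₄ => (fromCh a k 5).bind fun u₅ =>
          some (total a coin i m c₁ i₃ c₄ u₅)
  else none

/-- The output of `A_i` that can be computed from the messages received. -/
noncomputable def result : Option Bool :=
  open Classical in
  if a.id = i then none
  else (fromPar a k 0).bind fun m => (fromNb a i k 1).bind fun c₁ => (fromCh a k 2).bind fun u₂ =>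
    (fromPar a k 3).bind fun i₃ => (fromNb a i k 4).bind fun c₄ => (fromCh a k 5).bind fun u₅ =>
      some (decideCut a coin i m c₁ u₂ i₃ c₄ u₅)

variable {sd a coin i k}

theorem bind_mono {X Y : Type} {o o' : Option X} {f g : X → Option Y}
    (h : ∀ x, o = some x → o' = some x) (hf : ∀ x y, f x = some y → g x = some y) {y : Y}
    (hy : o.bind f = some y) : o'.bind g = some y := by
  obtain ⟨x, hx, hy⟩ := Option.bind_eq_some_iff.1 hy
  rw [h x hx]; exact hf x y hy

theorem fromPar_mono {k' : Table (Msg K κ c n)} (h : k.Le k') {p : Fin 6} (m : Msg K κ c n)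
    (hm : fromPar a k p = some m) : fromPar a k' p = some m :=
  bind_mono (fun _ h => h) (fun _ _ => h _ _ _) hm

theorem fromNb_mono {k' : Table (Msg K κ c n)} (h : k.Le k') {p : Fin 6} (m : ℕ → Msg K κ c n)
    (hm : fromNb a i k p = some m) : fromNb a i k' p = some m :=
  bind_mono (fromPar_mono h) (fun _ _ => gather_mono fun _ _ => h _ _ _) hm

theorem fromCh_mono {k' : Table (Msg K κ c n)} (h : k.Le k') {p : Fin 6} (m : ℕ → Msg K κ c n)
    (hm : fromCh a k p = some m) : fromCh a k' p = some m :=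
  gather_mono (fun _ _ => h _ _ _) hm

/-- A message is formed only when all its inputs have arrived; no decision depends on the absence of
a message. -/
theorem step_mono {k' : Table (Msg K κ c n)} (h : k.Le k') : (step sd a coin i k).Le (step sd a coin i k') := by
  classical
  intro j p m hm
  unfold step at hm ⊢
  split_ifs at hm ⊢
  · exact hm
  · rw [Option.map_eq_some_iff] at hm ⊢
    obtain ⟨u, hu, e⟩ := hm
    exact ⟨u, fromCh_mono h u hu, e⟩
  · exact fromPar_mono h m hm
  · exact bind_mono (fromPar_mono h) (fun _ _ h => h) hm
  · refine bind_mono (fromPar_mono h) (fun _ _ hy => ?_) hm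
    split_ifs at hy ⊢
    exact fromPar_mono h _ hy
  · exact bind_mono (fromPar_mono h) (fun _ _ => bind_mono (fromNb_mono h) fun _ _ =>
      bind_mono (fromCh_mono h) fun _ _ h => h) hm
  · exact bind_mono (fromPar_mono h) (fun _ _ => bind_mono (fromNb_mono h) fun _ _ =>
      bind_mono (fromPar_mono h) fun _ _ => bind_mono (fromNb_mono h) fun _ _ =>
      bind_mono (fromCh_mono h) fun _ _ h => h) hm

theorem result_mono {k' : Table (Msg K κ c n)} (h : k.Le k') {b : Bool} (hb : result a coin i k = some b) :
    result a coin i k' = some b := by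
  classical
  unfold result at hb ⊢
  split_ifs at hb ⊢
  exact bind_mono (fromPar_mono h) (fun _ _ => bind_mono (fromNb_mono h) fun _ _ =>
    bind_mono (fromCh_mono h) fun _ _ => bind_mono (fromPar_mono h) fun _ _ =>
    bind_mono (fromNb_mono h) fun _ _ => bind_mono (fromCh_mono h) fun _ _ h => h) hb

variable (sd)

/-- The algorithms `A_i` as a family. -/
noncomputable def family (lam : ℕ) : Family (LocalInput n κ lam) (CoinIdx κ c n → Bool) (Msg K κ c n)
    (2 ^ (κ * lg n)) where
  step a coin i k := step sd a coin i k
  mono _ _ _ _ _ h := step_mono h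

end Protocol

/-! ### The meaning of local inputs in the network. -/

namespace Setting

variable {V : Type} {κ n : ℕ} [Fintype V] (S : Setting κ n V)

/-- The child of `y` above `u`, if there is one. -/
noncomputable def comp (y u : V) : Option V :=
  open Classical in if h : ∃ w, S.Child y w ∧ S.InSub w u then some h.choose else none

variable {S}

theorem comp_eq_some {y u w : V} : S.comp y u = some w ↔ S.Child y w ∧ S.InSub w u := by
  unfold comp
  split_ifs with h
  · refine ⟨fun e => Option.some_injective _ e ▸ h.choose_spec, fun e => ?_⟩
    rw [h.choose_spec.1.eq_of_inSub e.1 h.choose_spec.2 e.2]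
  · exact ⟨nofun, fun e => absurd ⟨w, e⟩ h⟩

theorem comp_eq_none {y u : V} (hu : u ≠ y) : S.comp y u = none ↔ ¬ S.InSub y u := by
  constructor
  · intro h hy
    obtain ⟨w, hw⟩ := S.exists_child_of_inSub hy hu
    rw [comp_eq_some.2 hw] at h; cases h
  · intro h
    cases e : S.comp y u with
    | none => rfl
    | some w => exact absurd ((comp_eq_some.1 e).1.mem.trans (comp_eq_some.1 e).2) h

theorem comp_self (y : V) : S.comp y y = none := by
  cases e : S.comp y y with
  | none => rfl
  | some w => exact absurd (comp_eq_some.1 e).2 (comp_eq_some.1 e).1.not_inSub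

theorem comp_child {y w : V} (h : S.Child y w) : S.comp y w = some w :=
  comp_eq_some.2 ⟨h, InSub.refl w⟩

end Setting

namespace Prep

variable {V : Type} {κ n lam : ℕ} [Fintype V] {S : Setting κ n V} (P : Prep S lam)

theorem mem_nb {v : V} {j : ℕ} : j ∈ (P.localInput v).nb ↔ ∃ u, S.G.Adj v u ∧ S.id u = j := by
  classical
  simp only [LocalInput.nb, Finset.mem_filter, Finset.mem_range]
  refine ⟨fun h => h.2, fun h => ⟨?_, h⟩⟩
  obtain ⟨u, -, rfl⟩ := h
  exact S.id_lt u

theorem id_mem_nb {v u : V} : S.id u ∈ (P.localInput v).nb ↔ S.G.Adj v u := by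
  rw [mem_nb]
  exact ⟨fun ⟨w, h, e⟩ => S.id_inj e ▸ h, fun h => ⟨u, h, rfl⟩⟩

theorem mem_ch {v : V} {j : ℕ} : j ∈ (P.localInput v).ch ↔ ∃ w, S.Child v w ∧ S.id w = j := by
  rw [LocalInput.ch, Finset.mem_filter, mem_nb, Option.isSome_iff_exists]
  constructor
  · rintro ⟨-, x, hx⟩
    obtain ⟨w, hw, e, -⟩ := byId_eq_some (show byId S.id (IsChild S.T S.s v) _ j = some x from hx)
    exact ⟨w, hw, e⟩
  · rintro ⟨w, hw, rfl⟩
    exact ⟨⟨w, hw.adj, rfl⟩, _, byId_id S.id_inj _ _ hw⟩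

theorem id_mem_ch {v w : V} : S.id w ∈ (P.localInput v).ch ↔ S.Child v w := by
  rw [mem_ch]
  exact ⟨fun ⟨u, h, e⟩ => S.id_inj e ▸ h, fun h => ⟨w, h, rfl⟩⟩

theorem eid_ancOf (ξ) {u v : V} (h : u ≠ v) :
    (S.eid ξ u v).ancOf (S.id v) = S.anc v ∧ (S.eid ξ u v).ancOf (S.id u) = S.anc u := by
  have h' := S.id_inj.ne h
  unfold Setting.eid ExtId.ancOf
  split_ifs <;> simp_all

theorem ancN_id {v u : V} (h : S.G.Adj v u) : (P.localInput v).ancN (S.id u) = S.anc u := by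
  have e : (P.localInput v).eid (S.id u) = some (S.eid P.seedId v u) := byId_id S.id_inj _ _ h
  rw [LocalInput.ancN, e]
  exact (eid_ancOf _ h.ne).1

theorem pathN_id {v u : V} (h : S.G.Adj v u) : (P.localInput v).pathN (S.id u) = S.path u := by
  rw [LocalInput.pathN, ancN_id P h]; rfl

theorem anc_eq {v u : V} (h : S.G.Adj v u) : (P.localInput v).anc = S.anc v := by
  have hx : ∃ e, ∃ j, (P.localInput v).eid j = some e := ⟨_, _, byId_id S.id_inj _ _ h⟩
  rw [LocalInput.anc, dif_pos hx]
  obtain ⟨j, hj⟩ := hx.choose_spec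
  obtain ⟨w, hw, -, e⟩ := byId_eq_some (show byId S.id (S.G.Adj v) _ j = some _ from hj)
  rw [← e]
  exact (eid_ancOf _ hw.ne).2

theorem path_eq {v u : V} (h : S.G.Adj v u) : (P.localInput v).path = S.path v := by
  rw [LocalInput.path, anc_eq P h]; rfl

theorem par_child {u v : V} (h : S.Child u v) : (P.localInput v).par = some (S.id u) := by
  have ha := h.adj.symm
  have hx : ∃ j, j ∈ (P.localInput v).nb ∧ (P.localInput v).pathN j = (P.localInput v).path.dropLast :=
    ⟨S.id u, (id_mem_nb P).2 ha, by
      rw [pathN_id P ha, path_eq P ha]; exact (S.child_iff_dropLast h.ne).1 h⟩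
  rw [LocalInput.par, dif_pos hx]
  obtain ⟨h₁, h₂⟩ := hx.choose_spec
  obtain ⟨w, hw, e⟩ := (mem_nb P).1 h₁
  rw [← e] at h₂ ⊢
  rw [pathN_id P hw, path_eq P ha] at h₂
  rw [((S.child_iff_dropLast hw.ne').2 h₂).unique h]

theorem par_root : (P.localInput S.s).par = none := by
  rw [LocalInput.par, dif_neg]
  rintro ⟨j, hj, h⟩
  obtain ⟨w, hw, rfl⟩ := (mem_nb P).1 hj
  rw [pathN_id P hw, path_eq P hw, S.path_root] at h
  have := congrArg List.length h
  rw [S.length_path] at this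
  exact absurd this (S.length_rp_pos w).ne'

theorem par_eq_some {v : V} {j : ℕ} : (P.localInput v).par = some j ↔ ∃ u, S.Child u v ∧ S.id u = j := by
  by_cases hv : v = S.s
  · subst hv
    rw [par_root]
    exact ⟨nofun, fun ⟨u, h, _⟩ => absurd h (S.not_child_root u)⟩
  · obtain ⟨u, hu⟩ := S.child_of_ne_root hv
    rw [par_child P hu]
    exact ⟨fun h => ⟨u, hu, Option.some_injective _ h⟩, fun ⟨w, hw, e⟩ => by rw [← e, hw.unique hu]⟩

theorem par_eq_id {u v : V} : (P.localInput v).par = some (S.id u) ↔ S.Child u v := by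
  rw [par_eq_some]
  exact ⟨fun ⟨w, h, e⟩ => S.id_inj e ▸ h, fun h => ⟨u, h, rfl⟩⟩

theorem compOf_path (y u : V) : (P.localInput y).compOf (S.path u) = (S.comp y u).map S.id := by
  unfold LocalInput.compOf
  split_ifs with h
  · obtain ⟨h₁, h₂⟩ := h.choose_spec
    obtain ⟨w, hw, e⟩ := (mem_ch P).1 h₁
    rw [← e, pathN_id P hw.adj, S.path_prefix_iff] at h₂
    rw [Setting.comp_eq_some.2 ⟨hw, h₂⟩, ← e]; rfl
  · cases e : S.comp y u with
    | none => rfl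
    | some w =>
      obtain ⟨hw, hu⟩ := Setting.comp_eq_some.1 e
      exact absurd ⟨S.id w, (id_mem_ch P).2 hw, by rw [pathN_id P hw.adj]; exact S.path_prefix_iff.2 hu⟩ h

theorem mem_joins {y : V} {x : (ℕ × List (ℕ × ℕ)) × (ℕ × List (ℕ × ℕ))} :
    x ∈ (P.localInput y).joins ↔
      ∃ a b, s(a, b) ∈ P.E y ∧ x = ((S.id a, S.path a), (S.id b, S.path b)) := by
  constructor
  · rintro ⟨e, ⟨a, b, hab, rfl⟩, h⟩
    unfold Setting.eid at h
    split_ifs at h <;> rcases h with h | h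
    · exact ⟨a, b, hab, h⟩
    · exact ⟨b, a, Sym2.eq_swap ▸ hab, h⟩
    · exact ⟨b, a, Sym2.eq_swap ▸ hab, h⟩
    · exact ⟨a, b, hab, h⟩
  · rintro ⟨a, b, hab, rfl⟩
    refine ⟨S.eid P.seedId a b, ⟨a, b, hab, rfl⟩, ?_⟩
    unfold Setting.eid
    split_ifs
    · exact Or.inl rfl
    · exact Or.inr rfl

theorem joins_id {y : V} {i j : ℕ} {p q : List (ℕ × ℕ)} (h : ((i, p), (j, q)) ∈ (P.localInput y).joins) :
    ∃ a b, s(a, b) ∈ P.E y ∧ S.id a = i ∧ S.path a = p ∧ S.id b = j ∧ S.path b = q := by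
  obtain ⟨a, b, hab, h⟩ := (mem_joins P).1 h
  simp only [Prod.mk.injEq] at h
  exact ⟨a, b, hab, h.1.1.symm, h.1.2.symm, h.2.1.symm, h.2.2.symm⟩

end Prep

/-! ### Prefixes in the lexicographic order of lists. -/

section ListOrder

variable {α : Type*} [LinearOrder α]

theorem List.cons_le_cons_lex {a b : α} {x y : List α} : a :: x ≤ b :: y ↔ a < b ∨ a = b ∧ x ≤ y := by
  rw [← not_lt, List.cons_lt_cons_iff, ← not_lt (a := y)]
  rcases lt_trichotomy a b with h | rfl | h
  · simp [h, h.not_gt, h.ne']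
  · simp
  · simp [h, h.not_gt, h.ne']

theorem List.IsPrefix.le_of_lex {p x : List α} (h : p <+: x) : p ≤ x := by
  obtain ⟨t, rfl⟩ := h
  induction p with
  | nil => exact not_lt.1 (List.not_lt_nil _)
  | cons a p ih => rw [List.cons_append, List.cons_le_cons_lex]; exact Or.inr ⟨rfl, ih⟩

/-- The lists with a given prefix form a convex set. This is the source of all the interval tests on
component numbers. -/
theorem List.prefix_of_le_of_le {p x y z : List α} (hx : p <+: x) (hz : p <+: z) (h₁ : x ≤ y) (h₂ : y ≤ z) :
    p <+: y := by
  induction p generalizing x y z with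
  | nil => exact List.nil_prefix
  | cons a p ih =>
    obtain ⟨x, rfl⟩ := hx
    obtain ⟨z, rfl⟩ := hz
    cases y with
    | nil => exact absurd (List.nil_lt_cons _ _) (not_lt.2 h₁)
    | cons b y =>
      rw [List.cons_append, List.cons_le_cons_lex] at h₁ h₂
      have : a = b := by
        rcases h₁ with h₁ | h₁
        · rcases h₂ with h₂ | h₂
          · exact absurd h₁ h₂.not_gt
          · exact h₂.1.symm
        · exact h₁.1
      subst this
      exact List.cons_prefix_cons.2 ⟨rfl, ih (List.prefix_append _ _) (List.prefix_append _ _)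
        (h₁.resolve_left (lt_irrefl _)).2 (h₂.resolve_left (lt_irrefl _)).2⟩

theorem List.append_le_append_left_iff {p x y : List α} : p ++ x ≤ p ++ y ↔ x ≤ y := by
  induction p with
  | nil => rfl
  | cons a p ih => rw [List.cons_append, List.cons_append, List.cons_le_cons_lex, ih]; simp

end ListOrder

/-! ### The tree of components of `T` without `y`, and its numbering. -/

namespace Prep

variable {V : Type} {κ n lam : ℕ} [Fintype V] {S : Setting κ n V} (P : Prep S lam)

/-- Adjacency of the components of `T \ {y}`. -/
def quotGraph (y : V) : SimpleGraph (Option V) where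
  Adj c c' := c ≠ c' ∧ ∃ a b, s(a, b) ∈ P.E y ∧ S.comp y a = c ∧ S.comp y b = c'
  symm := ⟨fun _ _ ⟨h, a, b, hab, ha, hb⟩ => ⟨h.symm, b, a, Sym2.eq_swap ▸ hab, hb, ha⟩⟩
  loopless := ⟨fun _ h => h.1 rfl⟩

theorem child_or_child {u v : V} (h : S.T.Adj u v) : S.Child u v ∨ S.Child v u := by
  by_cases hv : v = S.s
  · subst hv
    exact Or.inr ⟨h.symm, S.inSub_root u⟩
  · obtain ⟨p, hp⟩ := S.child_of_ne_root hv
    by_cases hu : u = p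
    · exact Or.inl (hu ▸ hp)
    refine Or.inr ⟨h.symm, ?_⟩
    obtain ⟨q, hq, e⟩ := S.exists_rp u
    by_cases hm : v ∈ q.support
    · exact S.inSub_iff.2 (e ▸ hm)
    · have := S.rp_eq (q.concat h) (hq.concat hm h)
      rw [SimpleGraph.Walk.support_concat, ← e, hp.rp_eq] at this
      exact absurd (S.rp_injective (List.append_cancel_right this)).symm hu

theorem comp_eq_of_child {y u v : V} (h : S.Child u v) (hu : u ≠ y) (hv : v ≠ y) :
    S.comp y u = S.comp y v := by
  cases e : S.comp y u with
  | some w =>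
    obtain ⟨hw, hwu⟩ := Setting.comp_eq_some.1 e
    exact (Setting.comp_eq_some.2 ⟨hw, hwu.trans h.mem⟩).symm
  | none =>
    rw [Setting.comp_eq_none hu] at e
    refine ((Setting.comp_eq_none hv).2 fun h' => ?_).symm
    exact ((h.inSub_iff.1 h').resolve_left hv.symm |> e)

/-- Along a walk that avoids `y`, a tree edge stays in its component and an edge of `E y` stays in
it or joins two adjacent ones. -/
theorem quotGraph_reachable {y u v : V} (hu : u ≠ y) (hv : v ≠ y) :
    (P.quotGraph y).Reachable (S.comp y u) (S.comp y v) := by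
  obtain ⟨p⟩ := P.E_preconnected y ⟨u, hu⟩ ⟨v, hv⟩
  have key : ∀ {a b : ({y}ᶜ : Set V)} (p : ((S.T ⊔ SimpleGraph.fromEdgeSet (P.E y)).induce ({y}ᶜ : Set V)).Walk a b),
      (P.quotGraph y).Reachable (S.comp y a) (S.comp y b) := by
    intro a b p
    induction p with
    | nil => rfl
    | @cons a b c h p ih =>
      refine SimpleGraph.Reachable.trans ?_ ih
      rcases h with h | h
      · have : S.comp y a = S.comp y b := by
          rcases child_or_child h with h | h
          · exact comp_eq_of_child h a.2 b.2
          · exact (comp_eq_of_child h b.2 a.2).symm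
        rw [this]
      · by_cases e : S.comp y a = S.comp y b
        · rw [e]
        · exact SimpleGraph.Adj.reachable ⟨e, a, b, ((SimpleGraph.fromEdgeSet_adj _).1 h).1, rfl, rfl⟩
  exact key p

theorem ne_of_mem_E {y a b : V} (h : s(a, b) ∈ P.E y) : a ≠ y ∧ b ≠ y ∧ S.G.Adj a b := by
  have := P.E_avoids y _ h
  rw [Sym2.mem_iff] at this
  push Not at this
  exact ⟨this.1.symm, this.2.symm, (P.E_subset y h).1⟩

/-- The natural root is the component outside `T_y`. It is empty exactly if `y` is the root of `T`;
then the component of any child serves. -/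
theorem exists_root (y : V) : ∃ r : Option V, (∀ w, S.Child y w → (P.quotGraph y).Reachable r (some w)) ∧
    ∀ w, r = some w → S.Child y w ∧ y = S.s := by
  by_cases hy : y = S.s
  · by_cases hw : ∃ w, S.Child y w
    · obtain ⟨w, hw⟩ := hw
      refine ⟨some w, fun v hv => ?_, fun v hv => ?_⟩
      · rw [← Setting.comp_child hv, ← Setting.comp_child hw]
        exact P.quotGraph_reachable hw.ne.symm hv.ne.symm
      · rw [← Option.some_injective _ hv]; exact ⟨hw, hy⟩
    · exact ⟨none, fun v hv => absurd ⟨v, hv⟩ hw, nofun⟩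
  · refine ⟨none, fun v hv => ?_, nofun⟩
    rw [← Setting.comp_child hv, ← (Setting.comp_eq_none (u := S.s) (Ne.symm hy)).2
      fun h => hy (h.antisymm (S.inSub_root y))]
    exact P.quotGraph_reachable (Ne.symm hy) hv.ne.symm

-- Take shortest paths from the root in the graph of components. The key of a component extends that
-- of its predecessor by the path of the joining vertex and by its own identifier.
open scoped Classical in
theorem isPlan (y : V) : (P.localInput y).IsPlan (P.localInput y).plan.1 (P.localInput y).plan.2 := by
  have : Nonempty V := ⟨y⟩
  suffices h : ∃ x : (Option ℕ → CompKey) × (ℕ → Option (ℕ × ℕ)), (P.localInput y).IsPlan x.1 x.2 by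
    rw [LocalInput.plan, dif_pos h]; exact h.choose_spec
  obtain ⟨r, hr, hrs⟩ := P.exists_root y
  -- The last edge of a shortest path leads to a component whose distance is smaller by exactly one.
  have hp : ∀ w, S.Child y w → some w ≠ r → ∃ a b, s(a, b) ∈ P.E y ∧ S.comp y a = some w ∧
      (P.quotGraph y).dist r (some w) = (P.quotGraph y).dist r (S.comp y b) + 1 := by
    intro w hw hne
    obtain ⟨p, hl⟩ := (hr w hw).exists_walk_length_eq_dist
    have hn : ¬ p.Nil := fun hn => hne hn.eq.symm
    obtain ⟨-, b, a, hab, hb, ha⟩ := p.adj_penultimate hn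
    refine ⟨a, b, Sym2.eq_swap ▸ hab, ha, le_antisymm ?_ ?_⟩
    · have h₁ : (P.quotGraph y).Adj (S.comp y b) (some w) := hb ▸ p.adj_penultimate hn
      obtain ⟨q, hq⟩ := (show (P.quotGraph y).Reachable r (S.comp y b) from
        hb ▸ ⟨p.dropLast⟩).exists_walk_length_eq_dist
      rw [← hq]
      exact (SimpleGraph.dist_le (q.concat h₁)).trans (by rw [SimpleGraph.Walk.length_concat])
    · have h₂ : (P.quotGraph y).dist r (S.comp y b) ≤ p.dropLast.length := by
        rw [hb]; exact SimpleGraph.dist_le _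
      have h₃ := SimpleGraph.Walk.length_dropLast_add_one hn
      omega
  choose! A B hE hA hd using hp
  -- The first argument is fuel for the recursion towards the root; the distance from the root is
  -- sufficient, and exact for the recursion step.
  let lpN : ℕ → Option V → CompKey := fun m => Nat.rec (fun _ => []) (fun _ f c =>
    match c with
    | none => []
    | some w => if some w = r then [] else f (S.comp y (B w)) ++ [toLex (lexPath (S.path (B w)), S.id w)]) m
  let inv : ℕ → V := Function.invFun S.id
  have hinv : ∀ v, inv (S.id v) = v := Function.leftInverse_invFun S.id_inj
  have hinv' : ∀ o : Option V, (o.map S.id).map inv = o := fun o => by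
    rw [Option.map_map]; cases o <;> simp [hinv]
  have lp_none : ∀ m, lpN m none = [] := fun m => by cases m <;> rfl
  have lp_root : ∀ m, lpN m r = [] := fun m => by
    cases m with
    | zero => rfl
    | succ m => cases r with
      | none => rfl
      | some w => exact if_pos rfl
  have lp_succ : ∀ m w, some w ≠ r → lpN (m + 1) (some w) =
    lpN m (S.comp y (B w)) ++ [toLex (lexPath (S.path (B w)), S.id w)] := fun m w h => if_neg h
  refine ⟨(fun o => lpN ((P.quotGraph y).dist r (o.map inv)) (o.map inv),
    fun i => if some (inv i) = r then none else some (S.id (A (inv i)), S.id (B (inv i)))), ?_, ?_, ?_⟩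
  · exact lp_none _
  · intro i hi h
    obtain ⟨w, hw, rfl⟩ := (mem_ch P).1 hi
    have hwr : some w = r := by
      by_contra hne
      simp only [hinv, if_neg hne] at h
      cases h
    refine ⟨?_, ?_, ?_⟩
    · simp only [Option.map_some, hinv, hwr]; exact lp_root _
    · obtain ⟨h₁, h₂⟩ := hrs w hwr.symm
      rw [path_eq P h₁.adj, h₂, S.path_root]; rfl
    · intro i' hi' h'
      obtain ⟨w', hw', rfl⟩ := (mem_ch P).1 hi'
      have hwr' : some w' = r := by
        by_contra hne
        simp only [hinv, if_neg hne] at h'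
        cases h'
      rw [Option.some_injective _ (hwr'.trans hwr.symm)]
  · intro i hi e h
    obtain ⟨w, hw, rfl⟩ := (mem_ch P).1 hi
    have hwr : some w ≠ r := by
      intro hne
      simp only [hinv, if_pos hne] at h
      cases h
    simp only [hinv, if_neg hwr] at h
    obtain rfl := Option.some_injective _ h
    refine ⟨S.path (A w), S.path (B w), (mem_joins P).2 ⟨_, _, hE w hw hwr, rfl⟩, ?_, ?_⟩
    · rw [compOf_path, hA w hw hwr]; rfl
    · simp only [compOf_path, hinv', Option.map_some, hinv, hd w hw hwr]
      exact lp_succ _ w hwr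

/-- The position of a component. -/
noncomputable def lp (y : V) (o : Option V) : CompKey := (P.localInput y).plan.1 (o.map S.id)

/-- The number of a component. -/
noncomputable def num (y w : V) : ℕ := (P.localInput y).num (S.id w)

/-- The last number in the subtree of a component. -/
noncomputable def last (y w : V) : ℕ := (P.localInput y).last (S.id w)

/-- The edge `ab` joins the component of `w` to its parent component. -/
def Joint (y w a b : V) : Prop :=
  S.Child y w ∧ (P.localInput y).plan.2 (S.id w) = some (S.id a, S.id b)

/-- The component of `w` is the root of the tree of components. -/
def IsTop (y w : V) : Prop := S.Child y w ∧ (P.localInput y).plan.2 (S.id w) = none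

variable {P}

theorem Joint.unique {y w a b a' b' : V} (h : P.Joint y w a b) (h' : P.Joint y w a' b') :
    a = a' ∧ b = b' := by
  have := Option.some_injective _ (h.2.symm.trans h'.2)
  exact ⟨S.id_inj (congrArg Prod.fst this), S.id_inj (congrArg Prod.snd this)⟩

theorem lp_none (y : V) : P.lp y none = [] := (P.isPlan y).nil

theorem IsTop.lp_eq {y w : V} (h : P.IsTop y w) : P.lp y (some w) = [] :=
  ((P.isPlan y).top _ ((id_mem_ch P).2 h.1) h.2).1

theorem IsTop.eq_root {y w : V} (h : P.IsTop y w) : y = S.s := by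
  have := ((P.isPlan y).top _ ((id_mem_ch P).2 h.1) h.2).2.1
  rw [path_eq P h.1.adj, S.length_path] at this
  by_contra hy
  obtain ⟨p, hp⟩ := S.child_of_ne_root hy
  have h₂ := S.length_rp_pos p
  rw [hp.rp_eq, List.length_append, List.length_singleton] at this
  omega

theorem IsTop.unique {y w w' : V} (h : P.IsTop y w) (h' : P.IsTop y w') : w' = w :=
  S.id_inj (((P.isPlan y).top _ ((id_mem_ch P).2 h.1) h.2).2.2 _ ((id_mem_ch P).2 h'.1) h'.2)

theorem joint_aux {y w : V} (hw : S.Child y w) {e : ℕ × ℕ}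
    (he : (P.localInput y).plan.2 (S.id w) = some e) : ∃ a b, e = (S.id a, S.id b) ∧
      s(a, b) ∈ P.E y ∧ S.comp y a = some w ∧
      P.lp y (some w) = P.lp y (S.comp y b) ++ [toLex (lexPath (S.path b), S.id w)] := by
  obtain ⟨p, q, h₁, h₂, h₃⟩ := (P.isPlan y).step _ ((id_mem_ch P).2 hw) e he
  obtain ⟨a, b, hE, ha, rfl, hb, rfl⟩ := joins_id P h₁
  refine ⟨a, b, by rw [ha, hb], hE, ?_, ?_⟩
  · rw [compOf_path] at h₂
    cases e : S.comp y a with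
    | none => rw [e] at h₂; cases h₂
    | some v => rw [e] at h₂; rw [S.id_inj (Option.some_injective _ h₂)]
  · rw [compOf_path] at h₃; exact h₃

theorem isTop_or_joint {y w : V} (hw : S.Child y w) : P.IsTop y w ∨ ∃ a b, P.Joint y w a b := by
  cases he : (P.localInput y).plan.2 (S.id w) with
  | none => exact Or.inl ⟨hw, he⟩
  | some e =>
    obtain ⟨a, b, rfl, -⟩ := joint_aux hw he
    exact Or.inr ⟨a, b, hw, he⟩

theorem Joint.spec {y w a b : V} (h : P.Joint y w a b) : s(a, b) ∈ P.E y ∧ S.comp y a = some w ∧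
    P.lp y (some w) = P.lp y (S.comp y b) ++ [toLex (lexPath (S.path b), S.id w)] := by
  obtain ⟨a', b', e, h'⟩ := joint_aux h.1 h.2
  obtain rfl := S.id_inj (congrArg Prod.fst e)
  obtain rfl := S.id_inj (congrArg Prod.snd e)
  exact h'

theorem Joint.ne {y w a b : V} (h : P.Joint y w a b) : a ≠ y ∧ b ≠ y ∧ S.G.Adj a b :=
  P.ne_of_mem_E h.spec.1

/-- Only a root component has the empty key among the components at children; any other key ends
with the identifier of its component. -/
theorem lp_injective {y w w' : V} (h : S.Child y w) (h' : S.Child y w')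
    (e : P.lp y (some w) = P.lp y (some w')) : w = w' := by
  rcases isTop_or_joint (P := P) h with ht | ⟨a, b, hj⟩ <;>
    rcases isTop_or_joint (P := P) h' with ht' | ⟨a', b', hj'⟩
  · exact ht'.unique ht
  · rw [ht.lp_eq, hj'.spec.2.2] at e; simp at e
  · rw [ht'.lp_eq, hj.spec.2.2] at e; simp at e
  · rw [hj.spec.2.2, hj'.spec.2.2] at e
    have := List.append_inj_right' e rfl
    rw [List.singleton_inj] at this
    exact S.id_inj (congrArg (fun x => (ofLex x).2) this)

theorem mem_filter_num {y w v : V} :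
    S.id v ∈ ((P.localInput y).ch.filter fun j => (P.localInput y).plan.1 (some j) ≤
      (P.localInput y).plan.1 (some (S.id w))) ↔ S.Child y v ∧ P.lp y (some v) ≤ P.lp y (some w) := by
  rw [Finset.mem_filter, id_mem_ch]; rfl

theorem num_le_iff {y w w' : V} (h : S.Child y w) :
    P.num y w ≤ P.num y w' ↔ P.lp y (some w) ≤ P.lp y (some w') := by
  constructor
  · intro hn
    by_contra hlt
    rw [not_le] at hlt
    refine absurd hn (not_le.2 ?_)
    rw [num, num, LocalInput.num, LocalInput.num]
    refine Finset.card_lt_card ⟨fun j hj => ?_, fun hs => ?_⟩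
    · obtain ⟨v, hv, rfl⟩ := (mem_ch P).1 (Finset.mem_filter.1 hj).1
      exact mem_filter_num.2 ⟨hv, ((mem_filter_num.1 hj).2.trans hlt.le)⟩
    · exact absurd (mem_filter_num.1 (hs (mem_filter_num.2 ⟨h, le_rfl⟩))).2 (not_le.2 hlt)
  · intro hl
    rw [num, num, LocalInput.num, LocalInput.num]
    refine Finset.card_le_card fun j hj => ?_
    obtain ⟨v, hv, rfl⟩ := (mem_ch P).1 (Finset.mem_filter.1 hj).1
    exact mem_filter_num.2 ⟨hv, (mem_filter_num.1 hj).2.trans hl⟩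

theorem num_injective {y w w' : V} (h : S.Child y w) (h' : S.Child y w') (e : P.num y w = P.num y w') :
    w = w' :=
  lp_injective h h' (le_antisymm ((num_le_iff h).1 e.le) ((num_le_iff h').1 e.ge))

theorem num_pos {y w : V} (h : S.Child y w) : 0 < P.num y w :=
  Finset.card_pos.2 ⟨S.id w, mem_filter_num.2 ⟨h, le_rfl⟩⟩

theorem card_ch_le (y : V) : (P.localInput y).ch.card ≤ n := by
  classical
  refine (Finset.card_le_card (t := Finset.univ.image S.id) fun j hj => ?_).trans
    (Finset.card_image_le.trans S.card_eq.le)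
  obtain ⟨v, hv, rfl⟩ := (mem_ch P).1 hj
  exact Finset.mem_image_of_mem _ (Finset.mem_univ _)

theorem num_le (y w : V) : P.num y w ≤ n := (Finset.card_filter_le _ _).trans (card_ch_le y)

theorem mem_desc {y w : V} {j : ℕ} : j ∈ (P.localInput y).desc (S.id w) ↔
    ∃ v, S.Child y v ∧ P.lp y (some w) <+: P.lp y (some v) ∧ S.id v = j := by
  classical
  rw [show (P.localInput y).desc (S.id w) = (P.localInput y).ch.filter fun j =>
    (P.localInput y).plan.1 (some (S.id w)) <+: (P.localInput y).plan.1 (some j) by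
      rw [LocalInput.desc], Finset.mem_filter, mem_ch]
  constructor
  · rintro ⟨⟨v, hv, rfl⟩, h⟩; exact ⟨v, hv, h, rfl⟩
  · rintro ⟨v, hv, h, rfl⟩; exact ⟨⟨v, hv, rfl⟩, h⟩

theorem last_le (y w : V) : P.last y w ≤ n := by
  rw [last, LocalInput.last]
  refine Finset.sup_le fun j hj => ?_
  obtain ⟨v, -, -, rfl⟩ := mem_desc.1 hj
  exact num_le y v

theorem num_le_last {y w v : V} (h : S.Child y v) (hp : P.lp y (some w) <+: P.lp y (some v)) :
    P.num y v ≤ P.last y w :=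
  Finset.le_sup (f := (P.localInput y).num) (mem_desc.2 ⟨v, h, hp, rfl⟩)

theorem exists_last {y w v : V} (hv : S.Child y v) (h : P.num y v ≤ P.last y w) :
    ∃ z, S.Child y z ∧ P.lp y (some w) <+: P.lp y (some z) ∧ P.lp y (some v) ≤ P.lp y (some z) := by
  have hne : ((P.localInput y).desc (S.id w)).Nonempty := by
    rw [Finset.nonempty_iff_ne_empty]
    intro he
    rw [last, LocalInput.last, he, Finset.sup_empty] at h
    exact absurd (num_pos (P := P) hv) (by simpa using h)
  obtain ⟨j, hj, e⟩ := Finset.exists_mem_eq_sup _ hne (P.localInput y).num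
  obtain ⟨z, hz, hp, rfl⟩ := mem_desc.1 hj
  exact ⟨z, hz, hp, (num_le_iff hv).1 (h.trans e.le)⟩

/-- Numbers are ranks in the lexicographic order of keys. There the extensions of a key form a
convex set whose first element is the key itself. -/
theorem num_mem_iff {y w v : V} (hw : S.Child y w) (hv : S.Child y v) :
    (P.num y w ≤ P.num y v ∧ P.num y v ≤ P.last y w) ↔ P.lp y (some w) <+: P.lp y (some v) := by
  constructor
  · rintro ⟨h₁, h₂⟩
    obtain ⟨z, hz, hp, hl⟩ := exists_last hv h₂
    exact List.prefix_of_le_of_le (List.prefix_refl _) hp ((num_le_iff hw).1 h₁) hl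
  · intro h
    exact ⟨(num_le_iff hw).2 h.le_of_lex, num_le_last hv h⟩

theorem lexPath_prefix {p q : List (ℕ × ℕ)} : lexPath p <+: lexPath q ↔ p <+: q :=
  List.prefix_map_iff_of_injective toLex.injective

/-- The component numbers attached to a subtree are separated from those attached elsewhere. -/
theorem hull {y u w g₀ g₁ g₂ v a₀ b₀ a₁ b₁ a₂ b₂ : V} (h₀ : P.Joint y g₀ a₀ b₀)
    (h₁ : P.Joint y g₁ a₁ b₁) (h₂ : P.Joint y g₂ a₂ b₂) (hb₀ : S.comp y b₀ = some w)
    (hb₁ : S.comp y b₁ = some w) (hb₂ : S.comp y b₂ = some w) (hv : S.Child y v)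
    (hp : P.lp y (some g₀) <+: P.lp y (some v)) (hl : P.num y g₁ ≤ P.num y v)
    (hr : P.num y v ≤ P.last y g₂) (hu₁ : S.InSub u b₁) (hu₂ : S.InSub u b₂) : S.InSub u b₀ := by
  obtain ⟨t, ht⟩ := hp
  have e₀ : P.lp y (some v) = P.lp y (some w) ++ (toLex (lexPath (S.path b₀), S.id g₀) :: t) := by
    rw [← ht, h₀.spec.2.2, hb₀, List.append_assoc]; rfl
  -- After the common key of the component of `w`, keys are compared first by the symbolic path of
  -- the joining vertex. The path of `b₀` thus lies between those of `b₁` and `b₂`, and convexity of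
  -- prefixes applies to the path of `u`.
  have k₁ : lexPath (S.path b₁) ≤ lexPath (S.path b₀) := by
    have := (num_le_iff h₁.1).1 hl
    rw [e₀, h₁.spec.2.2, hb₁, List.append_le_append_left_iff, List.cons_le_cons_lex] at this
    have h' : toLex (lexPath (S.path b₁), S.id g₁) ≤ toLex (lexPath (S.path b₀), S.id g₀) := by
      rcases this with h | h
      · exact h.le
      · exact h.1.le
    exact Prod.Lex.monotone_fst _ _ h'
  have k₂ : lexPath (S.path b₀) ≤ lexPath (S.path b₂) := by
    obtain ⟨z, hz, ⟨t', ht'⟩, hle⟩ := exists_last hv hr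
    rw [e₀, ← ht', h₂.spec.2.2, hb₂, List.append_assoc, List.append_le_append_left_iff,
      List.singleton_append, List.cons_le_cons_lex] at hle
    have h' : toLex (lexPath (S.path b₀), S.id g₀) ≤ toLex (lexPath (S.path b₂), S.id g₂) := by
      rcases hle with h | h
      · exact h.le
      · exact h.1.le
    exact Prod.Lex.monotone_fst _ _ h'
  exact S.path_prefix_iff.1 (lexPath_prefix.1 (List.prefix_of_le_of_le
    (lexPath_prefix.2 (S.path_prefix_iff.2 hu₁)) (lexPath_prefix.2 (S.path_prefix_iff.2 hu₂)) k₁ k₂))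

/-- A proper descendant of a component lies below exactly one component attached to it. -/
theorem exists_joint_of_prefix {y w v : V} (hw : S.Child y w) (hv : S.Child y v)
    (h : P.lp y (some w) <+: P.lp y (some v)) (hne : v ≠ w) :
    ∃ g a b, P.Joint y g a b ∧ S.comp y b = some w ∧ P.lp y (some g) <+: P.lp y (some v) := by
  induction hl : (P.lp y (some v)).length using Nat.strong_induction_on generalizing v with
  | _ m ih =>
    rcases isTop_or_joint (P := P) hv with ht | ⟨a, b, hj⟩
    · rw [ht.lp_eq, List.prefix_nil] at h
      exact absurd (lp_injective hv hw (ht.lp_eq.trans h.symm)) hne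
    have e := hj.spec.2.2
    cases hb : S.comp y b with
    | none =>
      rw [hb, lp_none] at e
      -- If `v` is joined directly to the outside, its key has length one, so `w` would have the
      -- empty key and be a root component. Then `y` is the root of `T` and there is no outside.
      have hne' : P.lp y (some w) ≠ P.lp y (some v) := fun he => hne (lp_injective hw hv he).symm
      rw [e, List.nil_append] at h hne'
      rw [← List.nil_append [toLex (lexPath (S.path b), S.id v)], List.prefix_concat_iff] at h
      have h' := h.resolve_left (by simpa using hne')
      rw [List.prefix_nil] at h'
      rcases isTop_or_joint (P := P) hw with ht | ⟨a', b', hj'⟩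
      · have hy := ht.eq_root
        rw [Setting.comp_eq_none hj.ne.2.1, hy] at hb
        exact absurd (S.inSub_root b) hb
      · rw [hj'.spec.2.2] at h'; simp at h'
    | some v' =>
      rw [hb] at e
      have hv' := (Setting.comp_eq_some.1 hb).1
      by_cases hvw : v' = w
      · subst hvw
        exact ⟨v, a, b, hj, hb, List.prefix_refl _⟩
      · have h₁ : P.lp y (some w) <+: P.lp y (some v') := by
          rw [e, List.prefix_concat_iff] at h
          refine h.resolve_left fun h => hne (lp_injective hw hv (by rw [h, e])).symm
        obtain ⟨g, a', b', k₁, k₂, k₃⟩ := ih _ (by rw [← hl, e]; simp) hv' h₁ hvw rfl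
        exact ⟨g, a', b', k₁, k₂, k₃.trans (e ▸ List.prefix_append _ _)⟩

theorem Joint.prefix {y w g a b : V} (h : P.Joint y g a b) (hb : S.comp y b = some w) :
    P.lp y (some w) <+: P.lp y (some g) := by
  rw [h.spec.2.2, hb]; exact List.prefix_append _ _

theorem Joint.not_prefix {y w g a b : V} (h : P.Joint y g a b) (hb : S.comp y b = some w) :
    ¬ P.lp y (some g) <+: P.lp y (some w) := fun hp => by
  have := hp.length_le
  rw [h.spec.2.2, hb] at this
  simp at this

theorem Joint.eq_of_prefix {y w g g' v a b a' b' : V} (h : P.Joint y g a b) (h' : P.Joint y g' a' b')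
    (hb : S.comp y b = some w) (hb' : S.comp y b' = some w) (hp : P.lp y (some g) <+: P.lp y (some v))
    (hp' : P.lp y (some g') <+: P.lp y (some v)) : g = g' := by
  refine lp_injective h.1 h'.1 ((List.prefix_of_prefix_length_le hp hp' ?_).eq_of_length ?_) <;>
  · rw [h.spec.2.2, h'.spec.2.2, hb, hb']; simp

end Prep

/-! ### Expected messages and their positions within a phase. -/

namespace Setting

variable {V : Type} {κ n : ℕ} [Fintype V] (S : Setting κ n V)

/-- `u` is a vertex of `T_y` other than `y`. -/
def Under (y u : V) : Prop := S.InSub y u ∧ u ≠ y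

/-- The messages of `A_y`: downwards, between neighbours, and upwards. -/
def Expect (y : V) (p : Fin 6) (u v : V) : Prop :=
  match p with
  | 0 | 3 => S.InSub y u ∧ S.Child u v
  | 1 | 4 => S.Under y u ∧ S.Under y v ∧ S.G.Adj u v
  | 2 | 5 => S.Under y u ∧ S.Child v u

/-- The number of ancestors of `v` with identifier below `i`. -/
noncomputable def rank (v : V) (i : ℕ) : ℕ :=
  open Classical in (Finset.univ.filter fun z => S.InSub z v ∧ S.id z < i).card

/-- The position of a message in its phase. -/
noncomputable def pos (i : ℕ) (p : Fin 6) (u v : V) : ℕ :=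
  match p with
  | 0 | 3 => (S.rp v).length + S.rank v i
  | 1 | 4 => S.rank u i
  | 2 | 5 => 2 * (S.G.diam + 1 - (S.rp u).length) + S.rank u i

variable {S}

theorem Child.under {y u v : V} (h : S.Child u v) (hu : S.InSub y u) : S.Under y v :=
  ⟨hu.trans h.mem, fun e => h.not_inSub (e ▸ hu)⟩

theorem Child.inSub_of_under {y u v : V} (h : S.Child u v) (hv : S.Under y v) : S.InSub y u :=
  (h.inSub_iff.1 hv.1).resolve_left (Ne.symm hv.2)

theorem rank_lt (v y : V) (h : S.InSub y v) : S.rank v (S.id y) < (S.rp v).length := by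
  classical
  rw [rank, ← List.toFinset_card_of_nodup (S.rp_nodup v)]
  refine Finset.card_lt_card ⟨fun z hz => ?_, fun hs => ?_⟩
  · exact List.mem_toFinset.2 (Finset.mem_filter.1 hz).2.1
  · exact absurd (Finset.mem_filter.1 (hs (List.mem_toFinset.2 h))).2.2 (lt_irrefl _)

theorem rank_lt_rank {v y : V} {i : ℕ} (h : S.InSub y v) (hi : S.id y < i) :
    S.rank v (S.id y) < S.rank v i := by
  classical
  refine Finset.card_lt_card ⟨fun z hz => ?_, fun hs => ?_⟩
  · simp only [Finset.mem_filter, Finset.mem_univ, true_and] at hz ⊢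
    exact ⟨hz.1, hz.2.trans hi⟩
  · exact absurd (Finset.mem_filter.1 (hs (Finset.mem_filter.2 ⟨Finset.mem_univ y, h, hi⟩))).2.2 (lt_irrefl _)

/-- Passing to a child adds a single ancestor. The first bound is for the deadlines of messages
going down, the second for those going up. -/
theorem Child.rank_le {u v : V} (h : S.Child u v) (i : ℕ) : S.rank u i ≤ S.rank v i ∧
    S.rank v i ≤ S.rank u i + 1 := by
  classical
  constructor
  · refine Finset.card_le_card fun z hz => ?_
    simp only [Finset.mem_filter, Finset.mem_univ, true_and] at hz ⊢
    exact ⟨hz.1.trans h.mem, hz.2⟩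
  · refine (Finset.card_le_card (t := insert v (Finset.univ.filter fun z => S.InSub z u ∧ S.id z < i))
      fun z hz => ?_).trans (Finset.card_insert_le _ _)
    simp only [Finset.mem_filter, Finset.mem_univ, true_and, Finset.mem_insert] at hz ⊢
    rcases h.inSub_iff.1 hz.1 with e | e
    · exact Or.inl e
    · exact Or.inr ⟨e, hz.2⟩

theorem Child.length {u v : V} (h : S.Child u v) : (S.rp v).length = (S.rp u).length + 1 := by
  rw [h.rp_eq]; simp

theorem Expect.adj {y : V} {p : Fin 6} {u v : V} (h : S.Expect y p u v) : S.G.Adj u v := by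
  fin_cases p
  exacts [h.2.adj, h.2.2, h.2.adj.symm, h.2.adj, h.2.2, h.2.adj.symm]

theorem Expect.inSub {y : V} {p : Fin 6} {u v : V} (h : S.Expect y p u v) : S.InSub y u := by
  fin_cases p
  exacts [h.1, h.1.1, h.1.1, h.1, h.1.1, h.1.1]

theorem diam_pos_of_adj {u v : V} (h : S.G.Adj u v) : 0 < S.G.diam := by
  have : Nonempty V := ⟨u⟩
  have h₁ : S.G.dist u v = 1 := SimpleGraph.dist_eq_one_iff_adj.2 h
  have h₂ : S.G.dist u v ≤ S.G.diam := SimpleGraph.dist_le_diam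
    (SimpleGraph.connected_iff_ediam_ne_top.1 S.connected)
  omega

theorem pos_lt {y : V} {p : Fin 6} {u v : V} (h : S.Expect y p u v) :
    S.pos (S.id y) p u v < 4 * S.G.diam := by
  have hd := S.diam_pos_of_adj h.adj
  have hu := S.length_rp_le_diam u
  have hv := S.length_rp_le_diam v
  have hu' := S.length_rp_pos u
  have r₁ := rank_lt u y h.inSub
  have aux₀ : S.InSub y u → S.Child u v → (S.rp v).length + S.rank v (S.id y) < 4 * S.G.diam :=
    fun h₁ h₂ => by have := rank_lt v y (h₁.trans h₂.mem); omega
  have aux₁ : S.rank u (S.id y) < 4 * S.G.diam := by omega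
  have aux₂ : S.Child v u → 2 * (S.G.diam + 1 - (S.rp u).length) + S.rank u (S.id y) < 4 * S.G.diam := by
    intro hc
    have := hc.length
    have := S.length_rp_pos v
    omega
  fin_cases p
  exacts [aux₀ h.1 h.2, aux₁, aux₂ h.2, aux₀ h.1 h.2, aux₁, aux₂ h.2]

theorem pos_lt_pos {y y' : V} {p : Fin 6} {u v : V} (h : S.Expect y p u v)
    (hi : S.id y < S.id y') : S.pos (S.id y) p u v < S.pos (S.id y') p u v := by
  have aux₀ : S.InSub y u → S.Child u v → (S.rp v).length + S.rank v (S.id y) <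
    (S.rp v).length + S.rank v (S.id y') := fun h₁ h₂ =>
      Nat.add_lt_add_left (rank_lt_rank (h₁.trans h₂.mem) hi) _
  have aux := rank_lt_rank h.inSub hi
  fin_cases p
  exacts [aux₀ h.1 h.2, aux, Nat.add_lt_add_left aux _, aux₀ h.1 h.2, aux, Nat.add_lt_add_left aux _]

end Setting

/-! ### Soundness, progress and deadlines of the protocol. -/

namespace Prep

variable {V : Type} {κ n lam c : ℕ} [Fintype V] {S : Setting κ n V} (P : Prep S lam)
variable {K : Type} [Field K] (sd : (Fin (skDeg κ c n) → Bool) → K)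

open Protocol

theorem id_mem_nbU {y u w : V} {m : Msg K κ c n} (hm : (m.dep : ℕ) = (S.path y).length)
    (hu : S.InSub y u) (hw : S.G.Adj u w) :
    S.id w ∈ nbU (P.localInput u) (S.id y) m ↔ S.Under y w := by
  rw [nbU, Finset.mem_filter, id_mem_nb, path_eq P hw, pathN_id P hw, hm, ← S.inSub_iff_take hu,
    S.id_inj.ne_iff]
  exact ⟨fun h => ⟨h.2.2, h.2.1⟩, fun h => ⟨hw, h.2, h.1⟩⟩

theorem mem_nbU {y u : V} {m : Msg K κ c n} (hm : (m.dep : ℕ) = (S.path y).length)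
    (hu : S.InSub y u) {j : ℕ} :
    j ∈ nbU (P.localInput u) (S.id y) m ↔ ∃ w, S.G.Adj u w ∧ S.Under y w ∧ S.id w = j := by
  constructor
  · intro h
    obtain ⟨w, hw, rfl⟩ := (mem_nb P).1 (Finset.mem_filter.1 h).1
    exact ⟨w, hw, (id_mem_nbU P hm hu hw).1 h, rfl⟩
  · rintro ⟨w, hw, h, rfl⟩
    exact (id_mem_nbU P hm hu hw).2 h

/-- The messages of the protocol that may occur. -/
def Admissible (i : Fin (2 ^ (κ * lg n))) (p : Fin 6) (u v : V) (m : Msg K κ c n) : Prop :=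
  ∃ y, S.id y = i ∧ S.Expect y p u v ∧ (p = 0 → (m.dep : ℕ) = (S.path y).length)

variable {P sd} {i : Fin (2 ^ (κ * lg n))} {k : Table (Msg K κ c n)} {coin : CoinIdx κ c n → Bool}

theorem fromPar_admissible {v : V} (hk : ∀ j p m, k j p = some m → ∃ u, S.id u = j ∧ Admissible (S := S) i p u v m)
    {p : Fin 6} {m : Msg K κ c n} (h : fromPar (P.localInput v) k p = some m) :
    ∃ u, S.Child u v ∧ Admissible (S := S) i p u v m := by
  obtain ⟨j, hj, h⟩ := Option.bind_eq_some_iff.1 h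
  obtain ⟨u, hu, hg⟩ := hk j p m h
  exact ⟨u, (par_eq_id P).1 (hu ▸ hj), hg⟩

theorem fromPar_zero {v : V} (hk : ∀ j p m, k j p = some m → ∃ u, S.id u = j ∧ Admissible (S := S) i p u v m)
    {m : Msg K κ c n} (h : fromPar (P.localInput v) k 0 = some m) :
    ∃ y, S.id y = i ∧ S.Under y v ∧ (m.dep : ℕ) = (S.path y).length := by
  obtain ⟨u, hu, y, hy, he, hd⟩ := fromPar_admissible hk h
  exact ⟨y, hy, hu.under he.1, hd rfl⟩

theorem length_path_le (v : V) : (S.path v).length ≤ n :=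
  (S.length_path v).le.trans ((S.length_rp_le v).trans S.card_eq.le)

/-- Which neighbours are addressed depends on received contents only through the depth in the
messages of phase 0, so only this field has to be tracked. It lets a vertex cut the symbolic path of
`y` from its own. -/
theorem step_admissible {v : V}
    (hk : ∀ j p m, k j p = some m → ∃ u, S.id u = j ∧ Admissible (S := S) i p u v m)
    {w : V} {p : Fin 6} {m : Msg K κ c n} (hw : S.G.Adj v w)
    (h : step sd (P.localInput v) coin i k (S.id w) p = some m) : Admissible (S := S) i p v w m := by
  unfold step at h
  have hch : S.id w ∈ (P.localInput v).ch ↔ S.Child v w := id_mem_ch P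
  by_cases hv : (P.localInput v).id = i
  · rw [if_pos hv] at h
    split_ifs at h with h₁ h₂ h₃
    · subst h₂
      refine ⟨v, hv, ⟨Setting.InSub.refl v, hch.1 h₁⟩, fun _ => ?_⟩
      rw [← Option.some_injective _ h]
      change (P.localInput v).path.length % (n + 1) = _
      rw [path_eq P hw, Nat.mod_eq_of_lt (Nat.lt_succ_of_le (length_path_le v))]
    · subst h₃
      exact ⟨v, hv, ⟨Setting.InSub.refl v, hch.1 h₁⟩, fun e => absurd e (by decide)⟩
  · rw [if_neg hv] at h
    split_ifs at h with h₁ h₂ h₃ h₄ h₅ h₆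
    · obtain ⟨u, hu, y, hy, he, hd⟩ := fromPar_admissible hk h
      refine ⟨y, hy, ?_, hd⟩
      rcases h₁ with rfl | rfl <;> exact ⟨(hu.under he.1).1, hch.1 h₂⟩
    · obtain ⟨m', hm, h⟩ := Option.bind_eq_some_iff.1 h
      split_ifs at h with h₄
      obtain ⟨y, hy, hu, hd⟩ := fromPar_zero hk hm
      subst h₃
      exact ⟨y, hy, ⟨hu, (id_mem_nbU P hd hu.1 hw).1 (hy ▸ h₄), hw⟩, fun e => absurd e (by decide)⟩
    · obtain ⟨m', hm, h⟩ := Option.bind_eq_some_iff.1 h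
      split_ifs at h with h₅
      obtain ⟨y, hy, hu, hd⟩ := fromPar_zero hk hm
      subst h₄
      exact ⟨y, hy, ⟨hu, (id_mem_nbU P hd hu.1 hw).1 (hy ▸ h₅), hw⟩, fun e => absurd e (by decide)⟩
    · obtain ⟨m', hm, h⟩ := Option.bind_eq_some_iff.1 h
      obtain ⟨y, hy, hu, hd⟩ := fromPar_zero hk hm
      subst h₆
      exact ⟨y, hy, ⟨hu, (par_eq_id P).1 h₅⟩, fun e => absurd e (by decide)⟩
    · obtain ⟨m', hm, h⟩ := Option.bind_eq_some_iff.1 h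
      obtain ⟨y, hy, hu, hd⟩ := fromPar_zero hk hm
      have : p = 5 := by omega
      subst this
      exact ⟨y, hy, ⟨hu, (par_eq_id P).1 h₅⟩, fun e => absurd e (by decide)⟩

/-- The time by which a message is due. -/
noncomputable def due (S : Setting κ n V) (i : Fin (2 ^ (κ * lg n))) (p : Fin 6) (u v : V) : ℕ :=
  p * (4 * S.G.diam) + S.pos i p u v

theorem due_lt_due {y : V} (hy : S.id y = i) {i' : Fin (2 ^ (κ * lg n))} {p p' : Fin 6} (hp : p < p')
    {u v u' v' : V} (h : S.Expect y p u v) : due S i p u v < due S i' p' u' v' := by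
  have h₁ : S.pos i p u v < 4 * S.G.diam := hy ▸ S.pos_lt h
  have h₂ : ((p : ℕ) + 1) * (4 * S.G.diam) ≤ p' * (4 * S.G.diam) := Nat.mul_le_mul_right _ hp
  rw [Nat.succ_mul] at h₂
  unfold due
  omega

section Progress

variable {v : V} (hk : ∀ j p m, k j p = some m → ∃ u, S.id u = j ∧ Admissible (S := S) i p u v m)

theorem fromPar_isSome {y : V} (hv : S.Under y v) {p : Fin 6}
    (h : ∀ u, S.Child u v → S.InSub y u → (k (S.id u) p).isSome) :
    (fromPar (P.localInput v) k p).isSome := by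
  have hs : v ≠ S.s := fun e => hv.2 (((Setting.InSub.antisymm hv.1 (e ▸ S.inSub_root y))).symm)
  obtain ⟨u, hu⟩ := S.child_of_ne_root hs
  rw [fromPar, par_child P hu]
  exact h u hu (hu.inSub_of_under hv)

theorem fromCh_isSome {p : Fin 6} (h : ∀ u, S.Child v u → (k (S.id u) p).isSome) :
    (fromCh (P.localInput v) k p).isSome := by
  refine gather_isSome fun j hj => ?_
  obtain ⟨u, hu, rfl⟩ := (mem_ch P).1 hj
  exact h u hu

include hk in
theorem fromNb_isSome {y : V} (hy : S.id y = i) (hv : S.Under y v) {p : Fin 6}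
    (h₀ : ∀ u, S.Child u v → S.InSub y u → (k (S.id u) 0).isSome)
    (h : ∀ u, S.G.Adj v u → S.Under y u → (k (S.id u) p).isSome) :
    (fromNb (P.localInput v) i k p).isSome := by
  obtain ⟨m, hm⟩ := Option.isSome_iff_exists.1 (fromPar_isSome (P := P) hv h₀)
  rw [fromNb, hm]
  refine gather_isSome fun j hj => ?_
  obtain ⟨y', hy', -, hd⟩ := fromPar_zero hk hm
  obtain rfl := S.id_inj (hy'.trans hy.symm)
  rw [← hy] at hj
  obtain ⟨u, hu, hu', rfl⟩ := (mem_nbU P hd hv.1).1 hj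
  exact h u hu hu'

end Progress

theorem bind_isSome {X Y : Type} {o : Option X} {f : X → Option Y} (h : o.isSome)
    (hf : ∀ x, o = some x → (f x).isSome) : (o.bind f).isSome := by
  obtain ⟨x, rfl⟩ := Option.isSome_iff_exists.1 h
  exact hf x rfl

/-- Inputs from earlier phases are due earlier by `due_lt_due`. Inputs of the same phase come from
the parent when going down and from the children when going up, and the positions are strictly
monotone along these directions. -/
theorem step_progress {v : V}
    (hk : ∀ j p m, k j p = some m → ∃ u, S.id u = j ∧ Admissible (S := S) i p u v m)
    {w : V} {p : Fin 6} {y : V} (hy : S.id y = i) (h : S.Expect y p v w)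
    (hs : ∀ u p', S.Expect y p' u v → due S i p' u v < due S i p v w → (k (S.id u) p').isSome) :
    (step sd (P.localInput v) coin i k (S.id w) p).isSome := by
  have hid : ∀ u : V, (P.localInput u).id = S.id u := fun _ => rfl
  have e₀ : (0 : Fin 6) < p → S.Under y v → ∀ u, S.Child u v → S.InSub y u → (k (S.id u) 0).isSome :=
    fun hp hv u hu hyu => hs u 0 ⟨hyu, hu⟩ (due_lt_due hy hp ⟨hyu, hu⟩)
  have e₁ : (1 : Fin 6) < p → S.Under y v → ∀ u, S.G.Adj v u → S.Under y u → (k (S.id u) 1).isSome :=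
    fun hp hv u hu hyu => hs u 1 ⟨hyu, hv, hu.symm⟩ (due_lt_due hy hp ⟨hyu, hv, hu.symm⟩)
  have e₂ : (2 : Fin 6) < p → S.InSub y v → ∀ u, S.Child v u → (k (S.id u) 2).isSome :=
    fun hp hv u hu => hs u 2 ⟨hu.under hv, hu⟩ (due_lt_due hy hp ⟨hu.under hv, hu⟩)
  have e₃ : (3 : Fin 6) < p → S.Under y v → ∀ u, S.Child u v → S.InSub y u → (k (S.id u) 3).isSome :=
    fun hp hv u hu hyu => hs u 3 ⟨hyu, hu⟩ (due_lt_due hy hp ⟨hyu, hu⟩)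
  have e₄ : (4 : Fin 6) < p → S.Under y v → ∀ u, S.G.Adj v u → S.Under y u → (k (S.id u) 4).isSome :=
    fun hp hv u hu hyu => hs u 4 ⟨hyu, hv, hu.symm⟩ (due_lt_due hy hp ⟨hyu, hv, hu.symm⟩)
  have down : ∀ q : Fin 6, q = 0 ∨ q = 3 → p = q → S.Child v w → S.Under y v → ∀ u, S.Child u v →
      S.InSub y u → (k (S.id u) q).isSome := by
    intro q hq hp hvw hv u hu hyu
    subst hp
    have hE : S.Expect y p u v := by rcases hq with rfl | rfl <;> exact ⟨hyu, hu⟩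
    refine hs u p hE ?_
    have l := hvw.length
    have r := (hvw.rank_le i).1
    have : S.pos i p u v < S.pos i p v w := by
      rcases hq with rfl | rfl <;>
      · change (S.rp v).length + S.rank v i < (S.rp w).length + S.rank w i
        omega
    exact Nat.add_lt_add_left this _
  have up : ∀ q : Fin 6, q = 2 ∨ q = 5 → p = q → S.Under y v → ∀ u, S.Child v u →
      (k (S.id u) q).isSome := by
    intro q hq hp hv u hu
    subst hp
    have hE : S.Expect y p u v := by rcases hq with rfl | rfl <;> exact ⟨hu.under hv.1, hu⟩
    refine hs u p hE ?_
    have l := hu.length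
    have r := (hu.rank_le i).2
    have l' := S.length_rp_le_diam u
    -- The rank can fall by one from child to parent; the factor 2 before the height outweighs this.
    have : S.pos i p u v < S.pos i p v w := by
      rcases hq with rfl | rfl <;>
      · change 2 * (S.G.diam + 1 - (S.rp u).length) + S.rank u i <
          2 * (S.G.diam + 1 - (S.rp v).length) + S.rank v i
        omega
    exact Nat.add_lt_add_left this _
  have hne : S.Under y v → ¬ (P.localInput v).id = i := fun hv e =>
    hv.2 (S.id_inj (e.trans hy.symm))
  have hnb : S.Under y v → ∀ m, fromPar (P.localInput v) k 0 = some m → S.G.Adj v w → S.Under y w →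
      S.id w ∈ nbU (P.localInput v) i m := by
    intro hv m hm hvw hw
    obtain ⟨y', hy', -, hd⟩ := fromPar_zero hk hm
    obtain rfl := S.id_inj (hy'.trans hy.symm)
    rw [← hy]
    exact (id_mem_nbU P hd hv.1 hvw).2 hw
  have hp : p = 0 ∨ p = 1 ∨ p = 2 ∨ p = 3 ∨ p = 4 ∨ p = 5 := by omega
  unfold step
  rcases hp with rfl | rfl | rfl | rfl | rfl | rfl
  · have hc := (id_mem_ch P).2 h.2
    by_cases hv : v = y
    · subst hv
      simp [hid, hy, hc]
    · rw [if_neg (hne ⟨h.1, hv⟩), if_pos (Or.inl rfl), if_pos hc]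
      exact fromPar_isSome ⟨h.1, hv⟩ (down 0 (Or.inl rfl) rfl h.2 ⟨h.1, hv⟩)
  · rw [if_neg (hne h.1), if_neg (by decide), if_pos rfl]
    refine bind_isSome (fromPar_isSome h.1 (e₀ (by decide) h.1)) fun m hm => ?_
    rw [if_pos (hnb h.1 m hm h.2.2 h.2.1)]; rfl
  · rw [if_neg (hne h.1), if_neg (by decide), if_neg (by decide), if_neg (by decide),
      if_pos ((par_eq_id P).2 h.2), if_pos rfl]
    exact bind_isSome (fromPar_isSome h.1 (e₀ (by decide) h.1)) fun m hm =>
      bind_isSome (fromNb_isSome hk hy h.1 (e₀ (by decide) h.1) (e₁ (by decide) h.1)) fun c₁ _ =>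
      bind_isSome (fromCh_isSome (up 2 (Or.inl rfl) rfl h.1)) fun _ _ => rfl
  · have hc := (id_mem_ch P).2 h.2
    by_cases hv : v = y
    · subst hv
      rw [if_pos (show (P.localInput v).id = ↑i from hy), if_pos hc, if_neg (by decide), if_pos rfl, Option.isSome_map]
      exact fromCh_isSome (e₂ (by decide) h.1)
    · rw [if_neg (hne ⟨h.1, hv⟩), if_pos (Or.inr rfl), if_pos hc]
      exact fromPar_isSome ⟨h.1, hv⟩ (down 3 (Or.inr rfl) rfl h.2 ⟨h.1, hv⟩)
  · rw [if_neg (hne h.1), if_neg (by decide), if_neg (by decide), if_pos rfl]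
    refine bind_isSome (fromPar_isSome h.1 (e₀ (by decide) h.1)) fun m hm => ?_
    rw [if_pos (hnb h.1 m hm h.2.2 h.2.1)]
    exact fromPar_isSome h.1 (e₃ (by decide) h.1)
  · rw [if_neg (hne h.1), if_neg (by decide), if_neg (by decide), if_neg (by decide),
      if_pos ((par_eq_id P).2 h.2), if_neg (by decide)]
    exact bind_isSome (fromPar_isSome h.1 (e₀ (by decide) h.1)) fun m hm =>
      bind_isSome (fromNb_isSome hk hy h.1 (e₀ (by decide) h.1) (e₁ (by decide) h.1)) fun c₁ _ =>
      bind_isSome (fromPar_isSome h.1 (e₃ (by decide) h.1)) fun _ _ =>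
      bind_isSome (fromNb_isSome hk hy h.1 (e₀ (by decide) h.1) (e₄ (by decide) h.1)) fun _ _ =>
      bind_isSome (fromCh_isSome (up 5 (Or.inr rfl) rfl h.1)) fun _ _ => rfl

variable (P sd)

/-- The analysis of the protocol on a network. -/
noncomputable def analysis (act : Set (Fin (2 ^ (κ * lg n))))
    (coin : V → Fin (2 ^ (κ * lg n)) → CoinIdx κ c n → Bool) :
    SchedState.Analysis (family sd lam) act S.G S.id P.localInput coin where
  Good i p u v m := Admissible (S := S) i p u v m
  Exp i p u v := ∃ y, S.id y = i ∧ S.Expect y p u v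
  dl i p u v := due S i p u v
  bound := 24 * S.G.diam
  exp_adj := fun ⟨_, _, h⟩ => h.adj
  exp_of_good := fun ⟨y, hy, h, _⟩ => ⟨y, hy, h⟩
  closure := fun _ hk _ _ _ hw h => step_admissible hk hw h
  progress := fun _ hk _ _ ⟨_, hy, h⟩ hs => step_progress hk hy h fun u p' he hl => hs u p' ⟨_, hy, he⟩ hl
  dl_order := by
    rintro i i' p p' u v - - ⟨y, hy, h⟩ ⟨y', hy', h'⟩ (hp | ⟨rfl, hi⟩)
    · exact due_lt_due hy hp h
    · have hi' : (i : ℕ) < i' := hi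
      rw [← hy, ← hy'] at hi'
      unfold due
      rw [← hy, ← hy']
      exact Nat.add_lt_add_left (S.pos_lt_pos h hi') _
  dl_lt := by
    rintro i p u v ⟨y, hy, h⟩
    have h₁ := S.pos_lt h
    rw [hy] at h₁
    have h₂ : ((p : ℕ) + 1) * (4 * S.G.diam) ≤ 6 * (4 * S.G.diam) := Nat.mul_le_mul_right _ (by omega)
    rw [Nat.succ_mul] at h₂
    unfold due
    omega

end Prep

/-! ### Connectivity inside a set of vertices. -/

section Linked

variable {V : Type} (G : SimpleGraph V)

/-- Connectivity inside a set of vertices. -/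
def Linked (A : V → Prop) : V → V → Prop := Relation.ReflTransGen fun u v => A u ∧ A v ∧ G.Adj u v

variable {G}

theorem Linked.symm {A : V → Prop} {u v : V} (h : Linked G A u v) : Linked G A v u := by
  induction h with
  | refl => exact .refl
  | tail _ h ih => exact Relation.ReflTransGen.head ⟨h.2.1, h.1, h.2.2.symm⟩ ih

theorem Linked.mono {A B : V → Prop} (hAB : ∀ v, A v → B v) {u v : V} (h : Linked G A u v) :
    Linked G B u v := Relation.ReflTransGen.mono (fun _ _ h => ⟨hAB _ h.1, hAB _ h.2.1, h.2.2⟩) _ _ h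

theorem Linked.trans {A : V → Prop} {u v w : V} (h : Linked G A u v) (h' : Linked G A v w) :
    Linked G A u w := Relation.ReflTransGen.trans h h'

theorem Linked.single {A : V → Prop} {u v : V} (hu : A u) (hv : A v) (h : G.Adj u v) : Linked G A u v :=
  Relation.ReflTransGen.single ⟨hu, hv, h⟩

theorem Linked.reachable {A : Set V} {u v : V} (h : Linked G (· ∈ A) u v) (hu : u ∈ A) :
    ∃ hv : v ∈ A, (G.induce A).Reachable ⟨u, hu⟩ ⟨v, hv⟩ := by
  induction h with
  | refl => exact ⟨hu, .refl _⟩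
  | tail _ h ih =>
    obtain ⟨hv, ih⟩ := ih
    exact ⟨h.2.1, ih.trans (SimpleGraph.Adj.reachable h.2.2)⟩

end Linked

/-! ### Attachment to a component, and the parts of the graph without `x` and `y`. -/

namespace Prep

variable {V : Type} {κ n lam : ℕ} [Fintype V] {S : Setting κ n V} (P : Prep S lam)

/-- The vertex `v` lies in the subtree of components below the one of `w`. -/
def Below (y w v : V) : Prop := ∃ w', S.comp y v = some w' ∧ P.lp y (some w) <+: P.lp y (some w')

variable {P} {y : V}

theorem Below.ne {w v : V} (h : P.Below y w v) : v ≠ y := by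
  rintro rfl
  obtain ⟨w', h, -⟩ := h
  rw [Setting.comp_self] at h; cases h

theorem below_of_comp {w v : V} (h : S.comp y v = some w) : P.Below y w v := ⟨w, h, List.prefix_refl _⟩

theorem ne_of_comp {w v : V} (h : S.comp y v = some w) : v ≠ y := by
  rintro rfl
  rw [Setting.comp_self] at h; cases h

theorem Joint.comp_left {g a b : V} (h : P.Joint y g a b) : S.comp y a = some g := h.spec.2.1

theorem Joint.not_below {w a b : V} (h : P.Joint y w a b) : ¬ P.Below y w b := by
  rintro ⟨w', e, hp⟩
  exact h.not_prefix e hp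

theorem Joint.below_of_below {κ' g a b v : V} (h : P.Joint y g a b) (hb : S.comp y b = some κ')
    (hv : P.Below y g v) : P.Below y κ' v := by
  obtain ⟨w', e, hp⟩ := hv
  exact ⟨w', e, (h.prefix hb).trans hp⟩

theorem Joint.comp_ne {κ' g a b v : V} (h : P.Joint y g a b) (hb : S.comp y b = some κ')
    (hv : P.Below y g v) : S.comp y v ≠ some κ' := by
  rintro e
  obtain ⟨w', e', hp⟩ := hv
  rw [e] at e'
  exact h.not_prefix hb (Option.some_injective _ e' ▸ hp)

theorem exists_joint_of_below {κ' v : V} (hκ : S.Child y κ') (h : P.Below y κ' v)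
    (hne : S.comp y v ≠ some κ') : ∃ g a b, P.Joint y g a b ∧ S.comp y b = some κ' ∧ P.Below y g v := by
  obtain ⟨w', e, hp⟩ := h
  obtain ⟨g, a, b, h₁, h₂, h₃⟩ := exists_joint_of_prefix hκ (Setting.comp_eq_some.1 e).1 hp
    fun e' => hne (e' ▸ e)
  exact ⟨g, a, b, h₁, h₂, w', e, h₃⟩

theorem exists_joint_of_not_below {κ' v : V} (hκ : S.Child y κ') (hv : v ≠ y) (h : ¬ P.Below y κ' v) :
    ∃ a b, P.Joint y κ' a b := by
  rcases isTop_or_joint (P := P) hκ with ht | hj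
  · refine absurd ?_ h
    cases e : S.comp y v with
    | none =>
      rw [Setting.comp_eq_none hv, ht.eq_root] at e
      exact absurd (S.inSub_root v) e
    | some w => exact ⟨w, e, ht.lp_eq ▸ List.nil_prefix⟩
  · exact hj

variable (P)

open scoped Classical in
/-- The vertex of the component of `k` through which `v` is attached to it. -/
noncomputable def att (y k v : V) : V :=
  if S.comp y v = some k then v
  else if h : ∃ z g a, P.Joint y g a z ∧ S.comp y z = some k ∧ P.Below y g v then h.choose
  else if h : ∃ z b, P.Joint y k z b then h.choose else v

variable {P} {k : V}

theorem att_self {v : V} (h : S.comp y v = some k) : P.att y k v = v := if_pos h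

theorem att_below {v g a z : V} (h : P.Joint y g a z) (hz : S.comp y z = some k) (hv : P.Below y g v) :
    P.att y k v = z := by
  have hx : ∃ z g a, P.Joint y g a z ∧ S.comp y z = some k ∧ P.Below y g v := ⟨z, g, a, h, hz, hv⟩
  rw [att, if_neg (h.comp_ne hz hv), dif_pos hx]
  obtain ⟨g', a', h', hz', hv'⟩ := hx.choose_spec
  obtain ⟨w, e, hp⟩ := hv
  obtain ⟨w', e', hp'⟩ := hv'
  rw [e] at e'
  obtain rfl := Option.some_injective _ e'
  obtain rfl := h.eq_of_prefix h' hz hz' hp hp'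
  exact (h'.unique h).2

theorem att_out {v z b : V} (h : P.Joint y k z b) (hv : ¬ P.Below y k v) : P.att y k v = z := by
  have hx : ∃ z b, P.Joint y k z b := ⟨z, b, h⟩
  rw [att, if_neg fun e => hv (below_of_comp e), dif_neg, dif_pos hx]
  · obtain ⟨b', h'⟩ := hx.choose_spec
    exact (h'.unique h).1
  · rintro ⟨z, g, a, hj, hz, hb⟩
    exact hv (hj.below_of_below hz hb)

/-- The ways in which a vertex can be attached. -/
theorem att_cases (hk : S.Child y k) {v : V} (hv : v ≠ y) :
    S.comp y v = some k ∨ (∃ g a z, P.Joint y g a z ∧ S.comp y z = some k ∧ P.Below y g v) ∨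
      (¬ P.Below y k v ∧ ∃ z b, P.Joint y k z b) := by
  by_cases h : S.comp y v = some k
  · exact Or.inl h
  · by_cases hb : P.Below y k v
    · exact Or.inr (Or.inl (exists_joint_of_below hk hb h))
    · exact Or.inr (Or.inr ⟨hb, exists_joint_of_not_below hk hv hb⟩)

theorem comp_att (hk : S.Child y k) {v : V} (hv : v ≠ y) : S.comp y (P.att y k v) = some k := by
  rcases att_cases (P := P) hk hv with h | ⟨g, a, z, hj, hz, hb⟩ | ⟨h, z, b, hj⟩
  · rw [att_self h]; exact h
  · rw [att_below hj hz hb]; exact hz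
  · rw [att_out hj h]; exact hj.comp_left

variable (P)

/-- The vertex `q` names the part of `v` in the graph without `x` and `y`. -/
def PartRel (y k x v q : V) : Prop :=
  (S.Child x q ∧ S.InSub q (P.att y k v)) ∨
  (P.att y k v = x ∧ ∃ g, P.Joint y g q x ∧ P.Below y g v) ∨
  (P.att y k v = x ∧ ¬ P.Below y k v ∧ P.Joint y k x q) ∨
  (S.Child q x ∧ ¬ S.InSub x (P.att y k v))

/-- The vertex `q` is the name of a part. -/
def NameRel (y k x q : V) : Prop :=
  S.Child x q ∨ (∃ g, P.Joint y g q x) ∨ P.Joint y k x q ∨ (S.Child q x ∧ q ≠ y)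

variable {P} {x : V}

theorem comp_of_inSub {z v : V} (hz : S.comp y z = some k) (h : S.InSub z v) : S.comp y v = some k := by
  obtain ⟨h₁, h₂⟩ := Setting.comp_eq_some.1 hz
  exact Setting.comp_eq_some.2 ⟨h₁, h₂.trans h⟩

theorem comp_parent {q : V} (hx : S.comp y x = some k) (h : S.Child q x) (hq : q ≠ y) : S.comp y q = some k :=
  (comp_eq_of_child h hq (ne_of_comp hx)).trans hx

theorem NameRel.ne (hx : S.comp y x = some k) {q : V} (h : P.NameRel y k x q) : q ≠ x ∧ q ≠ y := by
  have hk := (Setting.comp_eq_some.1 hx).1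
  rcases h with h | ⟨g, h⟩ | h | h
  · exact ⟨h.ne.symm, ne_of_comp (comp_of_inSub hx h.mem)⟩
  · exact ⟨h.ne.2.2.ne, h.ne.1⟩
  · exact ⟨h.ne.2.2.ne', h.ne.2.1⟩
  · exact ⟨h.1.ne, h.2⟩

theorem PartRel.nameRel (hx : S.comp y x = some k) {v q : V} (hv : v ≠ y) (h : P.PartRel y k x v q) :
    P.NameRel y k x q := by
  have hk := (Setting.comp_eq_some.1 hx).1
  rcases h with h | ⟨-, g, h, -⟩ | ⟨-, -, h⟩ | ⟨h, h'⟩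
  · exact Or.inl h.1
  · exact Or.inr (Or.inl ⟨g, h⟩)
  · exact Or.inr (Or.inr (Or.inl h))
  · refine Or.inr (Or.inr (Or.inr ⟨h, ?_⟩))
    rintro rfl
    obtain ⟨h₁, h₂⟩ := Setting.comp_eq_some.1 (comp_att (P := P) hk hv)
    obtain ⟨-, h₃⟩ := Setting.comp_eq_some.1 hx
    rcases h.inSub_iff.1 h₃ with e | e
    · exact h' (e ▸ h₂)
    · exact hk.not_inSub e

theorem NameRel.partRel (hx : S.comp y x = some k) {q : V} (h : P.NameRel y k x q) :
    P.PartRel y k x q q := by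
  rcases h with h | ⟨g, h⟩ | h | h
  · refine Or.inl ⟨h, ?_⟩
    rw [att_self (comp_of_inSub hx h.mem)]
    exact Setting.InSub.refl q
  · have hb : P.Below y g q := below_of_comp h.comp_left
    exact Or.inr (Or.inl ⟨att_below h hx hb, g, h, hb⟩)
  · exact Or.inr (Or.inr (Or.inl ⟨att_out h h.not_below, h.not_below, h⟩))
  · refine Or.inr (Or.inr (Or.inr ⟨h.1, ?_⟩))
    rw [att_self (comp_parent hx h.1 h.2)]
    exact h.1.not_inSub

theorem exists_partRel (hx : S.comp y x = some k) {v : V} (hv : v ≠ y) (hvx : v ≠ x) :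
    ∃ q, P.PartRel y k x v q := by
  have hk := (Setting.comp_eq_some.1 hx).1
  by_cases h : S.InSub x (P.att y k v)
  · by_cases e : P.att y k v = x
    · rcases att_cases (P := P) hk hv with h₁ | ⟨g, a, z, hj, hz, hb⟩ | ⟨h₁, z, b, hj⟩
      · rw [att_self h₁] at e
        exact absurd e hvx
      · obtain rfl := (att_below hj hz hb).symm.trans e
        exact ⟨a, Or.inr (Or.inl ⟨e, g, hj, hb⟩)⟩
      · obtain rfl := (att_out hj h₁).symm.trans e
        exact ⟨b, Or.inr (Or.inr (Or.inl ⟨e, h₁, hj⟩))⟩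
    · obtain ⟨q, h₁, h₂⟩ := S.exists_child_of_inSub h e
      exact ⟨q, Or.inl ⟨h₁, h₂⟩⟩
  · have hs : x ≠ S.s := by
      rintro rfl
      exact h (S.inSub_root _)
    obtain ⟨q, hq⟩ := S.child_of_ne_root hs
    exact ⟨q, Or.inr (Or.inr (Or.inr ⟨hq, h⟩))⟩

section Connectivity

theorem joined_subtree {A : V → Prop} {w v : V} (hA : ∀ z, S.InSub w z → A z) (h : S.InSub w v) :
    Linked S.G A w v := by
  refine S.induction_below (P := fun v => Linked S.G A w v) .refl ?_ h
  intro u v hu hc ih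
  exact ih.trans (.single (hA _ hu) (hA _ (hu.trans hc.mem)) hc.adj)

/-- Each component is connected through the child of `y` at its top, and the joining edges link it
to its parent component inside the branch. The induction is on the length of the key. -/
theorem Joint.joined {g a b v : V} (h : P.Joint y g a b) (hv : P.Below y g v) :
    Linked S.G (P.Below y g) a v := by
  have aux : ∀ w z z', P.Below y g w → S.comp y w = some w → S.comp y z = some w →
      S.comp y z' = some w → Linked S.G (P.Below y g) z z' := by
    intro w z z' hw hww hz hz'
    have hA : ∀ u, S.InSub w u → P.Below y g u := fun u hu => by
      obtain ⟨w', e, hp⟩ := hw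
      rw [hww] at e
      exact ⟨w', comp_of_inSub (hww.trans e) hu, hp⟩
    exact (joined_subtree hA (Setting.comp_eq_some.1 hz).2).symm.trans
      (joined_subtree hA (Setting.comp_eq_some.1 hz').2)
  obtain ⟨w, e, hp⟩ := hv
  induction hl : (P.lp y (some w)).length using Nat.strong_induction_on generalizing v w with
  | _ m ih =>
    have hw := (Setting.comp_eq_some.1 e).1
    have hww := Setting.comp_child hw
    by_cases hgw : w = g
    · subst hgw
      exact aux w a v ⟨w, hww, hp⟩ hww h.comp_left e
    · obtain ⟨a', b', hj⟩ : ∃ a b, P.Joint y w a b := by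
        rcases isTop_or_joint (P := P) hw with ht | hj
        · exfalso
          rw [ht.lp_eq, List.prefix_nil, h.spec.2.2] at hp
          simp at hp
        · exact hj
      have hb' : P.Below y g b' := by
        by_contra hb
        have hx := hj.spec.2.2
        rw [hx, List.prefix_concat_iff] at hp
        rcases hp with hp | hp
        · exact hgw (lp_injective hw h.1 (by rw [hx, hp]))
        · cases e' : S.comp y b' with
          | none =>
            rw [e', lp_none, List.prefix_nil, h.spec.2.2] at hp
            simp at hp
          | some w' => rw [e'] at hp; exact hb ⟨w', e', hp⟩
      obtain ⟨w', e', hp'⟩ := hb'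
      have hlen : (P.lp y (some w')).length < m := by
        rw [← hl, hj.spec.2.2, e']; simp
      have h₁ := ih _ hlen w' e' hp' rfl
      have h₂ : P.Below y g a' := ⟨w, hj.comp_left, hp⟩
      exact h₁.trans ((Linked.single ⟨w', e', hp'⟩ h₂ hj.ne.2.2.symm).trans
        (aux w a' v ⟨w, hww, hp⟩ hww hj.comp_left e))

/-- From any vertex outside the branch of `k` one can climb towards the root of the tree of
components without entering that branch. All climbs end at the same vertex: the root of `T`, or the
top of the unique root component. -/
theorem Joint.joined_out {a b v : V} (h : P.Joint y k a b) (hv : v ≠ y) (hb : ¬ P.Below y k v) :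
    Linked S.G (fun z => z ≠ y ∧ ¬ P.Below y k z) b v := by
  have rest : ∀ z, z ≠ y → S.comp y z = none → S.s ≠ y ∧ Linked S.G (fun z => z ≠ y ∧ ¬ P.Below y k z) S.s z := by
    intro z hz hc
    have hnz := (Setting.comp_eq_none hz).1 hc
    have hs : S.s ≠ y := fun e => hnz (e ▸ S.inSub_root z)
    refine ⟨hs, S.induction_down (P := fun z => ¬ S.InSub y z →
      Linked S.G (fun z => z ≠ y ∧ ¬ P.Below y k z) S.s z) (fun _ => .refl) (fun u z hu ih hz => ?_) z hnz⟩
    have key : ∀ z, ¬ S.InSub y z → z ≠ y ∧ ¬ P.Below y k z := fun z hz => by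
      have hzy : z ≠ y := fun e => hz (e ▸ Setting.InSub.refl _)
      refine ⟨hzy, fun ⟨w, e, _⟩ => ?_⟩
      rw [(Setting.comp_eq_none hzy).2 hz] at e; cases e
    have hu' : ¬ S.InSub y u := fun h => hz (h.trans hu.mem)
    exact (ih hu').trans (.single (key u hu') (key z hz) hu.adj)
  -- Parents of components outside the branch of `k` are again outside it, because the branch is
  -- closed under descendants.
  have up : ∀ z, z ≠ y → ¬ P.Below y k z → ∃ r, Linked S.G (fun z => z ≠ y ∧ ¬ P.Below y k z) r z ∧
      ((S.s ≠ y ∧ r = S.s) ∨ P.IsTop y r) := by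
    intro z hz hbz
    induction hl : (P.lp y (S.comp y z)).length using Nat.strong_induction_on generalizing z with
    | _ m ih =>
      cases e : S.comp y z with
      | none =>
        obtain ⟨h₁, h₂⟩ := rest z hz e
        exact ⟨S.s, h₂, Or.inl ⟨h₁, rfl⟩⟩
      | some w =>
        obtain ⟨hw, hwz⟩ := Setting.comp_eq_some.1 e
        have hA : ∀ u, S.InSub w u → u ≠ y ∧ ¬ P.Below y k u := fun u hu => by
          have hc := comp_of_inSub (Setting.comp_child hw) hu
          refine ⟨ne_of_comp hc, fun ⟨w', e', hp⟩ => hbz ⟨w', ?_, hp⟩⟩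
          rw [e, ← hc, e']
        have hwz' := joined_subtree hA hwz
        rcases isTop_or_joint (P := P) hw with ht | ⟨a', b', hj⟩
        · exact ⟨w, hwz', Or.inr ht⟩
        · have hb' : ¬ P.Below y k b' := by
            rintro ⟨w', e', hp⟩
            exact hbz ⟨w, e, hp.trans (hj.prefix e')⟩
          have hlen : (P.lp y (S.comp y b')).length < m := by
            rw [← hl, e, hj.spec.2.2]; simp
          obtain ⟨r, h₁, h₂⟩ := ih _ hlen b' hj.ne.2.1 hb' rfl
          have ha := (Setting.comp_eq_some.1 hj.comp_left).2
          exact ⟨r, h₁.trans ((Linked.single (A := fun z => z ≠ y ∧ ¬ P.Below y k z) ⟨hj.ne.2.1, hb'⟩ (hA a' ha) hj.ne.2.2.symm).trans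
            ((joined_subtree hA ha).symm.trans hwz')), h₂⟩
  obtain ⟨r, h₁, h₂⟩ := up v hv hb
  obtain ⟨r', h₁', h₂'⟩ := up b h.ne.2.1 h.not_below
  have : r = r' := by
    rcases h₂ with ⟨hs, rfl⟩ | h₂ <;> rcases h₂' with ⟨hs', rfl⟩ | h₂'
    · rfl
    · exact absurd h₂'.eq_root.symm hs
    · exact absurd h₂.eq_root.symm hs'
    · exact h₂'.unique h₂
  subst this
  exact h₁'.symm.trans h₁

/-- A vertex reaches its point of attachment without meeting `x` unless that point is `x`. The point
of attachment is connected to the name of the part inside a subtree below `x`, or inside the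
component with the subtree of `x` removed. If the point is `x` itself, the part is a branch or the
complement of one. -/
theorem PartRel.joined (hx : S.comp y x = some k) {v q : V} (hv : v ≠ y)
    (h : P.PartRel y k x v q) : Linked S.G (fun z => z ≠ x ∧ z ≠ y) q v := by
  have hk := (Setting.comp_eq_some.1 hx).1
  have hxy := ne_of_comp hx
  have below : ∀ g a z, P.Joint y g a z → S.comp y z = some k → ∀ u, P.Below y g u → u ≠ x ∧ u ≠ y :=
    fun g a z hj hz u hu => ⟨fun e => hj.comp_ne hz (e ▸ hu) hx, hu.ne⟩
  have out : ∀ u, u ≠ y ∧ ¬ P.Below y k u → u ≠ x ∧ u ≠ y :=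
    fun u hu => ⟨fun e => hu.2 (below_of_comp (e ▸ hx)), hu.1⟩
  have toAtt : P.att y k v ≠ x → Linked S.G (fun z => z ≠ x ∧ z ≠ y) (P.att y k v) v := by
    intro hne
    have hay := ne_of_comp (comp_att (P := P) hk hv)
    rcases att_cases (P := P) hk hv with h₁ | ⟨g, a, z, hj, hz, hb⟩ | ⟨h₁, z, b, hj⟩
    · rw [att_self h₁]; exact .refl
    · rw [att_below hj hz hb] at hne hay ⊢
      exact (Linked.single (A := fun z => z ≠ x ∧ z ≠ y) ⟨hne, hay⟩ (below g a z hj hz a (below_of_comp hj.comp_left)) hj.ne.2.2.symm).trans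
        ((hj.joined hb).mono (below g a z hj hz))
    · rw [att_out hj h₁] at hne hay ⊢
      exact (Linked.single (A := fun z => z ≠ x ∧ z ≠ y) ⟨hne, hay⟩ (out b ⟨hj.ne.2.1, hj.not_below⟩) hj.ne.2.2).trans
        ((hj.joined_out hv h₁).mono out)
  rcases h with ⟨hc, hq⟩ | ⟨e, g, hj, hb⟩ | ⟨e, hb, hj⟩ | ⟨hc, hq⟩
  · have hA : ∀ z, S.InSub q z → z ≠ x ∧ z ≠ y := fun z hz =>
      ⟨fun e => hc.not_inSub (e ▸ hz), ne_of_comp (comp_of_inSub hx (hc.mem.trans hz))⟩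
    exact (joined_subtree hA hq).trans (toAtt (hA _ hq).1)
  · exact (hj.joined hb).mono (below g q x hj hx)
  · exact (hj.joined_out hv hb).mono out
  · have hca := comp_att (P := P) hk hv
    have hqy : q ≠ y := by
      rcases PartRel.nameRel hx hv (Or.inr (Or.inr (Or.inr ⟨hc, hq⟩)) : P.PartRel y k x v q) with h | ⟨g, h⟩ | h | h
      · exact absurd hc.mem h.not_inSub
      · exact h.ne.1
      · exact h.ne.2.1
      · exact h.2
    -- Removing the subtree of `x` from the component leaves a subtree of `T` hanging at `k`.
    have aux : ∀ z, S.InSub k z → ¬ S.InSub x z → Linked S.G (fun z => z ≠ x ∧ z ≠ y) k z := by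
      intro z hz
      refine S.induction_below (P := fun z => ¬ S.InSub x z → Linked S.G (fun z => z ≠ x ∧ z ≠ y) k z)
        (fun _ => .refl) ?_ hz
      intro u z hu huz ih hxz
      have hxu : ¬ S.InSub x u := fun h => hxz (h.trans huz.mem)
      refine (ih hxu).trans (.single ⟨?_, ?_⟩ ⟨?_, ?_⟩ huz.adj)
      · rintro rfl; exact hxu (Setting.InSub.refl _)
      · rintro rfl; exact hk.not_inSub hu
      · rintro rfl; exact hxz (Setting.InSub.refl _)
      · rintro rfl; exact hk.not_inSub (hu.trans huz.mem)
    have h₁ := aux q (Setting.comp_eq_some.1 (comp_parent hx hc hqy)).2 hc.not_inSub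
    have h₂ := aux _ (Setting.comp_eq_some.1 hca).2 hq
    exact h₁.symm.trans (h₂.trans (toAtt fun e => hq (e.symm ▸ Setting.InSub.refl _)))

end Connectivity

end Prep

theorem gather_apply {M : Type} {d : M} {A : Finset ℕ} {f : ℕ → Option M} {x : ℕ → M}
    (h : gather d A f = some x) {j : ℕ} (hj : j ∈ A) : f j = some (x j) := by
  classical
  unfold gather at h
  split_ifs at h with hf
  obtain ⟨m, hm⟩ := Option.isSome_iff_exists.1 (hf j hj)
  rw [← Option.some_injective _ h]
  simp [hj, hm]

/-! ### The values of all messages in a finished execution. -/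

namespace Prep

open Protocol

variable {V : Type} {κ n lam c : ℕ} [Fintype V] {S : Setting κ n V} (P : Prep S lam)
variable {K : Type} [Field K] (sd : (Fin (skDeg κ c n) → Bool) → K)

/-- The messages of the subalgorithm of `y`. -/
structure Values (y : V) (coin : V → CoinIdx κ c n → Bool) where
  m : V → Msg K κ c n
  c₁ : V → ℕ → Msg K κ c n
  u₂ : V → ℕ → Msg K κ c n
  i₃ : V → Msg K κ c n
  c₄ : V → ℕ → Msg K κ c n
  u₅ : V → ℕ → Msg K κ c n
  m_eq : ∀ {v w}, S.comp y v = some w → m v = start sd (P.localInput y) (coin y) (S.id w)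
  c₁_eq : ∀ {v u}, S.Under y v → S.Under y u → S.G.Adj v u →
    c₁ v (S.id u) = hello (P.localInput u) (coin u) (m u) (S.id v)
  u₂_eq : ∀ {v w}, S.InSub y v → S.Child v w →
    u₂ v (S.id w) = report (P.localInput w) (coin w) (S.id y) (m w) (c₁ w) (u₂ w)
  i₃_eq : ∀ {v w}, S.comp y v = some w → i₃ v = compSketch (P.localInput y) (u₂ y) (S.id w)
  c₄_eq : ∀ {v u}, S.Under y v → S.Under y u → S.G.Adj v u → c₄ v (S.id u) = i₃ u
  u₅_eq : ∀ {v w}, S.Under y v → S.Child v w → u₅ v (S.id w) =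
    total (P.localInput w) (coin w) (S.id y) (m w) (c₁ w) (i₃ w) (c₄ w) (u₅ w)

theorem under_of_comp {y v w : V} (h : S.comp y v = some w) : S.Under y v :=
  ⟨(Setting.comp_eq_some.1 h).1.mem.trans (Setting.comp_eq_some.1 h).2, ne_of_comp h⟩

theorem exists_comp {y v : V} (h : S.Under y v) : ∃ w, S.comp y v = some w := by
  obtain ⟨w, hw, hv⟩ := S.exists_child_of_inSub h.1 h.2
  exact ⟨w, Setting.comp_eq_some.2 ⟨hw, hv⟩⟩

theorem eq_some_getD {X : Type} {o : Option X} (h : o.isSome) (d : X) : o = some (o.getD d) := by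
  obtain ⟨x, rfl⟩ := Option.isSome_iff_exists.1 h; rfl

variable {P sd}

/-- By `IsFix.isSome` every expected message exists in a consistent family of tables, so its
equations can be read off from `step`. -/
theorem exists_values {act : Set (Fin (2 ^ (κ * lg n)))}
    {coin : V → Fin (2 ^ (κ * lg n)) → CoinIdx κ c n → Bool} {i : Fin (2 ^ (κ * lg n))} (hi : i ∈ act)
    {k : V → Table (Msg K κ c n)} (h : SchedState.IsFix (P.analysis sd act coin) i k) {y : V}
    (hy : S.id y = i) : ∃ X : P.Values sd y (fun v => coin v i), ∀ v, S.Under y v →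
      result (P.localInput v) (coin v i) i (k v) = some (decideCut (P.localInput v) (coin v i) (S.id y)
        (X.m v) (X.c₁ v) (X.u₂ v) (X.i₃ v) (X.c₄ v) (X.u₅ v)) := by
  have hk : ∀ v j p m, k v j p = some m → ∃ u, S.id u = j ∧ Admissible (S := S) i p u v m := h.ok
  have hs : ∀ {p u v}, S.Expect y p u v → (k v (S.id u) p).isSome := fun he => h.isSome hi ⟨y, hy, he⟩
  have eq : ∀ u v p, S.G.Adj u v → k v (S.id u) p =
    step sd (P.localInput u) (coin u i) i (k u) (S.id v) p := h.eq
  have par : ∀ {v}, S.Under y v → ∀ p, p = 0 ∨ p = 3 → (fromPar (P.localInput v) (k v) p).isSome := by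
    intro v hv p hp
    refine fromPar_isSome hv fun u hu hyu => ?_
    rcases hp with rfl | rfl <;> exact hs ⟨hyu, hu⟩
  have nb : ∀ {v}, S.Under y v → ∀ p, p = 1 ∨ p = 4 → (fromNb (P.localInput v) i (k v) p).isSome := by
    intro v hv p hp
    refine fromNb_isSome (hk v) hy hv (fun u hu hyu => hs (p := 0) ⟨hyu, hu⟩) fun u hu hyu => ?_
    rcases hp with rfl | rfl <;> exact hs ⟨hyu, hv, hu.symm⟩
  have ch : ∀ {v}, S.InSub y v → ∀ p, p = 2 ∨ p = 5 → (fromCh (P.localInput v) (k v) p).isSome := by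
    intro v hv p hp
    refine fromCh_isSome fun u hu => ?_
    rcases hp with rfl | rfl <;> exact hs ⟨hu.under hv, hu⟩
  let bl := Msg.blank K κ c n
  let m : V → Msg K κ c n := fun v => (fromPar (P.localInput v) (k v) 0).getD bl
  let c₁ : V → ℕ → Msg K κ c n := fun v => (fromNb (P.localInput v) i (k v) 1).getD fun _ => bl
  let u₂ : V → ℕ → Msg K κ c n := fun v => (fromCh (P.localInput v) (k v) 2).getD fun _ => bl
  let i₃ : V → Msg K κ c n := fun v => (fromPar (P.localInput v) (k v) 3).getD bl
  let c₄ : V → ℕ → Msg K κ c n := fun v => (fromNb (P.localInput v) i (k v) 4).getD fun _ => bl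
  let u₅ : V → ℕ → Msg K κ c n := fun v => (fromCh (P.localInput v) (k v) 5).getD fun _ => bl
  have em : ∀ {v}, S.Under y v → fromPar (P.localInput v) (k v) 0 = some (m v) := fun hv =>
    eq_some_getD (par hv 0 (Or.inl rfl)) bl
  have ec₁ : ∀ {v}, S.Under y v → fromNb (P.localInput v) i (k v) 1 = some (c₁ v) := fun hv =>
    eq_some_getD (nb hv 1 (Or.inl rfl)) _
  have eu₂ : ∀ {v}, S.InSub y v → fromCh (P.localInput v) (k v) 2 = some (u₂ v) := fun hv =>
    eq_some_getD (ch hv 2 (Or.inl rfl)) _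
  have ei₃ : ∀ {v}, S.Under y v → fromPar (P.localInput v) (k v) 3 = some (i₃ v) := fun hv =>
    eq_some_getD (par hv 3 (Or.inr rfl)) bl
  have ec₄ : ∀ {v}, S.Under y v → fromNb (P.localInput v) i (k v) 4 = some (c₄ v) := fun hv =>
    eq_some_getD (nb hv 4 (Or.inr rfl)) _
  have eu₅ : ∀ {v}, S.InSub y v → fromCh (P.localInput v) (k v) 5 = some (u₅ v) := fun hv =>
    eq_some_getD (ch hv 5 (Or.inr rfl)) _
  have hne : ∀ {v}, S.Under y v → ¬ (P.localInput v).id = i := fun hv e =>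
    hv.2 (S.id_inj (e.trans hy.symm))
  have hdep : ∀ {v}, S.Under y v → ((m v).dep : ℕ) = (S.path y).length := by
    intro v hv
    obtain ⟨y', hy', -, hd⟩ := fromPar_zero (P := P) (hk v) (em hv)
    obtain rfl := S.id_inj (hy'.trans hy.symm)
    exact hd
  have hnb : ∀ {v u}, S.Under y v → S.Under y u → S.G.Adj v u → S.id u ∈ nbU (P.localInput v) i (m v) := by
    intro v u hv hu ha
    rw [← hy]
    exact (id_mem_nbU P (hdep hv) hv.1 ha).2 hu
  have fromParEq : ∀ {u v} p, S.Child u v → fromPar (P.localInput v) (k v) p = k v (S.id u) p := by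
    intro u v p hu
    rw [fromPar, par_child P hu]; rfl
  -- Messages of the downward phases are forwarded unchanged, so every vertex has what `y` sent to
  -- the child above it.
  have down : ∀ (p : Fin 6), p = 0 ∨ p = 3 → ∀ {v w}, S.comp y v = some w →
      fromPar (P.localInput v) (k v) p = step sd (P.localInput y) (coin y i) i (k y) (S.id w) p := by
    intro p hp v w hv
    obtain ⟨hw, hwv⟩ := Setting.comp_eq_some.1 hv
    refine S.induction_below (P := fun v => fromPar (P.localInput v) (k v) p =
      step sd (P.localInput y) (coin y i) i (k y) (S.id w) p) ?_ ?_ hwv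
    · rw [fromParEq p hw, eq y w p hw.adj]
    · intro u v hu hc ih
      rw [fromParEq p hc, eq u v p hc.adj, ← ih]
      rw [step, if_neg (hne (under_of_comp (Setting.comp_eq_some.2 ⟨hw, hu⟩))), if_pos hp,
        if_pos ((id_mem_ch P).2 hc)]
  have hyi : (P.localInput y).id = i := hy
  refine ⟨⟨m, c₁, u₂, i₃, c₄, u₅, ?_, ?_, ?_, ?_, ?_, ?_⟩, ?_⟩
  · intro v w hv
    have e := down 0 (Or.inl rfl) hv
    rw [em (under_of_comp hv), step, if_pos hyi,
      if_pos ((id_mem_ch P).2 (Setting.comp_eq_some.1 hv).1), if_pos rfl] at e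
    exact Option.some_injective _ e
  · intro v u hv hu ha
    have e := gather_apply (((congrArg (fun o => Option.bind o _) (em hv)).symm.trans (ec₁ hv))) (hnb hv hu ha)
    rw [eq u v 1 ha.symm, step, if_neg (hne hu), if_neg (by decide), if_pos rfl, em hu,
      Option.bind_some, if_pos (hnb hu hv ha.symm)] at e
    exact (Option.some_injective _ e).symm
  · intro v w hv hc
    have hw := hc.under hv
    have e := gather_apply (eu₂ hv) ((id_mem_ch P).2 hc)
    rw [eq w v 2 hc.adj.symm, step, if_neg (hne hw), if_neg (by decide), if_neg (by decide),
      if_neg (by decide), if_pos (par_child P hc), if_pos rfl, em hw, ec₁ hw, eu₂ hw.1] at e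
    rw [hy]
    exact (Option.some_injective _ e).symm
  · intro v w hv
    have e := down 3 (Or.inr rfl) hv
    rw [ei₃ (under_of_comp hv), step, if_pos hyi,
      if_pos ((id_mem_ch P).2 (Setting.comp_eq_some.1 hv).1), if_neg (by decide), if_pos rfl,
      eu₂ (Setting.InSub.refl y)] at e
    exact Option.some_injective _ e
  · intro v u hv hu ha
    have e := gather_apply (((congrArg (fun o => Option.bind o _) (em hv)).symm.trans (ec₄ hv))) (hnb hv hu ha)
    rw [eq u v 4 ha.symm, step, if_neg (hne hu), if_neg (by decide), if_neg (by decide), if_pos rfl, em hu,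
      Option.bind_some, if_pos (hnb hu hv ha.symm), ei₃ hu] at e
    exact (Option.some_injective _ e).symm
  · intro v w hv hc
    have hw := hc.under hv.1
    have e := gather_apply (eu₅ hv.1) ((id_mem_ch P).2 hc)
    rw [eq w v 5 hc.adj.symm, step, if_neg (hne hw), if_neg (by decide), if_neg (by decide),
      if_neg (by decide), if_pos (par_child P hc), if_neg (by decide), em hw, ec₁ hw, ei₃ hw, ec₄ hw,
      eu₅ hw.1] at e
    rw [hy]
    exact (Option.some_injective _ e).symm
  · intro v hv
    rw [result, if_neg (hne hv), em hv, ec₁ hv, eu₂ hv.1, ei₃ hv, ec₄ hv, eu₅ hv.1]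
    exact congrArg (fun j => some (decideCut (P.localInput v) (coin v i) j (m v) (c₁ v) (u₂ v) (i₃ v)
      (c₄ v) (u₅ v))) hy.symm

end Prep

/-! ### Sketches of vertices, and the fields of the first messages. -/

namespace Prep

open Protocol

variable {V : Type} {κ n lam c : ℕ} [Fintype V] {S : Setting κ n V} (P : Prep S lam)
variable {K : Type} [Field K] (sd : (Fin (skDeg κ c n) → Bool) → K) (y : V) (coin : V → CoinIdx κ c n → Bool)

/-- The number of the component of `v`, and `0` outside `T_y`. -/
noncomputable def compNum (v : V) : ℕ := ((S.comp y v).map (P.num y)).getD 0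

/-- The label of `v`. -/
noncomputable def lab (v : V) : AncLabel × ℕ := (S.anc v, P.compNum y v)

/-- The edge `ab` is sampled by `a`. -/
def Owns (S : Setting κ n V) (y a b : V) : Prop :=
  S.G.Adj a b ∧ S.Under y a ∧ b ≠ y ∧ (S.Under y b → S.id a < S.id b)

/-- The seed of the edge identifiers. -/
def xi : K := sd fun b => coin y (.inr b)

open scoped Classical in
/-- The contribution of the edge `ab`, if it is sampled by `a`. -/
noncomputable def half (a b : V) : Sk K c n := fun t s =>
  if Owns S y a b ∧ ∀ s' < s, block (coin a) (S.id b) t s' = true then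
    xi sd y coin ^ edgeNum κ n (P.lab y a) (P.lab y b) else 0

/-- The contribution of the edge `ab`. -/
noncomputable def full (a b : V) : Sk K c n := P.half sd y coin a b + P.half sd y coin b a

/-- The sketch of `v`. -/
noncomputable def vsk (v : V) : Sk K c n := ∑ u, P.full sd y coin v u

variable {P sd y coin}

theorem full_comm (a b : V) : P.full sd y coin a b = P.full sd y coin b a := add_comm _ _

theorem full_of_not_adj {a b : V} (h : ¬ S.G.Adj a b) : P.full sd y coin a b = 0 := by
  funext t s
  have h₁ : ¬ Owns S y a b := fun h' => h h'.1
  have h₂ : ¬ Owns S y b a := fun h' => h h'.1.symm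
  simp [full, half, h₁, h₂]

theorem full_root (a : V) : P.full sd y coin a y = 0 := by
  funext t s
  have h₁ : ¬ Owns S y a y := fun h' => h'.2.2.1 rfl
  have h₂ : ¬ Owns S y y a := fun h' => h'.2.1.2 rfl
  simp [full, half, h₁, h₂]

theorem vsk_root : P.vsk sd y coin y = 0 :=
  Finset.sum_eq_zero fun u _ => (full_comm _ _).trans (full_root u)

theorem lab_mem (v : V) : P.lab y v ∈ labelSet κ n := by
  refine ⟨S.length_anc_le v, S.anc_bounds v, ?_⟩
  change ((S.comp y v).map (P.num y)).getD 0 ≤ n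
  cases S.comp y v with
  | none => exact Nat.zero_le _
  | some w => exact num_le y w

theorem lab_injective : Function.Injective (P.lab y) := fun _ _ h => S.anc_injective (congrArg Prod.fst h)

theorem compNum_of_comp {v w : V} (h : S.comp y v = some w) : P.compNum y v = P.num y w := by
  rw [compNum, h]; rfl

theorem compNum_of_not_under {v : V} (hv : v ≠ y) (h : ¬ S.Under y v) : P.compNum y v = 0 := by
  rw [compNum, (Setting.comp_eq_none hv).2 fun h' => h ⟨h', hv⟩]; rfl

theorem nb_eq (v : V) : open scoped Classical in
    (P.localInput v).nb = (Finset.univ.filter fun u => S.G.Adj v u).image S.id := by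
  classical
  ext j
  simp only [mem_nb, Finset.mem_image, Finset.mem_filter, Finset.mem_univ, true_and]

theorem ch_eq (v : V) : open scoped Classical in
    (P.localInput v).ch = (Finset.univ.filter fun u => S.Child v u).image S.id := by
  classical
  ext j
  simp only [mem_ch, Finset.mem_image, Finset.mem_filter, Finset.mem_univ, true_and]

namespace Values

variable (X : P.Values sd y coin)
include X

section Fields

variable {v w : V} (h : S.comp y v = some w)
include h

theorem m_k : ((X.m v).k : ℕ) = P.num y w := by
  rw [X.m_eq h]
  exact Nat.mod_eq_of_lt (Nat.lt_succ_of_le (num_le y w))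

theorem m_hi : ((X.m v).hi : ℕ) = P.last y w := by
  rw [X.m_eq h]
  exact Nat.mod_eq_of_lt (Nat.lt_succ_of_le (last_le y w))

theorem m_xi : (X.m v).xi = xi sd y coin := by rw [X.m_eq h]; rfl

theorem m_dep : ((X.m v).dep : ℕ) = (S.path y).length := by
  rw [X.m_eq h]
  have hw := (Setting.comp_eq_some.1 h).1
  change (P.localInput y).path.length % (n + 1) = _
  rw [path_eq P hw.adj, Nat.mod_eq_of_lt (Nat.lt_succ_of_le (length_path_le y))]

theorem parentEdge_m : parentEdge (X.m v) = (P.localInput y).plan.2 (S.id w) := by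
  have hw := (Setting.comp_eq_some.1 h).1
  rw [X.m_eq h, parentEdge, start]
  cases e : (P.localInput y).plan.2 (S.id w) with
  | none => rfl
  | some x =>
    obtain ⟨a, b, rfl, -⟩ := joint_aux hw e
    simp only [Option.map_some, Fin.val_ofNat, Nat.mod_eq_of_lt (S.id_lt a), Nat.mod_eq_of_lt (S.id_lt b)]

theorem parentEdge_eq_some {a b : V} : parentEdge (X.m v) = some (S.id a, S.id b) ↔ P.Joint y w a b := by
  rw [X.parentEdge_m h]
  exact ⟨fun e => ⟨(Setting.comp_eq_some.1 h).1, e⟩, fun e => e.2⟩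

theorem parentEdge_fst {a : V} : (parentEdge (X.m v)).map Prod.fst = some (S.id a) ↔
    ∃ b, P.Joint y w a b := by
  constructor
  · intro e
    rw [X.parentEdge_m h] at e
    cases e' : (P.localInput y).plan.2 (S.id w) with
    | none => rw [e'] at e; cases e
    | some x =>
      obtain ⟨a', b, rfl, -⟩ := joint_aux (Setting.comp_eq_some.1 h).1 e'
      rw [e'] at e
      obtain rfl := S.id_inj (Option.some_injective _ e)
      exact ⟨b, (Setting.comp_eq_some.1 h).1, e'⟩
  · rintro ⟨b, hj⟩
    rw [(X.parentEdge_eq_some h).2 hj]; rfl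

theorem mem_nbU {u : V} (ha : S.G.Adj v u) : S.id u ∈ nbU (P.localInput v) (S.id y) (X.m v) ↔ S.Under y u :=
  id_mem_nbU P (X.m_dep h) (under_of_comp h).1 ha

end Fields

section Messages

variable {v u w : V} (h : S.comp y v = some w) (ha : S.G.Adj v u)
include h ha

theorem c₁_val (hu : S.Under y u) : X.c₁ v (S.id u) = hello (P.localInput u) (coin u) (X.m u) (S.id v) :=
  X.c₁_eq (under_of_comp h) hu ha

theorem label_eq : label (P.localInput v) (X.m v) = P.lab y v := by
  rw [label, anc_eq P ha, X.m_k h, lab, compNum_of_comp h]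

theorem labelN_eq (huy : u ≠ y) :
    labelN (P.localInput v) (S.id y) (X.m v) (X.c₁ v) (S.id u) = P.lab y u := by
  rw [labelN, ancN_id P ha, lab]
  congr 1
  by_cases hu : S.Under y u
  · rw [if_pos ((X.mem_nbU h ha).2 hu), X.c₁_val h ha hu]
    obtain ⟨w', hw'⟩ := exists_comp hu
    rw [compNum_of_comp hw', ← X.m_k hw']; rfl
  · rw [if_neg fun h' => hu ((X.mem_nbU h ha).1 h'), compNum_of_not_under huy hu]

/-- Both ends must use the same sampling bits. If both lie under `y`, they are those of the end with
the smaller identifier, sent in phase 1; otherwise they are those of the end under `y`. So just one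
of the two halves of `full` is nonzero or allowed to be. -/
theorem entry_eq : entry (P.localInput v) (coin v) (S.id y) (X.m v) (X.c₁ v) (S.id u) =
    P.full sd y coin v u := by
  classical
  have hv := under_of_comp h
  have hid : (P.localInput v).id = S.id v := rfl
  funext t s
  by_cases huy : u = y
  · subst huy
    rw [full_root]
    simp [entry]
  have hne := S.id_inj.ne huy
  unfold entry
  rw [X.m_xi h, X.label_eq h ha, X.labelN_eq h ha huy]
  simp only [full, half, Pi.add_apply, hne, ne_eq, not_false_eq_true, true_and]
  by_cases hlt : S.Under y u ∧ S.id u < S.id v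
  · have h₁ : ¬ Owns S y v u := fun h' => (h'.2.2.2 hlt.1).not_gt hlt.2
    have h₂ : Owns S y u v := ⟨ha.symm, hlt.1, hv.2, fun _ => hlt.2⟩
    have hb : edgeBits (P.localInput v) (coin v) (S.id y) (X.m v) (X.c₁ v) (S.id u) =
        block (coin u) (S.id v) := by
      rw [edgeBits, hid, if_pos ⟨(X.mem_nbU h ha).2 hlt.1, hlt.2⟩, X.c₁_val h ha hlt.1]; rfl
    simp only [h₁, h₂, false_and, true_and, if_false, zero_add, hb]
    rw [edgeNum_comm]
  · have h₁ : Owns S y v u := ⟨ha, hv, huy, fun hu =>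
      lt_of_le_of_ne (not_lt.1 fun h' => hlt ⟨hu, h'⟩) (S.id_inj.ne ha.ne)⟩
    have h₂ : ¬ Owns S y u v := fun h' => hlt ⟨h'.2.1, h'.2.2.2 hv⟩
    have hb : edgeBits (P.localInput v) (coin v) (S.id y) (X.m v) (X.c₁ v) (S.id u) =
        block (coin v) (S.id u) := by
      rw [edgeBits, hid, if_neg fun h' => hlt ⟨(X.mem_nbU h ha).1 h'.1, h'.2⟩]
    simp only [h₁, h₂, false_and, true_and, if_false, add_zero, hb]

end Messages

theorem ownSketch_eq {v w : V} (h : S.comp y v = some w) :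
    ownSketch (P.localInput v) (coin v) (S.id y) (X.m v) (X.c₁ v) = P.vsk sd y coin v := by
  classical
  rw [ownSketch, nb_eq, Finset.sum_image fun _ _ _ _ e => S.id_inj e, vsk,
    ← Finset.sum_filter_add_sum_filter_not Finset.univ (fun u => S.G.Adj v u),
    Finset.sum_eq_zero (s := Finset.univ.filter fun u => ¬ S.G.Adj v u), add_zero]
  · exact Finset.sum_congr rfl fun u hu => X.entry_eq h (Finset.mem_filter.1 hu).2
  · exact fun u hu => full_of_not_adj (Finset.mem_filter.1 hu).2

theorem mem_attached {v w : V} (h : S.comp y v = some w) {j : ℕ} :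
    j ∈ attached (P.localInput v) (S.id y) (X.m v) (X.c₁ v) ↔ ∃ g a, P.Joint y g a v ∧ S.id a = j := by
  rw [attached, Finset.mem_filter]
  constructor
  · rintro ⟨h₁, h₂⟩
    obtain ⟨u, hu, hU, rfl⟩ := (Prep.mem_nbU P (X.m_dep h) (under_of_comp h).1).1 h₁
    obtain ⟨g, hg⟩ := exists_comp hU
    rw [X.c₁_val h hu hU] at h₂
    exact ⟨g, u, (X.parentEdge_eq_some hg).1 (of_decide_eq_true h₂), rfl⟩
  · rintro ⟨g, a, hj, rfl⟩
    have hU := under_of_comp hj.comp_left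
    refine ⟨(X.mem_nbU h hj.ne.2.2.symm).2 hU, ?_⟩
    rw [X.c₁_val h hj.ne.2.2.symm hU]
    exact decide_eq_true ((X.parentEdge_eq_some hj.comp_left).2 hj)

theorem c₁_joint {v w g a : V} (h : S.comp y v = some w) (hj : P.Joint y g a v) :
    ((X.c₁ v (S.id a)).k : ℕ) = P.num y g ∧ ((X.c₁ v (S.id a)).hi : ℕ) = P.last y g := by
  rw [X.c₁_val h hj.ne.2.2.symm (under_of_comp hj.comp_left)]
  exact ⟨X.m_k hj.comp_left, X.m_hi hj.comp_left⟩

end Values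

end Prep

/-! ### Information aggregated over subtrees. -/

namespace Setting

variable {V : Type} {κ n : ℕ} [Fintype V] {S : Setting κ n V}

/-- The common form of the summaries sent upwards: the flag and the thresholds on attached numbers
are disjunctions over a subtree. -/
theorem iff_exists_inSub {k : V} {Q q : V → Prop}
    (h : ∀ u, S.InSub k u → (Q u ↔ q u ∨ ∃ w, S.Child u w ∧ Q w)) (u : V) (hu : S.InSub k u) :
    Q u ↔ ∃ z, S.InSub u z ∧ q z := by
  revert hu
  refine S.induction_up (P := fun u => S.InSub k u → (Q u ↔ ∃ z, S.InSub u z ∧ q z)) ?_ u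
  intro u ih hu
  rw [h u hu]
  constructor
  · rintro (hq | ⟨w, hw, hQ⟩)
    · exact ⟨u, InSub.refl u, hq⟩
    · obtain ⟨z, hz, hq⟩ := (ih w hw (hu.trans hw.mem)).1 hQ
      exact ⟨z, hw.mem.trans hz, hq⟩
  · rintro ⟨z, hz, hq⟩
    by_cases e : z = u
    · exact Or.inl (e ▸ hq)
    · obtain ⟨w, hw, hwz⟩ := S.exists_child_of_inSub hz e
      exact Or.inr ⟨w, hw, (ih w hw (hu.trans hw.mem)).2 ⟨z, hwz, hq⟩⟩

end Setting

namespace Prep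

open Protocol

variable {V : Type} {κ n lam c : ℕ} [Fintype V] {S : Setting κ n V} {P : Prep S lam}
variable {K : Type} [Field K] {sd : (Fin (skDeg κ c n) → Bool) → K} {y : V} {coin : V → CoinIdx κ c n → Bool}

theorem sum_ch {M : Type*} [AddCommMonoid M] (v : V) (f : ℕ → M) : open scoped Classical in
    ∑ j ∈ (P.localInput v).ch, f j = ∑ w with S.Child v w, f (S.id w) := by
  classical
  rw [ch_eq, Finset.sum_image fun _ _ _ _ e => S.id_inj e]

open scoped Classical in
theorem sum_below {M : Type*} [AddCommMonoid M] (f : V → M) (w : V) :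
    ∑ z with P.Below y w z, f z =
      ∑ w' with S.Child y w' ∧ P.lp y (some w) <+: P.lp y (some w'), ∑ z with S.InSub w' z, f z := by
  rw [← Finset.sum_biUnion]
  · refine Finset.sum_congr ?_ fun _ _ => rfl
    ext z
    simp only [Finset.mem_filter, Finset.mem_univ, true_and, Finset.mem_biUnion, Below,
      Setting.comp_eq_some]
    constructor
    · rintro ⟨w', ⟨h₁, h₂⟩, h₃⟩; exact ⟨w', ⟨h₁, h₃⟩, h₂⟩
    · rintro ⟨w', ⟨h₁, h₃⟩, h₂⟩; exact ⟨w', ⟨h₁, h₂⟩, h₃⟩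
  · intro w₁ h₁ w₂ h₂ hne
    refine Finset.disjoint_left.2 fun z hz₁ hz₂ => hne ?_
    simp only [Finset.coe_filter, Finset.mem_univ, true_and, Set.mem_ofPred_eq, Finset.mem_filter] at *
    exact h₁.1.eq_of_inSub h₂.1 hz₁ hz₂

variable (P sd coin) in
open scoped Classical in
/-- The sketch of the subtree of components below `w`. -/
noncomputable def belowSk (y w : V) : Sk K c n := ∑ z with P.Below y w z, P.vsk sd y coin z

theorem below_iff {a g v : V} (h : S.comp y a = some g) :
    (∃ g, S.comp y a = some g ∧ P.Below y g v) ↔ P.Below y g v :=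
  ⟨fun ⟨_, e, hb⟩ => Option.some_injective _ (e.symm.trans h) ▸ hb, fun hb => ⟨g, h, hb⟩⟩

namespace Values

variable (X : P.Values sd y coin)
include X

theorem report_sk {u k : V} (h : S.comp y u = some k) : open scoped Classical in
    (report (P.localInput u) (coin u) (S.id y) (X.m u) (X.c₁ u) (X.u₂ u)).sk =
      ∑ z with S.InSub u z, P.vsk sd y coin z := by
  classical
  revert h
  refine S.induction_up (P := fun u => S.comp y u = some k →
    (report (P.localInput u) (coin u) (S.id y) (X.m u) (X.c₁ u) (X.u₂ u)).sk =
      ∑ z with S.InSub u z, P.vsk sd y coin z) ?_ u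
  intro u ih h
  rw [S.sum_subtree]
  change ownSketch _ _ _ _ _ + ∑ w ∈ (P.localInput u).ch, (X.u₂ u w).sk = _
  rw [X.ownSketch_eq h, sum_ch]
  congr 1
  refine Finset.sum_congr rfl fun w hw => ?_
  have hw := (Finset.mem_filter.1 hw).2
  rw [X.u₂_eq (under_of_comp h).1 hw]
  exact ih w hw (comp_of_inSub h hw.mem)

theorem compSketch_sk (w : V) : (compSketch (P.localInput y) (X.u₂ y) (S.id w)).sk =
    belowSk P sd coin y w := by
  classical
  have e : (P.localInput y).desc (S.id w) = (Finset.univ.filter fun w' =>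
      S.Child y w' ∧ P.lp y (some w) <+: P.lp y (some w')).image S.id := by
    ext j
    simp only [mem_desc, Finset.mem_image, Finset.mem_filter, Finset.mem_univ, true_and, and_assoc]
  change ∑ j ∈ (P.localInput y).desc (S.id w), (X.u₂ y j).sk = _
  rw [e, Finset.sum_image fun _ _ _ _ e => S.id_inj e, belowSk, sum_below]
  refine Finset.sum_congr rfl fun w' hw => ?_
  have hw := (Finset.mem_filter.1 hw).2
  rw [X.u₂_eq (Setting.InSub.refl y) hw.1]
  exact X.report_sk (Setting.comp_child hw.1)

theorem i₃_sk {v k : V} (h : S.comp y v = some k) : (X.i₃ v).sk = belowSk P sd coin y k := by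
  rw [X.i₃_eq h, X.compSketch_sk]

theorem attached_eq {v k : V} (h : S.comp y v = some k) : open scoped Classical in
    attached (P.localInput v) (S.id y) (X.m v) (X.c₁ v) =
      (Finset.univ.filter fun a => ∃ g, P.Joint y g a v).image S.id := by
  classical
  ext j
  simp only [X.mem_attached h, Finset.mem_image, Finset.mem_filter, Finset.mem_univ, true_and]
  constructor
  · rintro ⟨g, a, hj, e⟩; exact ⟨a, ⟨g, hj⟩, e⟩
  · rintro ⟨a, ⟨g, hj⟩, e⟩; exact ⟨g, a, hj, e⟩

omit X in
theorem sum_vsk [CharP K 2] : ∑ v, P.vsk sd y coin v = 0 := by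
  have h2 : ∀ x : Sk K c n, x + x = 0 := fun x => by funext t s; exact CharTwo.add_self_eq_zero _
  simp only [vsk, full, Finset.sum_add_distrib]
  rw [Finset.sum_comm (f := fun v u => P.half sd y coin u v)]
  exact h2 _

-- Every edge contribution occurs at both ends, so in characteristic two all vertex sketches add up
-- to 0, and a set and its complement have the same sketch. The vertex `y` contributes nothing.
omit X in
open scoped Classical in
theorem sum_out [CharP K 2] (k : V) : ∑ z with z ≠ y ∧ ¬ P.Below y k z, P.vsk sd y coin z =
    belowSk P sd coin y k := by
  have h2 : ∀ x : Sk K c n, x + x = 0 := fun x => by funext t s; exact CharTwo.add_self_eq_zero _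
  have h₁ : ∑ z with z ≠ y ∧ ¬ P.Below y k z, P.vsk sd y coin z =
      ∑ z with ¬ P.Below y k z, P.vsk sd y coin z := by
    rw [Finset.sum_filter, Finset.sum_filter]
    refine Finset.sum_congr rfl fun z _ => ?_
    by_cases hz : z = y
    · subst hz; simp [vsk_root]
    · simp [hz]
  have h₂ := Finset.sum_filter_add_sum_filter_not Finset.univ (P.Below y k) (P.vsk sd y coin)
  rw [sum_vsk] at h₂
  rw [h₁, belowSk]
  calc _ = (∑ z with P.Below y k z, P.vsk sd y coin z + ∑ z with P.Below y k z, P.vsk sd y coin z) +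
        ∑ z with ¬ P.Below y k z, P.vsk sd y coin z := by rw [h2, zero_add]
    _ = _ := by rw [add_assoc, h₂, add_zero]

-- What hangs at `v` is `v` itself, the branches joined at `v` and, if the edge to the parent
-- component ends at `v`, everything outside the branch of `k`. The three cases of `att_cases` show
-- that nothing is counted twice.
omit X in
open scoped Classical in
theorem sum_att [CharP K 2] {v k : V} (h : S.comp y v = some k) :
    ∑ z with z ≠ y ∧ P.att y k z = v, P.vsk sd y coin z = P.vsk sd y coin v +
      ∑ a with ∃ g, P.Joint y g a v, ∑ z with ∃ g, S.comp y a = some g ∧ P.Below y g z, P.vsk sd y coin z +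
      if ∃ b, P.Joint y k v b then belowSk P sd coin y k else 0 := by
  have hk := (Setting.comp_eq_some.1 h).1
  have hv := ne_of_comp h
  have e₁ : P.vsk sd y coin v = ∑ z, if z = v then P.vsk sd y coin z else 0 := by simp
  have e₃ : (if ∃ b, P.Joint y k v b then belowSk P sd coin y k else 0) =
      ∑ z, if (∃ b, P.Joint y k v b) ∧ z ≠ y ∧ ¬ P.Below y k z then P.vsk sd y coin z else 0 := by
    split_ifs with hj
    · rw [← sum_out, Finset.sum_filter]; simp [hj]
    · simp [hj]
  rw [e₃, e₁]
  simp only [Finset.sum_filter (p := fun z => ∃ g, _ ∧ P.Below y g z)]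
  rw [Finset.sum_comm, Finset.sum_filter, ← Finset.sum_add_distrib, ← Finset.sum_add_distrib]
  refine Finset.sum_congr rfl fun z _ => ?_
  by_cases hz : z = y
  · subst hz
    have h₁ : ∀ a, ¬ ∃ g, S.comp z a = some g ∧ P.Below z g z := fun a ⟨g, _, hb⟩ => hb.ne rfl
    simp [hv.symm, h₁]
  rcases att_cases (P := P) hk hz with h₁ | ⟨g, a, z₀, hj, hz₀, hb⟩ | ⟨h₁, z₀, b, hj⟩
  · have h₂ : ∀ a ∈ Finset.univ.filter (fun a => ∃ g, P.Joint y g a v),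
        (if ∃ g, S.comp y a = some g ∧ P.Below y g z then P.vsk sd y coin z else 0) = 0 := by
      intro a ha
      obtain ⟨g, hj⟩ := (Finset.mem_filter.1 ha).2
      rw [if_neg]
      rw [below_iff hj.comp_left]
      exact fun hb => hj.comp_ne h hb h₁
    rw [Finset.sum_eq_zero h₂, att_self h₁]
    simp [hz, below_of_comp h₁]
  · have h₂ : ∀ a', (∃ g, P.Joint y g a' v) → (∃ g, S.comp y a' = some g ∧ P.Below y g z) →
        z₀ = v ∧ a' = a := by
      rintro a' ⟨g', hj'⟩ h'
      rw [below_iff hj'.comp_left] at h'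
      have e := (att_below hj hz₀ hb).symm.trans (att_below hj' h h')
      obtain ⟨w, e₁, hp⟩ := hb
      obtain ⟨w', e₂, hp'⟩ := h'
      rw [e₁] at e₂
      obtain rfl := Option.some_injective _ e₂
      obtain rfl := hj.eq_of_prefix hj' hz₀ h hp hp'
      exact ⟨e, (hj'.unique hj).1⟩
    have h₃ : z ≠ v := fun e => hj.comp_ne hz₀ hb (e ▸ h)
    have h₄ : P.Below y k z := hj.below_of_below hz₀ hb
    rw [att_below hj hz₀ hb]
    by_cases e : z₀ = v
    · subst e
      rw [Finset.sum_eq_single a]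
      · have : ∃ g, S.comp y a = some g ∧ P.Below y g z := ⟨g, hj.comp_left, hb⟩
        simp [hz, h₃, h₄, this]
      · intro a' ha' hne
        exact if_neg fun h' => hne (h₂ a' (Finset.mem_filter.1 ha').2 h').2
      · exact fun h' => absurd (Finset.mem_filter.2 ⟨Finset.mem_univ a, g, hj⟩) h'
    · rw [Finset.sum_eq_zero]
      · simp [e, h₃, h₄]
      · intro a' ha'
        exact if_neg fun h' => e (h₂ a' (Finset.mem_filter.1 ha').2 h').1
  · have h₂ : z ≠ v := fun e => h₁ (below_of_comp (e ▸ h))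
    have h₃ : (∃ b, P.Joint y k v b) ↔ z₀ = v :=
      ⟨fun ⟨b', hj'⟩ => (hj.unique hj').1, fun e => ⟨b, e ▸ hj⟩⟩
    rw [att_out hj h₁, Finset.sum_eq_zero]
    · simp [hz, h₁, h₂, h₃]
    · intro a ha
      obtain ⟨g, hj'⟩ := (Finset.mem_filter.1 ha).2
      rw [if_neg]
      rw [below_iff hj'.comp_left]
      exact fun hb => h₁ (hj'.below_of_below h hb)

/-- Sort the vertices by their points of attachment: the sum over a fibre is given by `sum_att`, and
the fibres are added up from the leaves. -/
theorem total_sk [CharP K 2] {u k : V} (h : S.comp y u = some k) : open scoped Classical in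
    (total (P.localInput u) (coin u) (S.id y) (X.m u) (X.c₁ u) (X.i₃ u) (X.c₄ u) (X.u₅ u)).sk =
      ∑ z with z ≠ y ∧ S.InSub u (P.att y k z), P.vsk sd y coin z := by
  classical
  have fib : ∀ u, ∑ z with z ≠ y ∧ S.InSub u (P.att y k z), P.vsk sd y coin z =
      ∑ v with S.InSub u v, ∑ z with z ≠ y ∧ P.att y k z = v, P.vsk sd y coin z := by
    intro u
    rw [← Finset.sum_fiberwise_of_maps_to (t := Finset.univ.filter (S.InSub u)) (g := P.att y k)]
    · refine Finset.sum_congr rfl fun v hv => Finset.sum_congr ?_ fun _ _ => rfl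
      have hv := (Finset.mem_filter.1 hv).2
      ext z
      simp only [Finset.mem_filter, Finset.mem_univ, true_and]
      constructor
      · rintro ⟨⟨h₁, -⟩, h₂⟩; exact ⟨h₁, h₂⟩
      · rintro ⟨h₁, h₂⟩; exact ⟨⟨h₁, h₂ ▸ hv⟩, h₂⟩
    · exact fun z hz => Finset.mem_filter.2 ⟨Finset.mem_univ _, (Finset.mem_filter.1 hz).2.2⟩
  rw [fib]
  revert h
  refine S.induction_up (P := fun u => S.comp y u = some k →
    (total (P.localInput u) (coin u) (S.id y) (X.m u) (X.c₁ u) (X.i₃ u) (X.c₄ u) (X.u₅ u)).sk =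
      ∑ v with S.InSub u v, ∑ z with z ≠ y ∧ P.att y k z = v, P.vsk sd y coin z) ?_ u
  intro u ih h
  rw [S.sum_subtree, sum_att h]
  change ownSketch _ _ _ _ _ + ∑ j ∈ attached _ _ _ _, (X.c₄ u j).sk +
    (if (parentEdge (X.m u)).map Prod.fst = some (S.id u) then (X.i₃ u).sk else 0) +
    ∑ w ∈ (P.localInput u).ch, (X.u₅ u w).sk = _
  rw [X.ownSketch_eq h, sum_ch, X.attached_eq h, Finset.sum_image fun _ _ _ _ e => S.id_inj e, X.i₃_sk h]
  simp only [X.parentEdge_fst h]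
  congr 1
  · congr 2
    refine Finset.sum_congr rfl fun a ha => ?_
    obtain ⟨g, hj⟩ := (Finset.mem_filter.1 ha).2
    rw [X.c₄_eq (under_of_comp h) (under_of_comp hj.comp_left) hj.ne.2.2.symm, X.i₃_sk hj.comp_left, belowSk]
    simp only [below_iff hj.comp_left]
  · refine Finset.sum_congr rfl fun w hw => ?_
    have hw := (Finset.mem_filter.1 hw).2
    rw [X.u₅_eq (under_of_comp h) hw]
    exact ih w hw (comp_of_inSub h hw.mem)

section Summaries

variable {u k : V} (h : S.comp y u = some k)
include h

theorem report_flag : (report (P.localInput u) (coin u) (S.id y) (X.m u) (X.c₁ u) (X.u₂ u)).flag = true ↔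
    ∃ z, S.InSub u z ∧ ∃ b, P.Joint y k z b := by
  have hk := (Setting.comp_eq_some.1 h).1
  refine Setting.iff_exists_inSub (k := k) (Q := fun u =>
    (report (P.localInput u) (coin u) (S.id y) (X.m u) (X.c₁ u) (X.u₂ u)).flag = true)
    (q := fun z => ∃ b, P.Joint y k z b) (fun v hv => ?_) u (Setting.comp_eq_some.1 h).2
  have hc : S.comp y v = some k := Setting.comp_eq_some.2 ⟨hk, hv⟩
  change decide _ = true ↔ _
  rw [decide_eq_true_iff]
  refine or_congr (X.parentEdge_fst hc) ⟨?_, ?_⟩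
  · rintro ⟨j, hj, hf⟩
    obtain ⟨w, hw, rfl⟩ := (mem_ch P).1 hj
    rw [X.u₂_eq (under_of_comp hc).1 hw] at hf
    exact ⟨w, hw, hf⟩
  · rintro ⟨w, hw, hf⟩
    exact ⟨S.id w, (id_mem_ch P).2 hw, by rw [X.u₂_eq (under_of_comp hc).1 hw]; exact hf⟩

/-- The value 0 is the neutral element of the supremum and may mean that nothing is attached; only
positive thresholds carry information. -/
theorem report_lo (t : Fin (n + 1)) (ht : 0 < t) :
    t ≤ (report (P.localInput u) (coin u) (S.id y) (X.m u) (X.c₁ u) (X.u₂ u)).lo ↔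
      ∃ z, S.InSub u z ∧ ∃ g a, P.Joint y g a z ∧ (t : ℕ) ≤ n - P.num y g := by
  have hk := (Setting.comp_eq_some.1 h).1
  refine Setting.iff_exists_inSub (k := k) (Q := fun u =>
    t ≤ (report (P.localInput u) (coin u) (S.id y) (X.m u) (X.c₁ u) (X.u₂ u)).lo)
    (q := fun z => ∃ g a, P.Joint y g a z ∧ (t : ℕ) ≤ n - P.num y g) (fun v hv => ?_) u
    (Setting.comp_eq_some.1 h).2
  have hc : S.comp y v = some k := Setting.comp_eq_some.2 ⟨hk, hv⟩
  change t ≤ _ ⊔ _ ↔ _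
  have ht' : (⊥ : Fin (n + 1)) < t := ht
  rw [le_sup_iff, Finset.le_sup_iff ht', Finset.le_sup_iff ht']
  refine or_congr ⟨?_, ?_⟩ ⟨?_, ?_⟩
  · rintro ⟨j, hj, hl⟩
    obtain ⟨g, a, hJ, rfl⟩ := (X.mem_attached hc).1 hj
    rw [(X.c₁_joint hc hJ).1, Fin.le_def] at hl
    exact ⟨g, a, hJ, hl.trans (Nat.mod_le _ _)⟩
  · rintro ⟨g, a, hJ, hl⟩
    refine ⟨S.id a, (X.mem_attached hc).2 ⟨g, a, hJ, rfl⟩, ?_⟩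
    rw [(X.c₁_joint hc hJ).1, Fin.le_def]
    change (t : ℕ) ≤ (n - P.num y g) % (n + 1)
    rwa [Nat.mod_eq_of_lt (by omega)]
  · rintro ⟨j, hj, hf⟩
    obtain ⟨w, hw, rfl⟩ := (mem_ch P).1 hj
    rw [X.u₂_eq (under_of_comp hc).1 hw] at hf
    exact ⟨w, hw, hf⟩
  · rintro ⟨w, hw, hf⟩
    exact ⟨S.id w, (id_mem_ch P).2 hw, by rw [X.u₂_eq (under_of_comp hc).1 hw]; exact hf⟩

theorem report_hi (t : Fin (n + 1)) (ht : 0 < t) :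
    t ≤ (report (P.localInput u) (coin u) (S.id y) (X.m u) (X.c₁ u) (X.u₂ u)).hi ↔
      ∃ z, S.InSub u z ∧ ∃ g a, P.Joint y g a z ∧ (t : ℕ) ≤ P.last y g := by
  have hk := (Setting.comp_eq_some.1 h).1
  refine Setting.iff_exists_inSub (k := k) (Q := fun u =>
    t ≤ (report (P.localInput u) (coin u) (S.id y) (X.m u) (X.c₁ u) (X.u₂ u)).hi)
    (q := fun z => ∃ g a, P.Joint y g a z ∧ (t : ℕ) ≤ P.last y g) (fun v hv => ?_) u
    (Setting.comp_eq_some.1 h).2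
  have hc : S.comp y v = some k := Setting.comp_eq_some.2 ⟨hk, hv⟩
  change t ≤ _ ⊔ _ ↔ _
  have ht' : (⊥ : Fin (n + 1)) < t := ht
  rw [le_sup_iff, Finset.le_sup_iff ht', Finset.le_sup_iff ht']
  refine or_congr ⟨?_, ?_⟩ ⟨?_, ?_⟩
  · rintro ⟨j, hj, hl⟩
    obtain ⟨g, a, hJ, rfl⟩ := (X.mem_attached hc).1 hj
    rw [Fin.le_def, (X.c₁_joint hc hJ).2] at hl
    exact ⟨g, a, hJ, hl⟩
  · rintro ⟨g, a, hJ, hl⟩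
    refine ⟨S.id a, (X.mem_attached hc).2 ⟨g, a, hJ, rfl⟩, ?_⟩
    rwa [Fin.le_def, (X.c₁_joint hc hJ).2]
  · rintro ⟨j, hj, hf⟩
    obtain ⟨w, hw, rfl⟩ := (mem_ch P).1 hj
    rw [X.u₂_eq (under_of_comp hc).1 hw] at hf
    exact ⟨w, hw, hf⟩
  · rintro ⟨w, hw, hf⟩
    exact ⟨S.id w, (id_mem_ch P).2 hw, by rw [X.u₂_eq (under_of_comp hc).1 hw]; exact hf⟩

end Summaries

end Values

end Prep

/-! ### Naming the part of a vertex from its label. -/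

namespace Prep

open Protocol

variable {V : Type} {κ n lam c : ℕ} [Fintype V] {S : Setting κ n V} {P : Prep S lam}
variable {K : Type} [Field K] {sd : (Fin (skDeg κ c n) → Bool) → K} {y : V} {coin : V → CoinIdx κ c n → Bool}

theorem pick_eq {A : Finset ℕ} {p : ℕ → Prop} {z t : ℕ} (hA : t ∈ A) (ht : p t)
    (h : ∀ j ∈ A, p j → j = t) : pick A p z = t := by
  have hx : ∃ j ∈ A, p j := ⟨t, hA, ht⟩
  rw [pick, dif_pos hx]
  exact h _ hx.choose_spec.1 hx.choose_spec.2

theorem pick_none {A : Finset ℕ} {p : ℕ → Prop} {z : ℕ} (h : ∀ j ∈ A, ¬ p j) : pick A p z = z := by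
  rw [pick, dif_neg]
  rintro ⟨j, hj, hp⟩
  exact h j hj hp

theorem parName_eq {x q : V} (h : S.Child q x) : parName (P.localInput x) = S.id q := by
  rw [parName, par_child P h]; rfl

theorem pick_ch {x : V} {p : ℕ → Prop} {z : ℕ} {b : V} (hp : ∀ w, S.Child x w → (p (S.id w) ↔ S.InSub w b))
    {q : V} (hq : S.Child x q ∧ S.InSub q b) : pick (P.localInput x).ch p z = S.id q := by
  refine pick_eq ((id_mem_ch P).2 hq.1) ((hp q hq.1).2 hq.2) fun j hj h => ?_
  obtain ⟨w, hw, rfl⟩ := (mem_ch P).1 hj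
  rw [hw.eq_of_inSub hq.1 ((hp w hw).1 h) hq.2]

theorem pick_ch_none {x : V} {p : ℕ → Prop} {z : ℕ} {b : V}
    (hp : ∀ w, S.Child x w → (p (S.id w) ↔ S.InSub w b)) (hq : ¬ S.InSub x b) :
    pick (P.localInput x).ch p z = z := by
  refine pick_none fun j hj h => ?_
  obtain ⟨w, hw, rfl⟩ := (mem_ch P).1 hj
  exact hq (hw.mem.trans ((hp w hw).1 h))

theorem compNum_eq_iff {k v : V} (hk : S.Child y k) : P.compNum y v = P.num y k ↔ S.comp y v = some k := by
  cases e : S.comp y v with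
  | none =>
    rw [compNum, e]
    exact ⟨fun h => absurd h (num_pos hk).ne, nofun⟩
  | some w =>
    rw [compNum_of_comp e]
    have hw := (Setting.comp_eq_some.1 e).1
    exact ⟨fun h => by rw [num_injective hw hk h], fun h => by rw [Option.some_injective _ h]⟩

theorem compNum_mem_iff {k v : V} (hk : S.Child y k) :
    (P.num y k ≤ P.compNum y v ∧ P.compNum y v ≤ P.last y k) ↔ P.Below y k v := by
  cases e : S.comp y v with
  | none =>
    rw [compNum, e]
    refine ⟨fun h => absurd (num_pos (P := P) hk) (not_lt.2 h.1), ?_⟩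
    rintro ⟨w, e', -⟩
    rw [e] at e'; cases e'
  | some w =>
    rw [compNum_of_comp e, num_mem_iff hk (Setting.comp_eq_some.1 e).1, Below]
    exact ⟨fun h => ⟨w, e, h⟩, fun ⟨w', e', h⟩ => Option.some_injective _ (e.symm.trans e') ▸ h⟩

theorem compNum_lt_iff {k v : V} (hk : S.Child y k) :
    (P.num y k < P.compNum y v ∧ P.compNum y v ≤ P.last y k) ↔ P.Below y k v ∧ S.comp y v ≠ some k := by
  rw [← compNum_mem_iff hk, Ne, ← compNum_eq_iff (P := P) hk]
  omega

namespace Values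

variable (X : P.Values sd y coin)
include X

/-- The reported bounds come from two branches joined below `w`, one starting no later and one
ending no earlier than the number of `v`. By `hull` the branch of `v` is then joined below `w` as
well. -/
theorem hull_iff {x k w v g a z : V} (h : S.comp y x = some k) (hw : S.Child x w)
    (hj : P.Joint y g a z) (hz : S.comp y z = some k) (hb : P.Below y g v) :
    (n ≤ P.compNum y v + (X.u₂ x (S.id w)).lo ∧ P.compNum y v ≤ (X.u₂ x (S.id w)).hi) ↔ S.InSub w z := by
  have hwk : S.comp y w = some k := comp_of_inSub h hw.mem
  rw [X.u₂_eq (under_of_comp h).1 hw]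
  have lo := X.report_lo hwk
  have hi := X.report_hi hwk
  set r := report (P.localInput w) (coin w) (S.id y) (X.m w) (X.c₁ w) (X.u₂ w)
  obtain ⟨h₁, h₂⟩ := (compNum_mem_iff hj.1).2 hb
  have hpos : 0 < P.num y g := num_pos hj.1
  constructor
  · rintro ⟨h₃, h₄⟩
    have hhi : 0 < r.hi := by rw [Fin.lt_def, Fin.val_zero]; omega
    obtain ⟨z₂, hz₂, g₂, a₂, hj₂, hl₂⟩ := (hi _ hhi).1 le_rfl
    have hn₂ := num_le (P := P) y g₂
    obtain ⟨z₁, hz₁, g₁, a₁, hj₁, hl₁⟩ : ∃ z₁, S.InSub w z₁ ∧ ∃ g₁ a₁, P.Joint y g₁ a₁ z₁ ∧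
        P.num y g₁ ≤ P.compNum y v := by
      -- If `lo` is 0, the test forces the number of `v` to be at least `n`, the maximal number, so
      -- any branch below `w` starts no later; the one found for `hi` will do.
      by_cases hlo : 0 < r.lo
      · obtain ⟨z₁, hz₁, g₁, a₁, hj₁, hl₁⟩ := (lo _ hlo).1 le_rfl
        rw [Fin.lt_def, Fin.val_zero] at hlo
        exact ⟨z₁, hz₁, g₁, a₁, hj₁, by omega⟩
      · rw [Fin.lt_def, Fin.val_zero] at hlo
        exact ⟨z₂, hz₂, g₂, a₂, hj₂, by omega⟩
    obtain ⟨v', e, hp⟩ := hb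
    rw [compNum_of_comp e] at hl₁ h₄
    exact hull hj hj₁ hj₂ hz (comp_of_inSub hwk hz₁) (comp_of_inSub hwk hz₂)
      (Setting.comp_eq_some.1 e).1 hp hl₁ (h₄.trans hl₂) hz₁ hz₂
  · intro hwz
    constructor
    · by_cases hn : n ≤ P.num y g
      · omega
      · have := (lo ⟨n - P.num y g, by omega⟩ (by rw [Fin.lt_def, Fin.val_zero]; simp; omega)).2
          ⟨z, hwz, g, a, hj, le_rfl⟩
        rw [Fin.le_def] at this
        simp only at this
        omega
    · have hl := last_le (P := P) y g
      have := (hi ⟨P.last y g, by omega⟩ (by rw [Fin.lt_def, Fin.val_zero]; simp; omega)).2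
        ⟨z, hwz, g, a, hj, le_rfl⟩
      rw [Fin.le_def] at this
      exact h₂.trans this

/-- The computed name of the part of `v`. -/
noncomputable def part (x v : V) : ℕ :=
  partOf (P.localInput x) (S.id y) (X.m x) (X.c₁ x) (X.u₂ x) (P.lab y v)

/-- The three cases of `att_cases` are the three branches of `partOf`, distinguished by the
component number. Within each branch, the position of the point of attachment is tested by path
prefixes, by the hulls of attached numbers, or by the flag for the end of the parent edge. -/
theorem part_eq {x k v q : V} (h : S.comp y x = some k) (hv : v ≠ y) (hvx : v ≠ x)
    (hr : P.PartRel y k x v q) : X.part x v = S.id q := by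
  have hk := (Setting.comp_eq_some.1 h).1
  have l₁ : (P.lab y v).1 = S.anc v := rfl
  have l₂ : (P.lab y v).2 = P.compNum y v := rfl
  have hpre : ∀ w, S.Child x w → ((P.localInput x).pathN (S.id w) <+: expandAnc (S.anc v) ↔ S.InSub w v) :=
    fun w hw => by rw [pathN_id P hw.adj]; exact S.path_prefix_iff
  have hatt : ∀ j ∈ attached (P.localInput x) (S.id y) (X.m x) (X.c₁ x),
      (((X.c₁ x j).k : ℕ) ≤ P.compNum y v ∧ P.compNum y v ≤ (X.c₁ x j).hi) →
      ∃ g a, P.Joint y g a x ∧ S.id a = j ∧ P.Below y g v := by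
    intro j hj hc
    obtain ⟨g, a, hJ, rfl⟩ := (X.mem_attached h).1 hj
    rw [(X.c₁_joint h hJ).1, (X.c₁_joint h hJ).2, compNum_mem_iff hJ.1] at hc
    exact ⟨g, a, hJ, rfl, hc⟩
  unfold part partOf
  have c₁ := compNum_eq_iff (P := P) (v := v) hk
  have c₂ := compNum_lt_iff (P := P) (v := v) hk
  rw [l₁, l₂, X.m_k h, X.m_hi h]
  rcases att_cases (P := P) hk hv with h₁ | ⟨g, a, z, hj, hz, hb⟩ | ⟨h₁, z, b, hj⟩
  · rw [if_pos (c₁.2 h₁)]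
    rw [PartRel, att_self h₁] at hr
    rcases hr with hq | ⟨e, -⟩ | ⟨e, -⟩ | ⟨hc, hq⟩
    · exact pick_ch hpre hq
    · exact absurd e hvx
    · exact absurd e hvx
    · rw [pick_ch_none hpre hq, parName_eq hc]
  · have hne := hj.comp_ne hz hb
    rw [if_neg (fun e => hne (c₁.1 e)), if_pos (c₂.2 ⟨hj.below_of_below hz hb, hne⟩)]
    have hh : ∀ w, S.Child x w → ((n ≤ P.compNum y v + (X.u₂ x (S.id w)).lo ∧
        P.compNum y v ≤ (X.u₂ x (S.id w)).hi) ↔ S.InSub w z) := fun w hw => X.hull_iff h hw hj hz hb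
    have hnone : z ≠ x → ∀ j ∈ attached (P.localInput x) (S.id y) (X.m x) (X.c₁ x),
        ¬ (((X.c₁ x j).k : ℕ) ≤ P.compNum y v ∧ P.compNum y v ≤ (X.c₁ x j).hi) := by
      intro hzx j hj' hc
      obtain ⟨g', a', hJ, -, hb'⟩ := hatt j hj' hc
      exact hzx ((att_below hj hz hb).symm.trans (att_below hJ h hb'))
    rw [PartRel, att_below hj hz hb] at hr
    rcases hr with hq | ⟨rfl, g', hj', hb'⟩ | ⟨-, hn, -⟩ | ⟨hc, hq⟩
    · rw [pick_none (hnone fun e => hq.1.not_inSub (e ▸ hq.2))]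
      exact pick_ch hh hq
    · refine pick_eq ((X.mem_attached h).2 ⟨g', q, hj', rfl⟩) ?_ fun j hj'' hc => ?_
      · rw [(X.c₁_joint h hj').1, (X.c₁_joint h hj').2, compNum_mem_iff hj'.1]; exact hb'
      · obtain ⟨g'', a'', hJ, rfl, hb''⟩ := hatt j hj'' hc
        obtain ⟨w, e₁, hp⟩ := hb'
        obtain ⟨w', e₂, hp'⟩ := hb''
        rw [e₁] at e₂
        obtain rfl := Option.some_injective _ e₂
        obtain rfl := hj'.eq_of_prefix hJ h h hp hp'
        rw [(hJ.unique hj').1]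
    · exact absurd (hj.below_of_below hz hb) hn
    · rw [pick_none (hnone fun e => hq (e ▸ Setting.InSub.refl _)), pick_ch_none hh hq, parName_eq hc]
  · rw [if_neg fun e => h₁ (below_of_comp (c₁.1 e)), if_neg fun e => h₁ (c₂.1 e).1, (X.parentEdge_eq_some h).2 hj]
    have hf : ∀ w, S.Child x w → ((X.u₂ x (S.id w)).flag = true ↔ S.InSub w z) := by
      intro w hw
      rw [X.u₂_eq (under_of_comp h).1 hw, X.report_flag (comp_of_inSub h hw.mem)]
      exact ⟨fun ⟨z', hz', b', hj'⟩ => (hj'.unique hj).1 ▸ hz', fun hz => ⟨z, hz, b, hj⟩⟩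
    have hid : (P.localInput x).id = S.id x := rfl
    rw [PartRel, att_out hj h₁] at hr
    simp only [hid]
    have hid' : S.id z = S.id x → z = x := fun e => S.id_inj e
    rcases hr with hq | ⟨rfl, g', hj', hb'⟩ | ⟨rfl, -, hj'⟩ | ⟨hc, hq⟩
    · rw [if_neg fun e => hq.1.not_inSub (hid' e ▸ hq.2)]
      exact pick_ch hf hq
    · exact absurd (hj'.below_of_below h hb') h₁
    · rw [if_pos rfl, (hj.unique hj').2]
    · rw [if_neg fun e => hq (hid' e ▸ Setting.InSub.refl _), pick_ch_none hf hq, parName_eq hc]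

theorem part_eq_iff {x k v q : V} (h : S.comp y x = some k) (hv : v ≠ y) (hvx : v ≠ x) :
    X.part x v = S.id q ↔ P.PartRel y k x v q := by
  refine ⟨fun e => ?_, X.part_eq h hv hvx⟩
  obtain ⟨q', hq'⟩ := exists_partRel (P := P) h hv hvx
  rw [X.part_eq h hv hvx hq'] at e
  exact S.id_inj e ▸ hq'

theorem mem_names {x k : V} (h : S.comp y x = some k) {j : ℕ} :
    j ∈ names (P.localInput x) (S.id y) (X.m x) (X.c₁ x) ↔ ∃ q, P.NameRel y k x q ∧ S.id q = j := by
  classical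
  have hid : (P.localInput x).id = S.id x := rfl
  have e : names (P.localInput x) (S.id y) (X.m x) (X.c₁ x) = (P.localInput x).nb.filter fun j =>
    j ∈ (P.localInput x).ch ∨ j ∈ attached (P.localInput x) (S.id y) (X.m x) (X.c₁ x) ∨
      parentEdge (X.m x) = some ((P.localInput x).id, j) ∨ ((P.localInput x).par = some j ∧ j ≠ S.id y) := by
    rw [names]
  rw [e, Finset.mem_filter, mem_nb]
  constructor
  · rintro ⟨⟨q, hq, rfl⟩, h'⟩
    refine ⟨q, ?_, rfl⟩
    rw [id_mem_ch, X.mem_attached h, hid, X.parentEdge_eq_some h, par_eq_id, S.id_inj.ne_iff] at h'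
    rcases h' with h' | ⟨g, a, hj, e⟩ | h' | h'
    · exact Or.inl h'
    · exact Or.inr (Or.inl ⟨g, S.id_inj e ▸ hj⟩)
    · exact Or.inr (Or.inr (Or.inl h'))
    · exact Or.inr (Or.inr (Or.inr h'))
  · rintro ⟨q, hq, rfl⟩
    rw [id_mem_ch, X.mem_attached h, hid, X.parentEdge_eq_some h, par_eq_id, S.id_inj.ne_iff]
    rcases hq with hq | ⟨g, hq⟩ | hq | hq
    · exact ⟨⟨q, hq.adj, rfl⟩, Or.inl hq⟩
    · exact ⟨⟨q, hq.ne.2.2.symm, rfl⟩, Or.inr (Or.inl ⟨g, q, hq, rfl⟩)⟩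
    · exact ⟨⟨q, hq.ne.2.2, rfl⟩, Or.inr (Or.inr (Or.inl hq))⟩
    · exact ⟨⟨q, hq.1.adj.symm, rfl⟩, Or.inr (Or.inr (Or.inr hq))⟩

theorem part_mem_names {x k v : V} (h : S.comp y x = some k) (hv : v ≠ y) (hvx : v ≠ x) :
    X.part x v ∈ names (P.localInput x) (S.id y) (X.m x) (X.c₁ x) := by
  obtain ⟨q, hq⟩ := exists_partRel (P := P) h hv hvx
  exact (X.mem_names h).2 ⟨q, hq.nameRel h hv, (X.part_eq h hv hvx hq).symm⟩

end Values

end Prep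

/-! ### The multigraph of parts and the sketches of its classes. -/

namespace Prep

open Protocol

variable {V : Type} {κ n lam c : ℕ} [Fintype V] {S : Setting κ n V} (P : Prep S lam)
variable {K : Type} [Field K] (sd : (Fin (skDeg κ c n) → Bool) → K) (y : V) (coin : V → CoinIdx κ c n → Bool)

/-- The edges sampled by vertices of `T_y`, without those at `x`. -/
abbrev Edge (S : Setting κ n V) (y x : V) : Type := {e : V × V // Owns S y e.1 e.2 ∧ e.1 ≠ x ∧ e.2 ≠ x}

noncomputable instance (x : V) : Fintype (Edge S y x) :=
  open Classical in Subtype.fintype _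

/-- The name of the part of `v`. -/
noncomputable def pt (y k x v : V) : V :=
  open Classical in if h : ∃ q, P.PartRel y k x v q then h.choose else x

variable {P y} in
theorem pt_spec {x k v : V} (h : S.comp y x = some k) (hv : v ≠ y) (hvx : v ≠ x) :
    P.PartRel y k x v (P.pt y k x v) := by
  have hx := exists_partRel (P := P) h hv hvx
  rw [pt, dif_pos hx]
  exact hx.choose_spec

open scoped Classical in
/-- The parts of the graph without `x` and `y`, and the edges between them. -/
noncomputable def multi {x k : V} (h : S.comp y x = some k) : Multi ℕ (Edge S y x) where
  p₁ e := S.id (P.pt y k x e.1.1)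
  p₂ e := S.id (P.pt y k x e.1.2)
  names := (Finset.univ.filter (P.NameRel y k x)).image S.id
  mem₁ e := Finset.mem_image_of_mem _ (Finset.mem_filter.2 ⟨Finset.mem_univ _,
    (pt_spec h e.2.1.2.1.2 e.2.2.1).nameRel h e.2.1.2.1.2⟩)
  mem₂ e := Finset.mem_image_of_mem _ (Finset.mem_filter.2 ⟨Finset.mem_univ _,
    (pt_spec h e.2.1.2.2.1 e.2.2.2).nameRel h e.2.1.2.2.1⟩)

/-- The numbers of the edges. -/
noncomputable def code (x : V) (e : Edge S y x) : ℕ := edgeNum κ n (P.lab y e.1.1) (P.lab y e.1.2)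

/-- The sampling bits of the edges. -/
def bits (x : V) (t : Fin (numPhases c n)) (e : Edge S y x × Fin (numLevels n)) : Bool :=
  coin e.1.1.1 (.inl (⟨S.id e.1.1.2, S.id_lt _⟩, t, e.2))

variable {P sd y coin}

theorem block_id (v u : V) (t : Fin (numPhases c n)) (s : Fin (numLevels n)) :
    block (coin v) (S.id u) t s = coin v (.inl (⟨S.id u, S.id_lt _⟩, t, s)) := by
  rw [block]
  congr 3
  exact Fin.ext (Nat.mod_eq_of_lt (S.id_lt u))

/-- An edge number determines the unordered pair of labels, and `Owns` admits only one of the two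
orientations. -/
theorem code_injective (x : V) : Function.Injective (P.code y x) := by
  rintro ⟨⟨a, b⟩, h, _⟩ ⟨⟨a', b'⟩, h', _⟩ e
  rcases edgeNum_eq (lab_mem a) (lab_mem b) (lab_mem a') (lab_mem b') e with ⟨e₁, e₂⟩ | ⟨e₁, e₂⟩
  · obtain rfl := lab_injective e₁
    obtain rfl := lab_injective e₂
    rfl
  · obtain rfl := lab_injective e₁
    obtain rfl := lab_injective e₂
    exact absurd (h.2.2.2 h'.2.1) (h'.2.2.2 h.2.1).not_gt

theorem add_self_sk [CharP K 2] (z : Sk K c n) : z + z = 0 := by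
  funext t s; exact CharTwo.add_self_eq_zero _

theorem sub_eq_add_sk [CharP K 2] (z z' : Sk K c n) : z - z' = z + z' := by
  funext t s; exact CharTwo.sub_eq_add _ _

/-- Vertices outside `T_y` belong to the same part. -/
theorem partRel_congr {x k u v q : V} (h : S.comp y x = some k) (hu : u ≠ y) (hv : v ≠ y)
    (hu' : ¬ S.Under y u) (hv' : ¬ S.Under y v) (hr : P.PartRel y k x u q) : P.PartRel y k x v q := by
  have hk := (Setting.comp_eq_some.1 h).1
  have nb : ∀ z, z ≠ y → ¬ S.Under y z → ∀ g, ¬ P.Below y g z := by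
    rintro z hz hz' g ⟨w, e, -⟩
    exact hz' (under_of_comp e)
  have cs : ∀ z, z ≠ y → ¬ S.Under y z → ∃ z₀ b, P.Joint y k z₀ b := by
    intro z hz hz'
    rcases att_cases (P := P) hk hz with h₁ | ⟨g, a, z, hj, hz, hb⟩ | ⟨h₁, z, b, hj⟩
    · exact absurd (under_of_comp h₁) hz'
    · exact absurd hb (nb _ ‹_› hz' g)
    · exact ⟨z, b, hj⟩
  obtain ⟨z, b, hj⟩ := cs u hu hu'
  have e : P.att y k u = P.att y k v := by
    rw [att_out hj (nb u hu hu' k), att_out hj (nb v hv hv' k)]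
  rcases hr with hq | ⟨-, g, -, hb⟩ | ⟨e', hb, hj'⟩ | hq
  · exact Or.inl (e ▸ hq)
  · exact absurd hb (nb u hu hu' g)
  · exact Or.inr (Or.inr (Or.inl ⟨e ▸ e', nb v hv hv' k, hj'⟩))
  · exact Or.inr (Or.inr (Or.inr (e ▸ hq)))

section Distinct

variable {x k q : V} (h : S.comp y x = some k)
include h

/-- Together with the next facts this shows that the kinds of names do not collide: children and the
parent of `x` lie in its component, while joining edges lead out of it, to a branch below or to the
outside. -/
theorem not_joint_of_comp {g : V} (hq : S.comp y q = some k) : ¬ P.Joint y g q x := fun hj =>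
  hj.comp_ne h (below_of_comp hj.comp_left) hq

theorem not_joint_out_of_comp (hq : S.comp y q = some k) : ¬ P.Joint y k x q := fun hj =>
  hj.not_below (below_of_comp hq)

theorem comp_of_child_or (hq : q ≠ y) (hc : S.Child x q ∨ S.Child q x) : S.comp y q = some k := by
  rcases hc with hc | hc
  · exact comp_of_inSub h hc.mem
  · exact comp_parent h hc hq

theorem not_joint_out_of_joint {g : V} (hj : P.Joint y g q x) : ¬ P.Joint y k x q := fun hj' =>
  hj'.not_below (hj.below_of_below h (below_of_comp hj.comp_left))

end Distinct

theorem partRel_child {x k v q : V} (h : S.comp y x = some k) (hq : S.Child x q) :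
    (v ≠ y ∧ S.InSub q (P.att y k v)) ↔ ((v ≠ x ∧ v ≠ y) ∧ P.PartRel y k x v q) := by
  have hc := comp_of_inSub h hq.mem
  constructor
  · rintro ⟨h₁, h₂⟩
    refine ⟨⟨?_, h₁⟩, Or.inl ⟨hq, h₂⟩⟩
    rintro rfl
    rw [att_self h] at h₂
    exact hq.not_inSub h₂
  · rintro ⟨⟨-, h₁⟩, h₂ | ⟨-, g, hj, -⟩ | ⟨-, -, hj⟩ | ⟨hc', -⟩⟩
    · exact ⟨h₁, h₂.2⟩
    · exact absurd hj (not_joint_of_comp h hc)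
    · exact absurd hj (not_joint_out_of_comp h hc)
    · exact absurd hc'.mem hq.not_inSub

theorem partRel_joint {x k g v q : V} (h : S.comp y x = some k) (hj : P.Joint y g q x) :
    P.Below y g v ↔ ((v ≠ x ∧ v ≠ y) ∧ P.PartRel y k x v q) := by
  constructor
  · intro hb
    exact ⟨⟨fun e => hj.comp_ne h hb (e ▸ h), hb.ne⟩, Or.inr (Or.inl ⟨att_below hj h hb, g, hj, hb⟩)⟩
  · rintro ⟨-, ⟨hc, -⟩ | ⟨-, g', hj', hb⟩ | ⟨-, -, hj'⟩ | ⟨hc, -⟩⟩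
    · exact absurd hj (not_joint_of_comp h (comp_of_child_or h hj.ne.1 (Or.inl hc)))
    · have := hj.comp_left.symm.trans hj'.comp_left
      exact Option.some_injective _ this ▸ hb
    · exact absurd hj' (not_joint_out_of_joint h hj)
    · exact absurd hj (not_joint_of_comp h (comp_of_child_or h hj.ne.1 (Or.inr hc)))

theorem partRel_out {x k v q : V} (h : S.comp y x = some k) (hj : P.Joint y k x q) :
    (v ≠ y ∧ ¬ P.Below y k v) ↔ ((v ≠ x ∧ v ≠ y) ∧ P.PartRel y k x v q) := by
  constructor
  · rintro ⟨hv, hb⟩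
    exact ⟨⟨fun e => hb (below_of_comp (e ▸ h)), hv⟩, Or.inr (Or.inr (Or.inl ⟨att_out hj hb, hb, hj⟩))⟩
  · rintro ⟨⟨-, hv⟩, ⟨hc, -⟩ | ⟨-, g', hj', hb⟩ | ⟨-, hb, -⟩ | ⟨hc, -⟩⟩
    · exact absurd hj (not_joint_out_of_comp h (comp_of_child_or h hj.ne.2.1 (Or.inl hc)))
    · exact absurd hj (not_joint_out_of_joint h hj')
    · exact ⟨hv, hb⟩
    · exact absurd hj (not_joint_out_of_comp h (comp_of_child_or h hj.ne.2.1 (Or.inr hc)))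

variable (P sd y coin) in
open scoped Classical in
/-- The sketch of the part with name `q`. -/
noncomputable def ptSketch (k x : V) (q : ℕ) : Sk K c n :=
  ∑ v with (v ≠ x ∧ v ≠ y) ∧ S.id (P.pt y k x v) = q, ∑ u with u ≠ x ∧ u ≠ y, P.full sd y coin v u

open scoped Classical in
theorem vsk_sub (x v : V) : P.vsk sd y coin v - P.full sd y coin v x =
    ∑ u with u ≠ x ∧ u ≠ y, P.full sd y coin v u := by
  rw [vsk, ← Finset.add_sum_erase _ _ (Finset.mem_univ x), add_sub_cancel_left,
    ← Finset.filter_ne', Finset.sum_filter, Finset.sum_filter]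
  refine Finset.sum_congr rfl fun u _ => ?_
  by_cases hu : u = y
  · subst hu; simp [full_root]
  · simp [hu]

namespace Values

variable (X : P.Values sd y coin)
include X

theorem part_eq_pt {x k v : V} (h : S.comp y x = some k) (hv : v ≠ y) (hvx : v ≠ x) :
    X.part x v = S.id (P.pt y k x v) := X.part_eq h hv hvx (pt_spec h hv hvx)

theorem names_eq {x k : V} (h : S.comp y x = some k) :
    names (P.localInput x) (S.id y) (X.m x) (X.c₁ x) = (P.multi y h).names := by
  ext j
  rw [X.mem_names h]
  simp [multi]

/-- For each kind of name the received sketch is that of the whole part, edges to `x` included: the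
total of a child, the branch of an attached component, or the complement of the own branch.
Subtracting the entries of these edges leaves the edges within the graph without `x` and `y`. -/
theorem lowSketch_eq [CharP K 2] {x k q : V} (h : S.comp y x = some k) (hq : P.NameRel y k x q)
    (hc : ¬ S.Child q x) :
    lowSketch (P.localInput x) (coin x) (S.id y) (X.m x) (X.c₁ x) (X.u₂ x) (X.i₃ x) (X.c₄ x) (X.u₅ x)
      (S.id q) = ptSketch P sd y coin k x (S.id q) := by
  classical
  have key : ∀ (A : V → Prop), (∀ v, A v ↔ ((v ≠ x ∧ v ≠ y) ∧ P.PartRel y k x v q)) →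
      ∑ v with A v, P.vsk sd y coin v =
        ∑ v with (v ≠ x ∧ v ≠ y) ∧ S.id (P.pt y k x v) = S.id q, P.vsk sd y coin v := by
    intro A hA
    refine Finset.sum_congr (Finset.filter_congr fun v _ => ?_) fun _ _ => rfl
    rw [hA]
    refine and_congr_right fun hv => ?_
    rw [← X.part_eq_pt h hv.2 hv.1, X.part_eq_iff h hv.2 hv.1]
  have hraw : (if S.id q ∈ (P.localInput x).ch then (X.u₅ x (S.id q)).sk
      else if S.id q ∈ attached (P.localInput x) (S.id y) (X.m x) (X.c₁ x) then (X.c₄ x (S.id q)).sk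
      else (X.i₃ x).sk) =
      ∑ v with (v ≠ x ∧ v ≠ y) ∧ S.id (P.pt y k x v) = S.id q, P.vsk sd y coin v := by
    rcases hq with hq | ⟨g, hq⟩ | hq | hq
    · rw [if_pos ((id_mem_ch P).2 hq), X.u₅_eq (under_of_comp h) hq, X.total_sk (comp_of_inSub h hq.mem)]
      exact Eq.trans (by congr!) (key _ fun v => partRel_child h hq)
    · rw [if_neg, if_pos ((X.mem_attached h).2 ⟨g, q, hq, rfl⟩),
        X.c₄_eq (under_of_comp h) (under_of_comp hq.comp_left) hq.ne.2.2.symm, X.i₃_sk hq.comp_left]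
      · exact key _ fun v => partRel_joint h hq
      · rw [id_mem_ch]
        exact fun hc => not_joint_of_comp h (comp_of_child_or h hq.ne.1 (Or.inl hc)) hq
    · rw [if_neg, if_neg, X.i₃_sk h, ← sum_out]
      · exact Eq.trans (by congr!) (key _ fun v => partRel_out h hq)
      · rw [X.mem_attached h]
        rintro ⟨g, a, hj, e⟩
        obtain rfl := S.id_inj e
        exact not_joint_out_of_joint h hj hq
      · rw [id_mem_ch]
        exact fun hc => not_joint_out_of_comp h (comp_of_child_or h hq.ne.2.1 (Or.inl hc)) hq
    · exact absurd hq.1 hc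
  have hsub : ∑ j ∈ (P.localInput x).nb with j ≠ S.id y ∧ partOf (P.localInput x) (S.id y) (X.m x) (X.c₁ x)
        (X.u₂ x) (labelN (P.localInput x) (S.id y) (X.m x) (X.c₁ x) j) = S.id q,
        entry (P.localInput x) (coin x) (S.id y) (X.m x) (X.c₁ x) j =
      ∑ v with (v ≠ x ∧ v ≠ y) ∧ S.id (P.pt y k x v) = S.id q, P.full sd y coin v x := by
    rw [Finset.sum_filter, nb_eq, Finset.sum_image fun _ _ _ _ e => S.id_inj e, Finset.sum_filter,
      Finset.sum_filter]
    refine Finset.sum_congr rfl fun u _ => ?_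
    by_cases ha : S.G.Adj x u
    · by_cases hu : u = y
      · subst hu; simp
      · have e : partOf (P.localInput x) (S.id y) (X.m x) (X.c₁ x) (X.u₂ x) (P.lab y u) =
            S.id (P.pt y k x u) := X.part_eq_pt h hu ha.ne'
        simp only [ha, if_true, X.labelN_eq h ha hu, X.entry_eq h ha, e, S.id_inj.ne_iff, hu, ha.ne',
          ne_eq, not_false_eq_true, and_self, true_and, full_comm x u]
    · rw [if_neg ha, full_of_not_adj fun h' => ha h'.symm, ite_self]
  rw [lowSketch, hraw]
  refine (congrArg (_ - ·) ?_).trans ((congrArg (_ - ·) hsub).trans ?_)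
  · congr!
  rw [← Finset.sum_sub_distrib, ptSketch]
  exact Finset.sum_congr rfl fun v _ => vsk_sub x v

omit X in
open scoped Classical in
theorem sum_ptSketch (k x : V) (s : Finset ℕ) : ∑ q ∈ s, ptSketch P sd y coin k x q =
    ∑ v with (v ≠ x ∧ v ≠ y) ∧ S.id (P.pt y k x v) ∈ s, ∑ u with u ≠ x ∧ u ≠ y, P.full sd y coin v u := by
  unfold ptSketch
  rw [← Finset.sum_fiberwise_of_maps_to (t := s) (g := fun v => S.id (P.pt y k x v))]
  · refine Finset.sum_congr rfl fun q hq => Finset.sum_congr ?_ fun _ _ => rfl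
    ext v
    simp only [Finset.mem_filter, Finset.mem_univ, true_and]
    constructor
    · rintro ⟨h₁, h₂⟩; exact ⟨⟨h₁, h₂ ▸ hq⟩, h₂⟩
    · rintro ⟨⟨h₁, -⟩, h₂⟩; exact ⟨h₁, h₂⟩
  · exact fun v hv => (Finset.mem_filter.1 hv).2.2

/-- For the part of the parent: every edge that avoids `x` and `y` is counted at both ends, so the
sketches of all parts add up to 0. -/
theorem partSketch_eq [CharP K 2] {x k : V} (h : S.comp y x = some k) {j : ℕ}
    (hj : j ∈ (P.multi y h).names) :
    partSketch (P.localInput x) (coin x) (S.id y) (X.m x) (X.c₁ x) (X.u₂ x) (X.i₃ x) (X.c₄ x) (X.u₅ x) j =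
      ptSketch P sd y coin k x j := by
  classical
  rw [← X.names_eq h, X.mem_names h] at hj
  obtain ⟨q, hq, rfl⟩ := hj
  unfold partSketch
  by_cases hc : S.Child q x
  · rw [if_pos ((par_eq_id P).2 hc)]
    have h₁ : ∑ j ∈ (names (P.localInput x) (S.id y) (X.m x) (X.c₁ x)).erase (S.id q),
        lowSketch (P.localInput x) (coin x) (S.id y) (X.m x) (X.c₁ x) (X.u₂ x) (X.i₃ x) (X.c₄ x) (X.u₅ x) j =
        ∑ j ∈ (names (P.localInput x) (S.id y) (X.m x) (X.c₁ x)).erase (S.id q),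
          ptSketch P sd y coin k x j := by
      refine Finset.sum_congr rfl fun j hj => ?_
      obtain ⟨hne, hj⟩ := Finset.mem_erase.1 hj
      obtain ⟨q', hq', rfl⟩ := (X.mem_names h).1 hj
      exact X.lowSketch_eq h hq' fun hc' => hne (by rw [hc'.unique hc])
    have h₂ : ∑ j ∈ names (P.localInput x) (S.id y) (X.m x) (X.c₁ x), ptSketch P sd y coin k x j = 0 := by
      rw [sum_ptSketch]
      have : ∀ v, ((v ≠ x ∧ v ≠ y) ∧ S.id (P.pt y k x v) ∈
          names (P.localInput x) (S.id y) (X.m x) (X.c₁ x)) ↔ (v ≠ x ∧ v ≠ y) := by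
        refine fun v => and_iff_left_of_imp fun hv => ?_
        rw [← X.part_eq_pt h hv.2 hv.1]
        exact X.part_mem_names h hv.2 hv.1
      simp only [this]
      simp only [full, Finset.sum_add_distrib]
      rw [Finset.sum_comm (f := fun v u => P.half sd y coin u v)]
      exact add_self_sk _
    rw [← Finset.add_sum_erase _ _ ((X.mem_names h).2 ⟨q, hq, rfl⟩)] at h₂
    refine Eq.trans ?_ (h₁.trans ?_)
    · congr!
    · have := sub_eq_add_sk (ptSketch P sd y coin k x (S.id q))
        (∑ j ∈ (names (P.localInput x) (S.id y) (X.m x) (X.c₁ x)).erase (S.id q), ptSketch P sd y coin k x j)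
      rw [h₂, sub_eq_zero] at this
      exact this.symm
  · rw [if_neg fun e => hc ((par_eq_id P).1 e)]
    exact X.lowSketch_eq h hq hc

-- This is the linearity required by `decode_eq`: summed over a set of parts, the edges inside the
-- set cancel and the sampled edges leaving it remain.
open scoped Classical in
theorem sum_partSketch [CharP K 2] {x k : V} (h : S.comp y x = some k) (A : ℕ → Prop)
    (t : Fin (numPhases c n)) (s : Fin (numLevels n)) :
    ∑ q ∈ (P.multi y h).names with A q, partSketch (P.localInput x) (coin x) (S.id y) (X.m x) (X.c₁ x)
      (X.u₂ x) (X.i₃ x) (X.c₄ x) (X.u₅ x) q t s =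
    ∑ e ∈ (P.multi y h).sampledCut A (bits y coin x t) s, xi sd y coin ^ P.code y x e := by
  have e₁ : ∀ q ∈ (P.multi y h).names.filter A, partSketch (P.localInput x) (coin x) (S.id y) (X.m x)
      (X.c₁ x) (X.u₂ x) (X.i₃ x) (X.c₄ x) (X.u₅ x) q t s = ptSketch P sd y coin k x q t s := fun q hq => by
    rw [X.partSketch_eq h (Finset.mem_filter.1 hq).1]
  have e₂ : ∑ q ∈ (P.multi y h).names with A q, ptSketch P sd y coin k x q t s =
      (∑ q ∈ (P.multi y h).names with A q, ptSketch P sd y coin k x q) t s := by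
    simp only [Finset.sum_apply]
  rw [Finset.sum_congr rfl e₁, e₂, sum_ptSketch]
  simp only [Finset.sum_apply]
  set f : V → V → K := fun v u => P.half sd y coin v u t s
  set B : V → Prop := fun v => A (S.id (P.pt y k x v))
  have e₃ : ∀ v, ((v ≠ x ∧ v ≠ y) ∧ S.id (P.pt y k x v) ∈ (P.multi y h).names.filter A) ↔
      ((v ≠ x ∧ v ≠ y) ∧ B v) := by
    refine fun v => and_congr_right fun hv => ?_
    rw [Finset.mem_filter, and_iff_right_iff_imp]
    intro _
    rw [← X.names_eq h, ← X.part_eq_pt h hv.2 hv.1]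
    exact X.part_mem_names h hv.2 hv.1
  have e₄ : ∑ v with (v ≠ x ∧ v ≠ y) ∧ S.id (P.pt y k x v) ∈ (P.multi y h).names.filter A,
      ∑ u with u ≠ x ∧ u ≠ y, P.full sd y coin v u t s =
      ∑ v with v ≠ x ∧ v ≠ y, ∑ u with u ≠ x ∧ u ≠ y, if B v then f v u + f u v else 0 := by
    simp only [e₃, ← Finset.filter_filter]
    rw [Finset.sum_filter (p := B)]
    refine Finset.sum_congr rfl fun v _ => ?_
    split_ifs
    · rfl
    · simp
  -- The summand `f v u` occurs once for each end of the edge that lies in `B`; it survives exactly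
  -- when one end does.
  have e₅ : ∑ v with v ≠ x ∧ v ≠ y, ∑ u with u ≠ x ∧ u ≠ y, (if B v then f v u + f u v else 0) =
      ∑ v with v ≠ x ∧ v ≠ y, ∑ u with u ≠ x ∧ u ≠ y, if ¬ (B v ↔ B u) then f v u else 0 := by
    have : ∀ v u, (if B v then f v u + f u v else 0) =
        (if B v then f v u else 0) + (if B v then f u v else 0) := fun v u => by split_ifs <;> simp
    simp only [this, Finset.sum_add_distrib]
    rw [Finset.sum_comm (f := fun v u => if B v then f u v else 0), ← Finset.sum_add_distrib]
    refine Finset.sum_congr rfl fun v _ => ?_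
    rw [← Finset.sum_add_distrib]
    refine Finset.sum_congr rfl fun u _ => ?_
    by_cases hv : B v <;> by_cases hu : B u <;> simp [hv, hu, CharTwo.add_self_eq_zero]
  rw [e₄, e₅, ← Finset.sum_product', Multi.sampledCut, Multi.cut, Finset.filter_filter, Finset.sum_filter]
  symm
  have e₆ : ∀ e : Edge S y x, (if ¬ (A ((P.multi y h).p₁ e) ↔ A ((P.multi y h).p₂ e)) ∧
      Multi.Sampled (bits y coin x t) s e then xi sd y coin ^ P.code y x e else 0) =
      (fun e : V × V => if ¬ (B e.1 ↔ B e.2) then f e.1 e.2 else 0) e.1 := by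
    rintro ⟨⟨a, b⟩, hab, ha, hb⟩
    change _ = if ¬ (B a ↔ B b) then f a b else 0
    rw [ite_and]
    refine if_congr Iff.rfl ?_ rfl
    simp only [f, half, hab, true_and, block_id]
    exact if_congr Iff.rfl rfl rfl
  rw [Finset.sum_congr rfl fun e _ => e₆ e]
  rw [← Finset.sum_subtype (Finset.univ.filter fun e : V × V => Owns S y e.1 e.2 ∧ e.1 ≠ x ∧ e.2 ≠ x)
    (fun e => by simp) (fun e : V × V => if ¬ (B e.1 ↔ B e.2) then f e.1 e.2 else 0)]
  refine Finset.sum_subset_zero_on_sdiff (fun e he => ?_) (fun e he => ?_) fun _ _ => rfl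
  · obtain ⟨h₁, h₂, h₃⟩ := (Finset.mem_filter.1 he).2
    simp only [Finset.mem_product, Finset.mem_filter, Finset.mem_univ, true_and]
    exact ⟨⟨h₂, h₁.2.1.2⟩, h₃, h₁.2.2.1⟩
  · obtain ⟨h₁, h₂⟩ := Finset.mem_sdiff.1 he
    simp only [Finset.mem_product, Finset.mem_filter, Finset.mem_univ, true_and] at h₁ h₂
    have : ¬ Owns S y e.1 e.2 := fun h' => h₂ ⟨h', h₁.1.1, h₁.2.1⟩
    simp [f, half, this]

end Values

end Prep

/-! ### Correctness of the decision for favourable coins. -/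

namespace Prep

open Protocol

variable {V : Type} {κ n lam c : ℕ} [Fintype V] {S : Setting κ n V} {P : Prep S lam}
variable {K : Type} [Field K] {sd : (Fin (skDeg κ c n) → Bool) → K} {y : V} {coin : V → CoinIdx κ c n → Bool}

theorem pt_linked {x k v : V} (h : S.comp y x = some k) (hv : v ≠ y) (hvx : v ≠ x) :
    Linked S.G (fun z => z ≠ x ∧ z ≠ y) (P.pt y k x v) v := (pt_spec h hv hvx).joined h hv

theorem linked_of_conn {x k : V} (h : S.comp y x = some k) {a b : V}
    (hab : (P.multi y h).conn (S.id a) (S.id b)) : Linked S.G (fun z => z ≠ x ∧ z ≠ y) a b := by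
  have : Nonempty V := ⟨y⟩
  have hinv : ∀ v, Function.invFun S.id (S.id v) = v := Function.leftInverse_invFun S.id_inj
  have key : ∀ i j, (P.multi y h).conn i j →
      Linked S.G (fun z => z ≠ x ∧ z ≠ y) (Function.invFun S.id i) (Function.invFun S.id j) := by
    intro i j hij
    induction hij with
    | rel i j hr =>
      obtain ⟨⟨⟨u, v⟩, ho, hu, hv⟩, rfl, rfl⟩ := hr
      change Linked _ _ (Function.invFun S.id (S.id _)) (Function.invFun S.id (S.id _))
      rw [hinv, hinv]
      exact (pt_linked h ho.2.1.2 hu).trans ((Linked.single (A := fun z => z ≠ x ∧ z ≠ y)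
        ⟨hu, ho.2.1.2⟩ ⟨hv, ho.2.2.1⟩ ho.1).trans (pt_linked h ho.2.2.1 hv).symm)
    | refl => exact .refl
    | symm _ _ _ ih => exact ih.symm
    | trans _ _ _ _ _ ih₁ ih₂ => exact ih₁.trans ih₂
  have := key _ _ hab
  rwa [hinv, hinv] at this

namespace Values

variable (X : P.Values sd y coin)
include X

theorem pt_eq {x k v q : V} (h : S.comp y x = some k) (hv : v ≠ y) (hvx : v ≠ x)
    (hr : P.PartRel y k x v q) : P.pt y k x v = q :=
  S.id_inj ((X.part_eq_pt h hv hvx).symm.trans (X.part_eq h hv hvx hr))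

/-- An edge of the graph without `x` and `y` that has an end in `T_y` is owned by one of its ends
and so belongs to the multigraph. If both ends lie outside `T_y`, they are in the same part. -/
theorem conn_of_linked {x k : V} (h : S.comp y x = some k) {u v : V}
    (huv : Linked S.G (fun z => z ≠ x ∧ z ≠ y) u v) :
    (P.multi y h).conn (S.id (P.pt y k x u)) (S.id (P.pt y k x v)) := by
  induction huv with
  | refl => exact Setoid.refl' _ _
  | @tail b e _ hr ih =>
    obtain ⟨hb, he, ha⟩ := hr
    refine Setoid.trans' _ ih ?_
    have edge : ∀ a b, Owns S y a b → a ≠ x → b ≠ x →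
        (P.multi y h).conn (S.id (P.pt y k x a)) (S.id (P.pt y k x b)) := fun a b hab ha hb =>
      Relation.EqvGen.rel _ _ ⟨⟨(a, b), hab, ha, hb⟩, rfl, rfl⟩
    by_cases h₁ : Owns S y b e
    · exact edge b e h₁ hb.1 he.1
    by_cases h₂ : Owns S y e b
    · exact Setoid.symm' _ (edge e b h₂ he.1 hb.1)
    -- If neither end owns the edge, then neither lies under `y`: a single end under `y` would own
    -- it, and of two such ends the one with the smaller identifier would.
    have hlt := lt_or_gt_of_ne (S.id_inj.ne ha.ne)
    have nb : ¬ S.Under y b := fun hU => by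
      rcases hlt with hl | hl
      · exact h₁ ⟨ha, hU, he.2, fun _ => hl⟩
      · by_cases hU' : S.Under y e
        · exact h₂ ⟨ha.symm, hU', hb.2, fun _ => hl⟩
        · exact h₁ ⟨ha, hU, he.2, fun h => absurd h hU'⟩
    have ne : ¬ S.Under y e := fun hU => h₂ ⟨ha.symm, hU, hb.2, fun h => absurd h nb⟩
    rw [X.pt_eq h he.2 he.1 (partRel_congr h hb.2 he.2 nb ne (pt_spec h hb.2 hb.1))]

theorem pt_name {x k q : V} (h : S.comp y x = some k) (hq : P.NameRel y k x q) : P.pt y k x q = q :=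
  X.pt_eq h (hq.ne h).2 (hq.ne h).1 (hq.partRel h)

/-- Each part is connected in the graph and contains its name, so connectivity of the parts and of
the vertices is the same. -/
theorem conn_iff {x k : V} (h : S.comp y x = some k) :
    (∀ q ∈ (P.multi y h).names, ∀ q' ∈ (P.multi y h).names, (P.multi y h).conn q q') ↔
      ¬ S.IsCutPair x y := by
  have hxy : x ≠ y := ne_of_comp h
  have mem : ∀ {z}, (z ≠ x ∧ z ≠ y) ↔ z ∈ ({x, y}ᶜ : Set V) := by
    intro z; simp
  have names : ∀ q, q ∈ (P.multi y h).names ↔ ∃ z, P.NameRel y k x z ∧ S.id z = q := by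
    intro q; rw [← X.names_eq h]; exact X.mem_names h
  rw [Setting.IsCutPair, not_and, not_not]
  constructor
  · rintro hc - ⟨u, hu⟩ ⟨v, hv⟩
    have hu' := mem.2 hu
    have hv' := mem.2 hv
    have hp := hc _ ((names _).2 ⟨_, (pt_spec (P := P) h hu'.2 hu'.1).nameRel h hu'.2, rfl⟩) _
      ((names _).2 ⟨_, (pt_spec (P := P) h hv'.2 hv'.1).nameRel h hv'.2, rfl⟩)
    have hl := ((pt_linked h hu'.2 hu'.1).symm.trans ((linked_of_conn h hp).trans (pt_linked h hv'.2 hv'.1)))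
    obtain ⟨_, hr⟩ := Linked.reachable (A := ({x, y}ᶜ : Set V)) (hl.mono fun z hz => mem.1 hz) hu
    exact hr
  · intro hp q hq q' hq'
    obtain ⟨z, hz, rfl⟩ := (names q).1 hq
    obtain ⟨z', hz', rfl⟩ := (names q').1 hq'
    have key : ∀ {a b : ({x, y}ᶜ : Set V)} (_ : (S.G.induce ({x, y}ᶜ : Set V)).Walk a b),
        Linked S.G (fun z => z ≠ x ∧ z ≠ y) a.1 b.1 := by
      intro a b p
      induction p with
      | nil => exact .refl
      | @cons a b _ hadj _ ih =>
        exact (Linked.single (A := fun z => z ≠ x ∧ z ≠ y) (mem.2 a.2) (mem.2 b.2) hadj).trans ih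
    obtain ⟨p⟩ := hp hxy ⟨z, mem.1 (hz.ne h)⟩ ⟨z', mem.1 (hz'.ne h)⟩
    have := X.conn_of_linked h (key p)
    rwa [X.pt_name h hz, X.pt_name h hz'] at this

theorem decideCut_iff [CharP K 2] {x k : V} (h : S.comp y x = some k)
    (hg : (P.multi y h).GoodCoins (P.code y x) (2 ^ (2 * labelBits κ n)) (bits y coin x) (xi sd y coin)) :
    decideCut (P.localInput x) (coin x) (S.id y) (X.m x) (X.c₁ x) (X.u₂ x) (X.i₃ x) (X.c₄ x) (X.u₅ x) = true ↔
      S.IsCutPair x y := by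
  classical
  unfold decideCut
  rw [decide_eq_true_iff, ← not_iff_not, ← X.conn_iff h, not_not]
  have e := (P.multi y h).decode_eq (code := P.code y x) (h := bits y coin x)
    (ξ := xi sd y coin) (fun e => edgeNum_lt κ n _ _) hg
    (Z := partSketch (P.localInput x) (coin x) (S.id y) (X.m x) (X.c₁ x) (X.u₂ x) (X.i₃ x) (X.c₄ x) (X.u₅ x))
    (dec := fun z q q' => ∃ l ∈ labelSet κ n, ∃ l' ∈ labelSet κ n, edgeNum κ n l l' = z ∧
        partOf (P.localInput x) (S.id y) (X.m x) (X.c₁ x) (X.u₂ x) l = q ∧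
        partOf (P.localInput x) (S.id y) (X.m x) (X.c₁ x) (X.u₂ x) l' = q')
    (fun A t s => (Eq.trans (by congr!) (X.sum_partSketch h A t s)))
    (fun e => Or.inl ⟨_, lab_mem _, _, lab_mem _, rfl, X.part_eq_pt h e.2.1.2.1.2 e.2.2.1,
      X.part_eq_pt h e.2.1.2.2.1 e.2.2.2⟩) ?_ (numPhases c n)
  · rw [X.names_eq h, X.m_xi h, e]
    refine forall₂_congr fun q hq => forall₂_congr fun q' hq' => ?_
    exact ⟨fun hc => (P.multi y h).classes_le _ _ hc, hg.conn q hq q' hq'⟩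
  · rintro ⟨⟨u, v⟩, ho, hu, hv⟩ a b ⟨l, hl, l', hl', he, rfl, rfl⟩
    have p₁ : partOf (P.localInput x) (S.id y) (X.m x) (X.c₁ x) (X.u₂ x) (P.lab y u) = S.id (P.pt y k x u) :=
      X.part_eq_pt h ho.2.1.2 hu
    have p₂ : partOf (P.localInput x) (S.id y) (X.m x) (X.c₁ x) (X.u₂ x) (P.lab y v) = S.id (P.pt y k x v) :=
      X.part_eq_pt h ho.2.2.1 hv
    rcases edgeNum_eq hl hl' (lab_mem u) (lab_mem v) he with ⟨rfl, rfl⟩ | ⟨rfl, rfl⟩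
    · exact Or.inl ⟨p₁, p₂⟩
    · exact Or.inr ⟨p₂, p₁⟩

end Values

end Prep

/-! ### Failure probability of the decoding. -/

/-- The failure bound of the decoding algorithm. -/
theorem failure_le (κ c : ℕ) {n : ℕ} (hn : 2 ≤ n) {N : ℕ} (hN : N ≤ n) :
    ((15 : ℝ) / 16) ^ numPhases c n * N + numPhases c n * N * numLevels n *
      (((2 ^ (2 * labelBits κ n) : ℕ) : ℝ) * ((2 ^ (2 * labelBits κ n) : ℕ) : ℝ) / ((2 ^ skDeg κ c n : ℕ) : ℝ)) ≤
      1 / (n : ℝ) ^ (c + 2) := by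
  have hn' : (2 : ℝ) ≤ n := by exact_mod_cast hn
  have hN' : (N : ℝ) ≤ n := by exact_mod_cast hN
  have hl : (n : ℝ) ≤ 2 ^ lg n := by exact_mod_cast (lt_two_pow_lg n).le
  have hpow : ∀ d : ℕ, (n : ℝ) ^ d ≤ 2 ^ (d * lg n) := fun d => by
    rw [mul_comm, pow_mul]; gcongr
  have h₁ : ((15 : ℝ) / 16) ^ numPhases c n * N ≤ 1 / (n : ℝ) ^ (c + 3) := by
    have : ((15 : ℝ) / 16) ^ numPhases c n ≤ 1 / (n : ℝ) ^ (c + 4) := by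
      -- Sixteen phases reduce the expected surplus by at least one half.
      rw [numPhases, mul_assoc, pow_mul]
      calc (((15 : ℝ) / 16) ^ 16) ^ ((c + 4) * lg n) ≤ (1 / 2) ^ ((c + 4) * lg n) := by
            gcongr; norm_num
        _ = 1 / 2 ^ ((c + 4) * lg n) := by rw [one_div_pow]
        _ ≤ _ := one_div_le_one_div_of_le (by positivity) (hpow _)
    calc ((15 : ℝ) / 16) ^ numPhases c n * N ≤ 1 / (n : ℝ) ^ (c + 4) * n := by gcongr
      _ = 1 / (n : ℝ) ^ (c + 3) := by rw [pow_succ _ (c + 3)]; field_simp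
  have h₂ : (numPhases c n : ℝ) * N * numLevels n * (((2 ^ (2 * labelBits κ n) : ℕ) : ℝ) *
      ((2 ^ (2 * labelBits κ n) : ℕ) : ℝ) / ((2 ^ skDeg κ c n : ℕ) : ℝ)) ≤ 1 / (n : ℝ) ^ (c + 3) := by
    have hT : (numPhases c n : ℝ) ≤ 2 ^ numPhases c n := by exact_mod_cast Nat.lt_two_pow_self.le
    have hJ : (numLevels n : ℝ) ≤ 2 ^ numLevels n := by exact_mod_cast Nat.lt_two_pow_self.le
    have hq := hpow (c + 6)
    push_cast
    -- The summands of `skDeg` cancel the factors of the union bound: `4 * labelBits` the square of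
    -- the number of codes, the next two the numbers of phases and levels, and the last one the
    -- powers of `n`.
    rw [← pow_add, ← two_mul, ← mul_assoc, skDeg, pow_add, pow_add, pow_add, mul_div_assoc',
      div_le_div_iff₀ (by positivity) (by positivity)]
    calc (numPhases c n : ℝ) * N * numLevels n * 2 ^ (2 * 2 * labelBits κ n) * n ^ (c + 3)
        ≤ 2 ^ numPhases c n * n * 2 ^ numLevels n * 2 ^ (2 * 2 * labelBits κ n) * n ^ (c + 3) := by gcongr
      _ = (2 ^ (4 * labelBits κ n) * 2 ^ numPhases c n * 2 ^ numLevels n) * n ^ (c + 4) := by ring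
      _ ≤ (2 ^ (4 * labelBits κ n) * 2 ^ numPhases c n * 2 ^ numLevels n) * 2 ^ ((c + 6) * lg n) := by
          gcongr
          refine le_trans ?_ hq
          exact pow_le_pow_right₀ (by linarith) (by omega)
      _ = _ := by ring
  refine (add_le_add h₁ h₂).trans ?_
  rw [← two_mul, pow_succ _ (c + 2), mul_one_div, div_le_div_iff₀ (by positivity) (by positivity)]
  nlinarith [pow_pos (show (0 : ℝ) < n by linarith) (c + 2)]

namespace Prep

open Protocol

variable {V : Type} {κ n lam c : ℕ} [Fintype V] {S : Setting κ n V} {P : Prep S lam}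
variable {K : Type} [Field K]

theorem card_names_le {y x k : V} (h : S.comp y x = some k) : (P.multi y h).names.card ≤ n := by
  classical
  exact Finset.card_image_le.trans ((Finset.card_filter_le _ _).trans S.card_eq.le)

theorem four_mul_card_edge_lt (S : Setting κ n V) (y x : V) :
    4 * Fintype.card (Edge S y x) < 2 ^ numLevels n := by
  have h₁ : Fintype.card (Edge S y x) ≤ n * n := by
    refine (Fintype.card_subtype_le _).trans ?_
    rw [Fintype.card_prod, S.card_eq]
  have h₂ := lt_two_pow_lg n
  have h₃ : n * n < 2 ^ lg n * 2 ^ lg n := Nat.mul_self_lt_mul_self h₂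
  rw [numLevels, pow_add, two_mul, pow_add]
  omega

-- The bits that matter for `x` and `y` sit at distinct positions among the coins of all vertices,
-- so they are uniform and `prob_goodCoins` applies.
open scoped Classical in
theorem prob_not_goodCoins [Finite K] (sd : (Fin (skDeg κ c n) → Bool) ≃ K)
    (hK : Nat.card K = 2 ^ skDeg κ c n) {y x k : V} (h : S.comp y x = some k) :
    prob (fun coin : V → CoinIdx κ c n → Bool => ¬ (P.multi y h).GoodCoins (P.code y x)
      (2 ^ (2 * labelBits κ n)) (bits y coin x) (xi sd y coin)) ≤ 1 / (n : ℝ) ^ (c + 2) := by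
  have hn : 2 ≤ n := by
    rw [← S.card_eq]
    exact Fintype.one_lt_card_iff.2 ⟨x, y, ne_of_comp h⟩
  refine le_trans (le_of_eq ?_) (((P.multi y h).prob_goodCoins (K := K) (T := numPhases c n)
    (code_injective (P := P) (y := y) x) (fun e => edgeNum_lt κ n _ _) (four_mul_card_edge_lt S y x)).trans ?_)
  -- The sampling bits of an edge are stored at its owner under the identifier of the other end; the
  -- bits of the field element are stored at `y`.
  · let f : (Fin (numPhases c n) × Edge S y x × Fin (numLevels n)) ⊕ Fin (skDeg κ c n) → V × CoinIdx κ c n :=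
      Sum.elim (fun a => (a.2.1.1.1, .inl (⟨S.id a.2.1.1.2, S.id_lt _⟩, a.1, a.2.2))) fun b => (y, .inr b)
    have hf : Function.Injective f := by
      rintro (⟨t, ⟨⟨u, v⟩, h₁⟩, s⟩ | b) (⟨t', ⟨⟨u', v'⟩, h₁'⟩, s'⟩ | b') e
      · simp only [f, Sum.elim_inl, Prod.mk.injEq, Sum.inl.injEq, Fin.mk.injEq] at e
        obtain ⟨rfl, e, rfl, rfl⟩ := e
        obtain rfl := S.id_inj e
        rfl
      · simp [f] at e
      · simp [f] at e
      · simp only [f, Sum.elim_inr, Prod.mk.injEq, Sum.inr.injEq, true_and] at e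
        rw [e]
    let Q : ((Fin (numPhases c n) → Edge S y x × Fin (numLevels n) → Bool) × K) → Prop := fun z =>
      ¬ (P.multi y h).GoodCoins (P.code y x) (2 ^ (2 * labelBits κ n)) z.1 z.2
    let e₁ : (V → CoinIdx κ c n → Bool) ≃ (V × CoinIdx κ c n → Bool) := (Equiv.curry _ _ _).symm
    let e₂ : ((Fin (numPhases c n) × Edge S y x × Fin (numLevels n)) ⊕ Fin (skDeg κ c n) → Bool) ≃
        ((Fin (numPhases c n) → Edge S y x × Fin (numLevels n) → Bool) × K) :=
      (Equiv.sumArrowEquivProdArrow _ _ _).trans ((Equiv.curry _ _ _).prodCongr sd)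
    rw [show (fun x => ¬ (P.multi y h).GoodCoins (P.code y _) (2 ^ (2 * labelBits κ n)) x.1 x.2) = Q from rfl,
      ← prob_equiv e₂ Q, ← prob_comp_injective hf, ← prob_equiv e₁]
    rfl
  · rw [hK]
    exact failure_le κ c hn (card_names_le h)

end Prep

/-! ### Independent random delays. -/

section Delays

open scoped Classical in
theorem prob_forall_mem_le {Y : Type} [Fintype Y] {q w : ℕ} (D : Y → Finset (Fin q))
    (hw : ∀ y, (D y).card ≤ w) (s : Finset Y) :
    prob (fun ρ : Y → Fin q => ∀ y ∈ s, ρ y ∈ D y) ≤ ((w : ℝ) / q) ^ s.card := by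
  rcases Nat.eq_zero_or_pos q with rfl | hq
  · rcases s.eq_empty_or_nonempty with rfl | ⟨y, hy⟩
    · unfold prob
      simp only [Finset.card_empty, pow_zero]
      exact div_le_one_of_le₀ (by exact_mod_cast Finite.card_subtype_le _) (by positivity)
    · have : IsEmpty (Y → Fin 0) := ⟨fun ρ => (ρ y).elim0⟩
      simp only [prob, Nat.card_of_isEmpty, Nat.cast_zero, div_zero]
      positivity
  · have e : (Finset.univ.filter fun ρ : Y → Fin q => ∀ y ∈ s, ρ y ∈ D y) =
        Fintype.piFinset fun y => if y ∈ s then D y else Finset.univ := by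
      ext ρ
      simp only [Finset.mem_filter, Finset.mem_univ, true_and, Fintype.mem_piFinset]
      refine forall_congr' fun y => ?_
      split_ifs with h <;> simp [h]
    have hq' : (0 : ℝ) < q := by exact_mod_cast hq
    have e' : prob (fun ρ : Y → Fin q => ∀ y ∈ s, ρ y ∈ D y) = ((Fintype.piFinset fun y =>
        if y ∈ s then D y else Finset.univ).card : ℝ) / (Fintype.card (Y → Fin q) : ℝ) := by
      rw [prob_eq, ← e]; congr!
    rw [e', Fintype.card_piFinset, Fintype.card_fun, Fintype.card_fin]
    have : ∏ y, (if y ∈ s then D y else Finset.univ).card ≤ w ^ s.card * q ^ (sᶜ).card := by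
      rw [← Finset.prod_mul_prod_compl s]
      refine Nat.mul_le_mul ((Finset.prod_le_pow_card _ _ w fun y hy => ?_)) (Finset.prod_le_pow_card _ _ q fun y hy => ?_)
      · rw [if_pos hy]; exact hw y
      · rw [if_neg (Finset.mem_compl.1 hy)]; simp
    rw [div_pow, div_le_div_iff₀ (by positivity) (by positivity)]
    calc ((∏ y, (if y ∈ s then D y else Finset.univ).card : ℕ) : ℝ) * (q : ℝ) ^ s.card
        ≤ ((w ^ s.card * q ^ (sᶜ).card : ℕ) : ℝ) * (q : ℝ) ^ s.card := by gcongr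
      _ = (w : ℝ) ^ s.card * ((q ^ Fintype.card Y : ℕ) : ℝ) := by
        rw [← Finset.card_add_card_compl s]
        push_cast
        ring

/-- If few of the random times meet a slot in expectation, many do so with small probability. -/
theorem prob_le_card_le {Y : Type} [Fintype Y] {q w : ℕ} (D : Y → Finset (Fin q))
    (hw : ∀ y, (D y).card ≤ w) (Z : Finset Y) (hZ : ∀ y, (D y).Nonempty → y ∈ Z)
    (h : 2 * (Z.card * w) ≤ q) (m : ℕ) :
    prob (fun ρ : Y → Fin q => m ≤ Nat.card {y // ρ y ∈ D y}) ≤ 1 / 2 ^ m := by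
  classical
  rcases Nat.eq_zero_or_pos q with rfl | hq
  · rcases isEmpty_or_nonempty Y with hY | ⟨⟨y⟩⟩
    · rcases m with _ | m
      · simp only [pow_zero, div_one]
        unfold prob
        exact div_le_one_of_le₀ (by exact_mod_cast Finite.card_subtype_le _) (by positivity)
      · simp [prob]
    · have : IsEmpty (Y → Fin 0) := ⟨fun ρ => (ρ y).elim0⟩
      simp only [prob, Nat.card_of_isEmpty, Nat.cast_zero, div_zero]
      positivity
  have hq' : (0 : ℝ) < q := by exact_mod_cast hq
  -- If at least `m` times fall into their sets, then all members of some `m`-subset of `Z` do; the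
  -- union bound is over these subsets.
  refine (prob_mono (Q := fun ρ : Y → Fin q => ∃ s ∈ Z.powersetCard m, ∀ y ∈ s, ρ y ∈ D y) ?_).trans ?_
  · intro ρ hρ
    rw [Nat.card_eq_fintype_card, Fintype.card_subtype] at hρ
    obtain ⟨s, hs, hc⟩ := Finset.exists_subset_card_eq hρ
    have hs' : ∀ y ∈ s, ρ y ∈ D y := fun y hy => (Finset.mem_filter.1 (hs hy)).2
    exact ⟨s, Finset.mem_powersetCard.2 ⟨fun y hy => hZ y ⟨_, hs' y hy⟩, hc⟩, hs'⟩
  · refine (prob_exists_le' _ _ le_rfl (ε := ((w : ℝ) / q) ^ m) (by positivity) fun s hs => ?_).trans ?_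
    · rw [← (Finset.mem_powersetCard.1 hs).2]
      exact prob_forall_mem_le D hw s
    · rw [Finset.card_powersetCard]
      calc ((Z.card.choose m : ℕ) : ℝ) * ((w : ℝ) / q) ^ m ≤ (Z.card : ℝ) ^ m * ((w : ℝ) / q) ^ m := by
            gcongr
            exact_mod_cast Nat.choose_le_pow _ _
        _ = ((Z.card * w : ℝ) / q) ^ m := by rw [← mul_pow, mul_div_assoc]
        _ ≤ (1 / 2) ^ m := by
            refine pow_le_pow_left₀ (by positivity) ?_ m
            rw [div_le_div_iff₀ hq' (by norm_num), one_mul, mul_comm]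
            exact_mod_cast h
        _ = 1 / 2 ^ m := by rw [one_div_pow]

end Delays

/-! ### Encoding messages by bits. -/

section Encoding

theorem nonempty_codec {M : Type} [Finite M] [Nonempty M] {N W bw : ℕ} (hN : 0 < N) (hW : 0 < W)
    (hM : Nat.card M ≤ 2 ^ W) (hbw : 6 * (N * W) * 2 ≤ 2 ^ bw) : Nonempty (Codec M N W bw) := by
  classical
  have := Fintype.ofFinite M
  have : Nonempty (Item N W × Bool) := ⟨(Item.mk 0 ⟨0, hN⟩ ⟨0, hW⟩, true)⟩
  obtain ⟨f⟩ : Nonempty (M ↪ (Fin W → Bool)) := by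
    refine Function.Embedding.nonempty_of_card_le ?_
    rw [← Nat.card_eq_fintype_card]
    simpa using hM
  have hc : Fintype.card (Item N W × Bool) ≤ Fintype.card (Fin bw → Bool) := by
    rw [Fintype.card_prod, Fintype.card_lex, Fintype.card_prod, Fintype.card_lex, Fintype.card_prod]
    simpa using hbw
  obtain ⟨g⟩ := Function.Embedding.nonempty_of_card_le hc
  have hg : Function.Injective fun q => List.ofFn (g q) := List.ofFn_injective.comp g.injective
  exact ⟨{ pos := hW
           bits := f
           unbits := Function.invFun f
           unbits_bits := Function.leftInverse_invFun f.injective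
           enc := fun q => List.ofFn (g q)
           dec := Function.invFun fun q => List.ofFn (g q)
           dec_enc := Function.leftInverse_invFun hg
           length_enc := fun q => by simp }⟩

/-- The bit length of messages. -/
def msgBits (κ c n : ℕ) : ℕ :=
  4 * lg n + (2 * (κ * lg n) + 1) + skDeg κ c n + skDeg κ c n * (numPhases c n * numLevels n) +
    numPhases c n * numLevels n + 1

theorem msg_card_le (κ c n : ℕ) {K : Type} [Finite K] (hK : Nat.card K = 2 ^ skDeg κ c n) :
    Finite (Msg K κ c n) ∧ Nat.card (Msg K κ c n) ≤ 2 ^ msgBits κ c n := by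
  classical
  have := Fintype.ofFinite K
  let f : Msg K κ c n → (Fin (n + 1) × Fin (n + 1) × Fin (n + 1) × Fin (n + 1)) ×
    Option (Fin (2 ^ (κ * lg n)) × Fin (2 ^ (κ * lg n))) × K × Sk K c n ×
    (Fin (numPhases c n) → Fin (numLevels n) → Bool) × Bool := fun m => ((m.dep, m.k, m.lo, m.hi), m.edge, m.xi, m.sk, m.smp, m.flag)
  have hf : Function.Injective f := by
    intro m m' e
    simp only [f, Prod.mk.injEq] at e
    ext1 <;> tauto
  refine ⟨Finite.of_injective f hf, (Nat.card_le_card_of_injective f hf).trans ?_⟩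
  have h₁ : n + 1 ≤ 2 ^ lg n := lt_two_pow_lg n
  have h₂ : 2 ^ (κ * lg n) * 2 ^ (κ * lg n) + 1 ≤ 2 ^ (2 * (κ * lg n) + 1) := by
    rw [← pow_add, ← two_mul, pow_succ]
    have : 0 < 2 ^ (2 * (κ * lg n)) := by positivity
    omega
  rw [Nat.card_eq_fintype_card] at hK ⊢
  simp only [Fintype.card_prod, Fintype.card_fin, Fintype.card_option, Fintype.card_fun,
    Fintype.card_bool, hK]
  rw [msgBits]
  calc _ ≤ (2 ^ lg n * (2 ^ lg n * (2 ^ lg n * 2 ^ lg n))) * (2 ^ (2 * (κ * lg n) + 1) * (2 ^ skDeg κ c n *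
        (((2 ^ skDeg κ c n) ^ numLevels n) ^ numPhases c n * ((2 ^ numLevels n) ^ numPhases c n * 2)))) := by
        gcongr
    _ = _ := by
        simp only [← pow_mul, ← pow_succ, ← pow_add]
        congr 1
        ring

end Encoding

/-! ### Polylogarithmic bounds. -/

/-- Bounds by a constant times a power of the logarithm. -/
def PolyLog (g : ℕ → ℕ) : Prop := ∃ C k, ∀ n, g n ≤ C * lg n ^ k

namespace PolyLog

theorem const (a : ℕ) : PolyLog fun _ => a := ⟨a, 0, fun n => by simp⟩

theorem lg : PolyLog fun n => lg n := ⟨1, 1, fun n => by simp⟩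

theorem add {f g : ℕ → ℕ} (hf : PolyLog f) (hg : PolyLog g) : PolyLog fun n => f n + g n := by
  obtain ⟨C, k, h⟩ := hf
  obtain ⟨C', k', h'⟩ := hg
  refine ⟨C + C', max k k', fun n => ?_⟩
  rw [Nat.add_mul]
  exact Nat.add_le_add ((h n).trans (Nat.mul_le_mul_left _ (Nat.pow_le_pow_right (lg_pos n) (le_max_left _ _))))
    ((h' n).trans (Nat.mul_le_mul_left _ (Nat.pow_le_pow_right (lg_pos n) (le_max_right _ _))))

theorem mul {f g : ℕ → ℕ} (hf : PolyLog f) (hg : PolyLog g) : PolyLog fun n => f n * g n := by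
  obtain ⟨C, k, h⟩ := hf
  obtain ⟨C', k', h'⟩ := hg
  refine ⟨C * C', k + k', fun n => ?_⟩
  calc f n * g n ≤ (C * _root_.lg n ^ k) * (C' * _root_.lg n ^ k') := Nat.mul_le_mul (h n) (h' n)
    _ = _ := by ring

theorem labelBits (κ : ℕ) : PolyLog (labelBits κ) :=
  ((((const _).mul lg).add (const 1)).mul lg).add lg

theorem numPhases (c : ℕ) : PolyLog (numPhases c) := (const _).mul lg

theorem numLevels : PolyLog numLevels := ((const _).mul lg).add (const 2)

theorem skDeg (κ c : ℕ) : PolyLog (skDeg κ c) :=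
  ((((const 4).mul (labelBits κ)).add (numPhases c)).add numLevels).add ((const _).mul lg)

theorem msgBits (κ c : ℕ) : PolyLog (msgBits κ c) :=
  ((((((const 4).mul lg).add (((const 2).mul ((const κ).mul lg)).add (const 1))).add (skDeg κ c)).add
    ((skDeg κ c).mul ((numPhases c).mul numLevels))).add ((numPhases c).mul numLevels)).add (const 1)

/-- The logarithm of a number bounded by a power of the logarithm is at most a multiple of it. -/
theorem exists_le_two_pow {g : ℕ → ℕ} (hg : PolyLog g) : ∃ β, ∀ n, g n ≤ 2 ^ (β * _root_.lg n) := by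
  obtain ⟨C, k, h⟩ := hg
  refine ⟨C + k, fun n => (h n).trans ?_⟩
  rw [Nat.add_mul, pow_add]
  refine Nat.mul_le_mul ?_ ?_
  · refine Nat.lt_two_pow_self.le.trans (Nat.pow_le_pow_right (by norm_num) ?_)
    exact Nat.le_mul_of_pos_right _ (lg_pos n)
  · rw [mul_comm, pow_mul]
    exact Nat.pow_le_pow_left Nat.lt_two_pow_self.le _

end PolyLog

/-! ### The single algorithms and their joint execution. -/

namespace Protocol

variable {V : Type} {κ n lam c : ℕ} {K : Type} [Field K] {W bw : ℕ} {Coin : Type}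

/-- The number of random bits of a vertex in one of the subalgorithms. -/
def numCoins (κ c n : ℕ) : ℕ := Fintype.card (CoinIdx κ c n)

/-- The random bits, indexed by their use. -/
noncomputable def toIdx (ω : Coins (numCoins κ c n)) : CoinIdx κ c n → Bool :=
  fun a => ω (Fintype.equivFin _ a)

variable (sd : (Fin (skDeg κ c n) → Bool) → K) (cd : Codec (Msg K κ c n) (2 ^ (κ * lg n)) W bw)
  (cf : Coin → Fin (2 ^ (κ * lg n)) → CoinIdx κ c n → Bool)

/-- The outputs of all the subalgorithms. -/
noncomputable def outs (a : LocalInput n κ lam) (ω : Coin)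
    (k : Fin (2 ^ (κ * lg n)) → Table (Msg K κ c n)) (i : ℕ) : Option Bool :=
  if h : i < 2 ^ (κ * lg n) then result a (cf ω ⟨i, h⟩) i (k ⟨i, h⟩) else none

variable (lam) in
/-- The algorithm for the vertex with identifier `i`. -/
noncomputable def single (i : ℕ) :
    CongestAlg (LocalInput n κ lam) (Coins (numCoins κ c n)) (Option Bool) bw :=
  SchedState.alg cd (family sd lam) {j | (j : ℕ) = i} (fun ω _ => toIdx ω)
    fun a ω k => outs (fun ω _ => toIdx ω) a ω k i

variable (lam) in
/-- The algorithm that executes all of them. -/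
noncomputable def joint :
    CongestAlg (LocalInput n κ lam) (Coins 0 × (Fin (2 ^ (κ * lg n)) → Coins (numCoins κ c n)))
      (ℕ → Option Bool) bw :=
  SchedState.alg cd (family sd lam) Set.univ (fun ω i => toIdx (ω.2 i))
    (outs fun ω i => toIdx (ω.2 i))

variable {cf}

theorem outs_mono {a : LocalInput n κ lam} {ω : Coin} {k k' : Fin (2 ^ (κ * lg n)) → Table (Msg K κ c n)}
    (h : ∀ i, (k i).Le (k' i)) {i : ℕ} {b : Bool} (hb : outs cf a ω k i = some b) :
    outs cf a ω k' i = some b := by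
  unfold outs at hb ⊢
  split_ifs at hb ⊢
  exact result_mono (h _) hb

end Protocol

namespace Prep

open Protocol SchedState

variable {V : Type} {κ n lam c : ℕ} [Fintype V] {S : Setting κ n V} (P : Prep S lam)
variable {K : Type} [Field K] {W bw : ℕ} {Coin : Type}

/-- The random bits for which the subalgorithm of `y` is correct. -/
def Favorable (sd : (Fin (skDeg κ c n) → Bool) → K) (y : V) (coin : V → CoinIdx κ c n → Bool) : Prop :=
  ∀ x k (h : S.comp y x = some k), (P.multi y h).GoodCoins (P.code y x) (2 ^ (2 * labelBits κ n))
    (bits y coin x) (xi sd y coin)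

variable {P}

/-- A union bound over `x` costs one factor `n`. -/
theorem prob_not_favorable [Finite K] (sd : (Fin (skDeg κ c n) → Bool) ≃ K)
    (hK : Nat.card K = 2 ^ skDeg κ c n) (y : V) :
    prob (fun coin : V → CoinIdx κ c n → Bool => ¬ P.Favorable sd y coin) ≤ 1 / (n : ℝ) ^ (c + 1) := by
  have hn : (0 : ℝ) < n := by
    rw [← S.card_eq]
    exact_mod_cast Fintype.card_pos_iff.2 ⟨y⟩
  refine (prob_mono (Q := fun coin => ∃ x ∈ (Finset.univ : Finset V), ∃ k, ∃ h : S.comp y x = some k,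
    ¬ (P.multi y h).GoodCoins (P.code y x) (2 ^ (2 * labelBits κ n)) (bits y coin x) (xi sd y coin))
    ?_).trans ((prob_exists_le' _ _ (m := n) (ε := 1 / (n : ℝ) ^ (c + 2)) ?_ (by positivity) ?_).trans ?_)
  · intro coin h
    unfold Favorable at h
    push Not at h
    obtain ⟨x, k, h, hg⟩ := h
    exact ⟨x, Finset.mem_univ _, k, h, hg⟩
  · exact_mod_cast S.card_eq.le
  · intro x _
    by_cases hx : ∃ k, S.comp y x = some k
    swap
    · have : ∀ coin : V → CoinIdx κ c n → Bool, ¬ ∃ k, ∃ h : S.comp y x = some k,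
          ¬ (P.multi y h).GoodCoins (P.code y x) (2 ^ (2 * labelBits κ n)) (bits y coin x) (xi sd y coin) :=
        fun coin ⟨k, h, _⟩ => hx ⟨k, h⟩
      simp only [prob, this, Nat.card_of_isEmpty, Nat.cast_zero, zero_div]
      positivity
    · obtain ⟨k, hx⟩ := hx
      refine le_trans (prob_mono fun coin h => ?_) (prob_not_goodCoins (P := P) sd hK hx)
      obtain ⟨k', h, hg⟩ := h
      obtain rfl : k = k' := Option.some_injective _ (hx.symm.trans h)
      exact hg
  · rw [pow_succ _ (c + 1)]
    apply le_of_eq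
    field_simp

variable {sd : (Fin (skDeg κ c n) → Bool) → K} {cd : Codec (Msg K κ c n) (2 ^ (κ * lg n)) W bw}
  {act act' : Set (Fin (2 ^ (κ * lg n)))}

theorem isFix_congr {coin coin' : V → Fin (2 ^ (κ * lg n)) → CoinIdx κ c n → Bool} {i : Fin (2 ^ (κ * lg n))}
    (hc : ∀ v, coin v i = coin' v i) {k : V → Table (Msg K κ c n)}
    (h : IsFix (P.analysis sd act coin) i k) : IsFix (P.analysis sd act' coin') i k :=
  ⟨h.ok, fun u v p huv => by rw [h.eq u v p huv, hc]⟩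

theorem exists_decision [CharP K 2] {coin : V → Fin (2 ^ (κ * lg n)) → CoinIdx κ c n → Bool}
    {i : Fin (2 ^ (κ * lg n))} (hi : i ∈ act) {k : V → Table (Msg K κ c n)}
    (h : IsFix (P.analysis sd act coin) i k) {x y : V} (hy : S.id y = i) (hx : S.Under y x)
    (hf : P.Favorable sd y fun v => coin v i) :
    ∃ b, result (P.localInput x) (coin x i) i (k x) = some b ∧ (b = true ↔ S.IsCutPair x y) := by
  obtain ⟨X, hX⟩ := exists_values hi h hy
  obtain ⟨w, hw⟩ := exists_comp hx
  exact ⟨_, hX x hx, X.decideCut_iff hw (hf x w hw)⟩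

section Single

variable (y : V) (ω : V → Coins (numCoins κ c n))

theorem single_finishesBy {R : ℕ} (hR : 24 * S.G.diam * W ≤ R) :
    (single lam sd cd (S.id y)).FinishesBy S.G S.id P.localInput ω R :=
  finishesBy (P.analysis sd {j | (j : ℕ) = S.id y} fun v _ => toIdx (ω v)) S.id_inj hR

theorem single_out_succ (t : ℕ) (v : V) (b : Bool)
    (h : (single lam sd cd (S.id y)).outAt S.G S.id P.localInput ω t v = some b) :
    (single lam sd cd (S.id y)).outAt S.G S.id P.localInput ω (t + 1) v = some b := by
  unfold single at h ⊢
  rw [outAt_eq] at h ⊢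
  exact outs_mono (fun i => tab_mono S.id_inj (Nat.le_succ t) v i) h

theorem single_sends {t : ℕ} {u v : V} (h : (single lam sd cd (S.id y)).Sends S.G S.id P.localInput ω t u v) :
    S.InSub y u := by
  obtain ⟨q, -, hq, y', hy', he⟩ :=
    sends_imp (P.analysis sd {j | (j : ℕ) = S.id y} fun v _ => toIdx (ω v)) S.id_inj h
  obtain rfl : y' = y := S.id_inj (hy'.trans hq)
  exact he.inSub

open scoped Classical in
theorem single_card_sends_le (T : ℕ) (u v : V) : ((Finset.range T).filter fun t =>
    (single lam sd cd (S.id y)).Sends S.G S.id P.localInput ω t u v).card ≤ 6 * W := by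
  refine (card_sends_le (P.analysis sd {j | (j : ℕ) = S.id y} fun v _ => toIdx (ω v)) S.id_inj T u v).trans ?_
  have : Fintype.card (Fin 6 × Fin W) = 6 * W := by simp
  rw [← this, ← Finset.card_univ]
  refine Finset.card_le_card_of_injOn (fun q => (q.phase, q.bit)) (fun _ _ => Finset.mem_coe.2 (Finset.mem_univ _)) ?_
  intro q hq q' hq' e
  have h₁ : (q.tag : ℕ) = S.id y := (@Finset.mem_filter _ _ (_) _ _).1 hq |>.2
  have h₂ : (q'.tag : ℕ) = S.id y := (@Finset.mem_filter _ _ (_) _ _).1 hq' |>.2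
  have e₁ : q.phase = q'.phase := (Prod.ext_iff.1 e).1
  have e₂ : q.bit = q'.bit := (Prod.ext_iff.1 e).2
  rw [← q.eta, ← q'.eta, Fin.ext (h₁.trans h₂.symm), e₁, e₂]

theorem single_correct [CharP K 2] {R : ℕ} (hR : 24 * S.G.diam * W ≤ R) {x : V} (hx : S.Under y x)
    (hf : P.Favorable sd y fun v => toIdx (ω v)) : ∃ b,
      (single lam sd cd (S.id y)).outAt S.G S.id P.localInput ω R x = some b ∧
        (b = true ↔ S.IsCutPair x y) := by
  have hi : (⟨S.id y, S.id_lt y⟩ : Fin (2 ^ (κ * lg n))) ∈ {j : Fin (2 ^ (κ * lg n)) | (j : ℕ) = S.id y} := rfl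
  have h₁ := isFix (cd := cd) (outF := fun a ω k => outs (fun ω _ => toIdx ω) a ω k (S.id y))
    (cf := fun ω _ => toIdx ω) (ω := ω)
    (P.analysis sd {j | (j : ℕ) = S.id y} fun v _ => toIdx (ω v)) S.id_inj hR hi
  obtain ⟨b, hb, h⟩ := exists_decision hi h₁ rfl hx hf
  refine ⟨b, ?_, h⟩
  unfold single
  rw [outAt_eq, outs, dif_pos (S.id_lt y)]
  exact hb

end Single

section Joint

variable (ω : V → Coins 0 × (Fin (2 ^ (κ * lg n)) → Coins (numCoins κ c n)))

theorem joint_finishesBy {R : ℕ} (hR : 24 * S.G.diam * W ≤ R) :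
    (joint lam sd cd).FinishesBy S.G S.id P.localInput ω R :=
  finishesBy (P.analysis sd Set.univ fun v i => toIdx ((ω v).2 i)) S.id_inj hR

theorem joint_out_succ (t : ℕ) (v : V) (i : ℕ) (b : Bool)
    (h : (joint lam sd cd).outAt S.G S.id P.localInput ω t v i = some b) :
    (joint lam sd cd).outAt S.G S.id P.localInput ω (t + 1) v i = some b := by
  unfold joint at h ⊢
  rw [outAt_eq] at h ⊢
  exact outs_mono (fun i => tab_mono S.id_inj (Nat.le_succ t) v i) h

/-- For the tag of `y`, both final tables solve the same equations with the same coins, whatever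
else is executed; `IsFix.unique` identifies them. -/
theorem joint_eq_single {R : ℕ} (hR : 24 * S.G.diam * W ≤ R) (y v : V) :
    (joint lam sd cd).outAt S.G S.id P.localInput ω R v (S.id y) =
      (single lam sd cd (S.id y)).outAt S.G S.id P.localInput
        (fun w => (ω w).2 ⟨S.id y, S.id_lt y⟩) R v := by
  have hi : (⟨S.id y, S.id_lt y⟩ : Fin (2 ^ (κ * lg n))) ∈ {j : Fin (2 ^ (κ * lg n)) | (j : ℕ) = S.id y} := rfl
  have h₁ := isFix (cd := cd) (outF := fun a ω k => outs (fun ω _ => toIdx ω) a ω k (S.id y))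
    (cf := fun ω _ => toIdx ω) (ω := fun v => (ω v).2 ⟨S.id y, S.id_lt y⟩)
    (P.analysis sd {j | (j : ℕ) = S.id y} fun v _ => toIdx ((ω v).2 ⟨S.id y, S.id_lt y⟩)) S.id_inj hR hi
  have h₂ := isFix (cd := cd) (outF := outs fun ω i => toIdx (ω.2 i))
    (cf := fun ω i => toIdx (ω.2 i)) (ω := ω)
    (P.analysis sd Set.univ fun v i => toIdx ((ω v).2 i)) S.id_inj hR
    (Set.mem_univ ⟨S.id y, S.id_lt y⟩)
  have h₃ := isFix_congr (act' := Set.univ) (coin := fun v _ => toIdx ((ω v).2 ⟨S.id y, S.id_lt y⟩))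
    (coin' := fun v i => toIdx ((ω v).2 i)) (fun _ => rfl) h₁
  have e := congrFun (h₂.unique (Set.mem_univ _) h₃) v
  unfold single joint
  rw [outAt_eq, outAt_eq, outs, outs, dif_pos (S.id_lt y), dif_pos (S.id_lt y), e]

end Joint

end Prep

theorem one_sub_le_prob {Ω : Type} [Finite Ω] [Nonempty Ω] {P Q : Ω → Prop} {ε : ℝ} (hQ : prob Q ≤ ε)
    (h : ∀ ω, ¬ Q ω → P ω) : 1 - ε ≤ prob P := by
  rw [prob_not P]
  have := prob_mono (P := fun ω => ¬ P ω) (Q := Q) fun ω hP => by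
    by_contra hn
    exact hP (h ω hn)
  linarith

/-! ### Probability bounds for correctness and for random delays. -/

namespace Prep

open Protocol SchedState

variable {V : Type} {κ n lam c : ℕ} [Fintype V] {S : Setting κ n V} {P : Prep S lam}
variable {K : Type} [Field K] {W bw : ℕ}

theorem prob_single_not_favorable [Finite K] (sd : (Fin (skDeg κ c n) → Bool) ≃ K)
    (hK : Nat.card K = 2 ^ skDeg κ c n) (y : V) :
    prob (fun ω : V → Coins (numCoins κ c n) => ¬ P.Favorable sd y fun v => toIdx (ω v)) ≤
      1 / (n : ℝ) ^ (c + 1) := by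
  let e : (V → Coins (numCoins κ c n)) ≃ (V → CoinIdx κ c n → Bool) :=
    Equiv.piCongrRight fun _ => Equiv.arrowCongr (Fintype.equivFin _).symm (Equiv.refl _)
  exact (prob_equiv e fun coin => ¬ P.Favorable sd y coin).trans_le (prob_not_favorable (P := P) sd hK y)

theorem prob_joint_not_favorable [Finite K] (sd : (Fin (skDeg κ c n) → Bool) ≃ K)
    (hK : Nat.card K = 2 ^ skDeg κ c n) (y : V) :
    prob (fun ω : V → Coins 0 × (Fin (2 ^ (κ * lg n)) → Coins (numCoins κ c n)) =>
      ¬ P.Favorable sd y fun v => toIdx ((ω v).2 ⟨S.id y, S.id_lt y⟩)) ≤ 1 / (n : ℝ) ^ (c + 1) := by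
  let e : (V → Coins 0 × (Fin (2 ^ (κ * lg n)) → Coins (numCoins κ c n))) ≃
      (V × Fin (2 ^ (κ * lg n)) × Fin (numCoins κ c n) → Bool) :=
    { toFun := fun ω a => (ω a.1).2 a.2.1 a.2.2
      invFun := fun f v => (finZeroElim, fun i j => f (v, i, j))
      left_inv := fun ω => by
        funext v
        exact Prod.ext (Subsingleton.elim _ _) rfl
      right_inv := fun f => rfl }
  let f : V × CoinIdx κ c n → V × Fin (2 ^ (κ * lg n)) × Fin (numCoins κ c n) := fun a =>
    (a.1, ⟨S.id y, S.id_lt y⟩, Fintype.equivFin _ a.2)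
  have hf : Function.Injective f := by
    rintro ⟨v, a⟩ ⟨v', a'⟩ h
    have h₁ : v = v' := congrArg Prod.fst h
    have h₂ : Fintype.equivFin _ a = Fintype.equivFin _ a' := congrArg (fun z => z.2.2) h
    rw [h₁, (Fintype.equivFin _).injective h₂]
  refine le_trans (le_of_eq ?_) (prob_not_favorable (P := P) sd hK y)
  rw [← prob_equiv (Equiv.curry V (CoinIdx κ c n) Bool), ← prob_comp_injective hf, ← prob_equiv e]
  rfl

theorem diam_lt (S : Setting κ n V) : S.G.diam < n := by
  have : Nonempty V := ⟨S.s⟩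
  obtain ⟨u, v, h⟩ := S.G.exists_dist_eq_diam
  obtain ⟨p, hp, hl⟩ := (S.connected u v).exists_path_of_dist
  rw [← h, ← hl]
  exact hp.length_lt.trans_eq S.card_eq

variable {sd : (Fin (skDeg κ c n) → Bool) → K} {cd : Codec (Msg K κ c n) (2 ^ (κ * lg n)) W bw}

/-- Only ancestors `y` of `u` have messages to send from `u`, at most `S.G.diam + 1` of them. For
each, at most `6 * W` delays make a message meet the slot, one for each item. -/
theorem card_due_le (ω : V → V → Coins (numCoins κ c n)) {R : ℕ} (hR : 24 * S.G.diam * W ≤ R) (m τ : ℕ)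
    {u v : V} (huv : S.G.Adj u v) :
    prob (fun ρ : V → Fin (R + 1) => m ≤ Nat.card {y : V // (ρ y : ℕ) ≤ τ ∧
      (single lam sd cd (S.id y)).Sends S.G S.id P.localInput (ω y) (τ - (ρ y : ℕ)) u v}) ≤ 1 / 2 ^ m := by
  classical
  let D : V → Finset (Fin (R + 1)) := fun y => Finset.univ.filter fun d => (d : ℕ) ≤ τ ∧
    (single lam sd cd (S.id y)).Sends S.G S.id P.localInput (ω y) (τ - (d : ℕ)) u v
  have hw : ∀ y, (D y).card ≤ 6 * W := fun y => by
    refine le_trans ?_ (single_card_sends_le (P := P) (sd := sd) (cd := cd) y (ω y) (τ + 1) u v)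
    refine Finset.card_le_card_of_injOn (fun d => τ - (d : ℕ)) (fun d hd => ?_) fun d hd d' hd' h => ?_
    · exact Finset.mem_filter.2 ⟨Finset.mem_range.2 (Nat.lt_succ_of_le (Nat.sub_le _ _)), (Finset.mem_filter.1 hd).2.2⟩
    · have h₁ := (Finset.mem_filter.1 hd).2.1
      have h₂ := (Finset.mem_filter.1 hd').2.1
      exact Fin.ext (by dsimp only at h; omega)
  have hD : 1 ≤ S.G.diam := by
    have : Nontrivial V := ⟨u, v, huv.ne⟩
    have : Nonempty V := ⟨u⟩
    exact Nat.one_le_iff_ne_zero.2 (SimpleGraph.connected_iff_diam_ne_zero.1 S.connected)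
  have hZ : (S.rp u).toFinset.card ≤ S.G.diam + 1 := (List.toFinset_card_le _).trans (S.length_rp_le_diam u)
  have := prob_le_card_le D hw (S.rp u).toFinset (fun y ⟨d, hd⟩ =>
    List.mem_toFinset.2 (single_sends y (ω y) (Finset.mem_filter.1 hd).2.2)) (by
      -- An edge exists, so the diameter is positive and `S.G.diam + 1` is at most twice the
      -- diameter.
      have : (S.rp u).toFinset.card * (6 * W) ≤ (2 * S.G.diam) * (6 * W) := Nat.mul_le_mul_right _ (by omega)
      calc 2 * ((S.rp u).toFinset.card * (6 * W)) ≤ 2 * ((2 * S.G.diam) * (6 * W)) := by omega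
        _ = 24 * S.G.diam * W := by ring
        _ ≤ R + 1 := by omega) m
  simpa [D] using this

/-- Half of the exponent `L` pays for the powers of `n`; the other half pays for the factor `L` in
the number of slots. -/
theorem delay_failure_le {c n L : ℕ} (hn : 1 ≤ n) (hL : 2 * (c + 4) * lg n ≤ L) {D : ℕ} (hD : D < n) :
    (((2 * (L * D) + 1) * (n * n) : ℕ) : ℝ) * (1 / 2 ^ (L + 1)) ≤ 1 / (n : ℝ) ^ c := by
  have hn' : (0 : ℝ) < n := by exact_mod_cast hn
  rw [mul_one_div, div_le_div_iff₀ (by positivity) (by positivity), one_mul]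
  have key : (2 * (L * D) + 1) * (n * n) * n ^ c ≤ 2 ^ (L + 1) := by
    have hl := lg_pos n
    have h₁ : 2 * (L * D) + 1 ≤ 2 * (L + 1) * n := by
      have : L * D ≤ L * n := Nat.mul_le_mul_left _ hD.le
      nlinarith
    have h₂ : (c + 3) * lg n + 1 ≤ L / 2 := by
      rw [Nat.le_div_iff_mul_le (by norm_num)]
      nlinarith
    have h₃ : L + 1 ≤ 2 * 2 ^ (L / 2) := by
      have := Nat.lt_two_pow_self (n := L / 2)
      omega
    have h₄ : n ^ (c + 3) * 2 ≤ 2 ^ (L / 2) := by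
      calc n ^ (c + 3) * 2 ≤ (2 ^ lg n) ^ (c + 3) * 2 :=
            Nat.mul_le_mul_right _ (Nat.pow_le_pow_left (lt_two_pow_lg n).le _)
        _ = 2 ^ ((c + 3) * lg n + 1) := by rw [← pow_mul, pow_succ, mul_comm (lg n)]
        _ ≤ _ := Nat.pow_le_pow_right (by norm_num) h₂
    calc (2 * (L * D) + 1) * (n * n) * n ^ c ≤ (2 * (L + 1) * n) * (n * n) * n ^ c := by gcongr
      _ = (L + 1) * (n ^ (c + 3) * 2) := by ring
      _ ≤ (2 * 2 ^ (L / 2)) * 2 ^ (L / 2) := Nat.mul_le_mul h₃ h₄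
      _ = 2 ^ (2 * (L / 2) + 1) := by ring
      _ ≤ 2 ^ (L + 1) := Nat.pow_le_pow_right (by norm_num) (by omega)
  exact_mod_cast key

theorem prob_due_gt {L : ℕ} (hL : 2 * (c + 4) * lg n ≤ L) (hW : 24 * W ≤ L) {R : ℕ} (hR : R = L * S.G.diam) :
    prob (fun ρ : (V → V → Coins (numCoins κ c n)) × (V → Fin (R + 1)) => ¬ ∀ (τ : ℕ) (u v : V), S.G.Adj u v →
      Nat.card {y : V // (ρ.2 y : ℕ) ≤ τ ∧ (single lam sd cd (S.id y)).Sends S.G S.id P.localInput (ρ.1 y)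
        (τ - (ρ.2 y : ℕ)) u v} ≤ L) ≤ 1 / (n : ℝ) ^ c := by
  have hn : 1 ≤ n := by
    rw [← S.card_eq]
    exact Fintype.card_pos_iff.2 ⟨S.s⟩
  have hR' : 24 * S.G.diam * W ≤ R := by
    rw [hR]
    calc 24 * S.G.diam * W = 24 * W * S.G.diam := by ring
      _ ≤ _ := Nat.mul_le_mul_right _ hW
  refine prob_prod_le (by positivity) fun ω => ?_
  refine (prob_mono (Q := fun ρ : V → Fin (R + 1) =>
    ∃ a ∈ Finset.range (2 * R + 1) ×ˢ (Finset.univ : Finset (V × V)), S.G.Adj a.2.1 a.2.2 ∧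
      L + 1 ≤ Nat.card {y : V // (ρ y : ℕ) ≤ a.1 ∧ (single lam sd cd (S.id y)).Sends S.G S.id P.localInput (ω y)
        (a.1 - (ρ y : ℕ)) a.2.1 a.2.2}) ?_).trans ((prob_exists_le' _ _
      (m := ((2 * (L * S.G.diam) + 1) * (n * n) : ℕ)) (ε := 1 / 2 ^ (L + 1)) ?_ (by positivity) ?_).trans
      (delay_failure_le hn hL (diam_lt S)))
  · intro ρ h
    push Not at h
    obtain ⟨τ, u, v, huv, h⟩ := h
    refine ⟨(τ, u, v), Finset.mem_product.2 ⟨Finset.mem_range.2 ?_, Finset.mem_univ _⟩, huv, h⟩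
    -- Only the slots up to `2 * R` matter: a delay is at most `R`, and each execution ends within
    -- `R` rounds.
    obtain ⟨⟨y, h₁, h₂⟩⟩ := (Nat.card_pos_iff.1 (lt_of_le_of_lt (Nat.zero_le _) h)).1
    by_contra hc
    refine (single_finishesBy (P := P) (sd := sd) (cd := cd) y (ω y) hR' (τ - (ρ y : ℕ)) ?_).1 u v h₂
    have := (ρ y).2
    change ¬ τ < 2 * R + 1 at hc
    omega
  · rw [Finset.card_product, Finset.card_range, Finset.card_univ, Fintype.card_prod, S.card_eq, hR]
  · rintro ⟨τ, u, v⟩ -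
    by_cases huv : S.G.Adj u v
    · exact (prob_mono fun ρ h => h.2).trans (card_due_le ω hR' (L + 1) τ huv)
    · simp only [huv, false_and]
      simp [prob]

end Prep

/-! ### Choice of the constants and the main theorem. -/

/-- The field with `2 ^ skDeg κ c n` elements. -/
abbrev SkField (κ c n : ℕ) : Type := GaloisField 2 (skDeg κ c n)

theorem card_skField (κ c n : ℕ) : Nat.card (SkField κ c n) = 2 ^ skDeg κ c n :=
  GaloisField.card 2 _ (skDeg_ne_zero κ c n)

theorem nonempty_seedEquiv (κ c n : ℕ) : Nonempty ((Fin (skDeg κ c n) → Bool) ≃ SkField κ c n) :=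
  (Finite.card_eq).1 (by rw [card_skField]; simp)

open Protocol Prep in
theorem mainTheorem5 (κ lam c : ℕ) :
    ∃ (C k β : ℕ) (rA rB : ℕ → ℕ)
      -- `A n i` is the algorithm `A_y` on `n`-vertex graphs, for the vertex `y` with identifier `i`
      (A : ∀ n : ℕ, ℕ →
        CongestAlg (LocalInput n κ lam) (Coins (rA n)) (Option Bool) (β * lg n))
      -- `B n` executes all the `A_y`; its second coins are the coins for the several `A_y`
      (B : ∀ n : ℕ,
        CongestAlg (LocalInput n κ lam)
          (Coins (rB n) × (Fin (2 ^ (κ * lg n)) → Coins (rA n))) (ℕ → Option Bool) (β * lg n)),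
      ∀ (n : ℕ) (V : Type) [Fintype V] (S : Setting κ n V) (P : Prep S lam) (R K : ℕ),
        R = C * S.G.diam * lg n ^ k →
        K = C * lg n ^ k →
        -- each single `A_y`: rounds, final outputs, locality and congestion, for all coins;
        -- and correctness with high probability
        (∀ y : V,
          (∀ ω : V → Coins (rA n),
            (A n (S.id y)).FinishesBy S.G S.id P.localInput ω R ∧
            (∀ t v b,
              (A n (S.id y)).outAt S.G S.id P.localInput ω t v = some b →
              (A n (S.id y)).outAt S.G S.id P.localInput ω (t + 1) v = some b) ∧
            (∀ t u v, (A n (S.id y)).Sends S.G S.id P.localInput ω t u v →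
              S.InSub y u ∨ S.InSub y v) ∧
            (∀ N u v, S.G.Adj u v →
              (A n (S.id y)).load S.G S.id P.localInput ω N u v ≤ K)) ∧
          1 - 1 / (n : ℝ) ^ c ≤
            prob (fun ω : V → Coins (rA n) =>
              ∀ x, S.InSub y x → x ≠ y → ∃ b : Bool,
                (A n (S.id y)).outAt S.G S.id P.localInput ω R x = some b ∧
                (b = true ↔ S.IsCutPair x y))) ∧
        -- independent uniform delays in `{0, …, R}`, one for each `A_y`: with high probability at
        -- most `K` messages are due on each edge, in each direction, in each time slot
        1 - 1 / (n : ℝ) ^ c ≤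
          prob (fun ρ : (V → V → Coins (rA n)) × (V → Fin (R + 1)) =>
            ∀ (τ : ℕ) (u v : V), S.G.Adj u v →
              Nat.card {y : V // (ρ.2 y : ℕ) ≤ τ ∧
                (A n (S.id y)).Sends S.G S.id P.localInput (ρ.1 y)
                  (τ - (ρ.2 y : ℕ)) u v} ≤ K) ∧
        -- all the `A_y` together: outputs are final, and with high probability `B` finishes in
        -- time, reproduces the output of every `A_y` at every vertex, and every `x` learns
        -- for every proper ancestor `y` whether `x`, `y` is a cut pair
        (∀ (ω : V → Coins (rB n) ×
              (Fin (2 ^ (κ * lg n)) → Coins (rA n))) t v i b,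
          (B n).outAt S.G S.id P.localInput ω t v i = some b →
          (B n).outAt S.G S.id P.localInput ω (t + 1) v i = some b) ∧
        1 - 1 / (n : ℝ) ^ c ≤
          prob (fun ω : V → Coins (rB n) ×
              (Fin (2 ^ (κ * lg n)) → Coins (rA n)) =>
            (B n).FinishesBy S.G S.id P.localInput ω R ∧
            (∀ y v : V,
              (B n).outAt S.G S.id P.localInput ω R v (S.id y) =
                (A n (S.id y)).outAt S.G S.id P.localInput
                  (fun w => (ω w).2 ⟨S.id y, S.id_lt y⟩) R v) ∧
            (∀ y x : V, S.InSub y x → x ≠ y → ∃ b : Bool,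
              (B n).outAt S.G S.id P.localInput ω R x (S.id y) = some b ∧
              (b = true ↔ S.IsCutPair x y))) := by
  -- The first summand covers the time, 24 times the diameter in units of `msgBits` rounds, and the
  -- congestion, 6 items per bit position in two directions summing to `12 * msgBits`. The second
  -- makes the failure probability of the delays small.
  have hpl : PolyLog fun n => 24 * msgBits κ c n + 2 * (c + 4) * lg n :=
    ((PolyLog.const 24).mul (PolyLog.msgBits κ c)).add ((PolyLog.const _).mul PolyLog.lg)
  obtain ⟨C, k, hC⟩ := hpl
  -- The factor 12 counts six phases and two values of a bit. With the tag, of `κ * lg n` bits, a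
  -- transmitted item therefore fits into `(β + κ) * lg n` bits.
  obtain ⟨β, hβ⟩ := (((PolyLog.const 12).mul (PolyLog.msgBits κ c))).exists_le_two_pow
  have hcd : ∀ n, Nonempty (Codec (Msg (SkField κ c n) κ c n) (2 ^ (κ * lg n)) (msgBits κ c n)
      ((β + κ) * lg n)) := fun n => by
    have := (msg_card_le κ c n (card_skField κ c n)).1
    have : Nonempty (Msg (SkField κ c n) κ c n) := ⟨Msg.blank _ _ _ _⟩
    refine nonempty_codec (by positivity) (by unfold msgBits; omega)
      (msg_card_le κ c n (card_skField κ c n)).2 ?_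
    rw [Nat.add_mul, pow_add]
    calc 6 * (2 ^ (κ * lg n) * msgBits κ c n) * 2 = 12 * msgBits κ c n * 2 ^ (κ * lg n) := by ring
      _ ≤ _ := Nat.mul_le_mul_right _ (hβ n)
  let cd := fun n => (hcd n).some
  let sd := fun n => (nonempty_seedEquiv κ c n).some
  refine ⟨C, k, β + κ, numCoins κ c, fun _ => 0, fun n i => single lam (sd n) (cd n) i,
    fun n => joint lam (sd n) (cd n), ?_⟩
  intro n V _ S P R K hR hK
  have hL : 24 * msgBits κ c n + 2 * (c + 4) * lg n ≤ _ := hC n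
  rw [← hK] at hL
  have hRK : R = K * S.G.diam := by rw [hR, hK]; ring
  have hR' : 24 * S.G.diam * msgBits κ c n ≤ R := by
    rw [hRK]
    calc 24 * S.G.diam * msgBits κ c n = 24 * msgBits κ c n * S.G.diam := by ring
      _ ≤ _ := Nat.mul_le_mul_right _ (by omega)
  have : Nonempty V := ⟨S.s⟩
  have hn : (1 : ℝ) ≤ n := by
    rw [← S.card_eq]
    exact_mod_cast Fintype.card_pos_iff.2 ‹Nonempty V›
  refine ⟨fun y => ⟨fun ω => ⟨single_finishesBy y ω hR', single_out_succ y ω,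
    fun t u v h => Or.inl (single_sends y ω h), fun N u v _ => ?_⟩, ?_⟩, ?_, joint_out_succ, ?_⟩
  · refine (Nat.add_le_add (single_card_sends_le y ω N u v) (single_card_sends_le y ω N v u)).trans ?_
    omega
  · refine one_sub_le_prob ((prob_single_not_favorable (P := P) (sd n) (card_skField κ c n) y).trans ?_) ?_
    · exact one_div_le_one_div_of_le (by positivity) (pow_le_pow_right₀ hn (by omega))
    · intro ω h x hx hxy
      exact single_correct y ω hR' ⟨hx, hxy⟩ (not_not.1 h)
  · exact one_sub_le_prob (prob_due_gt (P := P) (sd := sd n) (cd := cd n) (by omega) (by omega) hRK)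
      fun ρ h => not_not.1 h
  · refine one_sub_le_prob (Q := fun ω => ∃ y ∈ (Finset.univ : Finset V),
      ¬ P.Favorable (sd n) y fun v => toIdx ((ω v).2 ⟨S.id y, S.id_lt y⟩))
      ((prob_exists_le' _ _ (m := n) (ε := 1 / (n : ℝ) ^ (c + 1)) (by exact_mod_cast S.card_eq.le)
        (by positivity) fun y _ => prob_joint_not_favorable (P := P) (sd n) (card_skField κ c n) y).trans ?_) ?_
    · rw [pow_succ]
      apply le_of_eq
      field_simp
    · intro ω h
      push Not at h
      refine ⟨joint_finishesBy ω hR', joint_eq_single ω hR', fun y x hx hxy => ?_⟩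
      rw [joint_eq_single ω hR']
      exact single_correct y _ hR' ⟨hx, hxy⟩ (h y (Finset.mem_univ _))
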